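/- Setting. Let $0<\epsilon<1$, and let $\alpha\approx 0.338$ be Otter's constant, the radius of convergence of $\sum_N|\mathcal V_N|x^N$, where $\mathcal V_N$ is the set of unlabelled trees on $N$ vertices. Let $\iota>0$ be so small that $\log\log\log\log(\iota^{-1})>\max\{100,\tfrac1\epsilon,\tfrac1{\log(\epsilon^{-1})}\}$ (all iterated logarithms being positive), let $0<\delta<\sqrt\alpha$ with $\alpha^{-1}(\sqrt\alpha-\delta)^2e^{\iota}>1$, let $\Delta>100\,\epsilon^{-4}\iota^{-4}$, $\lambda>\Delta$ and $\sqrt\alpha-\delta<s<1$. Let $\ell=\ell_n$ and $\aleph=\aleph_n$ be integers such that, for all large $n$, $\ell\le\log n$, $(\epsilon^2\lambda s)^\ell>n^4$, $\iota\aleph\in\mathbb N$ and $\aleph$ is odd, and such that $\aleph_n\to\infty$, $\aleph_n=o(\log\log\log n)$. Model. Under $\mathbb P=\mathbb P_n$: $\sigma\in\{\pm1\}^n$ is uniform; given $\sigma$, $G$ is a random graph on $[n]$ with independent edges, $ij$ being present with probability $\frac{(1+\epsilon)\lambda}n$ if $\sigma_i=\sigma_j$ and $\frac{(1-\epsilon)\lambda}n$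 otherwise; $\pi_*$ is a uniform permutation of $[n]$; $J_{ij},K_{ij}$ are i.i.d. Bernoulli($s$); $(\sigma,G)$, $\pi_*$, $J$, $K$ are independent; $A_{ij}=G_{ij}J_{ij}$ and $B_{ij}=G_{\pi_*^{-1}(i)\pi_*^{-1}(j)}K_{ij}$. Trees. For rooted trees $T,T'$ write $T\sim T'$ if one obtains isomorphic graphs by attaching, to non-leaf vertices of $T$ and of $T'$ (a leaf is a vertex of degree one), at most $|V(T)|/\log(\iota^{-1})$, respectively $|V(T')|/\log(\iota^{-1})$, pendant paths, each with at most $\log^2(\iota^{-1})$ edges. For a rooted tree $T$, $\mathsf{Des}(u)$ is the subtree formed by $u$ and its descendants, rooted at $u$, and $T_\iota=\{v:|\mathsf{Des}(v)|\ge\log^2(\iota^{-1})\}$. A rooted tree $T$ on $\aleph$ vertices is good if (1) all degrees are at most $\log^2(\iota^{-1})$; (2) no $\mathsf{Des}(u)$ is a path starting from $u$ of length at least $\log^2(\iota^{-1})$; (3) $|T_\iota|\ge\aleph/\log^4(\iota^{-1})$; (4) $\mathsf{Des}(a)\not\sim\mathsf{Des}(b)$ for distinct $a,b\in T_\iota$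 with the same parent; (5) the root has exactly two children $a,b$, where $|\mathsf{Des}(a)|=\lfloor\frac{\aleph-1}2\rfloor$, $|\mathsf{Des}(b)|=\lceil\frac{\aleph-1}2\rceil$, $\mathsf{Des}(a)\not\sim\mathsf{Des}(c)$ for all $c\in\mathsf{Des}(b)$, and $\mathsf{Des}(b)\not\sim\mathsf{Des}(c)$ for all $c\in\mathsf{Des}(a)$. Let $\mathcal T_\aleph$ be the set of unlabelled trees on $\aleph$ vertices that are good for some choice of the root. Pairings. A pairing of $T$ is a set $W$ of $\iota\aleph$ unordered pairs consisting of $2\iota\aleph$ distinct vertices, whose set is $\mathsf{Vert}(W)$. Put $D=(\log\log(\iota^{-1}))^{10}$. For each $T\in\mathcal T_\aleph$ fix a root making $T$ good and any set $\mathcal S(T)$ of $\lfloor\exp(\iota(\log\log(\iota^{-1}))^4\aleph)\rfloor$ pairings such that: (i) $\mathsf{Vert}(W)\subset T_\iota\setminus\{\text{root}\}$ for $W\in\mathcal S(T)$; (ii) $|\mathsf{Vert}(W)\cap\mathsf{Des}(u)|\le|\mathsf{Des}(u)|/\log(\iota^{-1})$ for $u\in T_\iota$, $W\in\mathcal S(T)$;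 (iii) $|\mathsf{Vert}(W)\triangle\mathsf{Vert}(W')|\ge\iota\aleph/2$ for $W\ne W'$ in $\mathcal S(T)$; (iv) for $W\in\mathcal S(T)$ and distinct $u,v\in\mathsf{Vert}(W)$, the distance of $u$ and $v$ in $T$ lies in $[D,2D]$ if $\{u,v\}\in W$ and is at least $10D$ otherwise, and for $W\ne W'$ in $\mathcal S(T)$ and $u\in\mathsf{Vert}(W)$, $v\in\mathsf{Vert}(W')$ with $u\ne v$ this distance is at least $D$. Let $\mathcal H=\{(T,W):T\in\mathcal T_\aleph,\ W\in\mathcal S(T)\}$ (decorated trees); for $\mathbf H=(T,W)$ write $\mathsf T(\mathbf H)=T$. Statistic. Fix $\mathcal J_A,\mathcal J_B\subset[n]$ with $|\mathcal J_A|=|\mathcal J_B|=\lfloor\iota^2n\rfloor$. A multigraph $S$ on vertices in $[n]$ satisfies $S\Vdash_A(T,W)$ if, counting edges with multiplicity, it decomposes into a copy $\mathsf T(S)$ of $T$ with vertices outside $\mathcal J_A$ and, for each $\{u,v\}\in W$, a self-avoiding path with $\ell$ edges joining the copies of $u$ and $v$ whose second and second-to-last vertices lie in $\mathcal J_A$;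 $S\Vdash_B(T,W)$ is defined in the same way with $\mathcal J_B$. Put $\phi_S(X)=\prod_{ij\in E(S)}\frac{X_{ij}-\lambda s/n}{\sqrt{\frac{\lambda s}n(1-\frac{\lambda s}n)}}$ (with multiplicity) and, $\operatorname{Aut}(T)$ being the number of automorphisms of $T$, $$f=\sum_{\mathbf H\in\mathcal H}\frac{s^{\aleph-1}\operatorname{Aut}(\mathsf T(\mathbf H))(\epsilon^2\lambda s)^{\ell\iota\aleph}}{n^{\aleph+\ell\iota\aleph}}\sum_{S_1\Vdash_A\mathbf H,\ S_2\Vdash_B\mathbf H}\phi_{S_1}(A)\phi_{S_2}(B).$$ Call $S_1$ or $S_2$ nonoverlapping if it has such a decomposition in which the interiors of the paths are disjoint from each other and from the tree. Let $\mathcal A(S_1,S_2)$ be the set of permutations $\pi$ of $[n]$ such that $\pi(S_1)\cap S_2$ (intersection of vertex sets and of edge sets) is a tree containing $\pi(\mathsf T(S_1))\cup\mathsf T(S_2)$ if $S_1,S_2$ are nonoverlapping, and $\mathcal A(S_1,S_2)=\emptyset$ otherwise. Let $f_{\mathcal A}$, respectively $f_{\mathcal A^c}$, be defined as $f$ with each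 summand multiplied by the indicator of $\pi_*\in\mathcal A(S_1,S_2)$, respectively $\pi_*\notin\mathcal A(S_1,S_2)$; so $f=f_{\mathcal A}+f_{\mathcal A^c}$. Claim. Put $$L_n=s^{2(\aleph-1)}|\mathcal H|\Big(\frac{\iota^4(\epsilon^2\lambda s)^\ell}n\Big)^{2\iota\aleph}e^{-4\iota^2\aleph},\qquad U_n=s^{2(\aleph-1)}|\mathcal H|\Big(\frac{\iota^4(\epsilon^2\lambda s)^\ell}n\Big)^{2\iota\aleph}e^{5\iota\log\log(\iota^{-1})\aleph}.$$ For every $\eta>0$ and all sufficiently large $n$, uniformly in $\mathcal J_A,\mathcal J_B$ and in the choice of the families $\mathcal S(T)$, $$L_n\le\mathbb E_{\mathbb P}[f]\le U_n,\qquad L_n\le\mathbb E_{\mathbb P}[f_{\mathcal A}]\le U_n,\qquad 0\le\mathbb E_{\mathbb P}[f_{\mathcal A^c}]\le\eta\,L_n,\qquad \mathbb E_{\mathbb P}[f_{\mathcal A^c}]\le\eta\,\mathbb E_{\mathbb P}[f_{\mathcal A}].$$ -/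

import Mathlib

noncomputable section

open scoped Classical

namespace CorrelatedSBM

/-! ### The correlated stochastic block model -/

/-- Probability that the random graph on `[n]` whose edges are independent, the edge `e` being
present with probability `q e`, equals `G`. -/
def edgeWeight {n : ℕ} (q : Sym2 (Fin n) → ℝ) (G : SimpleGraph (Fin n)) : ℝ :=
  ∏ e : Sym2 (Fin n) with ¬ e.IsDiag, if e ∈ G.edgeSet then q e else 1 - q e

/-- Edge probabilities of the two-community stochastic block model with labelling `σ`. -/
def sbmEdgeProb {n : ℕ} (lam ε : ℝ) (σ : Fin n → ℤˣ) (e : Sym2 (Fin n)) : ℝ :=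
  if ∀ i ∈ e, ∀ j ∈ e, σ i = σ j then (1 + ε) * lam / n else (1 - ε) * lam / n

/-- Joint probability mass function of the hidden permutation `π`, the labelling `σ`, the parent
graph `G` and the two subsampling graphs `J`, `K`. -/
def jointWeight {n : ℕ} (lam ε s : ℝ) (_π : Equiv.Perm (Fin n)) (σ : Fin n → ℤˣ)
    (G J K : SimpleGraph (Fin n)) : ℝ :=
  (Fintype.card (Equiv.Perm (Fin n)) : ℝ)⁻¹ * (Fintype.card (Fin n → ℤˣ) : ℝ)⁻¹ *
    edgeWeight (sbmEdgeProb lam ε σ) G * edgeWeight (fun _ => s) J * edgeWeight (fun _ => s) K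

/-- Expectation of `X (π, A, B)` under the correlated stochastic block model, where
`A i j = G i j * J i j` and `B i j = G (π⁻¹ i) (π⁻¹ j) * K i j`. -/
def expectation {n : ℕ} (lam ε s : ℝ)
    (X : Equiv.Perm (Fin n) → SimpleGraph (Fin n) → SimpleGraph (Fin n) → ℝ) : ℝ :=
  ∑ π : Equiv.Perm (Fin n), ∑ σ : Fin n → ℤˣ, ∑ G : SimpleGraph (Fin n),
    ∑ J : SimpleGraph (Fin n), ∑ K : SimpleGraph (Fin n),
      jointWeight lam ε s π σ G J K * X π (G ⊓ J) (G.comap π.symm ⊓ K)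

/-! ### Unlabelled trees and Otter's constant -/

/-- Isomorphism of trees on the vertex set `Fin k`. -/
def treeSetoid (k : ℕ) : Setoid {T : SimpleGraph (Fin k) // T.IsTree} where
  r T T' := Nonempty (T.1 ≃g T'.1)
  iseqv :=
    { refl := fun _ => ⟨SimpleGraph.Iso.refl⟩
      symm := fun ⟨f⟩ => ⟨f.symm⟩
      trans := fun ⟨f⟩ ⟨g⟩ => ⟨g.comp f⟩ }

/-- Unlabelled trees with `k` vertices. -/
def UnlabeledTree (k : ℕ) : Type := Quotient (treeSetoid k)

instance (k : ℕ) : Fintype (UnlabeledTree k) :=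
  haveI : Finite (UnlabeledTree k) := inferInstanceAs (Finite (Quotient (treeSetoid k)))
  Fintype.ofFinite _

/-- A fixed representative, on the vertex set `Fin k`, of an unlabelled tree. -/
def UnlabeledTree.graph {k : ℕ} (t : UnlabeledTree k) : SimpleGraph (Fin k) :=
  (Quotient.out (s := treeSetoid k) t).1

/-- Otter's constant: the radius of convergence of the generating function of unlabelled trees. -/
def otterConstant : ℝ :=
  sSup {x : ℝ | 0 ≤ x ∧ Summable fun N : ℕ => (Fintype.card (UnlabeledTree N) : ℝ) * x ^ N}

/-! ### Rooted trees

A rooted tree is a tree `T` together with a root `r`. -/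

/-- The descendants of `u` (including `u`) in the tree `T` with root `r`. -/
def descendants {V : Type*} (T : SimpleGraph V) (r u : V) : Set V :=
  {v | T.dist r v = T.dist r u + T.dist u v}

/-- The descendant tree of `u` in the tree `T` with root `r`; its root is `u`. -/
def descendantTree {V : Type*} (T : SimpleGraph V) (r u : V) :
    SimpleGraph (descendants T r u) :=
  T.induce (descendants T r u)

/-- `c` is a child of `p` in the tree `T` with root `r`. -/
def IsChild {V : Type*} (T : SimpleGraph V) (r p c : V) : Prop :=
  T.Adj p c ∧ T.dist r c = T.dist r p + 1

/-- A vertex of degree one. -/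
def IsLeaf {V : Type*} (T : SimpleGraph V) (v : V) : Prop :=
  (T.neighborSet v).ncard = 1

/-- The descendant tree of `u` is a path of length `x` (that is, with `x` edges) starting
from `u`. -/
def IsArmPath {V : Type*} (T : SimpleGraph V) (r u : V) (x : ℕ) : Prop :=
  ∃ f : SimpleGraph.pathGraph (x + 1) ≃g descendantTree T r u, (f 0 : V) = u

/-- The graph obtained from `T` by sticking, for every `i`, a path with `x i` new vertices (and
`x i` new edges) to the vertex `u i`. -/
def attachPaths {V : Type*} (T : SimpleGraph V) {k : ℕ} (u : Fin k → V) (x : Fin k → ℕ) :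
    SimpleGraph (V ⊕ (Σ i : Fin k, Fin (x i))) :=
  SimpleGraph.fromRel fun a b =>
    match a, b with
    | Sum.inl a, Sum.inl b => T.Adj a b
    | Sum.inl a, Sum.inr p => a = u p.1 ∧ (p.2 : ℕ) = 0
    | Sum.inr p, Sum.inr q => p.1 = q.1 ∧ (p.2 : ℕ) + 1 = (q.2 : ℕ)
    | Sum.inr _, Sum.inl _ => False

/-- The relation `T ∼ T'`: the two trees become isomorphic after few short paths have been stuck
to non-leaves of each of them. -/
def Similar (ι : ℝ) {V V' : Type*} (T : SimpleGraph V) (T' : SimpleGraph V') : Prop :=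
  ∃ (k k' : ℕ) (u : Fin k → V) (u' : Fin k' → V') (x : Fin k → ℕ) (x' : Fin k' → ℕ),
    (k : ℝ) ≤ (Real.log ι⁻¹)⁻¹ * Nat.card V ∧
    (k' : ℝ) ≤ (Real.log ι⁻¹)⁻¹ * Nat.card V' ∧
    (∀ i, ¬ IsLeaf T (u i)) ∧ (∀ i, ¬ IsLeaf T' (u' i)) ∧
    (∀ i, (x i : ℝ) ≤ Real.log ι⁻¹ ^ 2) ∧ (∀ i, (x' i : ℝ) ≤ Real.log ι⁻¹ ^ 2) ∧
    Nonempty (attachPaths T u x ≃g attachPaths T' u' x')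

/-- The vertices with at least `log²(1/ι)` descendants. -/
def majorVertices (ι : ℝ) {V : Type*} (T : SimpleGraph V) (r : V) : Set V :=
  {v | Real.log ι⁻¹ ^ 2 ≤ ((descendants T r v).ncard : ℝ)}

/-- The class of rooted trees (with `k` vertices) which is used for the statistic. -/
structure IsGoodRootedTree (ι : ℝ) {k : ℕ} (T : SimpleGraph (Fin k)) (r : Fin k) : Prop where
  isTree : T.IsTree
  degree_le : ∀ v, ((T.neighborSet v).ncard : ℝ) ≤ Real.log ι⁻¹ ^ 2
  arm_lt : ∀ (u : Fin k) (x : ℕ), IsArmPath T r u x → (x : ℝ) < Real.log ι⁻¹ ^ 2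
  le_major : (k : ℝ) / Real.log ι⁻¹ ^ 4 ≤ ((majorVertices ι T r).ncard : ℝ)
  not_similar_siblings : ∀ p a b : Fin k, IsChild T r p a → IsChild T r p b → a ≠ b →
    a ∈ majorVertices ι T r → b ∈ majorVertices ι T r →
    ¬ Similar ι (descendantTree T r a) (descendantTree T r b)
  root_children : ∃ a b : Fin k, a ≠ b ∧ (∀ c, IsChild T r r c ↔ c = a ∨ c = b) ∧
    (descendants T r a).ncard = ⌊((k : ℝ) - 1) / 2⌋₊ ∧
    (descendants T r b).ncard = ⌈((k : ℝ) - 1) / 2⌉₊ ∧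
    (∀ c ∈ descendants T r b, ¬ Similar ι (descendantTree T r a) (descendantTree T r c)) ∧
    (∀ c ∈ descendants T r a, ¬ Similar ι (descendantTree T r b) (descendantTree T r c))

/-- The unlabelled trees with `k` vertices which can be rooted so as to be good. -/
def goodTrees (ι : ℝ) (k : ℕ) : Set (UnlabeledTree k) :=
  {t | ∃ r : Fin k, IsGoodRootedTree ι t.graph r}

/-! ### Pairings and decorated trees -/

/-- `W` consists of `m` unordered pairs made of `2 m` distinct vertices. -/
structure IsPairing {k : ℕ} (m : ℕ) (W : Finset (Sym2 (Fin k))) : Prop where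
  card_eq : W.card = m
  not_isDiag : ∀ e ∈ W, ¬ e.IsDiag
  disjoint : ∀ e ∈ W, ∀ e' ∈ W, ∀ v, v ∈ e → v ∈ e' → e = e'

/-- The vertices occurring in a pairing. -/
def pairVertices {k : ℕ} (W : Finset (Sym2 (Fin k))) : Finset (Fin k) :=
  Finset.univ.filter fun v => ∃ e ∈ W, v ∈ e

/-- Admissible families of pairings of a rooted tree. -/
structure IsAdmissibleFamily (ι : ℝ) (m : ℕ) {k : ℕ} (T : SimpleGraph (Fin k)) (r : Fin k)
    (F : Finset (Finset (Sym2 (Fin k)))) : Prop where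
  card_eq : F.card = ⌊Real.exp (ι * Real.log (Real.log ι⁻¹) ^ 4 * k)⌋₊
  isPairing : ∀ W ∈ F, IsPairing m W
  subset_major : ∀ W ∈ F, ∀ v ∈ pairVertices W, v ∈ majorVertices ι T r ∧ v ≠ r
  sparse : ∀ W ∈ F, ∀ u ∈ majorVertices ι T r,
    (((pairVertices W : Set (Fin k)) ∩ descendants T r u).ncard : ℝ) ≤
      (Real.log ι⁻¹)⁻¹ * (descendants T r u).ncard
  separated : ∀ W ∈ F, ∀ W' ∈ F, W ≠ W' →
    ι * k / 2 ≤ ((symmDiff (pairVertices W) (pairVertices W')).card : ℝ)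
  dist_pair : ∀ W ∈ F, ∀ u v : Fin k, s(u, v) ∈ W →
    Real.log (Real.log ι⁻¹) ^ 10 ≤ (T.dist u v : ℝ) ∧
      (T.dist u v : ℝ) ≤ 2 * Real.log (Real.log ι⁻¹) ^ 10
  dist_not_pair : ∀ W ∈ F, ∀ u ∈ pairVertices W, ∀ v ∈ pairVertices W, u ≠ v → s(u, v) ∉ W →
    10 * Real.log (Real.log ι⁻¹) ^ 10 ≤ (T.dist u v : ℝ)
  dist_cross : ∀ W ∈ F, ∀ W' ∈ F, W ≠ W' → ∀ u ∈ pairVertices W, ∀ v ∈ pairVertices W', u ≠ v →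
    Real.log (Real.log ι⁻¹) ^ 10 ≤ (T.dist u v : ℝ)

/-- A choice, for every good unlabelled tree `t`, of an admissible family `F t` of pairings. -/
def IsAdmissibleChoice (ι : ℝ) (m : ℕ) {k : ℕ}
    (F : UnlabeledTree k → Finset (Finset (Sym2 (Fin k)))) : Prop :=
  ∀ t ∈ goodTrees ι k, ∃ r : Fin k,
    IsGoodRootedTree ι t.graph r ∧ IsAdmissibleFamily ι m t.graph r (F t)

/-- The family of decorated trees: good unlabelled trees together with one of the chosen
pairings. -/
def decoratedTrees (ι : ℝ) {k : ℕ} (F : UnlabeledTree k → Finset (Finset (Sym2 (Fin k)))) :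
    Finset (UnlabeledTree k × Finset (Sym2 (Fin k))) :=
  Finset.univ.filter fun H => H.1 ∈ goodTrees ι k ∧ H.2 ∈ F H.1

/-! ### Copies of decorated trees

A multigraph on `[n]` without isolated vertices is represented by its multiset of edges. -/

/-- The edges of the image of `T` under `φ`. -/
def treeEdges {n k : ℕ} (T : SimpleGraph (Fin k)) (φ : Fin k ↪ Fin n) :
    Multiset (Sym2 (Fin n)) :=
  T.edgeFinset.val.map (Sym2.map φ)

/-- The edges of the path `p 0, p 1, …, p ℓ`. -/
def pathEdges {n : ℕ} (ℓ : ℕ) (p : ℕ → Fin n) : Multiset (Sym2 (Fin n)) :=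
  (Multiset.range ℓ).map fun i => s(p i, p (i + 1))

/-- The multigraph `S` decomposes into the copy `φ(T)` of the tree `T`, with vertices outside `J`,
and, for every pair `e = {u, v}` of the pairing `P`, a self-avoiding path `w e` of length `ℓ` with
endpoints `φ u`, `φ v`, the neighbours of these endpoints on the path lying in `J`. -/
structure IsDecomposition {n k : ℕ} (J : Finset (Fin n)) (ℓ : ℕ) (T : SimpleGraph (Fin k))
    (P : Finset (Sym2 (Fin k))) (φ : Fin k ↪ Fin n) (w : Sym2 (Fin k) → ℕ → Fin n)
    (S : Multiset (Sym2 (Fin n))) : Prop where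
  tree_notMem : ∀ v, φ v ∉ J
  selfAvoiding : ∀ e ∈ P, Set.InjOn (w e) (Set.Iic ℓ)
  endpoints : ∀ e ∈ P, s(w e 0, w e ℓ) = e.map φ
  neighbors : ∀ e ∈ P, w e 1 ∈ J ∧ w e (ℓ - 1) ∈ J
  edges : S = treeEdges T φ + ∑ e ∈ P, pathEdges ℓ (w e)

theorem finite_setOf_isDecomposition {n k : ℕ} (J : Finset (Fin n)) (ℓ : ℕ)
    (T : SimpleGraph (Fin k)) (P : Finset (Sym2 (Fin k))) :
    {S : Multiset (Sym2 (Fin n)) | ∃ φ w, IsDecomposition J ℓ T P φ w S}.Finite := by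
  have key : ∀ N : ℕ, {S : Multiset (Sym2 (Fin n)) | S.card = N}.Finite := by
    intro N
    have h : Finite (Sym (Sym2 (Fin n)) N) := inferInstance
    exact h
  refine (key (T.edgeFinset.card + ∑ _e ∈ P, ℓ)).subset ?_
  rintro S ⟨φ, w, h⟩
  simp [h.edges, treeEdges, pathEdges]

/-- The multigraphs `S` on `[n]` with `S ⊩ (T, P)`, relative to the vertex set `J`. -/
def copies {n k : ℕ} (J : Finset (Fin n)) (ℓ : ℕ) (T : SimpleGraph (Fin k))
    (P : Finset (Sym2 (Fin k))) : Finset (Multiset (Sym2 (Fin n))) :=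
  (finite_setOf_isDecomposition J ℓ T P).toFinset

/-! ### The statistic -/

/-- The product over the edges of `S`, with multiplicity, of the centred and normalised entries
of the adjacency matrix of `X`; here `p` is the average edge density. -/
def signedCount {n : ℕ} (p : ℝ) (S : Multiset (Sym2 (Fin n))) (X : SimpleGraph (Fin n)) : ℝ :=
  (S.map fun e => ((if e ∈ X.edgeSet then 1 else 0) - p) / √(p * (1 - p))).prod

/-- The weight of the decorated trees with tree part `T`, which has `k` vertices, and with `m`
paths of length `ℓ`. -/
def statWeight (n : ℕ) (lam ε s : ℝ) (ℓ m : ℕ) {k : ℕ} (T : SimpleGraph (Fin k)) : ℝ :=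
  s ^ (k - 1) * (Nat.card (T ≃g T) : ℝ) * (ε ^ 2 * lam * s) ^ (ℓ * m) / (n : ℝ) ^ (k + ℓ * m)

/-- The statistic `f (A, B)`. -/
def statistic {n k : ℕ} (lam ε s : ℝ) (ℓ m : ℕ) (JA JB : Finset (Fin n))
    (Hs : Finset (UnlabeledTree k × Finset (Sym2 (Fin k)))) (A B : SimpleGraph (Fin n)) : ℝ :=
  ∑ H ∈ Hs, statWeight n lam ε s ℓ m H.1.graph *
    ∑ S₁ ∈ copies JA ℓ H.1.graph H.2, ∑ S₂ ∈ copies JB ℓ H.1.graph H.2,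
      signedCount (lam * s / n) S₁ A * signedCount (lam * s / n) S₂ B

/-- The part of the statistic coming from those pairs `(S₁, S₂)` of copies of decorated trees `H`
for which the hidden permutation `π` lies in `Good H S₁ S₂`. -/
def restrictedStatistic {n k : ℕ} (lam ε s : ℝ) (ℓ m : ℕ) (JA JB : Finset (Fin n))
    (Hs : Finset (UnlabeledTree k × Finset (Sym2 (Fin k))))
    (Good : UnlabeledTree k × Finset (Sym2 (Fin k)) →
      Multiset (Sym2 (Fin n)) → Multiset (Sym2 (Fin n)) → Set (Equiv.Perm (Fin n)))
    (π : Equiv.Perm (Fin n)) (A B : SimpleGraph (Fin n)) : ℝ :=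
  ∑ H ∈ Hs, statWeight n lam ε s ℓ m H.1.graph *
    ∑ S₁ ∈ copies JA ℓ H.1.graph H.2, ∑ S₂ ∈ copies JB ℓ H.1.graph H.2,
      signedCount (lam * s / n) S₁ A * signedCount (lam * s / n) S₂ B *
        (if π ∈ Good H S₁ S₂ then 1 else 0)

/-! ### The main configurations -/

/-- Every vertex occurs exactly once among the tree and the interiors of the paths. -/
structure IsNonoverlapping {n k : ℕ} (ℓ : ℕ) (P : Finset (Sym2 (Fin k))) (φ : Fin k ↪ Fin n)
    (w : Sym2 (Fin k) → ℕ → Fin n) : Prop where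
  path_tree : ∀ e ∈ P, ∀ i, 0 < i → i < ℓ → ∀ v, w e i ≠ φ v
  path_path : ∀ e ∈ P, ∀ e' ∈ P, e ≠ e' →
    ∀ i, 0 < i → i < ℓ → ∀ j, 0 < j → j < ℓ → w e i ≠ w e' j

/-- The simple graph (with vertex set the vertices incident to some edge) underlying a
multigraph. -/
def underlying {n : ℕ} (S : Multiset (Sym2 (Fin n))) :
    (⊤ : SimpleGraph (Fin n)).Subgraph where
  verts := {v | ∃ e ∈ S, v ∈ e}
  Adj a b := a ≠ b ∧ s(a, b) ∈ S
  adj_sub h := h.1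
  edge_vert h := ⟨_, h.2, Sym2.mem_mk_left _ _⟩
  symm := ⟨fun _ _ h => ⟨h.1.symm, Sym2.eq_swap ▸ h.2⟩⟩

/-- The permutations `π` for which `π(S₁) ∩ S₂` is a tree containing the (relabelled) tree part
of `S₁` and the tree part of `S₂`, where `S₁` and `S₂` have to be nonoverlapping copies of the
decorated tree `(T, P)`. -/
def goodPermutations {n k : ℕ} (JA JB : Finset (Fin n)) (ℓ : ℕ)
    (H : UnlabeledTree k × Finset (Sym2 (Fin k))) (S₁ S₂ : Multiset (Sym2 (Fin n))) :
    Set (Equiv.Perm (Fin n)) :=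
  {π | ∃ φ₁ w₁ φ₂ w₂,
    IsDecomposition JA ℓ H.1.graph H.2 φ₁ w₁ S₁ ∧ IsNonoverlapping ℓ H.2 φ₁ w₁ ∧
    IsDecomposition JB ℓ H.1.graph H.2 φ₂ w₂ S₂ ∧ IsNonoverlapping ℓ H.2 φ₂ w₂ ∧
    (underlying (S₁.map (Sym2.map π)) ⊓ underlying S₂).coe.IsTree ∧
    underlying ((treeEdges H.1.graph φ₁).map (Sym2.map π)) ≤
      underlying (S₁.map (Sym2.map π)) ⊓ underlying S₂ ∧
    underlying (treeEdges H.1.graph φ₂) ≤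
      underlying (S₁.map (Sym2.map π)) ⊓ underlying S₂}

/-- The order of magnitude `s^{2(k-1)} |ℋ| (ι⁴ (ε² λ s)^ℓ / n)^{2m}` of the first moment. -/
def firstMomentScale (n : ℕ) (lam ε s ι : ℝ) (ℓ m k : ℕ) (card : ℕ) : ℝ :=
  s ^ (2 * (k - 1)) * (card : ℝ) * (ι ^ 4 * (ε ^ 2 * lam * s) ^ ℓ / n) ^ (2 * m)

end CorrelatedSBM

end

/-!
The first moment of the tree-counting statistic in the correlated stochastic block model.

Given the labels and the hidden permutation, the expectation of `φ_{S₁}(A) φ_{S₂}(B)` factors over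
the edges, and the factor of an edge is `c + d χ` with `c, d ≥ 0`, where `χ` is the product of the
labels at its two ends (`expectation_restrictedStatistic`). Averages of products of signs are `0` or
`1`, so all moments of pairs of copies are nonnegative (`pairMoment_nonneg`). Relabelling `S₁` by the
hidden permutation only moves the reserved set `JA` (`copies_relabel`, `mem_goodPermutations_iff`).
It therefore suffices to bound, for every decorated tree `(T, P)` and uniformly in two reserved sets
`J₁`, `J₂`, the sum of the moments over the good pairs, which are nonoverlapping and whose
intersection is a tree containing both tree parts, and over all other pairs (`firstMoment_bounds`).

The decorated trees enter only through one property: all automorphisms of `T` fix the vertices of the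
pairing (`isRigidPairing_of_isGoodRootedTree`). The root of a good tree is its centroid, and siblings
with many descendants are not similar, so they cannot be exchanged.

Lower bound. Embed `T` outside `J₁ ∪ J₂` and add two disjoint families of paths. The two copies share
exactly the tree, and the two paths of every pair form a cycle, so that the signs multiply to `1`
(`le_pairMoment_of_common_tree`). A pair of copies arises from at most `|Aut T|` placements, which is
compensated by the weight of the statistic (`le_sum_good`).

Upper bound for the good pairs. The common part of a good pair is, inside either copy, the tree with
arms along the paths (`GoodPair.nonempty_armSystem`). It is a forest, so the labels average out on it.
The second copy is determined by the lengths of the arms, the position of its tree in the common part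
and the vertices of its paths outside the arms (`card_mul_card_le`). A unit of length of the arms
removes the choice of a vertex among at least about `ι² n`, and replaces two single edges, of moment
about `ε² λ s / n`, by a common one, of moment at most `s`. Since `λ > 100 / (ε⁴ ι⁴)`, the sum over all
arms is a convergent geometric series, up to a factor `exp (O(ι k))` (`sum_good_le`).

Bad pairs. Choose a minimal set of paths which, together with the trees, cover all edges of the pair;
each of them has a private edge. If all paths are needed, cutting the private edges keeps each copy
connected. Were the union then a forest, the copies would be nonoverlapping; a leaf of one tree
outside of the other copy would be a vertex of degree one, which makes the moment vanish; hence the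
trees lie in both copies and the pair is good (`goodPair_of_isAcyclic`). So a bad pair has an
additional edge, which costs a factor `n`, or a path which is not needed, which costs
`(ε² λ s / e)^ℓ ≥ n³` (`exists_excess`, `pairMoment_le_of_bad`).

The number of bad pairs with `v` vertices is bounded by exposing the vertices of the paths one by
one: a path which runs along known edges is predicted by them except at few exceptional vertices, and
Kraft's inequality gives `n^v` times a factor polynomial in `ℓ` and `k` for every exception
(`sum_pathSystem_le`, `sum_bad_le`). Since `k = o(log log log n)` and `ℓ ≤ log n`, all these factors
together are at most `exp (O((log log n)²))`, which is negligible against the gained factor `n`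
(`isLargeSize_of_loglog`).
-/

noncomputable section

open scoped Classical

namespace CorrelatedSBM

/-! ### The expectation as a product over edges -/

/-- Summing a product of edge factors over all graphs. -/
theorem sum_prod_edge {n : ℕ} (f : Sym2 (Fin n) → Prop → ℝ) :
    ∑ G : SimpleGraph (Fin n), ∏ e : Sym2 (Fin n) with ¬ e.IsDiag, f e (e ∈ G.edgeSet) =
      ∏ e : Sym2 (Fin n) with ¬ e.IsDiag, (f e True + f e False) := by
  rw [Finset.prod_add]
  refine Finset.sum_bij' (fun G _ => G.edgeFinset)
    (fun t _ => SimpleGraph.fromEdgeSet (t : Set (Sym2 (Fin n)))) ?_ ?_ ?_ ?_ ?_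
  · intro G _
    simp only [Finset.mem_powerset]
    intro e he
    simp only [Finset.mem_filter, Finset.mem_univ, true_and]
    exact G.not_isDiag_of_mem_edgeSet (by simpa using he)
  · intro t _
    simp
  · intro G _
    simp
  · intro t ht
    ext e
    simp only [Finset.mem_powerset] at ht
    simp only [SimpleGraph.mem_edgeFinset, SimpleGraph.edgeSet_fromEdgeSet, Set.mem_sdiff,
      Finset.mem_coe]
    constructor
    · exact fun h => h.1
    · intro h
      exact ⟨h, by simpa using ht h⟩
  · intro G _
    have hsub : G.edgeFinset ⊆ Finset.univ.filter fun e : Sym2 (Fin n) => ¬ e.IsDiag := by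
      intro e he
      simp only [Finset.mem_filter, Finset.mem_univ, true_and]
      exact G.not_isDiag_of_mem_edgeSet (by simpa using he)
    rw [← Finset.prod_sdiff hsub, mul_comm]
    congr 1
    · refine Finset.prod_congr rfl fun e he => ?_
      rw [eq_true (by simpa using he : e ∈ G.edgeSet)]
    · refine Finset.prod_congr rfl fun e he => ?_
      have : e ∉ G.edgeSet := by
        have := (Finset.mem_sdiff.1 he).2
        simpa using this
      rw [eq_false this]

/-- The normalised and centred indicator of an edge. -/
def centred (p : ℝ) (b : Prop) : ℝ := ((if b then 1 else 0) - p) / √(p * (1 - p))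

theorem signedCount_eq_prod {n : ℕ} (p : ℝ) (S : Multiset (Sym2 (Fin n)))
    (hS : ∀ e ∈ S, ¬ e.IsDiag) (X : SimpleGraph (Fin n)) :
    signedCount p S X =
      ∏ e : Sym2 (Fin n) with ¬ e.IsDiag, centred p (e ∈ X.edgeSet) ^ S.count e := by
  unfold signedCount
  rw [Finset.prod_multiset_map_count]
  refine Finset.prod_subset_one_on_sdiff (fun e he => ?_) (fun e he => ?_) (fun e he => ?_)
  · simp only [Finset.mem_filter, Finset.mem_univ, true_and]
    exact hS e (by simpa using he)
  · have : e ∉ S := by simpa using (Finset.mem_sdiff.1 he).2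
    simp [Multiset.count_eq_zero.2 this]
  · simp only [centred]
    congr

/-- Averaging over the subsampling graph. -/
theorem sum_subsample {n : ℕ} (p s : ℝ) (S : Multiset (Sym2 (Fin n)))
    (hS : ∀ e ∈ S, ¬ e.IsDiag) (G : SimpleGraph (Fin n)) :
    ∑ J : SimpleGraph (Fin n), edgeWeight (fun _ => s) J * signedCount p S (G ⊓ J) =
      ∏ e : Sym2 (Fin n) with ¬ e.IsDiag,
        (s * centred p (e ∈ G.edgeSet) ^ S.count e + (1 - s) * centred p False ^ S.count e) := by
  have := sum_prod_edge (n := n) (fun e b => (if b then s else 1 - s) *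
    centred p (e ∈ G.edgeSet ∧ b) ^ S.count e)
  simp only [and_true, and_false, if_true, if_false] at this
  rw [← this]
  refine Finset.sum_congr rfl fun J _ => ?_
  rw [signedCount_eq_prod p S hS, edgeWeight, ← Finset.prod_mul_distrib]
  refine Finset.prod_congr rfl fun e _ => ?_
  simp [SimpleGraph.edgeSet_inf]

theorem mem_edgeSet_comap_iff {n : ℕ} (π : Equiv.Perm (Fin n)) (G : SimpleGraph (Fin n))
    (e : Sym2 (Fin n)) :
    Sym2.map π e ∈ (G.comap π.symm).edgeSet ↔ e ∈ G.edgeSet := by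
  induction e with
  | _ x y => simp

theorem isDiag_map_perm {n : ℕ} (π : Equiv.Perm (Fin n)) (e : Sym2 (Fin n)) :
    (Sym2.map π e).IsDiag ↔ e.IsDiag := by
  induction e with
  | _ x y => simp

theorem prod_nonDiag_map_perm {n : ℕ} (π : Equiv.Perm (Fin n)) (f : Sym2 (Fin n) → ℝ) :
    ∏ e : Sym2 (Fin n) with ¬ e.IsDiag, f (Sym2.map π e) =
      ∏ e : Sym2 (Fin n) with ¬ e.IsDiag, f e := by
  refine Finset.prod_bij' (fun e _ => Sym2.map π e) (fun e _ => Sym2.map π.symm e) ?_ ?_ ?_ ?_ ?_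
  · intro e he
    simpa [isDiag_map_perm] using he
  · intro e he
    simpa [isDiag_map_perm] using he
  · intro e _
    simp [Sym2.map_map]
  · intro e _
    simp [Sym2.map_map]
  · intro e _
    rfl

/-- The mean, over the subsampling, of the `a`-th power of the centred indicator of an edge which
is present in the parent graph (without the normalisation). -/
def subMoment (s p : ℝ) (a : ℕ) : ℝ := s * (1 - p) ^ a + (1 - s) * (-p) ^ a

/-- The part of the joint moment of an edge (of orders `a`, `b` in the two graphs) which does not
depend on the labels. -/
def momConst (n : ℕ) (lam s : ℝ) (a b : ℕ) : ℝ :=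
  ((1 - lam / n) * (-(lam * s / n)) ^ (a + b) +
    lam / n * (subMoment s (lam * s / n) a * subMoment s (lam * s / n) b)) /
      √(lam * s / n * (1 - lam * s / n)) ^ (a + b)

/-- The coefficient of `σ i * σ j` in the joint moment of the edge `{i, j}` (of orders `a`, `b`
in the two graphs). -/
def momLin (n : ℕ) (lam ε s : ℝ) (a b : ℕ) : ℝ :=
  ε * (lam / n) * (subMoment s (lam * s / n) a * subMoment s (lam * s / n) b -
    (-(lam * s / n)) ^ (a + b)) / √(lam * s / n * (1 - lam * s / n)) ^ (a + b)

/-- The product of the two labels at the ends of an edge. -/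
def edgeSign {n : ℕ} (σ : Fin n → ℤˣ) (e : Sym2 (Fin n)) : ℝ :=
  if ∀ i ∈ e, ∀ j ∈ e, σ i = σ j then 1 else -1

/-- The expectation of `φ_S(A) φ_{S'}(B)` when the hidden permutation is the identity. -/
def pairMoment (n : ℕ) (lam ε s : ℝ) (S S' : Multiset (Sym2 (Fin n))) : ℝ :=
  (Fintype.card (Fin n → ℤˣ) : ℝ)⁻¹ * ∑ σ : Fin n → ℤˣ,
    ∏ e : Sym2 (Fin n) with ¬ e.IsDiag,
      (momConst n lam s (S.count e) (S'.count e) +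
        momLin n lam ε s (S.count e) (S'.count e) * edgeSign σ e)

theorem edgeSign_comp_perm {n : ℕ} (π : Equiv.Perm (Fin n)) (σ : Fin n → ℤˣ)
    (e : Sym2 (Fin n)) : edgeSign σ (Sym2.map π e) = edgeSign (σ ∘ π) e := by
  induction e with
  | _ x y => simp [edgeSign]

theorem subMoment_eq (s p : ℝ) (a : ℕ) :
    s * centred p True ^ a + (1 - s) * centred p False ^ a =
      subMoment s p a / √(p * (1 - p)) ^ a := by
  simp only [centred, subMoment, if_true, if_false, zero_sub, div_pow]
  ring

/-- Given the labels and the hidden permutation, the average over the graph and the two subsamplings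
factors over the edges; the factor of an edge is affine in the product of its labels. -/
theorem sum_graphs {n : ℕ} (lam ε s : ℝ) (π : Equiv.Perm (Fin n)) (σ : Fin n → ℤˣ)
    (S S' : Multiset (Sym2 (Fin n))) (hS : ∀ e ∈ S, ¬ e.IsDiag) (hS' : ∀ e ∈ S', ¬ e.IsDiag) :
    ∑ G : SimpleGraph (Fin n), ∑ J : SimpleGraph (Fin n), ∑ K : SimpleGraph (Fin n),
      edgeWeight (sbmEdgeProb lam ε σ) G * edgeWeight (fun _ => s) J *
        edgeWeight (fun _ => s) K * (signedCount (lam * s / n) S (G ⊓ J) *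
          signedCount (lam * s / n) S' (G.comap π.symm ⊓ K)) =
      ∏ e : Sym2 (Fin n) with ¬ e.IsDiag,
        (momConst n lam s ((S.map (Sym2.map π)).count e) (S'.count e) +
          momLin n lam ε s ((S.map (Sym2.map π)).count e) (S'.count e) *
            edgeSign (σ ∘ π.symm) e) := by
  set p := lam * s / n with hp
  have h1 : ∀ G : SimpleGraph (Fin n), ∑ J : SimpleGraph (Fin n), ∑ K : SimpleGraph (Fin n),
      edgeWeight (sbmEdgeProb lam ε σ) G * edgeWeight (fun _ => s) J *
        edgeWeight (fun _ => s) K * (signedCount p S (G ⊓ J) *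
          signedCount p S' (G.comap π.symm ⊓ K)) =
      ∏ e : Sym2 (Fin n) with ¬ e.IsDiag,
        ((if e ∈ G.edgeSet then sbmEdgeProb lam ε σ e else 1 - sbmEdgeProb lam ε σ e) *
        ((s * centred p (e ∈ G.edgeSet) ^ S.count e + (1 - s) * centred p False ^ S.count e) *
         (s * centred p (e ∈ G.edgeSet) ^ S'.count (Sym2.map π e) +
            (1 - s) * centred p False ^ S'.count (Sym2.map π e)))) := by
    intro G
    rw [Finset.prod_mul_distrib, Finset.prod_mul_distrib, ← sum_subsample p s S hS G]
    have h2 := sum_subsample p s S' hS' (G.comap π.symm)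
    rw [← prod_nonDiag_map_perm π] at h2
    simp only [mem_edgeSet_comap_iff] at h2
    rw [← h2, ← edgeWeight, Finset.sum_mul_sum, Finset.mul_sum]
    refine Finset.sum_congr rfl fun J _ => ?_
    rw [Finset.mul_sum]
    refine Finset.sum_congr rfl fun K _ => ?_
    ring
  rw [Finset.sum_congr rfl fun G _ => h1 G]
  refine (Eq.trans ?_ (sum_prod_edge
    (fun e b => (if b then sbmEdgeProb lam ε σ e else 1 - sbmEdgeProb lam ε σ e) *
        ((s * centred p b ^ S.count e + (1 - s) * centred p False ^ S.count e) *
         (s * centred p b ^ S'.count (Sym2.map π e) +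
            (1 - s) * centred p False ^ S'.count (Sym2.map π e)))))).trans ?_
  · refine Finset.sum_congr rfl fun G _ => Finset.prod_congr rfl fun e _ => ?_
    congr
  rw [← prod_nonDiag_map_perm π (fun e => momConst n lam s ((S.map (Sym2.map π)).count e)
    (S'.count e) + momLin n lam ε s ((S.map (Sym2.map π)).count e) (S'.count e) *
            edgeSign (σ ∘ π.symm) e)]
  refine Finset.prod_congr rfl fun e _ => ?_
  rw [Multiset.count_map_eq_count' _ _ (Sym2.map.injective π.injective), edgeSign_comp_perm]
  have hσ : (σ ∘ π.symm) ∘ π = σ := by ext; simp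
  rw [hσ]
  set a := S.count e
  set b := S'.count (Sym2.map π e)
  simp only [if_true, if_false]
  rw [subMoment_eq, subMoment_eq]
  have h3 : ∀ c : ℕ, s * centred p False ^ c + (1 - s) * centred p False ^ c =
      (-p) ^ c / √(p * (1 - p)) ^ c := by
    intro c
    simp only [centred, if_false, zero_sub, div_pow]
    ring
  rw [h3, h3]
  have h4 : sbmEdgeProb lam ε σ e = lam / n + ε * (lam / n) * edgeSign σ e := by
    unfold sbmEdgeProb edgeSign
    split_ifs <;> ring
  rw [h4, momConst, momLin, ← hp]
  simp only [pow_add, div_eq_mul_inv, mul_inv]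
  ring

theorem sum_labels_comp {n : ℕ} (π : Equiv.Perm (Fin n)) (f : (Fin n → ℤˣ) → ℝ) :
    ∑ σ : Fin n → ℤˣ, f (σ ∘ π.symm) = ∑ σ : Fin n → ℤˣ, f σ :=
  Fintype.sum_equiv (Equiv.arrowCongr π (Equiv.refl _)) _ _ (fun _ => rfl)

/-- The expectation is an average over the hidden permutation of sums of moments of pairs of copies. -/
theorem expectation_restrictedStatistic {n k : ℕ} (lam ε s : ℝ) (ℓ m : ℕ) (JA JB : Finset (Fin n))
    (Hs : Finset (UnlabeledTree k × Finset (Sym2 (Fin k))))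
    (Good : UnlabeledTree k × Finset (Sym2 (Fin k)) →
      Multiset (Sym2 (Fin n)) → Multiset (Sym2 (Fin n)) → Set (Equiv.Perm (Fin n)))
    (hdiag : ∀ H ∈ Hs, ∀ J : Finset (Fin n), ∀ S ∈ copies J ℓ H.1.graph H.2,
      ∀ e ∈ S, ¬ e.IsDiag) :
    expectation lam ε s (restrictedStatistic lam ε s ℓ m JA JB Hs Good) =
      (Fintype.card (Equiv.Perm (Fin n)) : ℝ)⁻¹ * ∑ π : Equiv.Perm (Fin n),
        ∑ H ∈ Hs, statWeight n lam ε s ℓ m H.1.graph *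
          ∑ S₁ ∈ copies JA ℓ H.1.graph H.2, ∑ S₂ ∈ copies JB ℓ H.1.graph H.2,
            pairMoment n lam ε s (S₁.map (Sym2.map π)) S₂ *
              (if π ∈ Good H S₁ S₂ then 1 else 0) := by
  unfold expectation
  rw [Finset.mul_sum]
  refine Finset.sum_congr rfl fun π _ => ?_
  have key : ∀ S₁ S₂ : Multiset (Sym2 (Fin n)), (∀ e ∈ S₁, ¬ e.IsDiag) → (∀ e ∈ S₂, ¬ e.IsDiag) →
      ∑ σ : Fin n → ℤˣ, ∑ G : SimpleGraph (Fin n), ∑ J : SimpleGraph (Fin n),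
        ∑ K : SimpleGraph (Fin n), jointWeight lam ε s π σ G J K *
          (signedCount (lam * s / n) S₁ (G ⊓ J) *
            signedCount (lam * s / n) S₂ (G.comap π.symm ⊓ K)) =
      (Fintype.card (Equiv.Perm (Fin n)) : ℝ)⁻¹ *
        pairMoment n lam ε s (S₁.map (Sym2.map π)) S₂ := by
    intro S₁ S₂ h1 h2
    rw [pairMoment, ← mul_assoc, Finset.mul_sum]
    refine Eq.trans ?_ (sum_labels_comp π _)
    refine Finset.sum_congr rfl fun σ _ => ?_
    rw [← sum_graphs lam ε s π σ S₁ S₂ h1 h2]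
    simp only [Finset.mul_sum, jointWeight]
    refine Finset.sum_congr rfl fun G _ => Finset.sum_congr rfl fun J _ =>
      Finset.sum_congr rfl fun K _ => ?_
    ring
  simp only [restrictedStatistic, Finset.mul_sum]
  -- move the sums over the randomness inside
  have comm : ∀ (F : (Fin n → ℤˣ) → SimpleGraph (Fin n) → SimpleGraph (Fin n) →
      SimpleGraph (Fin n) → UnlabeledTree k × Finset (Sym2 (Fin k)) →
      Multiset (Sym2 (Fin n)) → Multiset (Sym2 (Fin n)) → ℝ),
      ∑ σ, ∑ G, ∑ J, ∑ K, ∑ H ∈ Hs, ∑ S₁ ∈ copies JA ℓ H.1.graph H.2,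
        ∑ S₂ ∈ copies JB ℓ H.1.graph H.2, F σ G J K H S₁ S₂ =
      ∑ H ∈ Hs, ∑ S₁ ∈ copies JA ℓ H.1.graph H.2,
        ∑ S₂ ∈ copies JB ℓ H.1.graph H.2, ∑ σ, ∑ G, ∑ J, ∑ K, F σ G J K H S₁ S₂ := by
    intro F
    have step : ∀ {ι : Type} [Fintype ι] (F' : ι → UnlabeledTree k × Finset (Sym2 (Fin k)) →
      Multiset (Sym2 (Fin n)) → Multiset (Sym2 (Fin n)) → ℝ),
      ∑ i, ∑ H ∈ Hs, ∑ S₁ ∈ copies JA ℓ H.1.graph H.2,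
        ∑ S₂ ∈ copies JB ℓ H.1.graph H.2, F' i H S₁ S₂ =
      ∑ H ∈ Hs, ∑ S₁ ∈ copies JA ℓ H.1.graph H.2,
        ∑ S₂ ∈ copies JB ℓ H.1.graph H.2, ∑ i, F' i H S₁ S₂ := by
      intro ι _ F'
      rw [Finset.sum_comm]
      refine Finset.sum_congr rfl fun H _ => ?_
      rw [Finset.sum_comm]
      refine Finset.sum_congr rfl fun S₁ _ => ?_
      rw [Finset.sum_comm]
    simp only [step]
  rw [comm]
  refine Finset.sum_congr rfl fun H hH => Finset.sum_congr rfl fun S₁ h1 =>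
    Finset.sum_congr rfl fun S₂ h2 => ?_
  have := key S₁ S₂ (hdiag H hH JA S₁ h1) (hdiag H hH JB S₂ h2)
  rw [show ((Fintype.card (Equiv.Perm (Fin n)) : ℝ)⁻¹ * (statWeight n lam ε s ℓ m H.1.graph *
      (pairMoment n lam ε s (S₁.map (Sym2.map π)) S₂ * if π ∈ Good H S₁ S₂ then 1 else 0))) =
      ((Fintype.card (Equiv.Perm (Fin n)) : ℝ)⁻¹ *
        pairMoment n lam ε s (S₁.map (Sym2.map π)) S₂) *
        (statWeight n lam ε s ℓ m H.1.graph * (if π ∈ Good H S₁ S₂ then 1 else 0)) by ring,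
    ← this]
  simp only [Finset.sum_mul]
  refine Finset.sum_congr rfl fun σ _ => Finset.sum_congr rfl fun G _ =>
    Finset.sum_congr rfl fun J _ => Finset.sum_congr rfl fun K _ => ?_
  ring

/-! ### Averages over the labels -/

theorem edgeSign_mk {n : ℕ} (σ : Fin n → ℤˣ) (x y : Fin n) :
    edgeSign σ s(x, y) = (((σ x * σ y : ℤˣ) : ℤ) : ℝ) := by
  have h1 := Int.units_eq_one_or (σ x)
  have h2 := Int.units_eq_one_or (σ y)
  rcases h1 with h1 | h1 <;> rcases h2 with h2 | h2 <;> simp [edgeSign, h1, h2]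

theorem edgeSign_mul {n : ℕ} (σ τ : Fin n → ℤˣ) (e : Sym2 (Fin n)) :
    edgeSign (σ * τ) e = edgeSign σ e * edgeSign τ e := by
  induction e with
  | _ x y =>
    simp only [edgeSign_mk, Pi.mul_apply]
    push_cast
    ring

theorem edgeSign_eq_or {n : ℕ} (σ : Fin n → ℤˣ) (e : Sym2 (Fin n)) :
    edgeSign σ e = 1 ∨ edgeSign σ e = -1 := by
  unfold edgeSign
  split_ifs <;> simp

theorem neg_one_le_edgeSign {n : ℕ} (σ : Fin n → ℤˣ) (e : Sym2 (Fin n)) :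
    -1 ≤ edgeSign σ e := by
  rcases edgeSign_eq_or σ e with h | h <;> norm_num [h]

/-- The average over uniformly random labels. -/
def labelAverage {n : ℕ} (f : (Fin n → ℤˣ) → ℝ) : ℝ :=
  (Fintype.card (Fin n → ℤˣ) : ℝ)⁻¹ * ∑ σ : Fin n → ℤˣ, f σ

theorem labelAverage_const {n : ℕ} (c : ℝ) : labelAverage (fun _ : Fin n → ℤˣ => c) = c := by
  have : (Fintype.card (Fin n → ℤˣ) : ℝ) ≠ 0 := by
    exact_mod_cast Fintype.card_ne_zero
  unfold labelAverage
  rw [Finset.sum_const, Finset.card_univ, nsmul_eq_mul]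
  field_simp

theorem labelAverage_mono {n : ℕ} {f g : (Fin n → ℤˣ) → ℝ} (h : ∀ σ, f σ ≤ g σ) :
    labelAverage f ≤ labelAverage g :=
  mul_le_mul_of_nonneg_left (Finset.sum_le_sum fun σ _ => h σ) (by positivity)

theorem labelAverage_mul_left {n : ℕ} (c : ℝ) (f : (Fin n → ℤˣ) → ℝ) :
    labelAverage (fun σ => c * f σ) = c * labelAverage f := by
  unfold labelAverage
  rw [← Finset.mul_sum]
  ring

theorem labelAverage_mul_translate {n : ℕ} (τ : Fin n → ℤˣ) (f : (Fin n → ℤˣ) → ℝ) :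
    labelAverage (fun σ => f (τ * σ)) = labelAverage f := by
  unfold labelAverage
  congr 1
  exact Fintype.sum_equiv (Equiv.mulLeft τ) _ _ (fun _ => rfl)

theorem labelAverage_eq_zero_of_flip {n : ℕ} (τ : Fin n → ℤˣ) (f : (Fin n → ℤˣ) → ℝ)
    (h : ∀ σ, f (τ * σ) = - f σ) : labelAverage f = 0 := by
  have h1 := labelAverage_mul_translate τ f
  have h2 : labelAverage (fun σ => f (τ * σ)) = (-1) * labelAverage f := by
    rw [← labelAverage_mul_left]
    congr 1
    ext σ
    rw [h]
    ring
  linarith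

theorem prod_edgeSign_mul {n : ℕ} (Y : Finset (Sym2 (Fin n))) (σ τ : Fin n → ℤˣ) :
    ∏ e ∈ Y, edgeSign (σ * τ) e = (∏ e ∈ Y, edgeSign σ e) * ∏ e ∈ Y, edgeSign τ e := by
  simp only [edgeSign_mul, Finset.prod_mul_distrib]

theorem prod_edgeSign_eq_or {n : ℕ} (Y : Finset (Sym2 (Fin n))) (σ : Fin n → ℤˣ) :
    ∏ e ∈ Y, edgeSign σ e = 1 ∨ ∏ e ∈ Y, edgeSign σ e = -1 := by
  induction Y using Finset.induction_on with
  | empty => simp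
  | insert a s ha ih =>
    rw [Finset.prod_insert ha]
    rcases ih with h | h <;> rcases edgeSign_eq_or σ a with h' | h' <;> simp [h, h']

theorem labelAverage_sign_nonneg {n : ℕ} (Y : Finset (Sym2 (Fin n))) :
    0 ≤ labelAverage fun σ => ∏ e ∈ Y, edgeSign σ e := by
  by_cases h : ∃ τ : Fin n → ℤˣ, ∏ e ∈ Y, edgeSign τ e = -1
  · obtain ⟨τ, hτ⟩ := h
    refine (labelAverage_eq_zero_of_flip τ _ fun σ => ?_).ge
    rw [prod_edgeSign_mul, hτ]
    ring
  · push Not at h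
    have : (fun σ : Fin n → ℤˣ => ∏ e ∈ Y, edgeSign σ e) = fun _ => 1 := by
      ext σ
      exact (prod_edgeSign_eq_or Y σ).resolve_right (h σ)
    rw [this, labelAverage_const]
    norm_num

/-- Expansion into products of edge signs, whose label averages are `0` or `1`. -/
theorem labelAverage_expand {n : ℕ} (E : Finset (Sym2 (Fin n))) (c d : Sym2 (Fin n) → ℝ) :
    labelAverage (fun σ => ∏ e ∈ E, (c e + d e * edgeSign σ e)) =
      ∑ Z ∈ E.powerset, (∏ e ∈ E \ Z, c e) * (∏ e ∈ Z, d e) *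
        labelAverage fun σ => ∏ e ∈ Z, edgeSign σ e := by
  unfold labelAverage
  simp only [Finset.mul_sum]
  rw [Finset.sum_comm]
  refine Finset.sum_congr rfl fun σ _ => ?_
  rw [Finset.prod_congr rfl fun e _ => add_comm (c e) (d e * edgeSign σ e), Finset.prod_add,
    Finset.mul_sum]
  refine Finset.sum_congr rfl fun Z _ => ?_
  rw [Finset.prod_mul_distrib]
  ring

theorem labelAverage_prod_nonneg {n : ℕ} (E : Finset (Sym2 (Fin n))) (c d : Sym2 (Fin n) → ℝ)
    (hc : ∀ e ∈ E, 0 ≤ c e) (hd : ∀ e ∈ E, 0 ≤ d e) :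
    0 ≤ labelAverage (fun σ => ∏ e ∈ E, (c e + d e * edgeSign σ e)) := by
  rw [labelAverage_expand]
  refine Finset.sum_nonneg fun Z hZ => ?_
  rw [Finset.mem_powerset] at hZ
  refine mul_nonneg (mul_nonneg (Finset.prod_nonneg fun e he => hc e (Finset.sdiff_subset he))
    (Finset.prod_nonneg fun e he => hd e (hZ he))) (labelAverage_sign_nonneg Z)

/-- The term of the empty set of edges in the expansion. -/
theorem prod_le_labelAverage_prod {n : ℕ} (E : Finset (Sym2 (Fin n))) (c d : Sym2 (Fin n) → ℝ)
    (hc : ∀ e ∈ E, 0 ≤ c e) (hd : ∀ e ∈ E, 0 ≤ d e) :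
    ∏ e ∈ E, c e ≤ labelAverage (fun σ => ∏ e ∈ E, (c e + d e * edgeSign σ e)) := by
  rw [labelAverage_expand]
  have h0 : ∏ e ∈ E, c e = (∏ e ∈ E \ ∅, c e) * (∏ e ∈ (∅ : Finset (Sym2 (Fin n))), d e) *
        labelAverage fun σ : Fin n → ℤˣ => ∏ e ∈ (∅ : Finset (Sym2 (Fin n))), edgeSign σ e := by
    simp [labelAverage_const]
  rw [h0]
  refine Finset.single_le_sum (f := fun Z => (∏ e ∈ E \ Z, c e) * (∏ e ∈ Z, d e) *
        labelAverage fun σ => ∏ e ∈ Z, edgeSign σ e) (fun Z hZ => ?_) (by simp)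
  rw [Finset.mem_powerset] at hZ
  exact mul_nonneg (mul_nonneg (Finset.prod_nonneg fun e he => hc e (Finset.sdiff_subset he))
    (Finset.prod_nonneg fun e he => hd e (hZ he))) (labelAverage_sign_nonneg Z)

theorem abs_linear_le {c d t : ℝ} (hc : 0 ≤ c) (hd : 0 ≤ d) (h1 : t = 1 ∨ t = -1) :
    |c + d * t| ≤ c + d := by
  rw [abs_le]
  rcases h1 with h | h <;> subst h <;> constructor <;> linarith

theorem labelAverage_prod_le {n : ℕ} (E : Finset (Sym2 (Fin n))) (c d : Sym2 (Fin n) → ℝ)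
    (hc : ∀ e ∈ E, 0 ≤ c e) (hd : ∀ e ∈ E, 0 ≤ d e) :
    labelAverage (fun σ => ∏ e ∈ E, (c e + d e * edgeSign σ e)) ≤ ∏ e ∈ E, (c e + d e) := by
  rw [← labelAverage_const (n := n) (∏ e ∈ E, (c e + d e))]
  refine labelAverage_mono fun σ => ?_
  refine (le_abs_self _).trans ?_
  rw [Finset.abs_prod]
  exact Finset.prod_le_prod (fun _ _ => abs_nonneg _)
    (fun e he => abs_linear_le (hc e he) (hd e he) (edgeSign_eq_or σ e))

/-- Flipping the label of a vertex which lies on exactly one relevant edge changes the sign. -/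
theorem labelAverage_prod_eq_zero {n : ℕ} (E : Finset (Sym2 (Fin n))) (c d : Sym2 (Fin n) → ℝ)
    (v : Fin n) (e₀ : Sym2 (Fin n)) (he₀ : e₀ ∈ E) (hdiag : ¬ e₀.IsDiag) (hv : v ∈ e₀)
    (hc : c e₀ = 0) (hd : ∀ e ∈ E, v ∈ e → e ≠ e₀ → d e = 0) :
    labelAverage (fun σ => ∏ e ∈ E, (c e + d e * edgeSign σ e)) = 0 := by
  set τ : Fin n → ℤˣ := Function.update 1 v (-1) with hτ
  have hne : ∀ e, v ∉ e → edgeSign τ e = 1 := by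
    intro e he
    induction e with
    | _ x y =>
      simp only [Sym2.mem_iff, not_or] at he
      rw [edgeSign_mk]
      simp [hτ, Function.update_of_ne (Ne.symm he.1), Function.update_of_ne (Ne.symm he.2)]
  have heq : edgeSign τ e₀ = -1 := by
    induction e₀ with
    | _ x y =>
      have hxy : x ≠ y := by simpa using hdiag
      simp only [Sym2.mem_iff] at hv
      rw [edgeSign_mk]
      rcases hv with rfl | rfl
      · simp [hτ, Function.update_of_ne hxy.symm]
      · simp [hτ, Function.update_of_ne hxy]
  refine labelAverage_eq_zero_of_flip τ _ fun σ => ?_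
  rw [← Finset.mul_prod_erase E _ he₀, ← Finset.mul_prod_erase E _ he₀, hc, edgeSign_mul, heq,
    ← neg_mul]
  congr 1
  · ring
  · refine Finset.prod_congr rfl fun e he => ?_
    rw [Finset.mem_erase] at he
    by_cases hve : v ∈ e
    · rw [hd e he.2 hve he.1]
      ring
    · rw [edgeSign_mul, hne e hve, one_mul]

/-- A nonempty set of edges of a forest is not balanced: the labelling which is constant on the
two sides of one of these edges (a bridge) has total sign `-1`. -/
theorem labelAverage_sign_forest {n : ℕ} (X : SimpleGraph (Fin n)) (hX : X.IsAcyclic)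
    (Z : Finset (Sym2 (Fin n))) (hZ : ∀ e ∈ Z, e ∈ X.edgeSet) (hne : Z.Nonempty) :
    (labelAverage fun σ : Fin n → ℤˣ => ∏ e ∈ Z, edgeSign σ e) = 0 := by
  obtain ⟨e₀, he₀⟩ := hne
  have hbr := SimpleGraph.isAcyclic_iff_forall_isBridge.1 hX (hZ e₀ he₀)
  induction e₀ with
  | _ x y =>
    rw [SimpleGraph.isBridge_iff] at hbr
    set Y := X.deleteEdges {s(x, y)} with hY
    set τ : Fin n → ℤˣ := fun v => if Y.Reachable x v then -1 else 1 with hτ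
    have hprod : ∏ e ∈ Z, edgeSign τ e = -1 := by
      rw [← Finset.mul_prod_erase Z _ he₀]
      have h1 : edgeSign τ s(x, y) = -1 := by
        rw [edgeSign_mk]
        have : ¬ Y.Reachable x y := by
          simpa [hY] using hbr
        simp [hτ, this]
      have h2 : ∏ e ∈ Z.erase s(x, y), edgeSign τ e = 1 := by
        refine Finset.prod_eq_one fun e he => ?_
        rw [Finset.mem_erase] at he
        have hXe := hZ e he.2
        induction e with
        | _ a b =>
          have hab : Y.Adj a b := by
            rw [hY, SimpleGraph.deleteEdges_adj]
            exact ⟨by simpa using hXe, fun h => he.1 (by simpa using h)⟩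
          have : Y.Reachable x a ↔ Y.Reachable x b :=
            ⟨fun h => h.trans hab.reachable, fun h => h.trans hab.symm.reachable⟩
          rw [edgeSign_mk]
          by_cases h : Y.Reachable x a
          · simp [hτ, h, this.1 h]
          · have h' : ¬ Y.Reachable x b := fun h' => h (this.2 h')
            simp [hτ, h, h']
      rw [h1, h2, mul_one]
    refine labelAverage_eq_zero_of_flip τ _ fun σ => ?_
    rw [prod_edgeSign_mul, hprod]
    ring

/-- Over a forest, only the empty product of edge signs has a nonzero average. -/
theorem labelAverage_prod_forest {n : ℕ} (X : SimpleGraph (Fin n)) (hX : X.IsAcyclic)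
    (E : Finset (Sym2 (Fin n))) (hE : ∀ e ∈ E, e ∈ X.edgeSet) (c d : Sym2 (Fin n) → ℝ) :
    labelAverage (fun σ => ∏ e ∈ E, (c e + d e * edgeSign σ e)) = ∏ e ∈ E, c e := by
  rw [labelAverage_expand, Finset.sum_eq_single ∅]
  · simp [labelAverage_const]
  · intro Z hZ hne
    rw [Finset.mem_powerset] at hZ
    rw [labelAverage_sign_forest X hX Z (fun e he => hE e (hZ he))
      (Finset.nonempty_iff_ne_empty.2 hne), mul_zero]
  · simp

/-! ### Moments of single edges -/

theorem pairMoment_eq_labelAverage {n : ℕ} (lam ε s : ℝ) (S S' : Multiset (Sym2 (Fin n))) :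
    pairMoment n lam ε s S S' = labelAverage fun σ => ∏ e : Sym2 (Fin n) with ¬ e.IsDiag,
      (momConst n lam s (S.count e) (S'.count e) +
        momLin n lam ε s (S.count e) (S'.count e) * edgeSign σ e) := rfl

theorem momConst_zero_zero (n : ℕ) (lam s : ℝ) : momConst n lam s 0 0 = 1 := by
  simp [momConst, subMoment]

theorem momLin_zero_zero (n : ℕ) (lam ε s : ℝ) : momLin n lam ε s 0 0 = 0 := by
  simp [momLin, subMoment]

theorem momConst_one_zero (n : ℕ) (lam s : ℝ) : momConst n lam s 1 0 = 0 := by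
  simp only [momConst, subMoment]
  rw [div_eq_zero_iff]
  left
  simp
  ring

theorem momConst_comm (n : ℕ) (lam s : ℝ) (a b : ℕ) :
    momConst n lam s a b = momConst n lam s b a := by
  simp only [momConst]
  rw [add_comm a b, mul_comm (subMoment s (lam * s / n) a)]

theorem momLin_comm (n : ℕ) (lam ε s : ℝ) (a b : ℕ) :
    momLin n lam ε s a b = momLin n lam ε s b a := by
  simp only [momLin]
  rw [add_comm a b, mul_comm (subMoment s (lam * s / n) a)]

/-- Standing assumptions on the parameters: the edge density is small compared with the inverse
of the largest multiplicity `M`. -/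
structure SmallDensity (n : ℕ) (lam ε s : ℝ) (M : ℕ) : Prop where
  n_pos : 0 < n
  ε_pos : 0 < ε
  ε_lt : ε < 1
  s_pos : 0 < s
  s_lt : s < 1
  lam_pos : 0 < lam
  density_le : lam / n ≤ 1 / 5
  mul_le : M * (lam * s / n) ≤ 1 / 2

namespace SmallDensity

variable {n : ℕ} {lam ε s : ℝ} {M : ℕ}

theorem p_pos (h : SmallDensity n lam ε s M) : 0 < lam * s / n := by
  have := h.n_pos
  have := h.s_pos
  have := h.lam_pos
  positivity

theorem p_eq (_ : SmallDensity n lam ε s M) : lam * s / n = lam / n * s := by ring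

theorem density_pos (h : SmallDensity n lam ε s M) : 0 < lam / n := by
  have := h.n_pos
  have := h.lam_pos
  positivity

theorem p_le_s (h : SmallDensity n lam ε s M) : lam * s / n ≤ s / 5 := by
  rw [h.p_eq]
  nlinarith [h.density_le, h.s_pos]

theorem p_le (h : SmallDensity n lam ε s M) : lam * s / n ≤ lam / n := by
  rw [h.p_eq]
  nlinarith [h.density_pos, h.s_lt]

theorem p_le_fifth (h : SmallDensity n lam ε s M) : lam * s / n ≤ 1 / 5 :=
  h.p_le.trans h.density_le

theorem subMoment_ge (h : SmallDensity n lam ε s M) {a : ℕ} (ha : a ≤ M) :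
    s / 4 ≤ subMoment s (lam * s / n) a := by
  set p := lam * s / n with hp
  have hp0 : 0 < p := h.p_pos
  have hps : p ≤ s / 5 := h.p_le_s
  have hs := h.s_pos
  have hs1 := h.s_lt
  unfold subMoment
  rcases Nat.eq_zero_or_pos a with rfl | ha0
  · simp
    linarith
  · have h1 : 1 - a * p ≤ (1 - p) ^ a := by
      have := one_add_mul_le_pow (a := -p) (by linarith [h.p_le_fifth]) a
      calc 1 - a * p = 1 + a * -p := by ring
        _ ≤ _ := this
        _ = _ := by ring
    have h2 : (1 : ℝ) / 2 ≤ 1 - a * p := by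
      have : (a : ℝ) * p ≤ M * p := by
        have : (a : ℝ) ≤ M := by exact_mod_cast ha
        nlinarith
      linarith [h.mul_le]
    have h3 : |(-p) ^ a| ≤ p := by
      rw [abs_pow, abs_neg, abs_of_pos hp0]
      exact pow_le_of_le_one hp0.le (by linarith [h.p_le_fifth]) (by omega)
    have h4 := (abs_le.1 h3).1
    nlinarith

theorem subMoment_nonneg (h : SmallDensity n lam ε s M) {a : ℕ} (ha : a ≤ M) :
    0 ≤ subMoment s (lam * s / n) a :=
  le_trans (by linarith [h.s_pos]) (h.subMoment_ge ha)

theorem subMoment_le (h : SmallDensity n lam ε s M) {a : ℕ} (ha : 1 ≤ a) :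
    subMoment s (lam * s / n) a ≤ s + lam * s / n := by
  set p := lam * s / n with hp
  have hp0 : 0 < p := h.p_pos
  have hs := h.s_pos
  have hs1 := h.s_lt
  have h5 := h.p_le_fifth
  unfold subMoment
  have h1 : (1 - p) ^ a ≤ 1 := pow_le_one₀ (by linarith) (by linarith)
  have h3 : |(-p) ^ a| ≤ p := by
    rw [abs_pow, abs_neg, abs_of_pos hp0]
    exact pow_le_of_le_one hp0.le (by linarith [h.p_le_fifth]) (by omega)
  have h4 := (abs_le.1 h3).2
  nlinarith

theorem subMoment_mul_le (h : SmallDensity n lam ε s M) {a b : ℕ} (ha : a ≤ M) (hb : b ≤ M)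
    (hab : 1 ≤ a + b) :
    subMoment s (lam * s / n) a * subMoment s (lam * s / n) b ≤ s + lam * s / n := by
  have h0 : subMoment s (lam * s / n) 0 = 1 := by simp [subMoment]
  have hle : s + lam * s / n ≤ s + s / 5 := by linarith [h.p_le_s]
  rcases Nat.eq_zero_or_pos a with rfl | ha0
  · rw [h0, one_mul]
    exact h.subMoment_le (by omega)
  rcases Nat.eq_zero_or_pos b with rfl | hb0
  · rw [h0, mul_one]
    exact h.subMoment_le ha0
  · have h1 : subMoment s (lam * s / n) b ≤ 1 := by
      unfold subMoment
      have hp0 : 0 < lam * s / n := h.p_pos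
      have h5 := h.p_le_fifth
      have h1 : (1 - lam * s / n) ^ b ≤ 1 := pow_le_one₀ (by linarith) (by linarith)
      have h3 : |(-(lam * s / n)) ^ b| ≤ 1 := by
        rw [abs_pow, abs_neg, abs_of_pos hp0]
        exact pow_le_one₀ hp0.le (by linarith)
      have h4 := (abs_le.1 h3).2
      nlinarith [h.s_pos, h.s_lt]
    calc _ ≤ subMoment s (lam * s / n) a * 1 :=
          mul_le_mul_of_nonneg_left h1 (h.subMoment_nonneg ha)
      _ ≤ _ := by rw [mul_one]; exact h.subMoment_le ha0

theorem norm_pos (h : SmallDensity n lam ε s M) :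
    0 < √(lam * s / n * (1 - lam * s / n)) :=
  Real.sqrt_pos.2 (mul_pos h.p_pos (by linarith [h.p_le_fifth]))

theorem abs_neg_p_pow_le (h : SmallDensity n lam ε s M) {j i : ℕ} (hij : i ≤ j) :
    |(-(lam * s / n)) ^ j| ≤ (lam * s / n) ^ i := by
  rw [abs_pow, abs_neg, abs_of_pos h.p_pos]
  exact pow_le_pow_of_le_one h.p_pos.le (by linarith [h.p_le_fifth]) hij

theorem momConst_nonneg (h : SmallDensity n lam ε s M) {a b : ℕ} (ha : a ≤ M) (hb : b ≤ M) :
    0 ≤ momConst n lam s a b := by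
  rcases Nat.lt_or_ge (a + b) 2 with hab | hab
  · have : (a = 0 ∧ b = 0) ∨ (a = 1 ∧ b = 0) ∨ (a = 0 ∧ b = 1) := by omega
    rcases this with ⟨rfl, rfl⟩ | ⟨rfl, rfl⟩ | ⟨rfl, rfl⟩
    · rw [momConst_zero_zero]; norm_num
    · rw [momConst_one_zero]
    · rw [momConst_comm, momConst_one_zero]
  unfold momConst
  refine div_nonneg ?_ (pow_nonneg (Real.sqrt_nonneg _) _)
  have hA := h.subMoment_ge ha
  have hB := h.subMoment_ge hb
  have hd := h.density_pos
  have hd5 := h.density_le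
  have hs := h.s_pos
  have hAB : s / 4 * (s / 4) ≤ subMoment s (lam * s / n) a * subMoment s (lam * s / n) b :=
    mul_le_mul hA hB (by linarith) (by linarith)
  rcases Nat.even_or_odd (a + b) with he | ho
  · have : 0 ≤ (-(lam * s / n)) ^ (a + b) := he.pow_nonneg _
    have : 0 ≤ lam / n * (subMoment s (lam * s / n) a * subMoment s (lam * s / n) b) :=
      mul_nonneg hd.le (le_trans (by positivity) hAB)
    have h6 : 0 ≤ 1 - lam / n := by linarith
    positivity
  · have h3 : 3 ≤ a + b := by
      rcases ho with ⟨j, hj⟩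
      omega
    have h4 := (abs_le.1 (h.abs_neg_p_pow_le h3)).1
    have h5 : (lam * s / n) ^ 3 ≤ lam / n * (s / 4 * (s / 4)) := by
      have : (lam * s / n) ^ 3 = lam / n * (lam / n * s) ^ 2 * s := by ring
      rw [this]
      have h6 : (lam / n * s) ^ 2 ≤ (1 / 5 * s) ^ 2 :=
        pow_le_pow_left₀ (by positivity) (by nlinarith) 2
      have h7 : (lam / n * s) ^ 2 * s ≤ (1 / 5 * s) ^ 2 * 1 :=
        mul_le_mul h6 h.s_lt.le hs.le (by positivity)
      nlinarith
    have h8 : lam / n * (s / 4 * (s / 4)) ≤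
        lam / n * (subMoment s (lam * s / n) a * subMoment s (lam * s / n) b) :=
      mul_le_mul_of_nonneg_left hAB hd.le
    have hp3 : 0 ≤ (lam * s / n) ^ 3 := pow_nonneg h.p_pos.le 3
    have : -(lam * s / n) ^ 3 ≤ (1 - lam / n) * (-(lam * s / n)) ^ (a + b) := by
      nlinarith
    linarith

theorem momLin_nonneg (h : SmallDensity n lam ε s M) {a b : ℕ} (ha : a ≤ M) (hb : b ≤ M) :
    0 ≤ momLin n lam ε s a b := by
  unfold momLin
  have hd := h.density_pos
  have hε := h.ε_pos
  refine div_nonneg (mul_nonneg (by positivity) ?_) (pow_nonneg (Real.sqrt_nonneg _) _)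
  have hA := h.subMoment_ge ha
  have hB := h.subMoment_ge hb
  have hs := h.s_pos
  rcases Nat.lt_or_ge (a + b) 2 with hab | hab
  · have : (a = 0 ∧ b = 0) ∨ (a = 1 ∧ b = 0) ∨ (a = 0 ∧ b = 1) := by omega
    rcases this with ⟨rfl, rfl⟩ | ⟨rfl, rfl⟩ | ⟨rfl, rfl⟩
    · simp [subMoment]
    · simp [subMoment]; linarith
    · simp [subMoment]; linarith
  have hAB : s / 4 * (s / 4) ≤ subMoment s (lam * s / n) a * subMoment s (lam * s / n) b :=
    mul_le_mul hA hB (by linarith) (by linarith)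
  have h4 := (abs_le.1 (h.abs_neg_p_pow_le hab)).2
  have h5 : (lam * s / n) ^ 2 ≤ (s / 5) ^ 2 := pow_le_pow_left₀ h.p_pos.le h.p_le_s 2
  nlinarith

/-- The size of the contribution of an edge occurring once. -/
theorem momLin_one_zero (_ : SmallDensity n lam ε s M) :
    momLin n lam ε s 1 0 = ε * (lam * s / n) / √(lam * s / n * (1 - lam * s / n)) := by
  simp only [momLin, subMoment]
  congr 1
  · simp
    ring
  · simp

theorem momConst_one_one (h : SmallDensity n lam ε s M) :
    momConst n lam s 1 1 = (s - lam * s / n) / (1 - lam * s / n) := by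
  have hp := h.p_pos
  have h5 := h.p_le_fifth
  have h1 : 1 - lam * s / n ≠ 0 := by linarith
  unfold momConst
  rw [Real.sq_sqrt (mul_pos hp (by linarith)).le, div_eq_div_iff (by positivity) h1]
  simp only [subMoment]
  rw [h.p_eq]
  generalize lam / n = δ
  ring

theorem momLin_one_one (h : SmallDensity n lam ε s M) :
    momLin n lam ε s 1 1 = ε * (s - 2 * (lam * s / n)) / (1 - lam * s / n) := by
  have hp := h.p_pos
  have h5 := h.p_le_fifth
  have h1 : 1 - lam * s / n ≠ 0 := by linarith
  unfold momLin
  rw [Real.sq_sqrt (mul_pos hp (by linarith)).le, div_eq_div_iff (by positivity) h1]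
  simp only [subMoment]
  rw [h.p_eq]
  generalize lam / n = δ
  ring

theorem momLin_one_one_le (h : SmallDensity n lam ε s M) :
    momLin n lam ε s 1 1 ≤ momConst n lam s 1 1 := by
  rw [h.momLin_one_one, h.momConst_one_one]
  have hp := h.p_pos
  have h5 := h.p_le_fifth
  have hs := h.p_le_s
  refine div_le_div_of_nonneg_right ?_ (by linarith)
  nlinarith [h.ε_lt, h.ε_pos, h.s_pos]

theorem momConst_one_one_le (h : SmallDensity n lam ε s M) : momConst n lam s 1 1 ≤ s := by
  rw [h.momConst_one_one]
  have hp := h.p_pos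
  have h5 := h.p_le_fifth
  rw [div_le_iff₀ (by linarith)]
  nlinarith [h.s_lt]

theorem le_momConst_one_one (h : SmallDensity n lam ε s M) :
    s * (1 - lam / n) ≤ momConst n lam s 1 1 := by
  rw [h.momConst_one_one]
  have hp := h.p_pos
  have h5 := h.p_le_fifth
  rw [le_div_iff₀ (by linarith)]
  have : s - lam * s / n = s * (1 - lam / n) := by ring
  rw [this]
  have h6 : 0 ≤ s * (1 - lam / n) := mul_nonneg h.s_pos.le (by linarith [h.density_le])
  nlinarith

/-- A repeated edge pays the factor `p = lam * s / n` only once, whatever its multiplicity; the constant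
`e` absorbs the terms of higher order in `p`. -/
theorem mom_add_le (h : SmallDensity n lam ε s M) {a b : ℕ} (ha : a ≤ M) (hb : b ≤ M)
    (hab : 2 ≤ a + b) :
    momConst n lam s a b + momLin n lam ε s a b ≤
      Real.exp 1 * (lam * s / n) / √(lam * s / n * (1 - lam * s / n)) ^ (a + b) := by
  unfold momConst momLin
  rw [← add_div]
  refine div_le_div_of_nonneg_right ?_ (pow_nonneg (Real.sqrt_nonneg _) _)
  have hAB := h.subMoment_mul_le ha hb (by omega)
  have hAB0 : 0 ≤ subMoment s (lam * s / n) a * subMoment s (lam * s / n) b :=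
    mul_nonneg (h.subMoment_nonneg ha) (h.subMoment_nonneg hb)
  have h4 := abs_le.1 (h.abs_neg_p_pow_le hab)
  set Y := subMoment s (lam * s / n) a * subMoment s (lam * s / n) b
  set Z := (-(lam * s / n)) ^ (a + b)
  have hpd := h.p_eq
  set p := lam * s / n
  have hp0 : 0 < p := h.p_pos
  have hd := h.density_pos
  have hd5 := h.density_le
  set δ := lam / n
  have hε := h.ε_pos
  have hε1 := h.ε_lt
  have e1 : (1 - δ) * Z + δ * Y + ε * δ * (Y - Z) = (1 - (1 + ε) * δ) * Z + (1 + ε) * δ * Y := by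
    ring
  rw [e1]
  have h6 : (1 - (1 + ε) * δ) * Z ≤ p ^ 2 := by
    have h7 : 0 ≤ 1 - (1 + ε) * δ := by nlinarith
    have h8 : 1 - (1 + ε) * δ ≤ 1 := by nlinarith
    nlinarith [h4.2, sq_nonneg p]
  have h9 : (1 + ε) * δ * Y ≤ 2 * δ * (s + p) :=
    mul_le_mul (by nlinarith) hAB hAB0 (by positivity)
  have he := Real.exp_one_gt_d9
  have h10 : p ^ 2 ≤ 1 / 5 * p := by
    have := h.p_le_fifth
    nlinarith
  have h11 : 2 * δ * (s + p) = 2 * p + 2 * δ * p := by rw [hpd]; ring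
  nlinarith

/-- The contribution of an edge of total multiplicity `j ≥ 1`, compared with `j` edges occurring
once: every repetition costs a factor `e / (ε² p)`. -/
theorem mom_add_le' (h : SmallDensity n lam ε s M) {a b : ℕ} (ha : a ≤ M) (hb : b ≤ M)
    (hab : 1 ≤ a + b) :
    momConst n lam s a b + momLin n lam ε s a b ≤ (momLin n lam ε s 1 0) ^ (a + b) *
      (Real.exp 1 / (ε ^ 2 * (lam * s / n))) ^ (a + b - 1) := by
  rcases Nat.lt_or_ge (a + b) 2 with hab' | hab'
  · have : (a = 1 ∧ b = 0) ∨ (a = 0 ∧ b = 1) := by omega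
    rcases this with ⟨rfl, rfl⟩ | ⟨rfl, rfl⟩
    · simp [momConst_one_zero]
    · rw [momConst_comm, momLin_comm]
      simp [momConst_one_zero]
  refine (h.mom_add_le ha hb hab').trans ?_
  rw [h.momLin_one_zero, div_pow,
    div_mul_eq_mul_div ((ε * (lam * s / n)) ^ (a + b))]
  refine div_le_div_of_nonneg_right ?_ (pow_nonneg (Real.sqrt_nonneg _) _)
  have hp0 : 0 < lam * s / n := h.p_pos
  set p := lam * s / n
  obtain ⟨j, hj⟩ : ∃ j, a + b = j + 2 := ⟨a + b - 2, by omega⟩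
  rw [hj, show j + 2 - 1 = j + 1 by omega]
  have hε := h.ε_pos
  have e1 : (ε * p) ^ (j + 2) * (Real.exp 1 / (ε ^ 2 * p)) ^ (j + 1) =
      Real.exp 1 * p * (Real.exp 1 / ε) ^ j := by
    have e2 : Real.exp 1 / ε = (ε * p) * (Real.exp 1 / (ε ^ 2 * p)) := by
      field_simp
    have e3 : (ε * p) ^ 2 * (Real.exp 1 / (ε ^ 2 * p)) = Real.exp 1 * p := by
      field_simp
    rw [e2, mul_pow _ _ j, pow_add, pow_succ (Real.exp 1 / (ε ^ 2 * p)), ← e3]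
    ring
  rw [e1]
  refine le_mul_of_one_le_right (by positivity) (one_le_pow₀ ?_)
  rw [le_div_iff₀ hε]
  have := Real.exp_one_gt_d9
  linarith [h.ε_lt]

theorem momLin_one_zero_sq (h : SmallDensity n lam ε s M) :
    momLin n lam ε s 1 0 ^ 2 = ε ^ 2 * (lam * s / n) / (1 - lam * s / n) := by
  have hp := h.p_pos
  have h5 := h.p_le_fifth
  have h1 : 1 - lam * s / n ≠ 0 := by linarith
  rw [h.momLin_one_zero, div_pow, Real.sq_sqrt (mul_pos hp (by linarith)).le]
  field_simp

theorem momLin_one_zero_pos (h : SmallDensity n lam ε s M) : 0 < momLin n lam ε s 1 0 := by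
  rw [h.momLin_one_zero]
  exact div_pos (mul_pos h.ε_pos h.p_pos) h.norm_pos

end SmallDensity

/-! ### Moments of pairs of multigraphs -/

theorem count_le_of_card_le {α : Type*} [DecidableEq α] {S : Multiset α} {M : ℕ} (h : S.card ≤ M) (e : α) :
    S.count e ≤ M := (Multiset.count_le_card e S).trans h

/-- The coefficients of the expansion over the edges are nonnegative, and so are the averages of the
edge signs: there is no cancellation between pairs of copies. -/
theorem pairMoment_nonneg {n : ℕ} {lam ε s : ℝ} {M : ℕ} (h : SmallDensity n lam ε s M)
    {S S' : Multiset (Sym2 (Fin n))} (hS : S.card ≤ M) (hS' : S'.card ≤ M) :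
    0 ≤ pairMoment n lam ε s S S' := by
  rw [pairMoment_eq_labelAverage]
  exact labelAverage_prod_nonneg _ _ _
    (fun e _ => h.momConst_nonneg (count_le_of_card_le hS e) (count_le_of_card_le hS' e))
    (fun e _ => h.momLin_nonneg (count_le_of_card_le hS e) (count_le_of_card_le hS' e))

theorem prod_nonDiag_eq {n : ℕ} {S S' : Multiset (Sym2 (Fin n))}
    (hd : ∀ e ∈ S + S', ¬ e.IsDiag) (f : ℕ → ℕ → Sym2 (Fin n) → ℝ) (hf : ∀ e, f 0 0 e = 1) :
    ∏ e : Sym2 (Fin n) with ¬ e.IsDiag, f (S.count e) (S'.count e) e =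
      ∏ e ∈ (S + S').toFinset, f (S.count e) (S'.count e) e := by
  symm
  refine Finset.prod_subset (fun e he => ?_) (fun e _ he => ?_)
  · simp only [Finset.mem_filter, Finset.mem_univ, true_and]
    exact hd e (by simpa using he)
  · have he' : e ∉ S ∧ e ∉ S' := by simpa using he
    rw [Multiset.count_eq_zero.2 he'.1, Multiset.count_eq_zero.2 he'.2, hf]

theorem pairMoment_eq_toFinset {n : ℕ} (lam ε s : ℝ) {S S' : Multiset (Sym2 (Fin n))}
    (hd : ∀ e ∈ S + S', ¬ e.IsDiag) :
    pairMoment n lam ε s S S' = labelAverage fun σ => ∏ e ∈ (S + S').toFinset,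
      (momConst n lam s (S.count e) (S'.count e) +
        momLin n lam ε s (S.count e) (S'.count e) * edgeSign σ e) := by
  rw [pairMoment_eq_labelAverage]
  congr 1
  ext σ
  exact prod_nonDiag_eq hd (fun a b e => momConst n lam s a b + momLin n lam ε s a b *
    edgeSign σ e) (fun e => by rw [momConst_zero_zero, momLin_zero_zero]; ring)

/-- The moment vanishes if some vertex lies on exactly one edge, which is not repeated. -/
theorem pairMoment_eq_zero {n : ℕ} (lam ε s : ℝ) {S S' : Multiset (Sym2 (Fin n))}
    (hd : ∀ e ∈ S + S', ¬ e.IsDiag) {v : Fin n} {e₀ : Sym2 (Fin n)} (hv : v ∈ e₀)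
    (hcount : S.count e₀ + S'.count e₀ = 1) (hu : ∀ e ∈ S + S', v ∈ e → e = e₀) :
    pairMoment n lam ε s S S' = 0 := by
  rw [pairMoment_eq_toFinset lam ε s hd]
  have hmem : e₀ ∈ S + S' := by
    rw [← Multiset.count_pos, Multiset.count_add]
    omega
  refine labelAverage_prod_eq_zero _ _ _ v e₀ (by simpa using hmem) (hd _ hmem) hv ?_ ?_
  · have : (S.count e₀ = 1 ∧ S'.count e₀ = 0) ∨ (S.count e₀ = 0 ∧ S'.count e₀ = 1) := by omega
    rcases this with ⟨h1, h2⟩ | ⟨h1, h2⟩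
    · rw [h1, h2, momConst_one_zero]
    · rw [h1, h2, momConst_comm, momConst_one_zero]
  · intro e he hve hne
    exact absurd (hu e (by simpa using he) hve) hne

theorem sum_count_toFinset {α : Type*} [DecidableEq α] (S S' : Multiset α) :
    ∑ e ∈ (S + S').toFinset, (S.count e + S'.count e) = S.card + S'.card := by
  rw [← Multiset.card_add, ← Multiset.toFinset_sum_count_eq]
  exact Finset.sum_congr rfl fun e _ => (Multiset.count_add e S S').symm

/-- Bound without regard to the labels: with `2 * M` edges counted with multiplicity, every edge lost
by an overlap costs a factor `e / (ε² p)`. -/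
theorem pairMoment_le_crude {n : ℕ} {lam ε s : ℝ} {M : ℕ} (h : SmallDensity n lam ε s M)
    {S S' : Multiset (Sym2 (Fin n))} (hS : S.card = M) (hS' : S'.card = M)
    (hd : ∀ e ∈ S + S', ¬ e.IsDiag) :
    pairMoment n lam ε s S S' ≤ momLin n lam ε s 1 0 ^ (2 * M) *
      (Real.exp 1 / (ε ^ 2 * (lam * s / n))) ^ (2 * M - (S + S').toFinset.card) := by
  rw [pairMoment_eq_toFinset lam ε s hd]
  refine (labelAverage_prod_le _ _ _
    (fun e _ => h.momConst_nonneg (count_le_of_card_le hS.le e) (count_le_of_card_le hS'.le e))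
    (fun e _ => h.momLin_nonneg (count_le_of_card_le hS.le e)
      (count_le_of_card_le hS'.le e))).trans ?_
  have hpos : ∀ e ∈ (S + S').toFinset, 1 ≤ S.count e + S'.count e := by
    intro e he
    rw [← Multiset.count_add]
    exact Multiset.count_pos.2 (by simpa using he)
  refine (Finset.prod_le_prod (fun e _ => add_nonneg
    (h.momConst_nonneg (count_le_of_card_le hS.le e) (count_le_of_card_le hS'.le e))
    (h.momLin_nonneg (count_le_of_card_le hS.le e) (count_le_of_card_le hS'.le e)))
    (fun e he => h.mom_add_le' (count_le_of_card_le hS.le e) (count_le_of_card_le hS'.le e)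
      (hpos e he))).trans ?_
  rw [Finset.prod_mul_distrib, Finset.prod_pow_eq_pow_sum, Finset.prod_pow_eq_pow_sum,
    sum_count_toFinset, Finset.sum_tsub_distrib _ hpos, sum_count_toFinset, hS, hS']
  simp [two_mul]

theorem count_nodup {α : Type*} [DecidableEq α] {S : Multiset α} (hS : S.Nodup) (e : α) :
    S.count e = if e ∈ S.toFinset then 1 else 0 := by
  simp [Multiset.count_eq_of_nodup hS]

/-- The split of the edge product into common edges and edges occurring only once. -/
theorem pairMoment_nodup {n : ℕ} (lam ε s : ℝ) {S S' : Multiset (Sym2 (Fin n))}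
    (hd : ∀ e ∈ S + S', ¬ e.IsDiag) (hS : S.Nodup) (hS' : S'.Nodup) :
    pairMoment n lam ε s S S' =
      momLin n lam ε s 1 0 ^ (symmDiff S.toFinset S'.toFinset).card * labelAverage fun σ =>
        (∏ e ∈ symmDiff S.toFinset S'.toFinset, edgeSign σ e) *
        ∏ e ∈ S.toFinset ∩ S'.toFinset, (momConst n lam s 1 1 + momLin n lam ε s 1 1 *
          edgeSign σ e) := by
  rw [pairMoment_eq_toFinset lam ε s hd, ← labelAverage_mul_left]
  congr 1
  ext σ
  have hu : (S + S').toFinset = symmDiff S.toFinset S'.toFinset ∪ S.toFinset ∩ S'.toFinset := by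
    rw [Multiset.toFinset_add]
    ext e
    simp only [Finset.mem_union, Finset.mem_symmDiff, Finset.mem_inter]
    tauto
  have hdisj : Disjoint (symmDiff S.toFinset S'.toFinset) (S.toFinset ∩ S'.toFinset) := by
    rw [Finset.disjoint_left]
    intro e he
    simp only [Finset.mem_symmDiff, Finset.mem_inter] at he ⊢
    tauto
  rw [hu, Finset.prod_union hdisj, ← mul_assoc]
  congr 1
  · rw [← Finset.prod_const, ← Finset.prod_mul_distrib]
    refine Finset.prod_congr rfl fun e he => ?_
    rw [count_nodup hS, count_nodup hS']
    rw [Finset.mem_symmDiff] at he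
    rcases he with ⟨h1, h2⟩ | ⟨h1, h2⟩
    · simp only [h1, h2, if_true, if_false, momConst_one_zero, zero_add]
    · simp only [h1, h2, if_true, if_false]
      rw [momConst_comm, momLin_comm, momConst_one_zero, zero_add]
  · refine Finset.prod_congr rfl fun e he => ?_
    rw [Finset.mem_inter] at he
    rw [count_nodup hS, count_nodup hS']
    simp only [he.1, he.2, if_true]

/-- If the common edges form a forest, their labels average out, and every one of them contributes at
most `s`. -/
theorem pairMoment_le_forest {n : ℕ} {lam ε s : ℝ} {M : ℕ} (h : SmallDensity n lam ε s M)
    (hM : 1 ≤ M)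
    {S S' : Multiset (Sym2 (Fin n))} (hd : ∀ e ∈ S + S', ¬ e.IsDiag) (hS : S.Nodup)
    (hS' : S'.Nodup) (X : SimpleGraph (Fin n)) (hX : X.IsAcyclic)
    (hSX : ∀ e, e ∈ S → e ∈ S' → e ∈ X.edgeSet) :
    pairMoment n lam ε s S S' ≤ momLin n lam ε s 1 0 ^ (symmDiff S.toFinset S'.toFinset).card *
      s ^ (S.toFinset ∩ S'.toFinset).card := by
  rw [pairMoment_nodup lam ε s hd hS hS']
  have hc := h.momConst_nonneg hM hM
  have hdd := h.momLin_nonneg hM hM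
  have hcd := h.momLin_one_one_le
  refine mul_le_mul_of_nonneg_left ?_ (pow_nonneg h.momLin_one_zero_pos.le _)
  calc _ ≤ labelAverage fun σ : Fin n → ℤˣ => ∏ e ∈ S.toFinset ∩ S'.toFinset,
        (momConst n lam s 1 1 + momLin n lam ε s 1 1 * edgeSign σ e) := by
        refine labelAverage_mono fun σ => ?_
        refine mul_le_of_le_one_left (Finset.prod_nonneg fun e _ => ?_) ?_
        · nlinarith [neg_one_le_edgeSign σ e]
        · rcases prod_edgeSign_eq_or (symmDiff S.toFinset S'.toFinset) σ with h' | h'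
          · exact h'.le
          · rw [h']; norm_num
    _ = ∏ _e ∈ S.toFinset ∩ S'.toFinset, momConst n lam s 1 1 :=
        labelAverage_prod_forest X hX _ (fun e he => by
          rw [Finset.mem_inter, Multiset.mem_toFinset, Multiset.mem_toFinset] at he
          exact hSX e he.1 he.2) (fun _ => momConst n lam s 1 1) (fun _ => momLin n lam ε s 1 1)
    _ ≤ _ := by
        rw [Finset.prod_const]
        exact pow_le_pow_left₀ hc h.momConst_one_one_le _

/-- If the edges which are not common form cycles, their signs multiply to `1` and they all contribute. -/
theorem le_pairMoment {n : ℕ} {lam ε s : ℝ} {M : ℕ} (h : SmallDensity n lam ε s M)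
    (hM : 1 ≤ M)
    {S S' : Multiset (Sym2 (Fin n))} (hd : ∀ e ∈ S + S', ¬ e.IsDiag) (hS : S.Nodup)
    (hS' : S'.Nodup)
    (hsign : ∀ σ : Fin n → ℤˣ, ∏ e ∈ symmDiff S.toFinset S'.toFinset, edgeSign σ e = 1) :
    momLin n lam ε s 1 0 ^ (symmDiff S.toFinset S'.toFinset).card *
      (s * (1 - lam / n)) ^ (S.toFinset ∩ S'.toFinset).card ≤ pairMoment n lam ε s S S' := by
  rw [pairMoment_nodup lam ε s hd hS hS']
  have hc := h.momConst_nonneg hM hM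
  have hdd := h.momLin_nonneg hM hM
  refine mul_le_mul_of_nonneg_left ?_ (pow_nonneg h.momLin_one_zero_pos.le _)
  simp only [hsign, one_mul]
  refine le_trans ?_ (prod_le_labelAverage_prod _ _ _ (fun e _ => hc) (fun e _ => hdd))
  rw [Finset.prod_const]
  exact pow_le_pow_left₀ (mul_nonneg h.s_pos.le (by linarith [h.density_le]))
    h.le_momConst_one_one _

/-! ### Counting path systems by sequential exposure -/

/-- Kraft's inequality for sequences exposed one entry at a time: if, given the past, the weights
of the possible next entries sum to at most `C`, then the weights of all sequences of length `L`
sum to at most `C ^ L`. -/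
theorem sum_prod_le_pow {α : Type*} [Fintype α] (q : ℕ → (ℕ → α) → ℝ) (C : ℝ) (hC : 0 ≤ C)
    (hq : ∀ i x, 0 ≤ q i x) (hdep : ∀ i x y, (∀ j ≤ i, x j = y j) → q i x = q i y) (d : α)
    (L : ℕ) (hsum : ∀ i < L, ∀ x, ∑ a, q i (Function.update x i a) ≤ C)
    (A : Finset (ℕ → α)) (hA : ∀ x ∈ A, ∀ i, L ≤ i → x i = d) :
    ∑ x ∈ A, ∏ i ∈ Finset.range L, q i x ≤ C ^ L := by
  induction L generalizing A with
  | zero =>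
    have : A.card ≤ 1 := by
      rw [Finset.card_le_one]
      intro x hx y hy
      ext i
      rw [hA x hx i (Nat.zero_le i), hA y hy i (Nat.zero_le i)]
    simpa using this
  | succ L ih =>
    set B := A.image (fun x => Function.update x L d) with hB
    have ihB := ih (fun i hi x => hsum i (by omega) x) B (by
      intro x hx i hi
      rw [hB, Finset.mem_image] at hx
      obtain ⟨y, hy, rfl⟩ := hx
      rcases eq_or_ne i L with rfl | hne
      · simp
      · rw [Function.update_of_ne hne]
        exact hA y hy i (by omega))
    rw [← Finset.sum_fiberwise_of_maps_to (t := B)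
      (fun x hx => Finset.mem_image_of_mem (fun x => Function.update x L d) hx)]
    calc _ ≤ ∑ y ∈ B, (∏ i ∈ Finset.range L, q i y) * C := by
          refine Finset.sum_le_sum fun y _ => ?_
          have h1 : ∀ x ∈ A.filter (fun x => Function.update x L d = y),
              ∏ i ∈ Finset.range (L + 1), q i x =
                (∏ i ∈ Finset.range L, q i y) * q L (Function.update y L (x L)) := by
            intro x hx
            rw [Finset.mem_filter] at hx
            rw [Finset.prod_range_succ, ← hx.2]
            congr 1
            · refine Finset.prod_congr rfl fun i hi => hdep i _ _ fun j hj => ?_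
              rw [Finset.mem_range] at hi
              rw [Function.update_of_ne (by omega)]
            · simp
          rw [Finset.sum_congr rfl h1, ← Finset.mul_sum]
          refine mul_le_mul_of_nonneg_left ?_ (Finset.prod_nonneg fun i _ => hq i y)
          refine le_trans ?_ (hsum L (by omega) y)
          rw [← Finset.sum_image (s := A.filter (fun x => Function.update x L d = y))
            (f := fun a => q L (Function.update y L a)) (g := fun x => x L)]
          · exact Finset.sum_le_sum_of_subset_of_nonneg (Finset.subset_univ _)
              (fun a _ _ => hq _ _)
          · intro x hx x' hx' hxx
            simp only [Finset.coe_filter, Set.mem_ofPred_eq] at hx hx'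
            have h2 : x = Function.update y L (x L) := by rw [← hx.2]; simp
            have h3 : x' = Function.update y L (x' L) := by rw [← hx'.2]; simp
            rw [h2, h3]
            simp only at hxx
            rw [hxx]
      _ = (∑ y ∈ B, ∏ i ∈ Finset.range L, q i y) * C := by rw [Finset.sum_mul]
      _ ≤ C ^ L * C := mul_le_mul_of_nonneg_right ihB hC
      _ = C ^ (L + 1) := (pow_succ C L).symm

/-- The position of the vertex number `t` of the path number `j` in a list which consists of `c`
entries followed by paths with `ℓ + 1` vertices each. -/
def pathPos (c ℓ j t : ℕ) : ℕ := c + j * (ℓ + 1) + t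

/-- `a` and `b` are consecutive vertices of one of the first `R` paths listed in `x`, at positions
before `i`. -/
def Revealed {α : Type*} (c R ℓ : ℕ) (x : ℕ → α) (i : ℕ) (a b : α) : Prop :=
  ∃ j t, j < R ∧ t < ℓ ∧ pathPos c ℓ j (t + 1) < i ∧
    ((x (pathPos c ℓ j t) = a ∧ x (pathPos c ℓ j (t + 1)) = b) ∨
      (x (pathPos c ℓ j t) = b ∧ x (pathPos c ℓ j (t + 1)) = a))

/-- A list of vertices and paths, together with a set `D` of exceptional vertices, outside of which
all vertices are interior to the paths and have at most two neighbours on the paths. -/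
structure IsPathSystem {α : Type*} (c R ℓ : ℕ) (x : ℕ → α) (D : Finset α) : Prop where
  head_mem : ∀ i < c, x i ∈ D
  first_mem : ∀ j < R, x (pathPos c ℓ j 0) ∈ D
  last_mem : ∀ j < R, x (pathPos c ℓ j ℓ) ∈ D
  injOn : ∀ j < R, Set.InjOn (fun t => x (pathPos c ℓ j t)) (Set.Iic ℓ)
  degree_le : ∀ y ∉ D, ∀ a b d, Revealed c R ℓ x (c + R * (ℓ + 1)) y a →
    Revealed c R ℓ x (c + R * (ℓ + 1)) y b → Revealed c R ℓ x (c + R * (ℓ + 1)) y d →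
    a = b ∨ a = d ∨ b = d

/-- The entry at position `i` differs from all earlier entries. -/
def IsNewAt {α : Type*} (x : ℕ → α) (i : ℕ) : Prop := ∀ j < i, x j ≠ x i

/-- The predicted law of the next entry: uniform after a vertex which has just been seen for the
first time; otherwise uniform on the known neighbours of the current vertex other than the
preceding one. -/
def predicted {α : Type*} [Fintype α] (c R ℓ i : ℕ) (x : ℕ → α) : ℝ :=
  if 2 ≤ i then
    if IsNewAt x (i - 1) then (Fintype.card α : ℝ)⁻¹
    else if x i ≠ x (i - 2) ∧ Revealed c R ℓ x i (x (i - 1)) (x i) then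
      ((Finset.univ.filter fun a => a ≠ x (i - 2) ∧ Revealed c R ℓ x i (x (i - 1)) a).card : ℝ)⁻¹
    else 0
  else 0

/-- The weight of the next entry: the predicted law, plus a small multiple of the uniform law on
all vertices and on the vertices already seen. -/
def entryWeight {α : Type*} [Fintype α] (c R ℓ i : ℕ) (x : ℕ → α) : ℝ :=
  predicted c R ℓ i x + ((c + R * (ℓ + 1) : ℕ) : ℝ)⁻¹ * ((2 * (Fintype.card α : ℝ))⁻¹ +
    ((Finset.range i).filter fun j => x j = x i).card * (2 * ((c + R * (ℓ + 1) : ℕ) : ℝ))⁻¹)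

section

variable {α : Type*} {c R ℓ : ℕ}

theorem revealed_congr {i : ℕ} {x y : ℕ → α} (h : ∀ j < i, x j = y j) (a b : α) :
    Revealed c R ℓ x i a b ↔ Revealed c R ℓ y i a b := by
  unfold Revealed
  refine exists_congr fun j => exists_congr fun t => and_congr_right fun _ =>
    and_congr_right fun _ => and_congr_right fun h3 => ?_
  rw [h _ h3, h (pathPos c ℓ j t) (by unfold pathPos at *; omega)]

theorem predicted_nonneg [Fintype α] (i : ℕ) (x : ℕ → α) : 0 ≤ predicted c R ℓ i x := by
  unfold predicted
  split_ifs <;> positivity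

theorem predicted_congr [Fintype α] {i : ℕ} {x y : ℕ → α} (h : ∀ j ≤ i, x j = y j) :
    predicted c R ℓ i x = predicted c R ℓ i y := by
  unfold predicted
  by_cases hi : 2 ≤ i
  · have h1 : IsNewAt x (i - 1) ↔ IsNewAt y (i - 1) := by
      refine forall_congr' fun j => forall_congr' fun hj => ?_
      rw [h j (by omega), h (i - 1) (by omega)]
    have h2 : ∀ a b, Revealed c R ℓ x i a b ↔ Revealed c R ℓ y i a b :=
      revealed_congr fun j hj => h j hj.le
    simp only [hi, h1, h2, if_true, h i le_rfl, h (i - 1) (by omega), h (i - 2) (by omega)]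
  · simp [hi]

theorem sum_predicted_le [Fintype α] (i : ℕ) (x : ℕ → α) :
    ∑ a, predicted c R ℓ i (Function.update x i a) ≤ 1 := by
  by_cases hi : 2 ≤ i
  · have hup : ∀ a, ∀ j < i, Function.update x i a j = x j := fun a j hj =>
      Function.update_of_ne (by omega) _ _
    have h2 : ∀ a u v, Revealed c R ℓ (Function.update x i a) i u v ↔ Revealed c R ℓ x i u v :=
      fun a => revealed_congr (hup a)
    have h1 : ∀ a, IsNewAt (Function.update x i a) (i - 1) ↔ IsNewAt x (i - 1) := by
      intro a
      refine forall_congr' fun j => forall_congr' fun hj => ?_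
      rw [hup a j (by omega), hup a (i - 1) (by omega)]
    simp only [predicted, hi, h1, h2, if_true, Function.update_self, hup _ (i - 1) (by omega),
      hup _ (i - 2) (by omega)]
    by_cases hn : IsNewAt x (i - 1)
    · simp only [hn, if_true]
      rw [Finset.sum_const, nsmul_eq_mul, Finset.card_univ]
      exact mul_inv_le_one
    · simp only [hn, if_false]
      rw [← Finset.sum_filter, Finset.sum_const,
        nsmul_eq_mul]
      exact mul_inv_le_one
  · simp [predicted, hi]

theorem entryWeight_nonneg [Fintype α] (i : ℕ) (x : ℕ → α) : 0 ≤ entryWeight c R ℓ i x :=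
  add_nonneg (predicted_nonneg i x) (by positivity)

theorem entryWeight_congr [Fintype α] {i : ℕ} {x y : ℕ → α} (h : ∀ j ≤ i, x j = y j) :
    entryWeight c R ℓ i x = entryWeight c R ℓ i y := by
  unfold entryWeight
  rw [predicted_congr h]
  have h1 : ((Finset.range i).filter fun j => x j = x i) =
      (Finset.range i).filter fun j => y j = y i := by
    refine Finset.filter_congr fun j hj => ?_
    rw [Finset.mem_range] at hj
    rw [h j hj.le, h i le_rfl]
  rw [h1]

theorem sum_entryWeight_le [Fintype α] {i : ℕ} (hi : i < c + R * (ℓ + 1)) (x : ℕ → α) :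
    ∑ a, entryWeight c R ℓ i (Function.update x i a) ≤
      1 + ((c + R * (ℓ + 1) : ℕ) : ℝ)⁻¹ := by
  unfold entryWeight
  rw [Finset.sum_add_distrib, ← Finset.mul_sum, Finset.sum_add_distrib]
  set L := c + R * (ℓ + 1)
  have hL : (0 : ℝ) < L := by exact_mod_cast (by omega : 0 < L)
  refine add_le_add (sum_predicted_le i x) ?_
  refine mul_le_of_le_one_right (by positivity) ?_
  have h1 : ∑ _a : α, (2 * (Fintype.card α : ℝ))⁻¹ ≤ 1 / 2 := by
    rw [Finset.sum_const, nsmul_eq_mul, Finset.card_univ, mul_inv, mul_comm, mul_assoc]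
    have : (Fintype.card α : ℝ)⁻¹ * Fintype.card α ≤ 1 := inv_mul_le_one
    linarith
  have h2 : ∑ a : α, (((Finset.range i).filter fun j =>
      Function.update x i a j = Function.update x i a i).card : ℝ) = i := by
    have h3 : ∀ a : α, ((Finset.range i).filter fun j =>
        Function.update x i a j = Function.update x i a i) =
        (Finset.range i).filter fun j => x j = a := by
      intro a
      refine Finset.filter_congr fun j hj => ?_
      rw [Finset.mem_range] at hj
      rw [Function.update_self, Function.update_of_ne (by omega)]
    simp only [h3]
    rw [← Nat.cast_sum, ← Finset.card_eq_sum_card_fiberwise (f := x) (t := Finset.univ)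
      (fun _ _ => Finset.mem_coe.2 (Finset.mem_univ _)), Finset.card_range]
  rw [← Finset.sum_mul, h2]
  have h4 : (i : ℝ) * (2 * (L : ℝ))⁻¹ ≤ 1 / 2 := by
    have : (i : ℝ) ≤ L := by exact_mod_cast hi.le
    rw [← div_eq_mul_inv, div_le_iff₀ (by positivity)]
    linarith
  linarith

/-- The positions at which the next entry need not be the predicted one. -/
def SpecialPos (c ℓ : ℕ) (D : Finset α) (x : ℕ → α) (i : ℕ) : Prop :=
  ¬ ∃ j t, 2 ≤ t ∧ t ≤ ℓ ∧ i = pathPos c ℓ j t ∧ x (i - 1) ∉ D ∧ x i ∉ D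

theorem exists_pathPos {i : ℕ} (hc : c ≤ i) (hi : i < c + R * (ℓ + 1)) :
    ∃ j t, j < R ∧ t ≤ ℓ ∧ i = pathPos c ℓ j t := by
  refine ⟨(i - c) / (ℓ + 1), (i - c) % (ℓ + 1), ?_, ?_, ?_⟩
  · exact Nat.div_lt_of_lt_mul (by rw [mul_comm]; omega)
  · exact Nat.lt_succ_iff.1 (Nat.mod_lt _ (Nat.succ_pos ℓ))
  · unfold pathPos
    have := Nat.div_add_mod (i - c) (ℓ + 1)
    rw [mul_comm] at this
    omega

theorem pathPos_lt {j t : ℕ} (hj : j < R) (ht : t ≤ ℓ) : pathPos c ℓ j t < c + R * (ℓ + 1) := by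
  unfold pathPos
  have : (j + 1) * (ℓ + 1) ≤ R * (ℓ + 1) := Nat.mul_le_mul_right _ hj
  rw [add_mul, one_mul] at this
  omega

theorem IsPathSystem.interior {x : ℕ → α} {D : Finset α} (h : IsPathSystem c R ℓ x D) {i : ℕ}
    (hi : i < c + R * (ℓ + 1)) (hD : x i ∉ D) :
    ∃ j t, j < R ∧ t + 1 < ℓ ∧ i = pathPos c ℓ j (t + 1) := by
  have hc : c ≤ i := by
    by_contra hlt
    exact hD (h.head_mem i (by omega))
  obtain ⟨j, t, hj, ht, rfl⟩ := exists_pathPos hc hi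
  rcases Nat.eq_zero_or_pos t with rfl | ht0
  · exact absurd (h.first_mem j hj) hD
  · have : t ≠ ℓ := by
      rintro rfl
      exact hD (h.last_mem j hj)
    exact ⟨j, t - 1, hj, by omega, by congr 1; omega⟩

/-- Away from the special positions the next entry is the predicted one: after a new vertex every vertex
is possible; after an old one, the path continues along the path through that vertex found before. -/
theorem le_predicted [Fintype α] {x : ℕ → α} {D : Finset α} (h : IsPathSystem c R ℓ x D) {i : ℕ}
    (hi : i < c + R * (ℓ + 1)) (hs : ¬ SpecialPos c ℓ D x i) :
    (if IsNewAt x i then (Fintype.card α : ℝ)⁻¹ else 1) ≤ predicted c R ℓ i x := by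
  obtain ⟨j, t, ht, htℓ, rfl, hD1, hD0⟩ := not_not.1 hs
  have hj : j < R := by
    by_contra hR
    have : R * (ℓ + 1) ≤ j * (ℓ + 1) := Nat.mul_le_mul_right _ (by omega)
    unfold pathPos at hi
    omega
  have hcard : (Fintype.card α : ℝ)⁻¹ ≤ 1 := Nat.cast_inv_le_one _
  obtain ⟨u, rfl⟩ : ∃ u, t = u + 2 := ⟨t - 2, by omega⟩
  set i := pathPos c ℓ j (u + 2) with hidef
  have e1 : i - 1 = pathPos c ℓ j (u + 1) := by simp only [hidef, pathPos]; omega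
  have e2 : i - 2 = pathPos c ℓ j u := by simp only [hidef, pathPos]; omega
  have hi2 : 2 ≤ i := by simp only [hidef, pathPos]; omega
  -- the vertices before and after the current one are distinct
  have hne2 : x i ≠ x (i - 2) := by
    rw [e2]
    intro heq
    have := h.injOn j hj (Set.mem_Iic.2 htℓ) (Set.mem_Iic.2 (by omega : u ≤ ℓ)) heq
    omega
  have hne1 : x i ≠ x (i - 1) := by
    rw [e1]
    intro heq
    have := h.injOn j hj (Set.mem_Iic.2 htℓ) (Set.mem_Iic.2 (by omega : u + 1 ≤ ℓ)) heq
    omega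
  have nb0 : Revealed c R ℓ x (c + R * (ℓ + 1)) (x (i - 1)) (x i) :=
    ⟨j, u + 1, hj, by omega, pathPos_lt hj htℓ, Or.inl ⟨by rw [e1], rfl⟩⟩
  have nb2 : Revealed c R ℓ x (c + R * (ℓ + 1)) (x (i - 1)) (x (i - 2)) :=
    ⟨j, u, hj, by omega, pathPos_lt hj (by omega), Or.inr ⟨by rw [e2], by rw [e1]⟩⟩
  unfold predicted
  rw [if_pos hi2]
  by_cases hnew : IsNewAt x (i - 1)
  · rw [if_pos hnew, if_pos]
    -- a repetition would give the vertex `x i` a third neighbour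
    intro i' hi' heq
    have hi'1 : i' ≠ i - 1 := by
      rintro rfl
      exact hne1 heq.symm
    have hi'2 : i' ≠ i - 2 := by
      rintro rfl
      exact hne2 heq.symm
    obtain ⟨j', t', hj', ht', rfl⟩ := h.interior (i := i') (by omega) (by rw [heq]; exact hD0)
    have e3 : pathPos c ℓ j' (t' + 1) = pathPos c ℓ j' t' + 1 := rfl
    have e4 : pathPos c ℓ j' (t' + 2) = pathPos c ℓ j' t' + 2 := rfl
    have n1 : Revealed c R ℓ x (c + R * (ℓ + 1)) (x i) (x (pathPos c ℓ j' t')) :=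
      ⟨j', t', hj', by omega, pathPos_lt hj' (by omega), Or.inr ⟨rfl, heq⟩⟩
    have n2 : Revealed c R ℓ x (c + R * (ℓ + 1)) (x i) (x (pathPos c ℓ j' (t' + 2))) :=
      ⟨j', t' + 1, hj', by omega, pathPos_lt hj' (by omega), Or.inl ⟨heq, rfl⟩⟩
    have n3 : Revealed c R ℓ x (c + R * (ℓ + 1)) (x i) (x (i - 1)) :=
      ⟨j, u + 1, hj, by omega, pathPos_lt hj htℓ, Or.inr ⟨by rw [e1], rfl⟩⟩
    rcases h.degree_le _ hD0 _ _ _ n1 n2 n3 with h1 | h1 | h1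
    · have := h.injOn j' hj' (Set.mem_Iic.2 (by omega : t' ≤ ℓ))
        (Set.mem_Iic.2 (by omega : t' + 2 ≤ ℓ)) h1
      omega
    · exact hnew _ (by omega) h1
    · exact hnew _ (by omega) h1
  · rw [if_neg hnew]
    unfold IsNewAt at hnew
    push Not at hnew
    obtain ⟨i', hi', heq⟩ := hnew
    -- the vertex was visited before, in the interior of a path, so both of its neighbours are known
    obtain ⟨j', t', hj', ht', rfl⟩ := h.interior (i := i') (by omega) (by rw [heq]; exact hD1)
    have e3 : pathPos c ℓ j' (t' + 1) = pathPos c ℓ j' t' + 1 := rfl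
    have e4 : pathPos c ℓ j' (t' + 2) = pathPos c ℓ j' t' + 2 := rfl
    have r1 : Revealed c R ℓ x i (x (i - 1)) (x (pathPos c ℓ j' t')) :=
      ⟨j', t', hj', by omega, by omega, Or.inr ⟨rfl, heq⟩⟩
    have r2 : Revealed c R ℓ x i (x (i - 1)) (x (pathPos c ℓ j' (t' + 2))) :=
      ⟨j', t' + 1, hj', by omega, by rw [show t' + 1 + 1 = t' + 2 from rfl]; omega,
        Or.inl ⟨heq, rfl⟩⟩
    have hmono : ∀ a, Revealed c R ℓ x i (x (i - 1)) a →
        Revealed c R ℓ x (c + R * (ℓ + 1)) (x (i - 1)) a := by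
      rintro a ⟨j, t, h1, h2, h3, h4⟩
      exact ⟨j, t, h1, h2, by omega, h4⟩
    have hne : x (pathPos c ℓ j' t') ≠ x (pathPos c ℓ j' (t' + 2)) := by
      intro h1
      have := h.injOn j' hj' (Set.mem_Iic.2 (by omega : t' ≤ ℓ))
        (Set.mem_Iic.2 (by omega : t' + 2 ≤ ℓ)) h1
      omega
    have hrev : Revealed c R ℓ x i (x (i - 1)) (x i) := by
      rcases h.degree_le _ hD1 _ _ _ (hmono _ r1) (hmono _ r2) nb0 with h1 | h1 | h1
      · exact absurd h1 hne
      · rw [← h1]; exact r1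
      · rw [← h1]; exact r2
    -- one neighbour is the preceding entry, the other one is the next entry
    have huniq : (Finset.univ.filter fun a => a ≠ x (i - 2) ∧
        Revealed c R ℓ x i (x (i - 1)) a) = {x i} := by
      ext a
      simp only [Finset.mem_filter, Finset.mem_univ, true_and, Finset.mem_singleton]
      constructor
      · rintro ⟨ha, hra⟩
        rcases h.degree_le _ hD1 _ _ _ (hmono _ hra) nb2 nb0 with h1 | h1 | h1
        · exact absurd h1 ha
        · exact h1
        · exact absurd h1.symm hne2
      · rintro rfl
        exact ⟨hne2, hrev⟩
    rw [if_pos (⟨hne2, hrev⟩ : x i ≠ x (i - 2) ∧ Revealed c R ℓ x i (x (i - 1)) (x i)), huniq]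
    simp only [Finset.card_singleton, Nat.cast_one, inv_one]
    split_ifs
    · exact hcard
    · exact le_rfl

/-- At a special position the entry is paid for by the uniform part of the weight. -/
theorem le_entryWeight [Fintype α] {x : ℕ → α} {D : Finset α} (h : IsPathSystem c R ℓ x D) {i : ℕ}
    (hi : i < c + R * (ℓ + 1)) :
    (if IsNewAt x i then (Fintype.card α : ℝ)⁻¹ else 1) *
      (if SpecialPos c ℓ D x i then (2 * ((c + R * (ℓ + 1) : ℕ) : ℝ) ^ 2)⁻¹ else 1) ≤
      entryWeight c R ℓ i x := by
  set L := c + R * (ℓ + 1) with hL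
  have hL1 : (1 : ℝ) ≤ L := by exact_mod_cast (by omega : 1 ≤ L)
  by_cases hs : SpecialPos c ℓ D x i
  · rw [if_pos hs]
    unfold entryWeight
    refine le_add_of_nonneg_of_le (predicted_nonneg i x) ?_
    rw [← hL]
    by_cases hnew : IsNewAt x i
    · rw [if_pos hnew]
      calc (Fintype.card α : ℝ)⁻¹ * (2 * (L : ℝ) ^ 2)⁻¹
          = (L : ℝ)⁻¹ * ((2 * (Fintype.card α : ℝ))⁻¹ * (L : ℝ)⁻¹) := by
            rw [mul_inv, mul_inv, pow_two, mul_inv]; ring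
        _ ≤ (L : ℝ)⁻¹ * ((2 * (Fintype.card α : ℝ))⁻¹ * 1) := by
            gcongr
            exact inv_le_one_of_one_le₀ hL1
        _ ≤ _ := by
            gcongr
            rw [mul_one]
            exact le_add_of_nonneg_right (by positivity)
    · rw [if_neg hnew, one_mul]
      unfold IsNewAt at hnew
      push Not at hnew
      obtain ⟨j, hj, heq⟩ := hnew
      have h1 : (1 : ℝ) ≤ ((Finset.range i).filter fun j => x j = x i).card := by
        exact_mod_cast Finset.card_pos.2 ⟨j, by simp [hj, heq]⟩
      calc (2 * (L : ℝ) ^ 2)⁻¹ = (L : ℝ)⁻¹ * (1 * (2 * (L : ℝ))⁻¹) := by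
            rw [mul_inv, mul_inv, pow_two, mul_inv]; ring
        _ ≤ _ := by
            gcongr
            refine le_trans ?_ (le_add_of_nonneg_left (by positivity))
            gcongr
  · rw [if_neg hs, mul_one]
    refine (le_predicted h hi hs).trans ?_
    unfold entryWeight
    exact le_add_of_nonneg_right (by positivity)

/-- The positions of new entries count the distinct entries. -/
theorem card_new_eq (x : ℕ → α) (L : ℕ) :
    ((Finset.range L).filter fun i => IsNewAt x i).card =
      ((Finset.range L).image x).card := by
  refine Finset.card_bij (fun i _ => x i) ?_ ?_ ?_
  · intro i hi
    exact Finset.mem_image_of_mem x (Finset.mem_filter.1 hi).1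
  · intro i hi i' hi' heq
    rw [Finset.mem_filter] at hi hi'
    rcases lt_trichotomy i i' with hlt | rfl | hlt
    · exact absurd heq (hi'.2 i hlt)
    · rfl
    · exact absurd heq.symm (hi.2 i' hlt)
  · intro y hy
    rw [Finset.mem_image] at hy
    have hex : ∃ i, i < L ∧ x i = y := by
      obtain ⟨i, hi, rfl⟩ := hy
      exact ⟨i, Finset.mem_range.1 hi, rfl⟩
    refine ⟨Nat.find hex, ?_, (Nat.find_spec hex).2⟩
    rw [Finset.mem_filter, Finset.mem_range]
    refine ⟨(Nat.find_spec hex).1, fun j hj heq => ?_⟩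
    exact Nat.find_min hex hj ⟨hj.trans (Nat.find_spec hex).1,
      heq.trans (Nat.find_spec hex).2⟩

/-- A path meets every exceptional vertex at most once, and a visit accounts for at most two special
positions. -/
theorem card_special_le {x : ℕ → α} {D : Finset α} (h : IsPathSystem c R ℓ x D) :
    ((Finset.range (c + R * (ℓ + 1))).filter fun i => SpecialPos c ℓ D x i).card ≤
      c + 2 * R + 2 * R * D.card := by
  set Q := (Finset.range R ×ˢ Finset.range (ℓ + 1)).filter
    fun a => x (pathPos c ℓ a.1 a.2) ∈ D with hQ
  have hQc : Q.card ≤ R * D.card := by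
    calc Q.card ≤ (Finset.range R ×ˢ D).card := by
          refine Finset.card_le_card_of_injOn (fun a => (a.1, x (pathPos c ℓ a.1 a.2))) ?_ ?_
          · intro a ha
            have := Finset.mem_filter.1 (Finset.mem_coe.1 ha)
            rw [Finset.mem_product] at this
            exact Finset.mem_coe.2 (Finset.mem_product.2 ⟨this.1.1, this.2⟩)
          · rintro ⟨j, t⟩ ha ⟨j', t'⟩ ha' heq
            have h1 := (Finset.mem_filter.1 (Finset.mem_coe.1 ha)).1
            have h2 := (Finset.mem_filter.1 (Finset.mem_coe.1 ha')).1
            simp only [Finset.mem_product, Finset.mem_range] at h1 h2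
            simp only [Prod.mk.injEq] at heq
            obtain ⟨rfl, heq⟩ := heq
            have := h.injOn j h1.1 (Set.mem_Iic.2 (by omega : t ≤ ℓ))
              (Set.mem_Iic.2 (by omega : t' ≤ ℓ)) heq
            rw [this]
      _ = R * D.card := by rw [Finset.card_product, Finset.card_range]
  have hsub : ((Finset.range (c + R * (ℓ + 1))).filter fun i => SpecialPos c ℓ D x i) ⊆
      Finset.range c ∪ ((Finset.range R ×ˢ Finset.range 2).image fun a => pathPos c ℓ a.1 a.2) ∪
        ((Q.image fun a => pathPos c ℓ a.1 a.2) ∪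
          (Q.image fun a => pathPos c ℓ a.1 (a.2 + 1))) := by
    intro i hi
    rw [Finset.mem_filter, Finset.mem_range] at hi
    obtain ⟨hi, hs⟩ := hi
    simp only [Finset.mem_union, Finset.mem_range, Finset.mem_image, Finset.mem_product,
      Prod.exists, hQ, Finset.mem_filter]
    by_cases hc : i < c
    · exact Or.inl (Or.inl hc)
    obtain ⟨j, t, hj, ht, rfl⟩ := exists_pathPos (by omega) hi
    by_cases ht2 : t < 2
    · exact Or.inl (Or.inr ⟨j, t, ⟨hj, ht2⟩, rfl⟩)
    by_cases hD0 : x (pathPos c ℓ j t) ∈ D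
    · exact Or.inr (Or.inl ⟨j, t, ⟨⟨hj, by omega⟩, hD0⟩, rfl⟩)
    by_cases hD1 : x (pathPos c ℓ j (t - 1)) ∈ D
    · exact Or.inr (Or.inr ⟨j, t - 1, ⟨⟨hj, by omega⟩, hD1⟩, by unfold pathPos; omega⟩)
    · refine absurd ⟨j, t, by omega, ht, rfl, ?_, hD0⟩ hs
      have : pathPos c ℓ j t - 1 = pathPos c ℓ j (t - 1) := by unfold pathPos; omega
      rw [this]
      exact hD1
  refine (Finset.card_le_card hsub).trans ?_
  refine (Finset.card_union_le _ _).trans ?_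
  have h1 := Finset.card_union_le (Finset.range c)
    ((Finset.range R ×ˢ Finset.range 2).image fun a => pathPos c ℓ a.1 a.2)
  have h2 := Finset.card_union_le (Q.image fun a => pathPos c ℓ a.1 a.2)
    (Q.image fun a => pathPos c ℓ a.1 (a.2 + 1))
  have h3 := Finset.card_image_le (s := Finset.range R ×ˢ Finset.range 2)
    (f := fun a => pathPos c ℓ a.1 a.2)
  have h4 := Finset.card_image_le (s := Q) (f := fun a => pathPos c ℓ a.1 a.2)
  have h5 := Finset.card_image_le (s := Q) (f := fun a => pathPos c ℓ a.1 (a.2 + 1))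
  rw [Finset.card_product, Finset.card_range, Finset.card_range] at h3
  rw [Finset.card_range] at h1
  have : 2 * R * D.card = R * D.card + R * D.card := by ring
  omega

/-- The number of path systems with `v` distinct vertices is at most `n ^ v`, up to a factor which
is polynomial in the length of the list for every exceptional vertex. -/
theorem sum_pathSystem_le [Fintype α] (d : α) (hL : 0 < c + R * (ℓ + 1)) (A : Finset (ℕ → α))
    (hA : ∀ x ∈ A, ∀ i, c + R * (ℓ + 1) ≤ i → x i = d) (D : (ℕ → α) → Finset α)
    (hD : ∀ x ∈ A, IsPathSystem c R ℓ x (D x)) :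
    ∑ x ∈ A, ((Fintype.card α : ℝ)⁻¹) ^ ((Finset.range (c + R * (ℓ + 1))).image x).card *
      ((2 * ((c + R * (ℓ + 1) : ℕ) : ℝ) ^ 2)⁻¹) ^ (c + 2 * R + 2 * R * (D x).card) ≤ 3 := by
  set L := c + R * (ℓ + 1) with hLdef
  have hL1 : (1 : ℝ) ≤ L := by exact_mod_cast hL
  -- every list has at least the stated weight; all lists together have weight at most `e`
  calc _ ≤ ∑ x ∈ A, ∏ i ∈ Finset.range L, entryWeight c R ℓ i x := by
        refine Finset.sum_le_sum fun x hx => ?_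
        have h1 : ∀ i ∈ Finset.range L, (if IsNewAt x i then (Fintype.card α : ℝ)⁻¹ else 1) *
            (if SpecialPos c ℓ (D x) x i then (2 * (L : ℝ) ^ 2)⁻¹ else 1) ≤
            entryWeight c R ℓ i x := fun i hi =>
          le_entryWeight (hD x hx) (Finset.mem_range.1 hi)
        refine le_trans ?_ (Finset.prod_le_prod (fun i _ => ?_) h1)
        · rw [Finset.prod_mul_distrib, Finset.prod_ite, Finset.prod_ite]
          simp only [Finset.prod_const, one_pow, mul_one]
          rw [card_new_eq]
          refine mul_le_mul_of_nonneg_left ?_ (by positivity)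
          refine pow_le_pow_of_le_one (by positivity) ?_ (card_special_le (hD x hx))
          exact inv_le_one_of_one_le₀ (by nlinarith)
        · refine mul_nonneg ?_ ?_
          · split_ifs <;> positivity
          · split_ifs <;> positivity
    _ ≤ (1 + (L : ℝ)⁻¹) ^ L :=
        sum_prod_le_pow _ _ (by positivity) entryWeight_nonneg
          (fun i x y h => entryWeight_congr h) d L (fun i hi x => sum_entryWeight_le hi x) A hA
    _ ≤ (Real.exp (L : ℝ)⁻¹) ^ L := by
        refine pow_le_pow_left₀ (by positivity) ?_ _
        rw [add_comm]
        exact Real.add_one_le_exp _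
    _ = Real.exp 1 := by
        rw [← Real.exp_nat_mul, mul_inv_cancel₀ (by positivity)]
    _ ≤ 3 := by
        have := Real.exp_one_lt_d9
        linarith

end

/-! ### Decompositions -/

/-- The properties of a decorated tree which matter: `P` is a pairing of the tree `T`, no vertex of
which is a leaf, and every automorphism of `T` fixes all vertices of `P`. -/
structure IsRigidPairing {k : ℕ} (m : ℕ) (T : SimpleGraph (Fin k)) (P : Finset (Sym2 (Fin k))) :
    Prop where
  isTree : T.IsTree
  two_le : 2 ≤ k
  isPairing : IsPairing m P
  not_isLeaf : ∀ e ∈ P, ∀ v ∈ e, ¬ IsLeaf T v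
  fixed : ∀ a : T ≃g T, ∀ e ∈ P, ∀ v ∈ e, a v = v

theorem mem_treeEdges {n k : ℕ} {T : SimpleGraph (Fin k)} {φ : Fin k ↪ Fin n}
    {e : Sym2 (Fin n)} : e ∈ treeEdges T φ ↔ ∃ e' ∈ T.edgeSet, e'.map φ = e := by
  simp [treeEdges]

theorem mk_mem_treeEdges {n k : ℕ} {T : SimpleGraph (Fin k)} {φ : Fin k ↪ Fin n}
    {x y : Fin k} : s(φ x, φ y) ∈ treeEdges T φ ↔ T.Adj x y := by
  rw [mem_treeEdges]
  constructor
  · rintro ⟨e', he', heq⟩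
    rw [← Sym2.map_mk] at heq
    have h2 := Sym2.map.injective φ.injective heq
    rw [h2] at he'
    exact he'
  · intro h
    exact ⟨s(x, y), by simpa using h, by simp⟩

theorem exists_of_mem_treeEdges {n k : ℕ} {T : SimpleGraph (Fin k)} {φ : Fin k ↪ Fin n}
    {e : Sym2 (Fin n)} (h : e ∈ treeEdges T φ) : ∃ x y, T.Adj x y ∧ e = s(φ x, φ y) := by
  obtain ⟨e', he', rfl⟩ := mem_treeEdges.1 h
  induction e' with
  | _ x y => exact ⟨x, y, by simpa using he', by simp⟩

theorem mem_pathEdges {n ℓ : ℕ} {p : ℕ → Fin n} {e : Sym2 (Fin n)} :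
    e ∈ pathEdges ℓ p ↔ ∃ t < ℓ, s(p t, p (t + 1)) = e := by
  simp [pathEdges]

theorem mem_sum_pathEdges {n k ℓ : ℕ} {P : Finset (Sym2 (Fin k))}
    {w : Sym2 (Fin k) → ℕ → Fin n} {e : Sym2 (Fin n)} :
    e ∈ ∑ e ∈ P, pathEdges ℓ (w e) ↔ ∃ a ∈ P, ∃ t < ℓ, s(w a t, w a (t + 1)) = e := by
  rw [Multiset.mem_sum]
  simp only [mem_pathEdges]

theorem card_edgeFinset_tree {k : ℕ} {T : SimpleGraph (Fin k)} (hT : T.IsTree) :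
    T.edgeFinset.card = k - 1 := by
  have := hT.card_edgeFinset
  rw [Fintype.card_fin] at this
  omega

theorem treeEdges_card {n k : ℕ} {T : SimpleGraph (Fin k)} (hT : T.IsTree) (φ : Fin k ↪ Fin n) :
    (treeEdges T φ).card = k - 1 := by
  rw [treeEdges, Multiset.card_map, ← card_edgeFinset_tree hT]
  rfl

theorem treeEdges_nodup {n k : ℕ} (T : SimpleGraph (Fin k)) (φ : Fin k ↪ Fin n) :
    (treeEdges T φ).Nodup :=
  Multiset.Nodup.map (Sym2.map.injective φ.injective) T.edgeFinset.nodup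

namespace IsDecomposition

variable {n k ℓ m : ℕ} {J : Finset (Fin n)} {T : SimpleGraph (Fin k)} {P : Finset (Sym2 (Fin k))}
  {φ : Fin k ↪ Fin n} {w : Sym2 (Fin k) → ℕ → Fin n} {S : Multiset (Sym2 (Fin n))}

theorem mem_iff (h : IsDecomposition J ℓ T P φ w S) {e : Sym2 (Fin n)} :
    e ∈ S ↔ e ∈ treeEdges T φ ∨ ∃ a ∈ P, ∃ t < ℓ, s(w a t, w a (t + 1)) = e := by
  rw [h.edges, Multiset.mem_add, mem_sum_pathEdges]

theorem card_eq (h : IsDecomposition J ℓ T P φ w S) (hT : IsRigidPairing m T P) :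
    S.card = k - 1 + ℓ * m := by
  rw [h.edges, Multiset.card_add, treeEdges_card hT.isTree, Multiset.card_sum]
  simp [pathEdges, hT.isPairing.card_eq, mul_comm]

theorem ne_of_ne (h : IsDecomposition J ℓ T P φ w S) {a : Sym2 (Fin k)} (ha : a ∈ P) {t t' : ℕ}
    (ht : t ≤ ℓ) (ht' : t' ≤ ℓ) (hne : t ≠ t') : w a t ≠ w a t' := fun heq =>
  hne (h.selfAvoiding a ha (Set.mem_Iic.2 ht) (Set.mem_Iic.2 ht') heq)

theorem not_isDiag (h : IsDecomposition J ℓ T P φ w S) {e : Sym2 (Fin n)} (he : e ∈ S) :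
    ¬ e.IsDiag := by
  rcases h.mem_iff.1 he with h1 | ⟨a, ha, t, ht, rfl⟩
  · obtain ⟨x, y, hxy, rfl⟩ := exists_of_mem_treeEdges h1
    simpa using hxy.ne
  · simpa using h.ne_of_ne ha ht.le ht (by omega : t ≠ t + 1)

theorem exists_endpoints (h : IsDecomposition J ℓ T P φ w S) {a : Sym2 (Fin k)} (ha : a ∈ P) :
    ∃ u v, a = s(u, v) ∧ w a 0 = φ u ∧ w a ℓ = φ v := by
  have h1 := h.endpoints a ha
  induction a with
  | _ x y =>
    rw [Sym2.map_mk, Sym2.eq_iff] at h1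
    rcases h1 with h1 | h1
    · exact ⟨x, y, rfl, h1.1, h1.2⟩
    · exact ⟨y, x, Sym2.eq_swap, h1.1, h1.2⟩

theorem path_edge_inj_same (h : IsDecomposition J ℓ T P φ w S) {a : Sym2 (Fin k)} (ha : a ∈ P)
    {t t' : ℕ} (ht : t < ℓ) (ht' : t' < ℓ)
    (heq : s(w a t, w a (t + 1)) = s(w a t', w a (t' + 1))) : t = t' := by
  have inj := h.selfAvoiding a ha
  rw [Sym2.eq_iff] at heq
  rcases heq with h1 | h1
  · exact inj (Set.mem_Iic.2 ht.le) (Set.mem_Iic.2 ht'.le) h1.1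
  · have h2 := inj (Set.mem_Iic.2 ht.le) (Set.mem_Iic.2 ht') h1.1
    have h3 := inj (Set.mem_Iic.2 ht) (Set.mem_Iic.2 ht'.le) h1.2
    omega

/-- An endpoint of a path is the image of a vertex of the pairing. -/
theorem exists_of_endpoint (h : IsDecomposition J ℓ T P φ w S) {a : Sym2 (Fin k)} (ha : a ∈ P)
    {t : ℕ} (ht : t = 0 ∨ t = ℓ) : ∃ u ∈ a, w a t = φ u := by
  obtain ⟨u, v, rfl, h1, h2⟩ := h.exists_endpoints ha
  rcases ht with rfl | rfl
  · exact ⟨u, Sym2.mem_mk_left _ _, h1⟩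
  · exact ⟨v, Sym2.mem_mk_right _ _, h2⟩

/-- Different ends of paths are different vertices. -/
theorem endpoint_inj (h : IsDecomposition J ℓ T P φ w S) (hT : IsRigidPairing m T P)
    {a a' : Sym2 (Fin k)} (ha : a ∈ P) (ha' : a' ∈ P) {t t' : ℕ} (ht : t = 0 ∨ t = ℓ)
    (ht' : t' = 0 ∨ t' = ℓ) (heq : w a t = w a' t') : a = a' ∧ t = t' := by
  obtain ⟨u, hu, h1⟩ := h.exists_of_endpoint ha ht
  obtain ⟨u', hu', h2⟩ := h.exists_of_endpoint ha' ht'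
  have h3 : u = u' := φ.injective (by rw [← h1, ← h2, heq])
  subst h3
  obtain rfl := hT.isPairing.disjoint a ha a' ha' u hu hu'
  exact ⟨rfl, h.selfAvoiding a ha (Set.mem_Iic.2 (by omega)) (Set.mem_Iic.2 (by omega)) heq⟩

end IsDecomposition

/-! ### Nonoverlapping decompositions -/

section

variable {n k ℓ m : ℕ} {J : Finset (Fin n)} {T : SimpleGraph (Fin k)} {P : Finset (Sym2 (Fin k))}
  {φ : Fin k ↪ Fin n} {w : Sym2 (Fin k) → ℕ → Fin n} {S : Multiset (Sym2 (Fin n))}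

theorem IsNonoverlapping.path_edge_inj (hn : IsNonoverlapping ℓ P φ w)
    (h : IsDecomposition J ℓ T P φ w S) (hℓ : 2 ≤ ℓ) {a a' : Sym2 (Fin k)} (ha : a ∈ P)
    (ha' : a' ∈ P) {t t' : ℕ} (ht : t < ℓ) (ht' : t' < ℓ)
    (heq : s(w a t, w a (t + 1)) = s(w a' t', w a' (t' + 1))) : a = a' ∧ t = t' := by
  -- every edge of a path has an interior vertex
  have key : ∃ i, 0 < i ∧ i < ℓ ∧ w a i ∈ s(w a t, w a (t + 1)) := by
    rcases Nat.eq_zero_or_pos t with rfl | ht0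
    · exact ⟨1, by omega, by omega, Sym2.mem_mk_right _ _⟩
    · exact ⟨t, ht0, ht, Sym2.mem_mk_left _ _⟩
  obtain ⟨i, hi0, hi, hmem⟩ := key
  rw [heq, Sym2.mem_iff] at hmem
  have h2 : ∃ j, j ≤ ℓ ∧ w a i = w a' j := by
    rcases hmem with h1 | h1
    · exact ⟨t', ht'.le, h1⟩
    · exact ⟨t' + 1, ht', h1⟩
  obtain ⟨j, hj, hij⟩ := h2
  have haa : a = a' := by
    by_contra hne
    by_cases hj' : j = 0 ∨ j = ℓ
    · obtain ⟨u, -, hu⟩ := h.exists_of_endpoint ha' hj'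
      exact hn.path_tree a ha i hi0 hi u (hij.trans hu)
    · exact hn.path_path a ha a' ha' hne i hi0 hi j (by omega) (by omega) hij
  subst haa
  exact ⟨rfl, h.path_edge_inj_same ha ht ht' heq⟩

theorem IsNonoverlapping.path_edge_notMem (hn : IsNonoverlapping ℓ P φ w) (hℓ : 2 ≤ ℓ)
    {a : Sym2 (Fin k)} (ha : a ∈ P) {t : ℕ} (ht : t < ℓ) :
    s(w a t, w a (t + 1)) ∉ treeEdges T φ := by
  intro hmem
  obtain ⟨x, y, -, heq⟩ := exists_of_mem_treeEdges hmem
  rw [Sym2.eq_iff] at heq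
  rcases Nat.eq_zero_or_pos t with rfl | ht0
  · rcases heq with h1 | h1
    · exact hn.path_tree a ha 1 (by omega) (by omega) _ h1.2
    · exact hn.path_tree a ha 1 (by omega) (by omega) _ h1.2
  · rcases heq with h1 | h1
    · exact hn.path_tree a ha t (by omega) (by omega) _ h1.1
    · exact hn.path_tree a ha t (by omega) (by omega) _ h1.1

theorem IsNonoverlapping.nodup (hn : IsNonoverlapping ℓ P φ w)
    (h : IsDecomposition J ℓ T P φ w S) (hℓ : 2 ≤ ℓ) : S.Nodup := by
  rw [h.edges, Multiset.nodup_add]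
  refine ⟨treeEdges_nodup T φ, ?_, ?_⟩
  · change (P.val.bind fun e => pathEdges ℓ (w e)).Nodup
    rw [Multiset.nodup_bind]
    refine ⟨fun a ha => ?_, ?_⟩
    · refine Multiset.Nodup.map_on ?_ (Multiset.nodup_range ℓ)
      intro t ht t' ht' heq
      exact h.path_edge_inj_same ha (Multiset.mem_range.1 ht) (Multiset.mem_range.1 ht') heq
    · refine Multiset.Nodup.pairwise (fun a ha b hb hab => ?_) P.nodup
      rw [Function.onFun, Multiset.disjoint_left]
      intro e he he'
      obtain ⟨t, ht, rfl⟩ := mem_pathEdges.1 he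
      obtain ⟨t', ht', heq⟩ := mem_pathEdges.1 he'
      exact hab (hn.path_edge_inj h hℓ ha hb ht ht' heq.symm).1
  · rw [Multiset.disjoint_left]
    intro e he he'
    obtain ⟨a, ha, t, ht, rfl⟩ := mem_sum_pathEdges.1 he'
    exact hn.path_edge_notMem hℓ ha ht he

/-- The edges at a tree vertex which is not in the pairing are edges of the tree. -/
theorem IsNonoverlapping.mem_treeEdges_of_mem (hn : IsNonoverlapping ℓ P φ w)
    (h : IsDecomposition J ℓ T P φ w S) {v : Fin k} (hv : ∀ a ∈ P, v ∉ a) {e : Sym2 (Fin n)}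
    (he : e ∈ S) (hve : φ v ∈ e) : e ∈ treeEdges T φ := by
  rcases h.mem_iff.1 he with h1 | ⟨a, ha, t, ht, rfl⟩
  · exact h1
  · exfalso
    have key : ∀ j ≤ ℓ, φ v ≠ w a j := by
      intro j hj heq
      by_cases hj' : j = 0 ∨ j = ℓ
      · obtain ⟨u, hu, hwu⟩ := h.exists_of_endpoint ha hj'
        have : v = u := φ.injective (heq.trans hwu)
        exact hv a ha (this ▸ hu)
      · exact hn.path_tree a ha j (by omega) (by omega) v heq.symm
    rw [Sym2.mem_iff] at hve
    rcases hve with h1 | h1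
    · exact key t ht.le h1
    · exact key (t + 1) ht h1

theorem exists_neighbor_of_isLeaf {v : Fin k} (hv : IsLeaf T v) :
    ∃ u, T.Adj v u ∧ ∀ u', T.Adj v u' → u' = u := by
  obtain ⟨u, hu⟩ := Set.ncard_eq_one.1 hv
  refine ⟨u, ?_, fun u' hu' => ?_⟩
  · have : u ∈ T.neighborSet v := by rw [hu]; rfl
    exact this
  · have : u' ∈ T.neighborSet v := hu'
    rw [hu] at this
    exact this

/-- If the image of a leaf of the tree is not met by the other multigraph, the moment vanishes. -/
theorem pairMoment_eq_zero_of_leaf (lam ε s : ℝ) (hn : IsNonoverlapping ℓ P φ w)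
    (h : IsDecomposition J ℓ T P φ w S) (hT : IsRigidPairing m T P) (hℓ : 2 ≤ ℓ)
    {S' : Multiset (Sym2 (Fin n))} (hS' : ∀ e ∈ S', ¬ e.IsDiag) {v : Fin k} (hv : IsLeaf T v)
    (hvS' : ∀ e ∈ S', φ v ∉ e) :
    pairMoment n lam ε s S S' = 0 ∧ pairMoment n lam ε s S' S = 0 := by
  obtain ⟨u, huv, huniq⟩ := exists_neighbor_of_isLeaf hv
  have hmem : s(φ v, φ u) ∈ S := h.mem_iff.2 (Or.inl (mk_mem_treeEdges.2 huv))
  have hcount : S.count s(φ v, φ u) = 1 := Multiset.count_eq_one_of_mem (hn.nodup h hℓ) hmem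
  have hcount' : S'.count s(φ v, φ u) = 0 :=
    Multiset.count_eq_zero.2 fun h' => hvS' _ h' (Sym2.mem_mk_left _ _)
  have hu : ∀ e, e ∈ S ∨ e ∈ S' → φ v ∈ e → e = s(φ v, φ u) := by
    rintro e (he | he) hve
    · have hte := hn.mem_treeEdges_of_mem h
        (fun a ha hva => hT.not_isLeaf a ha v hva hv) he hve
      obtain ⟨x, y, hxy, rfl⟩ := exists_of_mem_treeEdges hte
      rw [Sym2.mem_iff] at hve
      rcases hve with h1 | h1
      · have h2 := φ.injective h1
        subst h2
        rw [huniq y hxy]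
      · have h2 := φ.injective h1
        subst h2
        rw [huniq x hxy.symm, Sym2.eq_swap]
    · exact absurd hve (hvS' e he)
  have hd : ∀ e, e ∈ S ∨ e ∈ S' → ¬ e.IsDiag := by
    rintro e (he | he)
    · exact h.not_isDiag he
    · exact hS' e he
  constructor
  · refine pairMoment_eq_zero lam ε s (fun e he => hd e (Multiset.mem_add.1 he))
      (Sym2.mem_mk_left (φ v) (φ u)) (by omega) (fun e he => hu e (Multiset.mem_add.1 he))
  · refine pairMoment_eq_zero lam ε s (fun e he => hd e (Multiset.mem_add.1 he).symm)
      (Sym2.mem_mk_left (φ v) (φ u)) (by omega) (fun e he => hu e (Multiset.mem_add.1 he).symm)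

end

/-! ### Paths leaving a connected part of a forest -/

section

variable {V : Type*}

theorem reachable_of_steps {K : SimpleGraph V} {y : ℕ → V} {i j : ℕ} (hij : i ≤ j)
    (hadj : ∀ a, i ≤ a → a < j → K.Adj (y a) (y (a + 1))) : K.Reachable (y i) (y j) := by
  induction j, hij using Nat.le_induction with
  | base => exact SimpleGraph.Reachable.refl _
  | succ j hj ih =>
    exact (ih fun a h1 h2 => hadj a h1 (by omega)).trans (hadj j hj (by omega)).reachable

/-- Removing an edge with an end outside `A` does not affect connections inside `A`. -/
theorem reachable_deleteEdges_of_inside {K B : SimpleGraph V} (hB : B ≤ K) {A : Set V}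
    (hBA : ∀ a b, B.Adj a b → a ∈ A ∧ b ∈ A) {x y u v : V} (h : B.Reachable x y) (hv : v ∉ A) :
    (K.deleteEdges {s(u, v)}).Reachable x y := by
  refine h.mono fun a b hab => ?_
  rw [SimpleGraph.deleteEdges_adj]
  refine ⟨hB hab, fun heq => ?_⟩
  rw [Set.mem_singleton_iff, Sym2.eq_iff] at heq
  rcases heq with ⟨-, rfl⟩ | ⟨rfl, -⟩
  · exact hv (hBA _ _ hab).2
  · exact hv (hBA _ _ hab).1

theorem not_reachable_deleteEdges {K : SimpleGraph V} (hK : K.IsAcyclic) {u v : V}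
    (h : K.Adj u v) : ¬ (K.deleteEdges {s(u, v)}).Reachable u v := by
  have := SimpleGraph.isAcyclic_iff_forall_isBridge.1 hK (e := s(u, v)) h
  rwa [SimpleGraph.isBridge_iff] at this

/-- The steps of a path after the first one avoid its starting point. -/
theorem reachable_deleteEdges_of_steps {K : SimpleGraph V} {y : ℕ → V} {len : ℕ}
    (hadj : ∀ i < len, K.Adj (y i) (y (i + 1))) (hinj : Set.InjOn y (Set.Iic len)) {j : ℕ}
    (hj1 : 1 ≤ j) (hj : j ≤ len) : (K.deleteEdges {s(y 0, y 1)}).Reachable (y 1) (y j) := by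
  refine reachable_of_steps hj1 fun a ha haj => ?_
  rw [SimpleGraph.deleteEdges_adj]
  refine ⟨hadj a (by omega), fun heq => ?_⟩
  rw [Set.mem_singleton_iff, Sym2.eq_iff] at heq
  rcases heq with h1 | h1
  · have := hinj (Set.mem_Iic.2 (by omega)) (Set.mem_Iic.2 (by omega)) h1.1
    omega
  · have := hinj (Set.mem_Iic.2 (by omega)) (Set.mem_Iic.2 (by omega)) h1.2
    omega

/-- A path in a forest which leaves a connected part `A` with its first step never returns. -/
theorem notMem_of_leave {K B : SimpleGraph V} (hK : K.IsAcyclic) (hB : B ≤ K) {A : Set V}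
    (hBA : ∀ a b, B.Adj a b → a ∈ A ∧ b ∈ A) (hconn : ∀ x ∈ A, ∀ y ∈ A, B.Reachable x y)
    {y : ℕ → V} {len : ℕ} (hy0 : y 0 ∈ A) (hy1 : y 1 ∉ A)
    (hadj : ∀ i < len, K.Adj (y i) (y (i + 1)))
    (hinj : Set.InjOn y (Set.Iic len)) {j : ℕ} (hj1 : 1 ≤ j) (hj : j ≤ len) : y j ∉ A := by
  intro hjA
  refine not_reachable_deleteEdges hK (hadj 0 (by omega)) ?_
  exact (reachable_deleteEdges_of_inside hB hBA (hconn _ hy0 _ hjA) hy1).trans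
    (reachable_deleteEdges_of_steps hadj hinj hj1 hj).symm

/-- Two paths in a forest which leave a connected part `A` at different vertices, with their first
steps, do not meet. -/
theorem ne_of_leave {K B : SimpleGraph V} (hK : K.IsAcyclic) (hB : B ≤ K) {A : Set V}
    (hBA : ∀ a b, B.Adj a b → a ∈ A ∧ b ∈ A) (hconn : ∀ x ∈ A, ∀ y ∈ A, B.Reachable x y)
    {y z : ℕ → V} {len len' : ℕ} (hy0 : y 0 ∈ A) (hy1 : y 1 ∉ A) (hz0 : z 0 ∈ A) (hz1 : z 1 ∉ A)
    (hadj : ∀ i < len, K.Adj (y i) (y (i + 1))) (hadj' : ∀ i < len', K.Adj (z i) (z (i + 1)))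
    (hinj : Set.InjOn y (Set.Iic len)) (hinj' : Set.InjOn z (Set.Iic len'))
    (hne : y 0 ≠ z 0) {i j : ℕ} (hj1 : 1 ≤ j) (hj : j ≤ len) (hi : i ≤ len') : y j ≠ z i := by
  intro heq
  refine not_reachable_deleteEdges hK (hadj 0 (by omega)) ?_
  have hz : ∀ a ≤ len', z a ≠ y 0 := by
    intro a ha h0
    rcases Nat.eq_zero_or_pos a with rfl | ha0
    · exact hne h0.symm
    · exact notMem_of_leave hK hB hBA hconn hz0 hz1 hadj' hinj' ha0 ha (h0 ▸ hy0)
  have h1 : (K.deleteEdges {s(y 0, y 1)}).Reachable (z 0) (z i) := by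
    refine reachable_of_steps (Nat.zero_le i) fun a _ hai => ?_
    rw [SimpleGraph.deleteEdges_adj]
    refine ⟨hadj' a (by omega), fun h2 => ?_⟩
    rw [Set.mem_singleton_iff, Sym2.eq_iff] at h2
    rcases h2 with h3 | h3
    · exact hz a (by omega) h3.1
    · exact hz (a + 1) (by omega) h3.2
  refine (reachable_deleteEdges_of_inside hB hBA (hconn _ hy0 _ hz0) hy1).trans (h1.trans ?_)
  rw [← heq]
  exact (reachable_deleteEdges_of_steps hadj hinj hj1 hj).symm

end

section

variable {n k ℓ m : ℕ} {J : Finset (Fin n)} {T : SimpleGraph (Fin k)} {P : Finset (Sym2 (Fin k))}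
  {φ : Fin k ↪ Fin n} {w : Sym2 (Fin k) → ℕ → Fin n} {S : Multiset (Sym2 (Fin n))}

/-- The graph with the edges of `S` except one edge on every path, the edge number `t a` of the
path `w a`. -/
def cutGraph (P : Finset (Sym2 (Fin k))) (w : Sym2 (Fin k) → ℕ → Fin n) (S : Multiset (Sym2 (Fin n)))
    (t : Sym2 (Fin k) → ℕ) : SimpleGraph (Fin n) :=
  SimpleGraph.fromEdgeSet {e | e ∈ S ∧ ∀ a ∈ P, e ≠ s(w a (t a), w a (t a + 1))}

/-- The chosen edges of the paths occur only once. -/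
structure IsCut (ℓ : ℕ) (T : SimpleGraph (Fin k)) (P : Finset (Sym2 (Fin k))) (φ : Fin k ↪ Fin n)
    (w : Sym2 (Fin k) → ℕ → Fin n) (t : Sym2 (Fin k) → ℕ) : Prop where
  lt : ∀ a ∈ P, t a < ℓ
  notMem_tree : ∀ a ∈ P, s(w a (t a), w a (t a + 1)) ∉ treeEdges T φ
  ne_path : ∀ a ∈ P, ∀ a' ∈ P, a ≠ a' → ∀ i < ℓ, s(w a (t a), w a (t a + 1)) ≠
    s(w a' i, w a' (i + 1))

/-- The path `w a`, read from one of its ends. -/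
def strand (ℓ : ℕ) (w : Sym2 (Fin k) → ℕ → Fin n) (a : Sym2 (Fin k)) (b : Bool) (j : ℕ) : Fin n :=
  if b then w a (ℓ - j) else w a j

/-- The number of edges of the path `w a` before the cut, read from one of its ends. -/
def strandLength (ℓ : ℕ) (t : Sym2 (Fin k) → ℕ) (a : Sym2 (Fin k)) (b : Bool) : ℕ :=
  if b then ℓ - 1 - t a else t a

theorem map_le_cutGraph (h : IsDecomposition J ℓ T P φ w S) {t : Sym2 (Fin k) → ℕ}
    (ht : IsCut ℓ T P φ w t) : T.map φ ≤ cutGraph P w S t := by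
  intro x y hxy
  obtain ⟨-, u, v, huv, rfl, rfl⟩ := hxy
  rw [cutGraph, SimpleGraph.fromEdgeSet_adj]
  have hmem : s(φ u, φ v) ∈ treeEdges T φ := mk_mem_treeEdges.2 huv
  refine ⟨⟨h.mem_iff.2 (Or.inl hmem), fun a ha heq => ?_⟩, φ.injective.ne huv.ne⟩
  exact ht.notMem_tree a ha (heq ▸ hmem)

theorem cutGraph_adj_path (h : IsDecomposition J ℓ T P φ w S) {t : Sym2 (Fin k) → ℕ}
    (ht : IsCut ℓ T P φ w t) {a : Sym2 (Fin k)} (ha : a ∈ P) {i : ℕ} (hi : i < ℓ) (hit : i ≠ t a) :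
    (cutGraph P w S t).Adj (w a i) (w a (i + 1)) := by
  rw [cutGraph, SimpleGraph.fromEdgeSet_adj]
  refine ⟨⟨h.mem_iff.2 (Or.inr ⟨a, ha, i, hi, rfl⟩), fun a' ha' heq => ?_⟩,
    h.ne_of_ne ha hi.le hi (by omega)⟩
  by_cases haa : a = a'
  · subst haa
    exact hit (h.path_edge_inj_same ha hi (ht.lt a ha) heq)
  · exact ht.ne_path a' ha' a ha (Ne.symm haa) i hi heq.symm

theorem cutGraph_adj_strand (h : IsDecomposition J ℓ T P φ w S) {t : Sym2 (Fin k) → ℕ}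
    (ht : IsCut ℓ T P φ w t) {a : Sym2 (Fin k)} (ha : a ∈ P) (b : Bool) {i : ℕ}
    (hi : i < strandLength ℓ t a b) :
    (cutGraph P w S t).Adj (strand ℓ w a b i) (strand ℓ w a b (i + 1)) := by
  have hta := ht.lt a ha
  cases b with
  | false =>
    simp only [strandLength, Bool.false_eq_true, if_false, strand] at *
    exact cutGraph_adj_path h ht ha (by omega) (by omega)
  | true =>
    simp only [strandLength, if_true, strand] at *
    have := cutGraph_adj_path h ht ha (i := ℓ - (i + 1)) (by omega) (by omega)
    rw [show ℓ - (i + 1) + 1 = ℓ - i by omega] at this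
    exact this.symm

theorem strand_injOn (h : IsDecomposition J ℓ T P φ w S) {a : Sym2 (Fin k)} (ha : a ∈ P)
    (b : Bool) {len : ℕ} (hlen : len ≤ ℓ) : Set.InjOn (strand ℓ w a b) (Set.Iic len) := by
  intro i hi j hj heq
  rw [Set.mem_Iic] at hi hj
  cases b with
  | false =>
    exact h.selfAvoiding a ha (Set.mem_Iic.2 (by omega)) (Set.mem_Iic.2 (by omega)) heq
  | true =>
    have := h.selfAvoiding a ha (Set.mem_Iic.2 (by omega : ℓ - i ≤ ℓ))
      (Set.mem_Iic.2 (by omega : ℓ - j ≤ ℓ)) heq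
    omega

theorem strandLength_le {t : Sym2 (Fin k) → ℕ} (ht : IsCut ℓ T P φ w t) {a : Sym2 (Fin k)}
    (ha : a ∈ P) (b : Bool) : strandLength ℓ t a b ≤ ℓ := by
  have := ht.lt a ha
  cases b <;> simp [strandLength] <;> omega

theorem strand_zero_mem (h : IsDecomposition J ℓ T P φ w S) {a : Sym2 (Fin k)} (ha : a ∈ P)
    (b : Bool) : strand ℓ w a b 0 ∈ Set.range φ := by
  cases b with
  | false =>
    obtain ⟨u, -, hu⟩ := h.exists_of_endpoint ha (Or.inl rfl)
    exact ⟨u, hu.symm⟩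
  | true =>
    obtain ⟨u, -, hu⟩ := h.exists_of_endpoint ha (Or.inr rfl)
    exact ⟨u, by simp [strand, hu]⟩

/-- The second vertex of a path lies in the reserved set `J`, which the tree avoids. -/
theorem strand_one_notMem (h : IsDecomposition J ℓ T P φ w S) {a : Sym2 (Fin k)} (ha : a ∈ P)
    (b : Bool) : strand ℓ w a b 1 ∉ Set.range φ := by
  rintro ⟨v, hv⟩
  refine h.tree_notMem v ?_
  rw [hv]
  cases b with
  | false => exact (h.neighbors a ha).1
  | true => exact (h.neighbors a ha).2

theorem strand_zero_inj (h : IsDecomposition J ℓ T P φ w S) (hT : IsRigidPairing m T P)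
    (hℓ : 1 ≤ ℓ) {a a' : Sym2 (Fin k)} (ha : a ∈ P) (ha' : a' ∈ P) {b b' : Bool}
    (heq : strand ℓ w a b 0 = strand ℓ w a' b' 0) : a = a' ∧ b = b' := by
  cases b <;> cases b' <;> simp only [strand, if_true, Bool.false_eq_true, if_false,
    Nat.sub_zero] at heq
  · exact ⟨(h.endpoint_inj hT ha ha' (by simp) (by simp) heq).1, rfl⟩
  · have := (h.endpoint_inj hT ha ha' (by simp) (by simp) heq).2
    omega
  · have := (h.endpoint_inj hT ha ha' (by simp) (by simp) heq).2
    omega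
  · exact ⟨(h.endpoint_inj hT ha ha' (by simp) (by simp) heq).1, rfl⟩

theorem map_adj_mem_range {a b : Fin n} (hab : (T.map φ).Adj a b) :
    a ∈ Set.range φ ∧ b ∈ Set.range φ := by
  obtain ⟨-, u, v, -, rfl, rfl⟩ := hab
  exact ⟨⟨u, rfl⟩, ⟨v, rfl⟩⟩

theorem map_reachable (hT : T.IsTree) {x y : Fin n} (hx : x ∈ Set.range φ) (hy : y ∈ Set.range φ) :
    (T.map φ).Reachable x y := by
  obtain ⟨u, rfl⟩ := hx
  obtain ⟨v, rfl⟩ := hy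
  exact (hT.connected.preconnected u v).map (SimpleGraph.Embedding.map φ T).toHom

/-- Every interior vertex of a path is reached from one of the two ends before the cut. -/
theorem exists_strand {t : Sym2 (Fin k) → ℕ} {a : Sym2 (Fin k)} {i : ℕ} (hi0 : 0 < i)
    (hi : i < ℓ) :
    ∃ b j, 1 ≤ j ∧ j ≤ strandLength ℓ t a b ∧ w a i = strand ℓ w a b j := by
  by_cases hit : i ≤ t a
  · exact ⟨false, i, hi0, by simpa [strandLength] using hit, by simp [strand]⟩
  · refine ⟨true, ℓ - i, by omega, by simp only [strandLength, if_true]; omega, ?_⟩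
    simp only [strand, if_true]
    rw [show ℓ - (ℓ - i) = i by omega]

/-- If cutting every path once leaves a forest, the multigraph is nonoverlapping: the paths leave
the tree with their first steps and can never meet the tree or each other again. -/
theorem isNonoverlapping_of_isAcyclic (h : IsDecomposition J ℓ T P φ w S)
    (hT : IsRigidPairing m T P) (hℓ : 1 ≤ ℓ) {t : Sym2 (Fin k) → ℕ} (ht : IsCut ℓ T P φ w t)
    (hK : (cutGraph P w S t).IsAcyclic) : IsNonoverlapping ℓ P φ w where
  path_tree := by
    intro a ha i hi0 hi v heq
    obtain ⟨b, j, hj1, hj, hw⟩ := exists_strand (w := w) (t := t) (a := a) hi0 hi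
    refine notMem_of_leave hK (map_le_cutGraph h ht) (fun _ _ => map_adj_mem_range)
      (fun x hx y hy => map_reachable hT.isTree hx hy) (strand_zero_mem h ha b)
      (strand_one_notMem h ha b) (fun i hi => cutGraph_adj_strand h ht ha b hi)
      (strand_injOn h ha b (strandLength_le ht ha b)) hj1 hj ⟨v, ?_⟩
    rw [← hw, heq]
  path_path := by
    intro a ha a' ha' hne i hi0 hi i' hi0' hi' heq
    obtain ⟨b, j, hj1, hj, hw⟩ := exists_strand (w := w) (t := t) (a := a) hi0 hi
    obtain ⟨b', j', hj1', hj', hw'⟩ := exists_strand (w := w) (t := t) (a := a') hi0' hi'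
    refine ne_of_leave hK (map_le_cutGraph h ht) (fun _ _ => map_adj_mem_range)
      (fun x hx y hy => map_reachable hT.isTree hx hy) (strand_zero_mem h ha b)
      (strand_one_notMem h ha b) (strand_zero_mem h ha' b') (strand_one_notMem h ha' b')
      (fun i hi => cutGraph_adj_strand h ht ha b hi)
      (fun i hi => cutGraph_adj_strand h ht ha' b' hi)
      (strand_injOn h ha b (strandLength_le ht ha b))
      (strand_injOn h ha' b' (strandLength_le ht ha' b')) ?_ hj1 hj hj' (by rw [← hw, ← hw', heq])
    exact fun h0 => hne (strand_zero_inj h hT hℓ ha ha' h0).1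

/-- All vertices of a path are connected to the tree after the cut. -/
theorem cutGraph_reachable_path (h : IsDecomposition J ℓ T P φ w S) {t : Sym2 (Fin k) → ℕ}
    (ht : IsCut ℓ T P φ w t) (hT : T.IsTree) (u : Fin k) {a : Sym2 (Fin k)} (ha : a ∈ P) {i : ℕ}
    (hi : i ≤ ℓ) : (cutGraph P w S t).Reachable (φ u) (w a i) := by
  have hta := ht.lt a ha
  have htree : ∀ x ∈ Set.range φ, (cutGraph P w S t).Reachable (φ u) x := fun x hx =>
    (map_reachable hT ⟨u, rfl⟩ hx).mono (map_le_cutGraph h ht)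
  by_cases hit : i ≤ t a
  · refine (htree _ (strand_zero_mem h ha false)).trans ?_
    exact reachable_of_steps (y := w a) (Nat.zero_le i) fun j _ hj =>
      cutGraph_adj_path h ht ha (by omega) (by omega)
  · refine (htree _ (strand_zero_mem h ha true)).trans ?_
    refine SimpleGraph.Reachable.symm ?_
    simp only [strand, if_true, Nat.sub_zero]
    exact reachable_of_steps (y := w a) hi fun j hj1 hj =>
      cutGraph_adj_path h ht ha (by omega) (by omega)

/-- Cutting every path once leaves a copy connected. -/
theorem cutGraph_reachable (h : IsDecomposition J ℓ T P φ w S) {t : Sym2 (Fin k) → ℕ}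
    (ht : IsCut ℓ T P φ w t) (hT : T.IsTree) (u : Fin k) {e : Sym2 (Fin n)} (he : e ∈ S)
    {x : Fin n} (hx : x ∈ e) : (cutGraph P w S t).Reachable (φ u) x := by
  rcases h.mem_iff.1 he with h1 | ⟨a, ha, i, hi, rfl⟩
  · obtain ⟨p, q, -, rfl⟩ := exists_of_mem_treeEdges h1
    rw [Sym2.mem_iff] at hx
    rcases hx with rfl | rfl
    · exact (map_reachable hT ⟨u, rfl⟩ ⟨p, rfl⟩).mono (map_le_cutGraph h ht)
    · exact (map_reachable hT ⟨u, rfl⟩ ⟨q, rfl⟩).mono (map_le_cutGraph h ht)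
  · rw [Sym2.mem_iff] at hx
    rcases hx with rfl | rfl
    · exact cutGraph_reachable_path h ht hT u ha hi.le
    · exact cutGraph_reachable_path h ht hT u ha hi

end

/-! ### Counting vertices and edges of connected graphs -/

section

variable {V : Type*}

theorem card_le_of_reachable [Fintype V] (G : SimpleGraph V) (A : Finset V) (a : V)
    (hA : ∀ v ∈ A, G.Reachable a v) : A.card ≤ G.edgeSet.ncard + 1 := by
  set C := G.connectedComponentMk a with hC
  have h1 := (SimpleGraph.ConnectedComponent.connected_toSimpleGraph C).card_vert_le_card_edgeSet_add_one
  have h2 : A.card ≤ Nat.card C.supp := by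
    rw [Nat.card_coe_set_eq, ← Set.ncard_coe_finset]
    refine Set.ncard_le_ncard (fun x hx => ?_) (Set.toFinite _)
    rw [SimpleGraph.ConnectedComponent.mem_supp_iff, hC, SimpleGraph.ConnectedComponent.eq]
    exact (hA x hx).symm
  have h3 : Nat.card C.toSimpleGraph.edgeSet ≤ G.edgeSet.ncard := by
    rw [Nat.card_coe_set_eq]
    refine Set.ncard_le_ncard_of_injOn (Sym2.map Subtype.val) ?_
      (Sym2.map.injective Subtype.val_injective).injOn (Set.toFinite _)
    intro e he
    induction e with
    | _ x y => exact he
  exact h2.trans (h1.trans (by omega))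

theorem card_le_of_reachable_two [Fintype V] (G : SimpleGraph V) (A : Finset V) (a b : V)
    (hA : ∀ v ∈ A, G.Reachable a v ∨ G.Reachable b v) : A.card ≤ G.edgeSet.ncard + 2 := by
  by_cases hab : a = b
  · subst hab
    have := card_le_of_reachable G A a (fun v hv => (hA v hv).elim id id)
    omega
  · have hle : (G ⊔ SimpleGraph.edge a b).edgeSet.ncard ≤ G.edgeSet.ncard + 1 := by
      have : (G ⊔ SimpleGraph.edge a b).edgeSet ⊆ insert s(a, b) G.edgeSet := by
        intro e he
        induction e with
        | _ x y =>
          simp only [SimpleGraph.mem_edgeSet, SimpleGraph.sup_adj,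
            SimpleGraph.edge_adj, Set.mem_insert_iff, Sym2.eq_iff] at he ⊢
          tauto
      exact (Set.ncard_le_ncard this (Set.toFinite _)).trans (Set.ncard_insert_le _ _)
    have := card_le_of_reachable (G ⊔ SimpleGraph.edge a b) A a (fun v hv => by
      rcases hA v hv with h | h
      · exact h.mono le_sup_left
      · refine SimpleGraph.Reachable.trans ?_ (h.mono le_sup_left)
        refine SimpleGraph.Adj.reachable ?_
        rw [SimpleGraph.sup_adj, SimpleGraph.edge_adj]
        exact Or.inr ⟨Or.inl ⟨rfl, rfl⟩, hab⟩)
    omega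

theorem reachable_deleteEdges {G : SimpleGraph V} {x y : V}
    (hxy : (G.deleteEdges {s(x, y)}).Reachable x y) {u v : V} (h : G.Reachable u v) :
    (G.deleteEdges {s(x, y)}).Reachable u v := by
  obtain ⟨p⟩ := h
  induction p with
  | nil => exact SimpleGraph.Reachable.refl _
  | cons hadj p ih =>
    rename_i a b c
    refine SimpleGraph.Reachable.trans ?_ ih
    by_cases heq : s(a, b) = s(x, y)
    · rw [Sym2.eq_iff] at heq
      rcases heq with ⟨rfl, rfl⟩ | ⟨rfl, rfl⟩
      · exact hxy
      · exact hxy.symm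
    · refine SimpleGraph.Adj.reachable ?_
      rw [SimpleGraph.deleteEdges_adj]
      exact ⟨hadj, heq⟩

theorem isAcyclic_of_card [Fintype V] {G : SimpleGraph V} (A : Finset V) (a : V)
    (hA : ∀ v ∈ A, G.Reachable a v) (hcard : G.edgeSet.ncard < A.card) : G.IsAcyclic := by
  rw [SimpleGraph.isAcyclic_iff_forall_isBridge]
  intro e he
  induction e with
  | _ x y =>
    rw [SimpleGraph.isBridge_iff]
    intro hxy
    have h1 := card_le_of_reachable (G.deleteEdges {s(x, y)}) A a
      (fun v hv => reachable_deleteEdges hxy (hA v hv))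
    rw [SimpleGraph.edgeSet_deleteEdges] at h1
    have h2 := Set.ncard_sdiff_singleton_add_one he (Set.toFinite _)
    omega

/-! ### Paths in forests -/

/-- In a forest, a path of a subgraph `K` between two vertices which are also connected in a
subgraph `K'` runs inside `K'`. -/
theorem edges_mem_of_isAcyclic {U K K' : SimpleGraph V} (hU : U.IsAcyclic) (hK : K ≤ U)
    (hK' : K' ≤ U) {x y : V} (p : K.Walk x y) (hp : p.IsPath) (h : K'.Reachable x y) :
    ∀ e ∈ p.edges, e ∈ K'.edgeSet := by
  obtain ⟨q, hq⟩ := h.exists_isPath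
  have hpq : p.mapLe hK = q.mapLe hK' :=
    congrArg Subtype.val ((hU.subsingleton_path x y).elim
      ⟨p.mapLe hK, (SimpleGraph.Walk.isPath_mapLe hK).2 hp⟩
      ⟨q.mapLe hK', (SimpleGraph.Walk.isPath_mapLe hK').2 hq⟩)
  intro e he
  have h1 : e ∈ (p.mapLe hK).edges := by simpa using he
  rw [hpq] at h1
  have h2 : e ∈ q.edges := by simpa using h1
  exact q.edges_subset_edgeSet h2

/-- Two connected subgraphs of a forest meet in a connected graph. -/
theorem inf_reachable_of_isAcyclic {U K K' : SimpleGraph V} (hU : U.IsAcyclic) (hK : K ≤ U)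
    (hK' : K' ≤ U) {x y : V} (h : K.Reachable x y) (h' : K'.Reachable x y) :
    (K ⊓ K').Reachable x y := by
  obtain ⟨p, hp⟩ := h.exists_isPath
  have h1 := edges_mem_of_isAcyclic hU hK hK' p hp h'
  exact ⟨p.transfer (K ⊓ K') fun e he => by
    rw [SimpleGraph.edgeSet_inf]
    exact ⟨p.edges_subset_edgeSet he, h1 e he⟩⟩

theorem isLeaf_of_unique_adj {G : SimpleGraph V} {v u : V} (h : G.Adj v u)
    (huniq : ∀ w, G.Adj v w → w = u) : IsLeaf G v := by
  unfold IsLeaf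
  rw [Set.ncard_eq_one]
  refine ⟨u, ?_⟩
  ext w
  simp only [SimpleGraph.mem_neighborSet, Set.mem_singleton_iff]
  exact ⟨huniq w, fun hw => hw ▸ h⟩

/-- Every edge of a finite forest lies on a path between two leaves. -/
theorem exists_leaf_path [Fintype V] {T : SimpleGraph V} (hT : T.IsAcyclic) {x y : V}
    (hxy : T.Adj x y) : ∃ (u v : V) (p : T.Walk u v), p.IsPath ∧ s(x, y) ∈ p.edges ∧
      IsLeaf T u ∧ IsLeaf T v := by
  set Q : ℕ → Prop := fun l => ∃ (u v : V) (p : T.Walk u v), p.IsPath ∧ s(x, y) ∈ p.edges ∧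
    p.length = l with hQ
  have hQ1 : Q 1 := ⟨x, y, hxy.toWalk, by
    simp [SimpleGraph.Walk.cons_isPath_iff, hxy.ne], by simp, by simp⟩
  have hbound : ∀ l, Q l → l ≤ Fintype.card V := by
    rintro l ⟨u, v, p, hp, -, rfl⟩
    exact hp.length_lt.le
  obtain ⟨u, v, p, hp, hmem, hlen⟩ : Q (Nat.findGreatest Q (Fintype.card V)) :=
    Nat.findGreatest_spec (hbound 1 hQ1) hQ1
  have hmax : ∀ l, Q l → l ≤ p.length := by
    intro l hl
    rw [hlen]
    exact Nat.le_findGreatest (hbound l hl) hl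
  have hnil : ¬ p.Nil := by
    intro h
    rw [SimpleGraph.Walk.edges_eq_nil.2 h] at hmem
    simp at hmem
  have key : ∀ {u v : V} (p : T.Walk u v), p.IsPath → s(x, y) ∈ p.edges → ¬ p.Nil →
      (∀ l, Q l → l ≤ p.length) → IsLeaf T v := by
    intro u v p hp hmem hnil hmax
    refine isLeaf_of_unique_adj (p.adj_penultimate hnil).symm fun w hw => ?_
    refine hT.eq_penultimate_of_adj_end hp hw ?_
    by_contra hsupp
    have := hmax (p.length + 1) ⟨u, w, p.concat hw, hp.concat hsupp hw, by
      rw [SimpleGraph.Walk.edges_concat]; simp [hmem], by simp⟩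
    omega
  refine ⟨u, v, p, hp, hmem, ?_, key p hp hmem hnil hmax⟩
  exact key p.reverse hp.reverse (by simpa using hmem)
    (by simpa using hnil) (by simpa using hmax)

end

/-! ### Minimal covers -/

/-- A subfamily `R` which, together with `B`, covers as much as the whole family and every member of
which is needed: it contains an element covered by nothing else. -/
theorem exists_minimal_cover {ι β : Type*} [DecidableEq β] (B : Finset β) (Q : Finset ι) (pe : ι → Finset β) :
    ∃ R ⊆ Q, B ∪ R.biUnion pe = B ∪ Q.biUnion pe ∧
      ∀ i ∈ R, ∃ e ∈ pe i, e ∉ B ∧ ∀ j ∈ R, j ≠ i → e ∉ pe j := by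
  obtain ⟨R, hR, hmin⟩ := Finset.exists_min_image
    (Q.powerset.filter fun R => B ∪ R.biUnion pe = B ∪ Q.biUnion pe) Finset.card
    ⟨Q, by simp⟩
  rw [Finset.mem_filter, Finset.mem_powerset] at hR
  refine ⟨R, hR.1, hR.2, fun i hi => ?_⟩
  by_contra hcon
  push Not at hcon
  have h1 : R.erase i ∈ Q.powerset.filter fun R => B ∪ R.biUnion pe = B ∪ Q.biUnion pe := by
    rw [Finset.mem_filter, Finset.mem_powerset]
    refine ⟨(Finset.erase_subset i R).trans hR.1, ?_⟩
    rw [← hR.2]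
    ext e
    simp only [Finset.mem_union, Finset.mem_biUnion, Finset.mem_erase]
    constructor
    · rintro (h | ⟨j, hj, he⟩)
      · exact Or.inl h
      · exact Or.inr ⟨j, hj.2, he⟩
    · rintro (h | ⟨j, hj, he⟩)
      · exact Or.inl h
      · by_cases hji : j = i
        · subst hji
          by_cases hB : e ∈ B
          · exact Or.inl hB
          · obtain ⟨j', hj', hne, he'⟩ := hcon e he hB
            exact Or.inr ⟨j', ⟨hne, hj'⟩, he'⟩
        · exact Or.inr ⟨j, ⟨hji, hj⟩, he⟩
  have h2 := hmin _ h1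
  rw [Finset.card_erase_of_mem hi] at h2
  have := Finset.card_pos.2 ⟨i, hi⟩
  omega

/-! ### Pairs of copies -/

/-- `S₁` and `S₂` are nonoverlapping copies of the decorated tree `(T, P)` whose intersection is
a tree containing both tree parts. -/
def GoodPair {n k : ℕ} (J₁ J₂ : Finset (Fin n)) (ℓ : ℕ) (T : SimpleGraph (Fin k))
    (P : Finset (Sym2 (Fin k))) (S₁ S₂ : Multiset (Sym2 (Fin n))) : Prop :=
  ∃ φ₁ w₁ φ₂ w₂,
    IsDecomposition J₁ ℓ T P φ₁ w₁ S₁ ∧ IsNonoverlapping ℓ P φ₁ w₁ ∧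
    IsDecomposition J₂ ℓ T P φ₂ w₂ S₂ ∧ IsNonoverlapping ℓ P φ₂ w₂ ∧
    (underlying S₁ ⊓ underlying S₂).coe.IsTree ∧
    underlying (treeEdges T φ₁) ≤ underlying S₁ ⊓ underlying S₂ ∧
    underlying (treeEdges T φ₂) ≤ underlying S₁ ⊓ underlying S₂

/-- The vertices which are incident to some edge of `S`. -/
def support {n : ℕ} (S : Multiset (Sym2 (Fin n))) : Finset (Fin n) :=
  Finset.univ.filter fun v => ∃ e ∈ S, v ∈ e

theorem mem_support {n : ℕ} {S : Multiset (Sym2 (Fin n))} {v : Fin n} :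
    v ∈ support S ↔ ∃ e ∈ S, v ∈ e := by
  simp [support]

theorem support_add {n : ℕ} (S S' : Multiset (Sym2 (Fin n))) :
    support (S + S') = support S ∪ support S' := by
  ext v
  simp only [Finset.mem_union, mem_support, Multiset.mem_add]
  constructor
  · rintro ⟨e, h | h, hv⟩
    · exact Or.inl ⟨e, h, hv⟩
    · exact Or.inr ⟨e, h, hv⟩
  · rintro (⟨e, h, hv⟩ | ⟨e, h, hv⟩)
    · exact ⟨e, Or.inl h, hv⟩
    · exact ⟨e, Or.inr h, hv⟩

theorem exists_adj_of_isTree {k : ℕ} {T : SimpleGraph (Fin k)} (hT : T.IsTree) (hk : 2 ≤ k)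
    (v : Fin k) : ∃ u, T.Adj v u := by
  have : Nontrivial (Fin k) := Fin.nontrivial_iff_two_le.2 hk
  exact hT.connected.preconnected.exists_adj_of_nontrivial v

theorem mem_support_of_tree {n k ℓ m : ℕ} {J : Finset (Fin n)} {T : SimpleGraph (Fin k)}
    {P : Finset (Sym2 (Fin k))} {φ : Fin k ↪ Fin n} {w : Sym2 (Fin k) → ℕ → Fin n}
    {S : Multiset (Sym2 (Fin n))} (h : IsDecomposition J ℓ T P φ w S) (hT : IsRigidPairing m T P)
    (v : Fin k) : φ v ∈ support S := by
  obtain ⟨u, hu⟩ := exists_adj_of_isTree hT.isTree hT.two_le v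
  exact mem_support.2 ⟨s(φ v, φ u), h.mem_iff.2 (Or.inl (mk_mem_treeEdges.2 hu)),
    Sym2.mem_mk_left _ _⟩

theorem exists_isLeaf {k : ℕ} {T : SimpleGraph (Fin k)} (hT : T.IsTree) (hk : 2 ≤ k) :
    ∃ v, IsLeaf T v := by
  obtain ⟨u, hu⟩ := exists_adj_of_isTree hT hk ⟨0, by omega⟩
  obtain ⟨a, b, -, -, -, ha, -⟩ := exists_leaf_path hT.isAcyclic hu
  exact ⟨a, ha⟩

section

variable {n k ℓ m : ℕ} {J : Bool → Finset (Fin n)} {T : SimpleGraph (Fin k)}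
  {P : Finset (Sym2 (Fin k))} {φ : Bool → Fin k ↪ Fin n} {w : Bool → Sym2 (Fin k) → ℕ → Fin n}
  {S : Bool → Multiset (Sym2 (Fin n))}

/-- In the forest obtained by cutting all paths of two copies once, the two cut copies are
connected, so that the paths between the leaves of one tree run inside the other copy. -/
theorem goodPair_of_isAcyclic (h : ∀ b, IsDecomposition (J b) ℓ T P (φ b) (w b) (S b))
    (hT : IsRigidPairing m T P) (hℓ : 2 ≤ ℓ) {t : Bool → Sym2 (Fin k) → ℕ}
    (ht : ∀ b, IsCut ℓ T P (φ b) (w b) (t b))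
    (hpriv : ∀ b, ∀ a ∈ P, s(w b a (t b a), w b a (t b a + 1)) ∉ S (!b))
    (hU : (cutGraph P (w false) (S false) (t false) ⊔
      cutGraph P (w true) (S true) (t true)).IsAcyclic)
    (hleaf : ∀ b, IsNonoverlapping ℓ P (φ b) (w b) → ∀ v, IsLeaf T v →
      φ b v ∈ support (S (!b)))
    (hne : (support (S false) ∩ support (S true)).Nonempty) :
    GoodPair (J false) (J true) ℓ T P (S false) (S true) := by
  set K : Bool → SimpleGraph (Fin n) := fun b => cutGraph P (w b) (S b) (t b) with hKdef
  set U := K false ⊔ K true with hUdef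
  have hKU : ∀ b, K b ≤ U := by
    intro b
    cases b
    · exact le_sup_left
    · exact le_sup_right
  have hKa : ∀ b, (K b).IsAcyclic := fun b => hU.anti (hKU b)
  have hnon : ∀ b, IsNonoverlapping ℓ P (φ b) (w b) := fun b =>
    isNonoverlapping_of_isAcyclic (h b) hT (by omega) (ht b) (hKa b)
  have hk0 : 0 < k := by have := hT.two_le; omega
  have hreach : ∀ b, ∀ x ∈ support (S b), ∀ y ∈ support (S b), (K b).Reachable x y := by
    intro b x hx y hy
    obtain ⟨e, he, hxe⟩ := mem_support.1 hx
    obtain ⟨e', he', hye⟩ := mem_support.1 hy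
    exact (cutGraph_reachable (h b) (ht b) hT.isTree ⟨0, hk0⟩ he hxe).symm.trans
      (cutGraph_reachable (h b) (ht b) hT.isTree ⟨0, hk0⟩ he' hye)
  have hKS : ∀ b x y, (K b).Adj x y → s(x, y) ∈ S b := by
    intro b x y hxy
    rw [hKdef] at hxy
    simp only [cutGraph, SimpleGraph.fromEdgeSet_adj, Set.mem_ofPred_eq] at hxy
    exact hxy.1.1
  -- an edge of a tree lies on a path between two of its leaves, which belong to the other copy
  have htree : ∀ b, ∀ e ∈ treeEdges T (φ b), e ∈ S (!b) := by
    intro b e he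
    obtain ⟨x, y, hxy, rfl⟩ := exists_of_mem_treeEdges he
    obtain ⟨u, v, p, hp, hmem, hu, hv⟩ := exists_leaf_path hT.isTree.isAcyclic hxy
    have hle : T.map (φ b) ≤ K b := map_le_cutGraph (h b) (ht b)
    let f : T →g K b := (SimpleGraph.Hom.ofLE hle).comp (SimpleGraph.Embedding.map (φ b) T).toHom
    have hf : ∀ z, f z = φ b z := fun z => rfl
    have hfinj : Function.Injective f := (φ b).injective
    have hpath : (p.map f).IsPath := (SimpleGraph.Walk.isPath_map_iff_of_injective hfinj).2 hp
    have h2 := edges_mem_of_isAcyclic hU (hKU b) (hKU (!b)) (p.map f) hpath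
      (hreach (!b) _ (hleaf b (hnon b) u hu) _ (hleaf b (hnon b) v hv)) s(φ b x, φ b y) (by
        rw [SimpleGraph.Walk.edges_map]
        exact List.mem_map.2 ⟨s(x, y), hmem, rfl⟩)
    exact hKS _ _ _ h2
  refine ⟨φ false, w false, φ true, w true, h false, hnon false, h true, hnon true, ?_, ?_, ?_⟩
  · have hverts : ∀ b, ∀ x, x ∈ (underlying (S b)).verts ↔ x ∈ support (S b) := fun b x => by
      rw [mem_support]; rfl
    have hmemS : ∀ x y, (underlying (S false) ⊓ underlying (S true)).Adj x y → U.Adj x y := by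
      rintro x y ⟨⟨hxy, h1⟩, -, h2⟩
      refine hKU false ?_
      simp only [hKdef, cutGraph, SimpleGraph.fromEdgeSet_adj, Set.mem_ofPred_eq]
      exact ⟨⟨h1, fun a ha heq => hpriv false a ha (heq ▸ h2)⟩, hxy⟩
    have : Nonempty (underlying (S false) ⊓ underlying (S true)).verts := by
      obtain ⟨x, hx⟩ := hne
      rw [Finset.mem_inter] at hx
      exact ⟨⟨x, (hverts _ _).2 hx.1, (hverts _ _).2 hx.2⟩⟩
    refine ⟨⟨?_⟩, ?_⟩
    · rintro ⟨x, hx1, hx2⟩ ⟨y, hy1, hy2⟩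
      rw [hverts] at hx1 hx2 hy1 hy2
      obtain ⟨p⟩ := inf_reachable_of_isAcyclic hU (hKU false) (hKU true)
        (hreach false x hx1 y hy1) (hreach true x hx2 y hy2)
      have key : ∀ {x y : Fin n} (p : (K false ⊓ K true).Walk x y)
          (hx : x ∈ (underlying (S false) ⊓ underlying (S true)).verts)
          (hy : y ∈ (underlying (S false) ⊓ underlying (S true)).verts),
          (underlying (S false) ⊓ underlying (S true)).coe.Reachable ⟨x, hx⟩ ⟨y, hy⟩ := by
        intro x y p
        induction p with
        | nil => intro hx hy; exact SimpleGraph.Reachable.refl _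
        | cons hadj p ih =>
          rename_i a b c
          intro hx hy
          have hab : (underlying (S false) ⊓ underlying (S true)).Adj a b :=
            ⟨⟨hadj.1.ne, hKS _ _ _ hadj.1⟩, ⟨hadj.2.ne, hKS _ _ _ hadj.2⟩⟩
          have hb := hab.snd_mem
          refine SimpleGraph.Reachable.trans (SimpleGraph.Adj.reachable ?_) (ih hb hy)
          exact hab
      exact key p _ _
    · let f : (underlying (S false) ⊓ underlying (S true)).coe →g U :=
        ⟨Subtype.val, fun {a b} hab => hmemS _ _ hab⟩
      exact hU.comap f Subtype.val_injective
  all_goals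
    constructor
    · rintro x ⟨e, he, hx⟩
      first
        | exact ⟨⟨e, (h false).mem_iff.2 (Or.inl he), hx⟩, ⟨e, htree false e he, hx⟩⟩
        | exact ⟨⟨e, htree true e he, hx⟩, ⟨e, (h true).mem_iff.2 (Or.inl he), hx⟩⟩
    · rintro x y ⟨hxy, he⟩
      first
        | exact ⟨⟨hxy, (h false).mem_iff.2 (Or.inl he)⟩, ⟨hxy, htree false _ he⟩⟩
        | exact ⟨⟨hxy, htree true _ he⟩, ⟨hxy, (h true).mem_iff.2 (Or.inl he)⟩⟩

theorem edgeSet_fromEdgeSet_ncard {n : ℕ} (A : Finset (Sym2 (Fin n)))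
    (hA : ∀ e ∈ A, ¬ e.IsDiag) :
    (SimpleGraph.fromEdgeSet (A : Set (Sym2 (Fin n)))).edgeSet.ncard = A.card := by
  rw [SimpleGraph.edgeSet_fromEdgeSet, ← Set.ncard_coe_finset]
  congr 1
  ext e
  simp only [Set.mem_sdiff, Finset.mem_coe]
  exact ⟨fun h => h.1, fun h => ⟨h, hA e h⟩⟩

/-- If all paths are needed, a bad pair has at least as many edges as vertices and paths. -/
theorem card_support_add_le_of_isCut
    (h : ∀ b, IsDecomposition (J b) ℓ T P (φ b) (w b) (S b))
    (hT : IsRigidPairing m T P) (hℓ : 2 ≤ ℓ) {t : Bool → Sym2 (Fin k) → ℕ}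
    (ht : ∀ b, IsCut ℓ T P (φ b) (w b) (t b))
    (hpriv : ∀ b, ∀ a ∈ P, s(w b a (t b a), w b a (t b a + 1)) ∉ S (!b))
    (hleaf : ∀ b, IsNonoverlapping ℓ P (φ b) (w b) → ∀ v, IsLeaf T v →
      φ b v ∈ support (S (!b)))
    (hbad : ¬ GoodPair (J false) (J true) ℓ T P (S false) (S true)) :
    (support (S false + S true)).card + 2 * m ≤ (S false + S true).toFinset.card := by
  set K : Bool → SimpleGraph (Fin n) := fun b => cutGraph P (w b) (S b) (t b) with hKdef
  have hk0 : 0 < k := by have := hT.two_le; omega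
  -- the edges which are cut
  let D : Bool → Finset (Sym2 (Fin n)) := fun b => P.image fun a =>
    s(w b a (t b a), w b a (t b a + 1))
  have hDS : ∀ b, D b ⊆ (S b).toFinset := by
    intro b e he
    obtain ⟨a, ha, rfl⟩ := Finset.mem_image.1 he
    rw [Multiset.mem_toFinset]
    exact (h b).mem_iff.2 (Or.inr ⟨a, ha, t b a, (ht b).lt a ha, rfl⟩)
  have hDS' : ∀ b, ∀ e ∈ D b, e ∉ S (!b) := by
    intro b e he
    obtain ⟨a, ha, rfl⟩ := Finset.mem_image.1 he
    exact hpriv b a ha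
  have hDcard : ∀ b, (D b).card = m := by
    intro b
    rw [Finset.card_image_of_injOn, hT.isPairing.card_eq]
    intro a ha a' ha' heq
    by_contra hne
    exact (ht b).ne_path a ha a' ha' hne _ ((ht b).lt a' ha') heq
  have hKeq : ∀ b, K b = SimpleGraph.fromEdgeSet
      (((S b).toFinset \ D b : Finset (Sym2 (Fin n))) : Set (Sym2 (Fin n))) := by
    intro b
    simp only [hKdef, cutGraph]
    congr 1
    ext e
    simp only [Set.mem_ofPred_eq, Finset.coe_sdiff, Set.mem_sdiff, Finset.mem_coe,
      Multiset.mem_toFinset, D, Finset.mem_image, not_exists, not_and]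
    exact and_congr_right fun _ => forall_congr' fun a => forall_congr' fun _ =>
      ⟨fun h1 h2 => h1 h2.symm, fun h1 h2 => h1 h2.symm⟩
  have hKcard : ∀ b, (K b).edgeSet.ncard = ((S b).toFinset \ D b).card := by
    intro b
    rw [hKeq, edgeSet_fromEdgeSet_ncard]
    intro e he
    rw [Finset.mem_sdiff, Multiset.mem_toFinset] at he
    exact (h b).not_isDiag he.1
  have hKcard' : ∀ b, (K b).edgeSet.ncard + m = (S b).toFinset.card := by
    intro b
    rw [hKcard, ← hDcard b]
    exact Finset.card_sdiff_add_card_eq_card (hDS b)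
  have hreach : ∀ b, ∀ x ∈ support (S b), (K b).Reachable (φ b ⟨0, hk0⟩) x := by
    intro b x hx
    obtain ⟨e, he, hxe⟩ := mem_support.1 hx
    exact cutGraph_reachable (h b) (ht b) hT.isTree ⟨0, hk0⟩ he hxe
  rw [support_add]
  by_cases hne : (support (S false) ∩ support (S true)).Nonempty
  -- the copies meet: the union of the cut copies is connected, and not a forest
  · set U := K false ⊔ K true with hUdef
    have hUcard : U.edgeSet.ncard + 2 * m = (S false + S true).toFinset.card := by
      have h1 : U = SimpleGraph.fromEdgeSet
          (((S false + S true).toFinset \ (D false ∪ D true) : Finset (Sym2 (Fin n))) :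
            Set (Sym2 (Fin n))) := by
        rw [hUdef, hKeq, hKeq, ← SimpleGraph.fromEdgeSet_union]
        congr 1
        ext e
        have h1 := hDS' false e
        have h2 := hDS' true e
        simp only [Set.mem_union, Finset.mem_coe, Finset.mem_sdiff, Finset.mem_union,
          Multiset.toFinset_add, Multiset.mem_toFinset, Bool.not_false, Bool.not_true] at h1 h2 ⊢
        tauto
      rw [h1, edgeSet_fromEdgeSet_ncard]
      · have h2 : D false ∪ D true ⊆ (S false + S true).toFinset := by
          rw [Multiset.toFinset_add]
          exact Finset.union_subset_union (hDS false) (hDS true)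
        have h3 : Disjoint (D false) (D true) := by
          rw [Finset.disjoint_left]
          intro e he he'
          have := hDS true he'
          rw [Multiset.mem_toFinset] at this
          exact hDS' false e he this
        have h4 := Finset.card_sdiff_add_card_eq_card h2
        rw [Finset.card_union_of_disjoint h3, hDcard, hDcard] at h4
        omega
      · intro e he
        rw [Finset.mem_sdiff, Multiset.mem_toFinset, Multiset.mem_add] at he
        rcases he.1 with h1 | h1
        · exact (h false).not_isDiag h1
        · exact (h true).not_isDiag h1
    have hUreach : ∀ x ∈ support (S false) ∪ support (S true),
        U.Reachable (φ false ⟨0, hk0⟩) x := by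
      obtain ⟨y, hy⟩ := hne
      rw [Finset.mem_inter] at hy
      intro x hx
      rw [Finset.mem_union] at hx
      rcases hx with hx | hx
      · exact (hreach false x hx).mono le_sup_left
      · exact ((hreach false y hy.1).mono le_sup_left).trans
          (((hreach true y hy.2).symm.trans (hreach true x hx)).mono le_sup_right)
    by_contra hlt
    have hac : U.IsAcyclic := isAcyclic_of_card _ _ hUreach (by omega)
    exact hbad (goodPair_of_isAcyclic h hT hℓ ht hpriv hac hleaf hne)
  -- disjoint copies: neither of the cut copies is a forest, since the leaves of the tree would be
  -- vertices of degree one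
  · have hdisj : Disjoint (support (S false)) (support (S true)) := by
      rw [Finset.disjoint_iff_inter_eq_empty]
      exact Finset.not_nonempty_iff_eq_empty.1 hne
    have hside : ∀ b, (support (S b)).card ≤ (K b).edgeSet.ncard := by
      intro b
      by_contra hlt
      have hac : (K b).IsAcyclic := isAcyclic_of_card _ _ (hreach b) (by omega)
      have hnon := isNonoverlapping_of_isAcyclic (h b) hT (by omega) (ht b) hac
      obtain ⟨v, hv⟩ := exists_isLeaf hT.isTree hT.two_le
      have h1 := hleaf b hnon v hv
      have h2 := mem_support_of_tree (h b) hT v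
      refine hne ⟨φ b v, ?_⟩
      rw [Finset.mem_inter]
      cases b
      · exact ⟨h2, h1⟩
      · exact ⟨h1, h2⟩
    have hE : (S false + S true).toFinset.card =
        (S false).toFinset.card + (S true).toFinset.card := by
      rw [Multiset.toFinset_add, Finset.card_union_of_disjoint]
      rw [Finset.disjoint_left]
      intro e he he'
      rw [Multiset.mem_toFinset] at he he'
      induction e with
      | _ x y =>
        exact hne ⟨x, Finset.mem_inter.2 ⟨mem_support.2 ⟨_, he, Sym2.mem_mk_left _ _⟩,
          mem_support.2 ⟨_, he', Sym2.mem_mk_left _ _⟩⟩⟩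
    rw [Finset.card_union_of_disjoint hdisj, hE, ← hKcard', ← hKcard']
    have h1 := hside false
    have h2 := hside true
    omega

/-- The excess of the union of a bad pair of copies with a nonzero moment: `r` is the number of
paths which may be dropped without losing edges. -/
theorem exists_excess (h : ∀ b, IsDecomposition (J b) ℓ T P (φ b) (w b) (S b))
    (hT : IsRigidPairing m T P) (hℓ : 2 ≤ ℓ) (lam ε s : ℝ)
    (hne : pairMoment n lam ε s (S false) (S true) ≠ 0)
    (hbad : ¬ GoodPair (J false) (J true) ℓ T P (S false) (S true)) :
    ∃ r ≤ 2 * m, (r = 0 → (support (S false + S true)).card + 2 * m ≤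
        (S false + S true).toFinset.card) ∧
      (support (S false + S true)).card + 2 * m ≤ (S false + S true).toFinset.card + r + 2 ∧
      (S false + S true).toFinset.card + r * ℓ ≤ 2 * (k - 1 + ℓ * m) := by
  have hk0 : 0 < k := by have := hT.two_le; omega
  have hleaf : ∀ b, IsNonoverlapping ℓ P (φ b) (w b) → ∀ v, IsLeaf T v →
      φ b v ∈ support (S (!b)) := by
    intro b hnon v hv
    by_contra hmem
    rw [mem_support] at hmem
    push Not at hmem
    have h1 := pairMoment_eq_zero_of_leaf lam ε s hnon (h b) hT hℓ
      (fun e he => (h (!b)).not_isDiag he) hv hmem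
    cases b
    · exact hne h1.1
    · exact hne h1.2
  set B : Finset (Sym2 (Fin n)) :=
    (treeEdges T (φ false)).toFinset ∪ (treeEdges T (φ true)).toFinset with hB
  set Q : Finset (Bool × Sym2 (Fin k)) := Finset.univ ×ˢ P with hQ
  set pe : Bool × Sym2 (Fin k) → Finset (Sym2 (Fin n)) :=
    fun i => (pathEdges ℓ (w i.1 i.2)).toFinset with hpe
  have hBmem : ∀ b, ∀ e ∈ treeEdges T (φ b), e ∈ B := by
    intro b e he
    rw [hB, Finset.mem_union, Multiset.mem_toFinset, Multiset.mem_toFinset]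
    cases b
    · exact Or.inl he
    · exact Or.inr he
  have hQmem : ∀ {b a}, (b, a) ∈ Q ↔ a ∈ P := by
    intro b a
    simp [hQ]
  have hpemem : ∀ {b a e}, e ∈ pe (b, a) ↔ ∃ t < ℓ, s(w b a t, w b a (t + 1)) = e := by
    intro b a e
    simp only [hpe, Multiset.mem_toFinset, mem_pathEdges]
  obtain ⟨R, hRQ, hRU, hR⟩ := exists_minimal_cover B Q pe
  have hUeq : (S false + S true).toFinset = B ∪ R.biUnion pe := by
    rw [hRU]
    ext e
    rw [Multiset.mem_toFinset, Multiset.mem_add, (h false).mem_iff, (h true).mem_iff,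
      Finset.mem_union, Finset.mem_biUnion]
    constructor
    · rintro ((h1 | ⟨a, ha, ht⟩) | (h1 | ⟨a, ha, ht⟩))
      · exact Or.inl (hBmem false e h1)
      · exact Or.inr ⟨(false, a), hQmem.2 ha, hpemem.2 ht⟩
      · exact Or.inl (hBmem true e h1)
      · exact Or.inr ⟨(true, a), hQmem.2 ha, hpemem.2 ht⟩
    · rintro (h1 | ⟨⟨b, a⟩, ha, ht⟩)
      · rw [hB, Finset.mem_union, Multiset.mem_toFinset, Multiset.mem_toFinset] at h1
        exact h1.elim (fun h1 => Or.inl (Or.inl h1)) (fun h1 => Or.inr (Or.inl h1))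
      · have h2 := hpemem.1 ht
        have h3 := hQmem.1 ha
        cases b
        · exact Or.inl (Or.inr ⟨a, h3, h2⟩)
        · exact Or.inr (Or.inr ⟨a, h3, h2⟩)
  -- every path in `R` has an edge which lies neither on a tree nor on another path of `R`
  have hpriv : ∀ i : Bool × Sym2 (Fin k), ∃ t, i ∈ R → t < ℓ ∧
      s(w i.1 i.2 t, w i.1 i.2 (t + 1)) ∉ B ∧ ∀ j ∈ R, j ≠ i →
        s(w i.1 i.2 t, w i.1 i.2 (t + 1)) ∉ pe j := by
    intro i
    by_cases hi : i ∈ R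
    · obtain ⟨e, he, heB, hej⟩ := hR i hi
      obtain ⟨t, ht, rfl⟩ := hpemem.1 he
      exact ⟨t, fun _ => ⟨ht, heB, hej⟩⟩
    · exact ⟨0, fun hi' => absurd hi' hi⟩
  choose t ht using hpriv
  have hQcard : Q.card = 2 * m := by
    rw [hQ, Finset.card_product, hT.isPairing.card_eq]
    rfl
  have hRcard : R.card ≤ 2 * m := hQcard ▸ Finset.card_le_card hRQ
  have hUnot : ∀ e ∈ (S false + S true).toFinset, ¬ e.IsDiag := by
    intro e he
    rw [Multiset.mem_toFinset, Multiset.mem_add] at he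
    rcases he with h1 | h1
    · exact (h false).not_isDiag h1
    · exact (h true).not_isDiag h1
  refine ⟨2 * m - R.card, by omega, ?_, ?_, ?_⟩
  · intro h0
    have hRQ' : R = Q := Finset.eq_of_subset_of_card_le hRQ (by omega)
    refine card_support_add_le_of_isCut h hT hℓ (t := fun b a => t (b, a)) (fun b => ?_) ?_
      hleaf hbad
    · have hmem : ∀ a ∈ P, (b, a) ∈ R := fun a ha => hRQ' ▸ hQmem.2 ha
      refine ⟨fun a ha => (ht _ (hmem a ha)).1, fun a ha h1 => ?_, fun a ha a' ha' hne i hi heq => ?_⟩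
      · exact (ht _ (hmem a ha)).2.1 (hBmem b _ h1)
      · exact (ht _ (hmem a ha)).2.2 _ (hmem a' ha') (fun heq => hne (congrArg Prod.snd heq).symm)
          (hpemem.2 ⟨i, hi, heq.symm⟩)
    · intro b a ha hmem
      have hmemR : ∀ b, ∀ a ∈ P, (b, a) ∈ R := fun b a ha => hRQ' ▸ hQmem.2 ha
      rcases (h (!b)).mem_iff.1 hmem with h1 | ⟨a', ha', i, hi, h1⟩
      · exact (ht _ (hmemR b a ha)).2.1 (hBmem _ _ h1)
      · exact (ht _ (hmemR b a ha)).2.2 _ (hmemR (!b) a' ha') (by simp)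
          (hpemem.2 ⟨i, hi, h1⟩)
  · -- remove a private edge of every path which is needed
    set D : Finset (Sym2 (Fin n)) := R.image fun i =>
      s(w i.1 i.2 (t i), w i.1 i.2 (t i + 1)) with hD
    have hDU : D ⊆ (S false + S true).toFinset := by
      intro e he
      obtain ⟨i, hi, rfl⟩ := Finset.mem_image.1 he
      rw [hUeq, Finset.mem_union, Finset.mem_biUnion]
      exact Or.inr ⟨i, hi, hpemem.2 ⟨t i, (ht i hi).1, rfl⟩⟩
    have hDcard : D.card = R.card := by
      refine Finset.card_image_of_injOn ?_
      intro i hi j hj heq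
      by_contra hne
      exact (ht i hi).2.2 j hj (Ne.symm hne) (hpemem.2 ⟨t j, (ht j hj).1, heq.symm⟩)
    set G := SimpleGraph.fromEdgeSet
      (((S false + S true).toFinset \ D : Finset (Sym2 (Fin n))) : Set (Sym2 (Fin n))) with hG
    have hGcard : G.edgeSet.ncard + R.card = (S false + S true).toFinset.card := by
      rw [hG, edgeSet_fromEdgeSet_ncard _ fun e he => hUnot e (Finset.mem_sdiff.1 he).1, ← hDcard]
      exact Finset.card_sdiff_add_card_eq_card hDU
    have hGadj : ∀ x y, s(x, y) ∈ (S false + S true).toFinset → s(x, y) ∉ D → G.Adj x y := by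
      intro x y h1 h2
      rw [hG, SimpleGraph.fromEdgeSet_adj]
      refine ⟨Finset.mem_coe.2 (Finset.mem_sdiff.2 ⟨h1, h2⟩), fun heq => hUnot _ h1 ?_⟩
      rw [heq]
      exact Sym2.mk_isDiag_iff.2 rfl
    have hBU : ∀ e ∈ B, e ∈ (S false + S true).toFinset := fun e he => by
      rw [hUeq]
      exact Finset.mem_union_left _ he
    have hBD : ∀ e ∈ B, e ∉ D := by
      intro e he hD'
      obtain ⟨i, hi, rfl⟩ := Finset.mem_image.1 hD'
      exact (ht i hi).2.1 he
    have htreeG : ∀ b, ∀ x y, G.Reachable (φ b x) (φ b y) := by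
      intro b x y
      have hle : T.map (φ b) ≤ G := by
        intro p q hpq
        obtain ⟨-, u, v, huv, rfl, rfl⟩ := hpq
        have := hBmem b _ (mk_mem_treeEdges.2 huv)
        exact hGadj _ _ (hBU _ this) (hBD _ this)
      exact (map_reachable hT.isTree ⟨x, rfl⟩ ⟨y, rfl⟩).mono hle
    have hpathadj : ∀ i ∈ R, ∀ j < ℓ, j ≠ t i →
        G.Adj (w i.1 i.2 j) (w i.1 i.2 (j + 1)) := by
      intro i hi j hj hne
      have haP : i.2 ∈ P := hQmem.1 (show (i.1, i.2) ∈ Q from hRQ hi)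
      refine hGadj _ _ ?_ ?_
      · rw [hUeq, Finset.mem_union, Finset.mem_biUnion]
        exact Or.inr ⟨i, hi, hpemem.2 ⟨j, hj, rfl⟩⟩
      · intro hmem
        obtain ⟨i', hi', heq⟩ := Finset.mem_image.1 hmem
        by_cases hii : i' = i
        · subst hii
          exact hne ((h i'.1).path_edge_inj_same haP (ht i' hi').1 hj heq).symm
        · exact (ht i' hi').2.2 i hi (Ne.symm hii) (hpemem.2 ⟨j, hj, heq.symm⟩)
    have hpathG : ∀ i ∈ R, ∀ j ≤ ℓ, G.Reachable (φ i.1 ⟨0, hk0⟩) (w i.1 i.2 j) := by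
      intro i hi j hj
      have haP : i.2 ∈ P := hQmem.1 (show (i.1, i.2) ∈ Q from hRQ hi)
      obtain ⟨u, v, -, h1, h2⟩ := (h i.1).exists_endpoints haP
      by_cases hjt : j ≤ t i
      · have := htreeG i.1 ⟨0, hk0⟩ u
        rw [← h1] at this
        exact this.trans (reachable_of_steps (Nat.zero_le j) fun a _ ha =>
          hpathadj i hi a (by have := (ht i hi).1; omega) (by omega))
      · have := htreeG i.1 ⟨0, hk0⟩ v
        rw [← h2] at this
        exact this.trans (reachable_of_steps hj fun a ha ha' =>
          hpathadj i hi a ha' (by omega)).symm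
    -- every vertex is still connected to one of the two trees
    have hall : ∀ x ∈ support (S false + S true),
        G.Reachable (φ false ⟨0, hk0⟩) x ∨ G.Reachable (φ true ⟨0, hk0⟩) x := by
      intro x hx
      obtain ⟨e, he, hxe⟩ := mem_support.1 hx
      suffices hb : ∃ b, G.Reachable (φ b ⟨0, hk0⟩) x by
        obtain ⟨b, hb⟩ := hb
        cases b
        · exact Or.inl hb
        · exact Or.inr hb
      rw [← Multiset.mem_toFinset, hUeq, Finset.mem_union, Finset.mem_biUnion] at he
      rcases he with he | ⟨i, hi, he⟩
      · have : ∃ b, e ∈ treeEdges T (φ b) := by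
          rw [hB, Finset.mem_union, Multiset.mem_toFinset, Multiset.mem_toFinset] at he
          exact he.elim (fun h1 => ⟨_, h1⟩) (fun h1 => ⟨_, h1⟩)
        obtain ⟨b, hb⟩ := this
        obtain ⟨p, q, -, rfl⟩ := exists_of_mem_treeEdges hb
        rw [Sym2.mem_iff] at hxe
        rcases hxe with rfl | rfl
        · exact ⟨b, htreeG _ _ _⟩
        · exact ⟨b, htreeG _ _ _⟩
      · obtain ⟨j, hj, rfl⟩ := hpemem.1 he
        rw [Sym2.mem_iff] at hxe
        rcases hxe with rfl | rfl
        · exact ⟨i.1, hpathG i hi j hj.le⟩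
        · exact ⟨i.1, hpathG i hi (j + 1) hj⟩
    have := card_le_of_reachable_two G _ _ _ hall
    omega
  · have h1 : B.card ≤ 2 * (k - 1) := by
      refine (Finset.card_union_le _ _).trans ?_
      have h2 := fun b => Multiset.toFinset_card_le (treeEdges T (φ b))
      have h3 := h2 false
      have h4 := h2 true
      rw [treeEdges_card hT.isTree] at h3 h4
      omega
    have h2 : (R.biUnion pe).card ≤ R.card * ℓ := by
      refine Finset.card_biUnion_le_card_mul _ _ _ fun i _ => ?_
      refine (Multiset.toFinset_card_le _).trans ?_
      simp [pathEdges]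
    have h3 : (S false + S true).toFinset.card ≤ 2 * (k - 1) + R.card * ℓ := by
      rw [hUeq]
      exact (Finset.card_union_le _ _).trans (add_le_add h1 h2)
    have h4 : R.card * ℓ + (2 * m - R.card) * ℓ = 2 * (ℓ * m) := by
      rw [← add_mul, show R.card + (2 * m - R.card) = 2 * m by omega]
      ring
    omega

end

/-! ### Listing the vertices of a pair of copies -/

/-- The list of the vertices of two copies: first the images of the vertices of the trees, then the
vertices of the paths; the two copies alternate. -/
def vertexList {n k : ℕ} (m ℓ : ℕ) (d : Fin n) (q : ℕ → Sym2 (Fin k)) (φ : Bool → Fin k ↪ Fin n)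
    (w : Bool → Sym2 (Fin k) → ℕ → Fin n) (i : ℕ) : Fin n :=
  if i < 2 * k then
    if h : i.div2 < k then φ i.bodd ⟨i.div2, h⟩ else d
  else if i < 2 * k + 2 * m * (ℓ + 1) then
    w ((i - 2 * k) / (ℓ + 1)).bodd (q ((i - 2 * k) / (ℓ + 1)).div2) ((i - 2 * k) % (ℓ + 1))
  else d

/-- The exceptional vertices of a list of vertices and paths: the listed vertices, and all vertices
with at least three neighbours on the paths. -/
def exceptional {n : ℕ} (c R ℓ : ℕ) (x : ℕ → Fin n) : Finset (Fin n) :=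
  (Finset.range c).image x ∪ Finset.univ.filter fun y => ∃ a b d,
    Revealed c R ℓ x (c + R * (ℓ + 1)) y a ∧ Revealed c R ℓ x (c + R * (ℓ + 1)) y b ∧
    Revealed c R ℓ x (c + R * (ℓ + 1)) y d ∧ a ≠ b ∧ a ≠ d ∧ b ≠ d

theorem exists_enumeration {k m : ℕ} (hk : 0 < k) (P : Finset (Sym2 (Fin k))) (hP : P.card = m) :
    ∃ q : ℕ → Sym2 (Fin k), (∀ a < m, q a ∈ P) ∧ ∀ e ∈ P, ∃ a < m, q a = e := by
  refine ⟨fun a => if h : a < m then (P.equivFinOfCardEq hP).symm ⟨a, h⟩ else s(⟨0, hk⟩, ⟨0, hk⟩),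
    fun a ha => ?_, fun e he => ?_⟩
  · simp only [dif_pos ha]
    exact Subtype.coe_prop _
  · refine ⟨P.equivFinOfCardEq hP ⟨e, he⟩, Fin.is_lt _, ?_⟩
    simp

theorem bit_lt_two_mul {b : Bool} {a m : ℕ} : Nat.bit b a < 2 * m ↔ a < m := by
  cases b <;> (simp [Nat.bit]; try omega)

theorem div2_lt_of_lt_two_mul {i m : ℕ} (h : i < 2 * m) : i.div2 < m := by
  rw [Nat.div2_val]
  omega

section

variable {n k ℓ m : ℕ} {d : Fin n} {q : ℕ → Sym2 (Fin k)} {φ : Bool → Fin k ↪ Fin n}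
  {w : Bool → Sym2 (Fin k) → ℕ → Fin n}

theorem vertexList_head {i : ℕ} (hi : i < 2 * k) :
    vertexList m ℓ d q φ w i = φ i.bodd ⟨i.div2, div2_lt_of_lt_two_mul hi⟩ := by
  rw [vertexList, if_pos hi, dif_pos (div2_lt_of_lt_two_mul hi)]

theorem vertexList_bit (b : Bool) (v : Fin k) :
    vertexList m ℓ d q φ w (Nat.bit b v) = φ b v := by
  rw [vertexList_head (bit_lt_two_mul.2 v.is_lt)]
  simp

theorem vertexList_pathPos {j t : ℕ} (hj : j < 2 * m) (ht : t ≤ ℓ) :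
    vertexList m ℓ d q φ w (pathPos (2 * k) ℓ j t) = w j.bodd (q j.div2) t := by
  have h1 : ¬ pathPos (2 * k) ℓ j t < 2 * k := by unfold pathPos; omega
  rw [vertexList, if_neg h1, if_pos (pathPos_lt hj ht)]
  have h2 : pathPos (2 * k) ℓ j t - 2 * k = t + (ℓ + 1) * j := by
    unfold pathPos
    rw [mul_comm j]
    omega
  rw [h2, Nat.add_mul_div_left _ _ (Nat.succ_pos ℓ), Nat.add_mul_mod_self_left,
    Nat.div_eq_of_lt (Nat.lt_succ_of_le ht), Nat.mod_eq_of_lt (Nat.lt_succ_of_le ht), zero_add]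

theorem vertexList_of_le {i : ℕ} (hi : 2 * k + 2 * m * (ℓ + 1) ≤ i) :
    vertexList m ℓ d q φ w i = d := by
  have : 0 ≤ 2 * m * (ℓ + 1) := Nat.zero_le _
  rw [vertexList, if_neg (by omega), if_neg (by omega)]

variable {J : Bool → Finset (Fin n)} {T : SimpleGraph (Fin k)} {P : Finset (Sym2 (Fin k))}
  {S : Bool → Multiset (Sym2 (Fin n))}

theorem revealed_vertexList {i : ℕ} {y a : Fin n}
    (h : Revealed (2 * k) (2 * m) ℓ (vertexList m ℓ d q φ w) i y a) :
    ∃ b j t, j < m ∧ t < ℓ ∧ s(y, a) = s(w b (q j) t, w b (q j) (t + 1)) := by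
  obtain ⟨j, t, hj, ht, -, h1⟩ := h
  rw [vertexList_pathPos hj ht.le, vertexList_pathPos hj (by omega)] at h1
  refine ⟨j.bodd, j.div2, t, div2_lt_of_lt_two_mul hj, ht, ?_⟩
  rw [Sym2.eq_iff]
  rcases h1 with ⟨h1, h2⟩ | ⟨h1, h2⟩
  · exact Or.inl ⟨h1.symm, h2.symm⟩
  · exact Or.inr ⟨h2.symm, h1.symm⟩

theorem revealed_mem (h : ∀ b, IsDecomposition (J b) ℓ T P (φ b) (w b) (S b))
    (hq : ∀ a < m, q a ∈ P) {i : ℕ} {y a : Fin n}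
    (hr : Revealed (2 * k) (2 * m) ℓ (vertexList m ℓ d q φ w) i y a) :
    s(y, a) ∈ (S false + S true).toFinset := by
  obtain ⟨b, j, t, hj, ht, heq⟩ := revealed_vertexList hr
  rw [heq, Multiset.mem_toFinset, Multiset.mem_add]
  have : s(w b (q j) t, w b (q j) (t + 1)) ∈ S b :=
    (h b).mem_iff.2 (Or.inr ⟨q j, hq j hj, t, ht, rfl⟩)
  cases b
  · exact Or.inl this
  · exact Or.inr this

/-- The vertex list of a pair of copies is a path system, so that such pairs can be counted by
sequential exposure. -/
theorem isPathSystem_vertexList (hℓ : 1 ≤ ℓ)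
    (h : ∀ b, IsDecomposition (J b) ℓ T P (φ b) (w b) (S b)) (hq : ∀ a < m, q a ∈ P) :
    IsPathSystem (2 * k) (2 * m) ℓ (vertexList m ℓ d q φ w)
      (exceptional (2 * k) (2 * m) ℓ (vertexList m ℓ d q φ w)) := by
  have htree : ∀ b v, φ b v ∈ exceptional (2 * k) (2 * m) ℓ (vertexList m ℓ d q φ w) := by
    intro b v
    refine Finset.mem_union_left _ (Finset.mem_image.2 ⟨Nat.bit b v, ?_, vertexList_bit b v⟩)
    exact Finset.mem_range.2 (bit_lt_two_mul.2 v.is_lt)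
  have hend : ∀ j < 2 * m, ∀ t, t = 0 ∨ t = ℓ → vertexList m ℓ d q φ w (pathPos (2 * k) ℓ j t) ∈
      exceptional (2 * k) (2 * m) ℓ (vertexList m ℓ d q φ w) := by
    intro j hj t ht
    rw [vertexList_pathPos hj (by omega)]
    obtain ⟨u, -, hu⟩ := (h j.bodd).exists_of_endpoint (hq _ (div2_lt_of_lt_two_mul hj)) ht
    rw [hu]
    exact htree _ _
  refine ⟨fun i hi => ?_, fun j hj => hend j hj 0 (Or.inl rfl),
    fun j hj => hend j hj ℓ (Or.inr rfl), fun j hj t ht t' ht' heq => ?_, ?_⟩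
  · rw [vertexList_head hi]
    exact htree _ _
  · rw [Set.mem_Iic] at ht ht'
    simp only [vertexList_pathPos hj ht, vertexList_pathPos hj ht'] at heq
    exact (h j.bodd).selfAvoiding _ (hq _ (div2_lt_of_lt_two_mul hj)) ht ht' heq
  · intro y hy a b e ha hb he
    by_contra hcon
    push Not at hcon
    refine hy (Finset.mem_union_right _ (Finset.mem_filter.2 ⟨Finset.mem_univ _, a, b, e, ha, hb,
      he, hcon.1, hcon.2.1, hcon.2.2⟩))

theorem image_vertexList (h : ∀ b, IsDecomposition (J b) ℓ T P (φ b) (w b) (S b))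
    (hT : IsRigidPairing m T P) (hℓ : 1 ≤ ℓ) (hq : ∀ a < m, q a ∈ P)
    (hq' : ∀ e ∈ P, ∃ a < m, q a = e) :
    (Finset.range (2 * k + 2 * m * (ℓ + 1))).image (vertexList m ℓ d q φ w) =
      support (S false + S true) := by
  have hS : ∀ b, ∀ x ∈ support (S b), x ∈ support (S false + S true) := by
    intro b x hx
    rw [support_add, Finset.mem_union]
    cases b
    · exact Or.inl hx
    · exact Or.inr hx
  ext x
  rw [Finset.mem_image]
  constructor
  · rintro ⟨i, hi, rfl⟩
    rw [Finset.mem_range] at hi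
    by_cases hi2 : i < 2 * k
    · rw [vertexList_head hi2]
      exact hS _ _ (mem_support_of_tree (h _) hT _)
    · obtain ⟨j, t, hj, ht, rfl⟩ := exists_pathPos (by omega) hi
      rw [vertexList_pathPos hj ht]
      refine hS j.bodd _ (mem_support.2 ?_)
      have hmem := hq _ (div2_lt_of_lt_two_mul hj)
      rcases ht.lt_or_eq with ht | rfl
      · exact ⟨_, (h _).mem_iff.2 (Or.inr ⟨_, hmem, t, ht, rfl⟩), Sym2.mem_mk_left _ _⟩
      · refine ⟨_, (h _).mem_iff.2 (Or.inr ⟨_, hmem, t - 1, by omega, rfl⟩), ?_⟩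
        rw [Nat.sub_add_cancel hℓ]
        exact Sym2.mem_mk_right _ _
  · intro hx
    have : ∃ b, x ∈ support (S b) := by
      rw [support_add, Finset.mem_union] at hx
      exact hx.elim (fun h => ⟨_, h⟩) (fun h => ⟨_, h⟩)
    obtain ⟨b, hx⟩ := this
    obtain ⟨e, he, hxe⟩ := mem_support.1 hx
    have htree : ∀ v, ∃ i ∈ Finset.range (2 * k + 2 * m * (ℓ + 1)),
        vertexList m ℓ d q φ w i = φ b v := by
      intro v
      refine ⟨Nat.bit b v, Finset.mem_range.2 ?_, vertexList_bit b v⟩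
      have := (bit_lt_two_mul (b := b)).2 v.is_lt
      omega
    rcases (h b).mem_iff.1 he with h1 | ⟨a, ha, t, ht, rfl⟩
    · obtain ⟨u, v, -, rfl⟩ := exists_of_mem_treeEdges h1
      rw [Sym2.mem_iff] at hxe
      rcases hxe with rfl | rfl
      · exact htree _
      · exact htree _
    · obtain ⟨j, hj, rfl⟩ := hq' a ha
      have hpath : ∀ t ≤ ℓ, ∃ i ∈ Finset.range (2 * k + 2 * m * (ℓ + 1)),
          vertexList m ℓ d q φ w i = w b (q j) t := by
        intro t ht
        have hb := (bit_lt_two_mul (b := b)).2 hj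
        refine ⟨pathPos (2 * k) ℓ (Nat.bit b j) t, Finset.mem_range.2 (pathPos_lt hb ht), ?_⟩
        rw [vertexList_pathPos hb ht]
        simp
      rw [Sym2.mem_iff] at hxe
      rcases hxe with rfl | rfl
      · exact hpath t ht.le
      · exact hpath (t + 1) ht

/-- The handshake bound for the number of exceptional vertices. -/
theorem card_exceptional_le (h : ∀ b, IsDecomposition (J b) ℓ T P (φ b) (w b) (S b))
    (hq : ∀ a < m, q a ∈ P) :
    (exceptional (2 * k) (2 * m) ℓ (vertexList m ℓ d q φ w)).card +
        2 * (support (S false + S true)).card ≤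
      4 * k + 2 * (S false + S true).toFinset.card := by
  set x := vertexList m ℓ d q φ w
  set U := (S false + S true).toFinset with hU
  set Z : Finset (Fin n) := Finset.univ.filter fun y => ∃ a b d,
    Revealed (2 * k) (2 * m) ℓ x (2 * k + 2 * m * (ℓ + 1)) y a ∧
    Revealed (2 * k) (2 * m) ℓ x (2 * k + 2 * m * (ℓ + 1)) y b ∧
    Revealed (2 * k) (2 * m) ℓ x (2 * k + 2 * m * (ℓ + 1)) y d ∧ a ≠ b ∧ a ≠ d ∧ b ≠ d with hZ
  set H : Finset (Fin n) := (Finset.range (2 * k)).image x with hH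
  have hHcard : H.card ≤ 2 * k := by
    simpa using Finset.card_image_le (s := Finset.range (2 * k)) (f := x)
  have hHmem : ∀ b v, φ b v ∈ H := fun b v => Finset.mem_image.2 ⟨Nat.bit b v,
    Finset.mem_range.2 (bit_lt_two_mul.2 v.is_lt), vertexList_bit b v⟩
  have hcard : (exceptional (2 * k) (2 * m) ℓ x).card ≤ H.card + Z.card := Finset.card_union_le _ _
  have hUdiag : ∀ e ∈ U, ¬ e.IsDiag := by
    intro e he
    rw [hU, Multiset.mem_toFinset, Multiset.mem_add] at he
    rcases he with h1 | h1
    · exact (h false).not_isDiag h1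
    · exact (h true).not_isDiag h1
  have hSU : ∀ b, ∀ e ∈ S b, e ∈ U := by
    intro b e he
    rw [hU, Multiset.mem_toFinset, Multiset.mem_add]
    cases b
    · exact Or.inl he
    · exact Or.inr he
  set dg : Fin n → ℕ := fun y => (U.filter fun e => y ∈ e).card with hdg
  have hsum : ∑ y, dg y = 2 * U.card := by
    have h1 : ∑ y, dg y = ∑ e ∈ U, (Finset.univ.filter fun y => y ∈ e).card := by
      simp only [hdg, Finset.card_filter]
      exact Finset.sum_comm
    rw [h1, Finset.sum_const_nat (m := 2), mul_comm]
    intro e he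
    rw [← Sym2.card_toFinset_of_not_isDiag e (hUdiag e he)]
    congr 1
    ext y
    simp
  have hZsub : Z ⊆ support (S false + S true) := by
    intro y hy
    obtain ⟨-, a, -, -, ha, -⟩ := Finset.mem_filter.1 hy
    have := revealed_mem h hq ha
    exact mem_support.2 ⟨s(y, a), Multiset.mem_toFinset.1 this, Sym2.mem_mk_left _ _⟩
  have hpoint : ∀ y ∈ support (S false + S true),
      2 + (if y ∈ Z then 1 else 0) ≤ dg y + (if y ∈ H then 1 else 0) := by
    intro y hy
    by_cases hyZ : y ∈ Z
    · rw [if_pos hyZ]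
      obtain ⟨-, a, b, c, ha, hb, hc, hab, hac, hbc⟩ := Finset.mem_filter.1 hyZ
      have h3 : ({s(y, a), s(y, b), s(y, c)} : Finset (Sym2 (Fin n))) ⊆
          U.filter fun e => y ∈ e := by
        intro e he
        simp only [Finset.mem_insert, Finset.mem_singleton] at he
        rw [Finset.mem_filter]
        rcases he with rfl | rfl | rfl
        · exact ⟨revealed_mem h hq ha, Sym2.mem_mk_left _ _⟩
        · exact ⟨revealed_mem h hq hb, Sym2.mem_mk_left _ _⟩
        · exact ⟨revealed_mem h hq hc, Sym2.mem_mk_left _ _⟩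
      have h4 : ({s(y, a), s(y, b), s(y, c)} : Finset (Sym2 (Fin n))).card = 3 := by
        rw [Finset.card_eq_three]
        refine ⟨_, _, _, ?_, ?_, ?_, rfl⟩ <;> rw [Ne, Sym2.congr_right] <;> assumption
      have := Finset.card_le_card h3
      simp only [hdg]
      omega
    · rw [if_neg hyZ]
      obtain ⟨e, he, hye⟩ := mem_support.1 hy
      have hb : ∃ b, e ∈ S b := by
        rw [Multiset.mem_add] at he
        exact he.elim (fun h => ⟨_, h⟩) (fun h => ⟨_, h⟩)
      obtain ⟨b, hb⟩ := hb
      by_cases hyH : y ∈ H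
      · rw [if_pos hyH]
        have : 0 < dg y := Finset.card_pos.2 ⟨e, Finset.mem_filter.2 ⟨hSU b e hb, hye⟩⟩
        omega
      · rw [if_neg hyH]
        -- a vertex outside of the trees is interior to a path
        have hint : ∃ a ∈ P, ∃ t, 0 < t ∧ t < ℓ ∧ y = w b a t := by
          rcases (h b).mem_iff.1 hb with h1 | ⟨a, ha, t, ht, rfl⟩
          · obtain ⟨u, v, -, rfl⟩ := exists_of_mem_treeEdges h1
            rw [Sym2.mem_iff] at hye
            rcases hye with rfl | rfl
            · exact absurd (hHmem _ _) hyH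
            · exact absurd (hHmem _ _) hyH
          · have hends : ∀ t, t = 0 ∨ t = ℓ → y ≠ w b a t := by
              rintro t ht rfl
              obtain ⟨u, -, hu⟩ := (h b).exists_of_endpoint ha ht
              exact hyH (hu ▸ hHmem _ _)
            rw [Sym2.mem_iff] at hye
            rcases hye with rfl | rfl
            · exact ⟨a, ha, t, Nat.pos_of_ne_zero fun h0 => hends t (Or.inl h0) rfl, ht, rfl⟩
            · exact ⟨a, ha, t + 1, Nat.succ_pos t,
                lt_of_le_of_ne ht fun h0 => hends (t + 1) (Or.inr h0) rfl, rfl⟩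
        obtain ⟨a, ha, t, ht0, ht, rfl⟩ := hint
        have h1 : s(w b a t, w b a (t + 1)) ∈ S b := (h b).mem_iff.2 (Or.inr ⟨a, ha, t, ht, rfl⟩)
        have h2 : s(w b a (t - 1), w b a (t - 1 + 1)) ∈ S b :=
          (h b).mem_iff.2 (Or.inr ⟨a, ha, t - 1, by omega, rfl⟩)
        have hne : s(w b a t, w b a (t + 1)) ≠ s(w b a (t - 1), w b a (t - 1 + 1)) := by
          intro heq
          have := (h b).path_edge_inj_same ha ht (by omega) heq
          omega
        have h3 : ({s(w b a t, w b a (t + 1)), s(w b a (t - 1), w b a (t - 1 + 1))} :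
            Finset (Sym2 (Fin n))) ⊆ U.filter fun e => w b a t ∈ e := by
          intro e he
          simp only [Finset.mem_insert, Finset.mem_singleton] at he
          rw [Finset.mem_filter]
          rcases he with rfl | rfl
          · exact ⟨hSU b _ h1, Sym2.mem_mk_left _ _⟩
          · refine ⟨hSU b _ h2, ?_⟩
            rw [Nat.sub_add_cancel ht0]
            exact Sym2.mem_mk_right _ _
        have h4 := Finset.card_le_card h3
        rw [Finset.card_pair hne] at h4
        simp only [hdg]
        omega
  have h1 := Finset.sum_le_sum hpoint
  rw [Finset.sum_add_distrib, Finset.sum_add_distrib, Finset.sum_const, smul_eq_mul,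
    ← Finset.card_filter, ← Finset.card_filter, Finset.filter_mem_eq_inter,
    Finset.inter_eq_right.2 hZsub] at h1
  have h2 : ∑ y ∈ support (S false + S true), dg y ≤ 2 * U.card := by
    rw [← hsum]
    exact Finset.sum_le_univ_sum_of_nonneg fun _ => Nat.zero_le _
  have h3 : ((support (S false + S true)).filter fun y => y ∈ H).card ≤ H.card := by
    refine Finset.card_le_card fun y hy => (Finset.mem_filter.1 hy).2
  omega

/-- The vertex list determines the pair of copies. -/
theorem eq_of_vertexList_eq {φ' : Bool → Fin k ↪ Fin n} {w' : Bool → Sym2 (Fin k) → ℕ → Fin n}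
    {S' : Bool → Multiset (Sym2 (Fin n))}
    (h : ∀ b, IsDecomposition (J b) ℓ T P (φ b) (w b) (S b))
    (h' : ∀ b, IsDecomposition (J b) ℓ T P (φ' b) (w' b) (S' b))
    (hq : ∀ e ∈ P, ∃ a < m, q a = e)
    (heq : vertexList m ℓ d q φ w = vertexList m ℓ d q φ' w') : S = S' := by
  funext b
  have h1 : φ b = φ' b := by
    ext v
    rw [← vertexList_bit (m := m) (ℓ := ℓ) (d := d) (q := q) (w := w) b v, heq, vertexList_bit]
  rw [(h b).edges, (h' b).edges, h1]
  congr 1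
  refine Finset.sum_congr rfl fun e he => ?_
  obtain ⟨j, hj, rfl⟩ := hq e he
  have key : ∀ t ≤ ℓ, w b (q j) t = w' b (q j) t := by
    intro t ht
    have h2 := congrFun heq (pathPos (2 * k) ℓ (Nat.bit b j) t)
    rw [vertexList_pathPos (bit_lt_two_mul.2 hj) ht, vertexList_pathPos (bit_lt_two_mul.2 hj) ht]
      at h2
    simpa using h2
  unfold pathEdges
  refine Multiset.map_congr rfl fun t ht => ?_
  rw [Multiset.mem_range] at ht
  rw [key t ht.le, key (t + 1) ht]

end

/-! ### The contribution of the bad pairs -/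

/-- The normalisation `(1 - p) ^ M` is at least `1 / 2`, since `M * p` is small. -/
theorem momLin_pow_le {n : ℕ} {lam ε s : ℝ} {M : ℕ} (h : SmallDensity n lam ε s M) :
    momLin n lam ε s 1 0 ^ (2 * M) ≤ 2 * (ε ^ 2 * lam * s / n) ^ M := by
  have hp := h.p_pos
  have h5 := h.p_le_fifth
  have hε := h.ε_pos
  rw [pow_mul, h.momLin_one_zero_sq, div_pow]
  have h1 : (1 : ℝ) / 2 ≤ (1 - lam * s / n) ^ M := by
    have h2 := one_add_mul_le_pow (a := -(lam * s / n)) (by linarith) M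
    have h3 := h.mul_le
    have h4 : 1 + -(lam * s / (n : ℝ)) = 1 - lam * s / n := by ring
    rw [h4] at h2
    linarith
  have h2 : ε ^ 2 * lam * s / n = ε ^ 2 * (lam * s / n) := by ring
  rw [h2, div_le_iff₀ (by linarith)]
  have h3 : 0 ≤ (ε ^ 2 * (lam * s / n)) ^ M := by positivity
  nlinarith

section

variable {n k ℓ m : ℕ} {T : SimpleGraph (Fin k)} {P : Finset (Sym2 (Fin k))}

/-- The base of the entropy factor of the path systems: `2 * L ^ 2`, where `L` is the length of the
vertex list. -/
def entropyBase (k m ℓ : ℕ) : ℝ := 2 * ((2 * k + 2 * m * (ℓ + 1) : ℕ) : ℝ) ^ 2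

/-- The contribution of one bad pair: an excess of edges over vertices, or a long overlap, makes up
for the number of ways to arrange the two copies. -/
theorem pairMoment_le_of_bad {lam ε s : ℝ} (hd : SmallDensity n lam ε s (k - 1 + ℓ * m))
    {J : Bool → Finset (Fin n)} {φ : Bool → Fin k ↪ Fin n} {w : Bool → Sym2 (Fin k) → ℕ → Fin n}
    {S : Bool → Multiset (Sym2 (Fin n))} {d : Fin n} {q : ℕ → Sym2 (Fin k)}
    (h : ∀ b, IsDecomposition (J b) ℓ T P (φ b) (w b) (S b))
    (hT : IsRigidPairing m T P) (hℓ : 2 ≤ ℓ) (hq : ∀ a < m, q a ∈ P)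
    (hKn : entropyBase k m ℓ ^ (8 * m) ≤ n)
    (hg1 : Real.exp 1 ≤ ε ^ 2 * lam * s)
    (hg : (n : ℝ) ^ 3 ≤ (ε ^ 2 * lam * s / Real.exp 1) ^ ℓ)
    (hbad : ¬ GoodPair (J false) (J true) ℓ T P (S false) (S true)) :
    pairMoment n lam ε s (S false) (S true) ≤
      2 * (ε ^ 2 * lam * s / n) ^ (k - 1 + ℓ * m) *
        ((n : ℝ) ^ (2 * (k - 1 + ℓ * m)) / n ^ (2 * m)) *
        entropyBase k m ℓ ^ (2 * k + 4 * m + 4 * m * (4 * k + 4 * m)) *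
      (((n : ℝ)⁻¹) ^ (support (S false + S true)).card *
        ((entropyBase k m ℓ)⁻¹) ^ (2 * k + 2 * (2 * m) + 2 * (2 * m) *
          (exceptional (2 * k) (2 * m) ℓ (vertexList m ℓ d q φ w)).card)) := by
  set K := entropyBase k m ℓ with hK
  set M := k - 1 + ℓ * m with hM
  set g := ε ^ 2 * lam * s with hgdef
  have hn1 : (1 : ℝ) ≤ n := by exact_mod_cast hd.n_pos
  have hn0 : (0 : ℝ) < n := by linarith
  have he0 := Real.exp_pos 1
  have hg0 : 0 < g := he0.trans_le hg1
  have hG1 : 1 ≤ g / Real.exp 1 := (one_le_div he0).2 hg1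
  have hK1 : 1 ≤ K := by
    have h1 : (1 : ℝ) ≤ ((2 * k + 2 * m * (ℓ + 1) : ℕ) : ℝ) := by
      have := hT.two_le
      exact_mod_cast (by omega : 1 ≤ 2 * k + 2 * m * (ℓ + 1))
    rw [hK, entropyBase]
    nlinarith
  have hK0 : 0 < K := by linarith
  by_cases hne : pairMoment n lam ε s (S false) (S true) = 0
  · rw [hne]
    positivity
  obtain ⟨r, hr2, hr0, hr1, hrE⟩ := exists_excess h hT hℓ lam ε s hne hbad
  have hD := card_exceptional_le (d := d) h hq
  set D := exceptional (2 * k) (2 * m) ℓ (vertexList m ℓ d q φ w)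
  set v := (support (S false + S true)).card
  set E := (S false + S true).toFinset.card with hE
  rw [← hM] at hrE
  have hEM : E ≤ 2 * M := le_trans (Nat.le_add_right _ _) hrE
  have hPM := pairMoment_le_crude hd ((h false).card_eq hT) ((h true).card_eq hT) (by
    intro e he
    rw [Multiset.mem_add] at he
    exact he.elim (h false).not_isDiag (h true).not_isDiag)
  rw [← hE] at hPM
  set G := g / Real.exp 1 with hG
  have hG0 : 0 < G := by linarith
  have hratio : Real.exp 1 / (ε ^ 2 * (lam * s / n)) = n / G := by
    rw [hG, hgdef]
    have := hd.ε_pos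
    have := hd.lam_pos
    have := hd.s_pos
    field_simp
  rw [hratio] at hPM
  -- `y` is the excess: every unit of it allows two more exceptional vertices and comes with a spare
  -- factor `n`; a path without edges of its own saves `ℓ` edges, which is worth `G ^ ℓ ≥ n ^ 3`
  obtain ⟨y, hDy, hny⟩ : ∃ y : ℕ, D.card ≤ 4 * k + 4 * m + 2 * y ∧
      (n : ℝ) ^ (v + 2 * m + y) ≤ n ^ E * G ^ (2 * M - E) := by
    rcases Nat.eq_zero_or_pos r with rfl | hrpos
    · have h1 := hr0 rfl
      refine ⟨E - (v + 2 * m), by omega, ?_⟩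
      rw [show v + 2 * m + (E - (v + 2 * m)) = E by omega]
      exact le_mul_of_one_le_right (by positivity) (one_le_pow₀ hG1)
    · refine ⟨E + r + 2 - (v + 2 * m), by omega, ?_⟩
      rw [show v + 2 * m + (E + r + 2 - (v + 2 * m)) = E + (r + 2) by omega, pow_add]
      refine mul_le_mul_of_nonneg_left ?_ (by positivity)
      calc (n : ℝ) ^ (r + 2) ≤ n ^ (3 * r) := pow_le_pow_right₀ hn1 (by omega)
        _ = (n ^ 3) ^ r := pow_mul _ _ _
        _ ≤ (G ^ ℓ) ^ r := pow_le_pow_left₀ (by positivity) hg r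
        _ = G ^ (ℓ * r) := (pow_mul _ _ _).symm
        _ ≤ G ^ (2 * M - E) := pow_le_pow_right₀ hG1 (by
            have := mul_comm ℓ r
            omega)
  set b0 := 2 * k + 4 * m + 4 * m * (4 * k + 4 * m) with hb0
  have hKy : K ^ (2 * k + 2 * (2 * m) + 2 * (2 * m) * D.card) ≤ K ^ b0 * n ^ y := by
    calc K ^ (2 * k + 2 * (2 * m) + 2 * (2 * m) * D.card) ≤ K ^ (b0 + 8 * m * y) := by
          refine pow_le_pow_right₀ hK1 ?_
          have : 2 * (2 * m) * D.card ≤ 4 * m * (4 * k + 4 * m + 2 * y) := by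
            rw [show 2 * (2 * m) = 4 * m by ring]
            exact Nat.mul_le_mul_left _ hDy
          have h2 : 4 * m * (4 * k + 4 * m + 2 * y) = 4 * m * (4 * k + 4 * m) + 8 * m * y := by ring
          omega
      _ = K ^ b0 * (K ^ (8 * m)) ^ y := by rw [pow_add, ← pow_mul]
      _ ≤ K ^ b0 * n ^ y := by gcongr
  have hmain : (n : ℝ) ^ (2 * M - E) / G ^ (2 * M - E) * (n ^ (2 * m) * n ^ v *
      K ^ (2 * k + 2 * (2 * m) + 2 * (2 * m) * D.card)) ≤ n ^ (2 * M) * K ^ b0 := by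
    calc (n : ℝ) ^ (2 * M - E) / G ^ (2 * M - E) * (n ^ (2 * m) * n ^ v *
          K ^ (2 * k + 2 * (2 * m) + 2 * (2 * m) * D.card))
        ≤ (n : ℝ) ^ (2 * M - E) / G ^ (2 * M - E) * (n ^ (2 * m) * n ^ v * (K ^ b0 * n ^ y)) := by
          gcongr
      _ = (n : ℝ) ^ (2 * M - E) / G ^ (2 * M - E) * n ^ (v + 2 * m + y) * K ^ b0 := by ring
      _ ≤ (n : ℝ) ^ (2 * M - E) / G ^ (2 * M - E) * (n ^ E * G ^ (2 * M - E)) * K ^ b0 := by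
          gcongr
      _ = (n : ℝ) ^ (2 * M - E + E) * K ^ b0 := by
          rw [pow_add (n : ℝ) (2 * M - E) E]
          field_simp
      _ = n ^ (2 * M) * K ^ b0 := by rw [Nat.sub_add_cancel hEM]
  have hpos : 0 < (n : ℝ) ^ (2 * m) * n ^ v *
      K ^ (2 * k + 2 * (2 * m) + 2 * (2 * m) * D.card) := by positivity
  calc pairMoment n lam ε s (S false) (S true)
      ≤ momLin n lam ε s 1 0 ^ (2 * M) * (n / G) ^ (2 * M - E) := hPM
    _ ≤ 2 * (g / n) ^ M * (n / G) ^ (2 * M - E) := by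
        gcongr
        exact momLin_pow_le hd
    _ = 2 * (g / n) ^ M * ((n : ℝ) ^ (2 * M - E) / G ^ (2 * M - E)) := by
        rw [div_pow (n : ℝ) G]
    _ ≤ 2 * (g / n) ^ M * (n ^ (2 * M) * K ^ b0 / (n ^ (2 * m) * n ^ v *
          K ^ (2 * k + 2 * (2 * m) + 2 * (2 * m) * D.card))) := by
        refine mul_le_mul_of_nonneg_left ?_ (by positivity)
        rw [le_div_iff₀ hpos]
        exact hmain
    _ = _ := by
        have key : ∀ a b c d e f : ℝ, 2 * a * (b * c / (d * e * f)) =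
            2 * a * (b / d) * c * (e⁻¹ * f⁻¹) := by
          intros
          simp only [div_eq_mul_inv, mul_inv]
          ring
        rw [inv_pow, inv_pow]
        exact key _ _ _ _ _ _

/-- The contribution of all bad pairs: compared with the good ones, it loses a factor `n`, up to the
entropy of the path systems. -/
theorem sum_bad_le {lam ε s : ℝ} (hd : SmallDensity n lam ε s (k - 1 + ℓ * m))
    (hT : IsRigidPairing m T P) (hℓ : 2 ≤ ℓ) (J₁ J₂ : Finset (Fin n))
    (hKn : entropyBase k m ℓ ^ (8 * m) ≤ n)
    (hg1 : Real.exp 1 ≤ ε ^ 2 * lam * s)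
    (hg : (n : ℝ) ^ 3 ≤ (ε ^ 2 * lam * s / Real.exp 1) ^ ℓ) :
    ∑ S₁ ∈ copies J₁ ℓ T P, ∑ S₂ ∈ copies J₂ ℓ T P,
        pairMoment n lam ε s S₁ S₂ * (if GoodPair J₁ J₂ ℓ T P S₁ S₂ then 0 else 1) ≤
      6 * (ε ^ 2 * lam * s / n) ^ (k - 1 + ℓ * m) *
        ((n : ℝ) ^ (2 * (k - 1 + ℓ * m)) / n ^ (2 * m)) *
        entropyBase k m ℓ ^ (2 * k + 4 * m + 4 * m * (4 * k + 4 * m)) := by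
  have hk := hT.two_le
  obtain ⟨q, hq, hq'⟩ := exists_enumeration (by omega : 0 < k) P hT.isPairing.card_eq
  let d : Fin n := ⟨0, hd.n_pos⟩
  let J : Bool → Finset (Fin n) := fun b => bif b then J₂ else J₁
  let S : Multiset (Sym2 (Fin n)) × Multiset (Sym2 (Fin n)) → Bool → Multiset (Sym2 (Fin n)) :=
    fun p b => bif b then p.2 else p.1
  set A : Finset (Multiset (Sym2 (Fin n)) × Multiset (Sym2 (Fin n))) :=
    (copies J₁ ℓ T P ×ˢ copies J₂ ℓ T P).filter fun p => ¬ GoodPair J₁ J₂ ℓ T P p.1 p.2 with hA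
  -- list the vertices of every bad pair, and count the lists by sequential exposure
  have hdec : ∀ p, ∃ x : ℕ → Fin n, p ∈ A → ∃ φ w,
      (∀ b, IsDecomposition (J b) ℓ T P (φ b) (w b) (S p b)) ∧ x = vertexList m ℓ d q φ w := by
    intro p
    by_cases hp : p ∈ A
    · rw [hA, Finset.mem_filter, Finset.mem_product] at hp
      have h1 : ∀ b, ∃ φ w, IsDecomposition (J b) ℓ T P φ w (S p b) := by
        intro b
        cases b
        · have h1 := hp.1.1
          rwa [copies, Set.Finite.mem_toFinset] at h1
        · have h1 := hp.1.2
          rwa [copies, Set.Finite.mem_toFinset] at h1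
      choose φ w h using h1
      exact ⟨_, fun _ => ⟨φ, w, h, rfl⟩⟩
    · exact ⟨fun _ => d, fun h => absurd h hp⟩
  choose x hx using hdec
  have hinj : Set.InjOn x A := by
    intro p hp p' hp' heq
    obtain ⟨φ, w, h, h1⟩ := hx p hp
    obtain ⟨φ', w', h', h1'⟩ := hx p' hp'
    have := eq_of_vertexList_eq h h' hq' (h1.symm.trans (heq.trans h1'))
    exact Prod.ext (congrFun this false) (congrFun this true)
  have hkraft := sum_pathSystem_le (c := 2 * k) (R := 2 * m) (ℓ := ℓ) d (by omega) (A.image x)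
    (by
      intro y hy i hi
      obtain ⟨p, hp, rfl⟩ := Finset.mem_image.1 hy
      obtain ⟨φ, w, -, h1⟩ := hx p hp
      rw [h1, vertexList_of_le hi]) (exceptional (2 * k) (2 * m) ℓ) (by
      intro y hy
      obtain ⟨p, hp, rfl⟩ := Finset.mem_image.1 hy
      obtain ⟨φ, w, h, h1⟩ := hx p hp
      rw [h1]
      exact isPathSystem_vertexList (by omega) h hq)
  rw [Finset.sum_image hinj, Fintype.card_fin] at hkraft
  set C : ℝ := 2 * (ε ^ 2 * lam * s / n) ^ (k - 1 + ℓ * m) *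
    ((n : ℝ) ^ (2 * (k - 1 + ℓ * m)) / n ^ (2 * m)) *
      entropyBase k m ℓ ^ (2 * k + 4 * m + 4 * m * (4 * k + 4 * m)) with hC
  have hC0 : 0 ≤ C := by
    have := hd.ε_pos
    have := hd.lam_pos
    have := hd.s_pos
    rw [hC, entropyBase]
    positivity
  calc ∑ S₁ ∈ copies J₁ ℓ T P, ∑ S₂ ∈ copies J₂ ℓ T P,
        pairMoment n lam ε s S₁ S₂ * (if GoodPair J₁ J₂ ℓ T P S₁ S₂ then 0 else 1)
      = ∑ p ∈ A, pairMoment n lam ε s p.1 p.2 := by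
        rw [hA, Finset.sum_filter, Finset.sum_product]
        refine Finset.sum_congr rfl fun S₁ _ => Finset.sum_congr rfl fun S₂ _ => ?_
        by_cases hgood : GoodPair J₁ J₂ ℓ T P S₁ S₂ <;> simp [hgood]
    _ ≤ ∑ p ∈ A, C * ((n : ℝ)⁻¹ ^ ((Finset.range (2 * k + 2 * m * (ℓ + 1))).image (x p)).card *
          ((2 * ((2 * k + 2 * m * (ℓ + 1) : ℕ) : ℝ) ^ 2)⁻¹) ^ (2 * k + 2 * (2 * m) +
            2 * (2 * m) * (exceptional (2 * k) (2 * m) ℓ (x p)).card)) := by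
        refine Finset.sum_le_sum fun p hp => ?_
        obtain ⟨φ, w, h, h1⟩ := hx p hp
        have hbad := (Finset.mem_filter.1 hp).2
        have h2 := pairMoment_le_of_bad (d := d) hd h hT hℓ hq hKn hg1 hg hbad
        rw [← image_vertexList (d := d) h hT (by omega) hq hq'] at h2
        rw [h1]
        exact h2
    _ ≤ C * 3 := by
        rw [← Finset.mul_sum]
        refine mul_le_mul_of_nonneg_left ?_ hC0
        refine le_of_eq_of_le (Finset.sum_congr rfl fun p _ => ?_) hkraft
        congr!
    _ = _ := by rw [hC]; ring

end

/-! ### Rigidity of nonoverlapping copies -/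

section

variable {n k ℓ m : ℕ} {J : Finset (Fin n)} {T : SimpleGraph (Fin k)} {P : Finset (Sym2 (Fin k))}
  {φ φ' : Fin k ↪ Fin n} {w w' : Sym2 (Fin k) → ℕ → Fin n} {S S' : Multiset (Sym2 (Fin n))}

/-- The neighbours of an interior vertex of a path are its neighbours on the path. -/
theorem IsNonoverlapping.eq_of_interior (hn : IsNonoverlapping ℓ P φ w)
    (h : IsDecomposition J ℓ T P φ w S) {a : Sym2 (Fin k)} (ha : a ∈ P) {t : ℕ} (ht0 : 0 < t)
    (ht : t < ℓ) {z : Fin n} (hz : s(w a t, z) ∈ S) : z = w a (t - 1) ∨ z = w a (t + 1) := by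
  rcases h.mem_iff.1 hz with h1 | ⟨a', ha', i, hi, heq⟩
  · obtain ⟨u, v, -, heq⟩ := exists_of_mem_treeEdges h1
    rw [Sym2.eq_iff] at heq
    rcases heq with ⟨h2, -⟩ | ⟨h2, -⟩
    · exact absurd h2 (hn.path_tree a ha t ht0 ht _)
    · exact absurd h2 (hn.path_tree a ha t ht0 ht _)
  · have key : ∀ j ≤ ℓ, w a' j = w a t → a' = a ∧ j = t := by
      intro j hj heq'
      have hj0 : j ≠ 0 ∧ j ≠ ℓ := by
        constructor
        · rintro rfl
          obtain ⟨u, -, hu⟩ := h.exists_of_endpoint ha' (Or.inl rfl)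
          exact hn.path_tree a ha t ht0 ht u (by rw [← heq', hu])
        · rintro rfl
          obtain ⟨u, -, hu⟩ := h.exists_of_endpoint ha' (Or.inr rfl)
          exact hn.path_tree a ha t ht0 ht u (by rw [← heq', hu])
      have haa : a' = a := by
        by_contra hne
        exact hn.path_path a' ha' a ha hne j (by omega) (by omega) t ht0 ht heq'
      subst haa
      exact ⟨rfl, h.selfAvoiding a' ha' (Set.mem_Iic.2 hj) (Set.mem_Iic.2 ht.le) heq'⟩
    rw [Sym2.eq_iff] at heq
    rcases heq with ⟨h2, h3⟩ | ⟨h2, h3⟩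
    · obtain ⟨rfl, rfl⟩ := key i hi.le h2
      exact Or.inr h3.symm
    · obtain ⟨rfl, rfl⟩ := key (i + 1) hi h3
      exact Or.inl h2.symm

/-- An end of a path lies on a single edge leading out of the tree. -/
theorem IsNonoverlapping.eq_of_end (hn : IsNonoverlapping ℓ P φ w)
    (h : IsDecomposition J ℓ T P φ w S) (hT : IsRigidPairing m T P) (hℓ : 2 ≤ ℓ)
    {a : Sym2 (Fin k)} (ha : a ∈ P) (b : Bool) {z : Fin n} (hz : s(strand ℓ w a b 0, z) ∈ S)
    (hzφ : z ∉ Set.range φ) : z = strand ℓ w a b 1 := by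
  rcases h.mem_iff.1 hz with h1 | ⟨a', ha', i, hi, heq⟩
  · obtain ⟨u, v, -, heq⟩ := exists_of_mem_treeEdges h1
    rw [Sym2.eq_iff] at heq
    rcases heq with ⟨-, h2⟩ | ⟨-, h2⟩
    · exact absurd ⟨v, h2.symm⟩ hzφ
    · exact absurd ⟨u, h2.symm⟩ hzφ
  · obtain ⟨u, hu⟩ := strand_zero_mem h ha b
    have hends : ∀ j ≤ ℓ, w a' j = strand ℓ w a b 0 → j = 0 ∨ j = ℓ := by
      intro j hj heq'
      by_contra hcon
      exact hn.path_tree a' ha' j (by omega) (by omega) u (by rw [heq', hu])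
    have hs0 : strand ℓ w a b 0 = w a (if b then ℓ else 0) := by cases b <;> simp [strand]
    rw [Sym2.eq_iff] at heq
    rcases heq with ⟨h2, h3⟩ | ⟨h2, h3⟩
    · have hi0 : i = 0 := (hends i hi.le h2).resolve_right hi.ne
      subst hi0
      rw [hs0] at h2
      obtain ⟨rfl, h4⟩ := h.endpoint_inj hT ha' ha (Or.inl rfl) (by cases b <;> simp) h2
      have hb : b = false := by
        cases b
        · rfl
        · simp only [if_true] at h4; omega
      subst hb
      rw [← h3]
      simp [strand]
    · have hi0 : i + 1 = ℓ := (hends (i + 1) hi h3).resolve_left (by omega)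
      rw [hs0, hi0] at h3
      obtain ⟨rfl, h4⟩ := h.endpoint_inj hT ha' ha (Or.inr rfl) (by cases b <;> simp) h3
      have hb : b = true := by
        cases b
        · simp only [Bool.false_eq_true, if_false] at h4; omega
        · rfl
      subst hb
      rw [← h2]
      simp only [strand, if_true]
      congr 1
      omega

/-- A path is determined by its starting point as long as it stays inside another nonoverlapping
copy. -/
theorem strand_eq_strand (h : IsDecomposition J ℓ T P φ w S)
    (h' : IsDecomposition J ℓ T P φ' w' S') (hn' : IsNonoverlapping ℓ P φ' w')
    (hT : IsRigidPairing m T P) (hℓ : 2 ≤ ℓ) {a : Sym2 (Fin k)} (ha : a ∈ P) (b : Bool)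
    (h0 : strand ℓ w a b 0 = strand ℓ w' a b 0) {t₀ : ℕ} (ht₀ : t₀ ≤ ℓ)
    (hmem : ∀ t < t₀, s(strand ℓ w a b t, strand ℓ w a b (t + 1)) ∈ S') :
    ∀ t ≤ t₀, strand ℓ w a b t = strand ℓ w' a b t := by
  intro t
  induction t using Nat.strong_induction_on with
  | _ t ih =>
    intro ht
    rcases t with _ | _ | t
    · exact h0
    -- the first step leaves the tree, and there is only one path edge to follow
    · have h1 := hmem 0 (by omega)
      rw [h0] at h1
      refine hn'.eq_of_end h' hT hℓ ha b h1 ?_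
      rintro ⟨v, hv⟩
      refine h'.tree_notMem v ?_
      rw [hv]
      cases b with
      | false => exact (h.neighbors a ha).1
      | true => exact (h.neighbors a ha).2
    -- at an interior vertex there are only two edges, and the path does not turn back
    · have h1 := ih (t + 1) (by omega) (by omega)
      have h2 := ih t (by omega) (by omega)
      have h3 := hmem (t + 1) (by omega)
      rw [h1] at h3
      have hne : strand ℓ w a b (t + 2) ≠ strand ℓ w' a b t := by
        rw [← h2]
        intro heq
        have := strand_injOn h ha b le_rfl (Set.mem_Iic.2 (by omega)) (Set.mem_Iic.2 (by omega)) heq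
        omega
      cases b with
      | false =>
        simp only [strand, Bool.false_eq_true, if_false] at h3 hne ⊢
        exact (hn'.eq_of_interior h' ha (by omega) (by omega) h3).resolve_left hne
      | true =>
        simp only [strand, if_true] at h3 hne ⊢
        have h4 := hn'.eq_of_interior h' ha (by omega) (by omega) h3
        rw [show ℓ - (t + 1) - 1 = ℓ - (t + 2) by omega,
          show ℓ - (t + 1) + 1 = ℓ - t by omega] at h4
        exact h4.resolve_right hne

theorem range_eq_of_treeEdges_eq (hT : T.IsTree) (hk : 2 ≤ k)
    (heq : treeEdges T φ = treeEdges T φ') : Set.range φ' ⊆ Set.range φ := by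
  rintro _ ⟨v, rfl⟩
  obtain ⟨u, hu⟩ := exists_adj_of_isTree hT hk v
  have h1 : s(φ' v, φ' u) ∈ treeEdges T φ := by rw [heq]; exact mk_mem_treeEdges.2 hu
  obtain ⟨x, y, -, h2⟩ := exists_of_mem_treeEdges h1
  rw [Sym2.eq_iff] at h2
  rcases h2 with ⟨h2, -⟩ | ⟨h2, -⟩
  · exact ⟨x, h2.symm⟩
  · exact ⟨y, h2.symm⟩

/-- Two embeddings of a tree with the same image differ by an automorphism. -/
theorem exists_iso_of_treeEdges_eq (hT : T.IsTree) (hk : 2 ≤ k)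
    (heq : treeEdges T φ = treeEdges T φ') : ∃ a : T ≃g T, ∀ v, φ' v = φ (a v) := by
  have h1 := range_eq_of_treeEdges_eq hT hk heq
  choose f hf using fun v => h1 ⟨v, rfl⟩
  have hinj : Function.Injective f := fun u v huv => φ'.injective (by rw [← hf, ← hf, huv])
  refine ⟨⟨Equiv.ofBijective f (Finite.injective_iff_bijective.1 hinj), ?_⟩, fun v => (hf v).symm⟩
  intro u v
  rw [Equiv.ofBijective_apply, Equiv.ofBijective_apply, ← mk_mem_treeEdges (φ := φ),
    ← mk_mem_treeEdges (φ := φ'), hf, hf, heq]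

/-- Automorphisms of the tree do not change its image. -/
theorem treeEdges_iso (a : T ≃g T) :
    treeEdges T (a.toEquiv.toEmbedding.trans φ) = treeEdges T φ := by
  refine (Multiset.Nodup.ext (treeEdges_nodup T _) (treeEdges_nodup T _)).2 fun e => ?_
  constructor
  · intro he
    obtain ⟨x, y, hxy, rfl⟩ := exists_of_mem_treeEdges he
    exact mk_mem_treeEdges.2 (a.map_adj_iff.2 hxy)
  · intro he
    obtain ⟨x, y, hxy, rfl⟩ := exists_of_mem_treeEdges he
    have h1 := mk_mem_treeEdges (φ := a.toEquiv.toEmbedding.trans φ).2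
      (a.symm.map_adj_iff.2 hxy)
    simpa using h1

/-! ### Arms -/

/-- The tree part of a copy together with the arms of length `x a b` at the ends of the paths. -/
def armEdges (ℓ : ℕ) (T : SimpleGraph (Fin k)) (P : Finset (Sym2 (Fin k))) (φ : Fin k ↪ Fin n)
    (w : Sym2 (Fin k) → ℕ → Fin n) (x : Sym2 (Fin k) → Bool → ℕ) : Finset (Sym2 (Fin n)) :=
  (treeEdges T φ).toFinset ∪ (P ×ˢ (Finset.univ : Finset Bool)).biUnion fun i =>
    (Finset.range (x i.1 i.2)).image fun t => s(strand ℓ w i.1 i.2 t, strand ℓ w i.1 i.2 (t + 1))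

theorem mem_armEdges {x : Sym2 (Fin k) → Bool → ℕ} {e : Sym2 (Fin n)} :
    e ∈ armEdges ℓ T P φ w x ↔ e ∈ treeEdges T φ ∨ ∃ a ∈ P, ∃ b, ∃ t < x a b,
      s(strand ℓ w a b t, strand ℓ w a b (t + 1)) = e := by
  simp only [armEdges, Finset.mem_union, Multiset.mem_toFinset, Finset.mem_biUnion,
    Finset.mem_product, Finset.mem_univ, and_true, Finset.mem_image, Finset.mem_range, Prod.exists]
  refine or_congr_right ⟨?_, ?_⟩
  · rintro ⟨a, b, ha, h⟩
    exact ⟨a, ha, b, h⟩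
  · rintro ⟨a, ha, b, h⟩
    exact ⟨a, b, ha, h⟩

theorem strand_edge {a : Sym2 (Fin k)} {b : Bool} {t : ℕ} (ht : t < ℓ) :
    s(strand ℓ w a b t, strand ℓ w a b (t + 1)) =
      s(w a (if b then ℓ - 1 - t else t), w a ((if b then ℓ - 1 - t else t) + 1)) := by
  cases b with
  | false => rfl
  | true =>
    simp only [strand, if_true]
    rw [Sym2.eq_swap, show ℓ - (t + 1) = ℓ - 1 - t by omega,
      show ℓ - t = ℓ - 1 - t + 1 by omega]

theorem card_armEdges (h : IsDecomposition J ℓ T P φ w S) (hn : IsNonoverlapping ℓ P φ w)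
    (hT : IsRigidPairing m T P) (hℓ : 2 ≤ ℓ) {x : Sym2 (Fin k) → Bool → ℕ}
    (hx : ∀ a ∈ P, x a false + x a true < ℓ) :
    (armEdges ℓ T P φ w x).card = k - 1 + ∑ a ∈ P, (x a false + x a true) := by
  have hlt : ∀ a ∈ P, ∀ b, ∀ t < x a b, t < ℓ := by
    intro a ha b t ht
    have := hx a ha
    cases b <;> omega
  rw [armEdges, Finset.card_union_of_disjoint, Multiset.toFinset_card_of_nodup
    (treeEdges_nodup T φ), treeEdges_card hT.isTree, Finset.card_biUnion, Finset.sum_product]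
  · congr 1
    refine Finset.sum_congr rfl fun a ha => ?_
    have : ∀ b, ((Finset.range (x a b)).image fun t =>
        s(strand ℓ w a b t, strand ℓ w a b (t + 1))).card = x a b := by
      intro b
      rw [Finset.card_image_of_injOn, Finset.card_range]
      intro t ht t' ht' heq
      have ht := hlt a ha b t (by simpa using ht)
      have ht' := hlt a ha b t' (by simpa using ht')
      simp only [strand_edge ht, strand_edge ht'] at heq
      have := (hn.path_edge_inj h hℓ ha ha (by cases b <;> simp <;> omega)
        (by cases b <;> simp <;> omega) heq).2
      cases b <;> simp at this <;> omega
    simp only [this, Fintype.sum_bool]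
    ring
  · rintro ⟨a, b⟩ hi ⟨a', b'⟩ hi' hne
    have ha : a ∈ P := (Finset.mem_product.1 hi).1
    have ha' : a' ∈ P := (Finset.mem_product.1 hi').1
    rw [Function.onFun, Finset.disjoint_left]
    intro e he he'
    obtain ⟨t, ht, rfl⟩ := Finset.mem_image.1 he
    obtain ⟨t', ht', heq⟩ := Finset.mem_image.1 he'
    rw [Finset.mem_range] at ht ht'
    dsimp only at ht ht'
    have htl := hlt a ha b t ht
    have htl' := hlt a' ha' b' t' ht'
    rw [strand_edge htl, strand_edge htl'] at heq
    obtain ⟨rfl, h2⟩ := hn.path_edge_inj h hℓ ha' ha (by cases b' <;> simp <;> omega)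
      (by cases b <;> simp <;> omega) heq
    have := hx a' ha
    cases b <;> cases b' <;> first | exact absurd rfl hne | skip
    all_goals
      simp only [if_true, Bool.false_eq_true, if_false] at h2
      omega
  · rw [Finset.disjoint_left]
    intro e he he'
    rw [Multiset.mem_toFinset] at he
    obtain ⟨⟨a, b⟩, hi, he'⟩ := Finset.mem_biUnion.1 he'
    have ha := (Finset.mem_product.1 hi).1
    obtain ⟨t, ht, rfl⟩ := Finset.mem_image.1 he'
    have htl := hlt a ha b t (Finset.mem_range.1 ht)
    rw [strand_edge htl] at he
    exact hn.path_edge_notMem hℓ ha (by cases b <;> simp <;> omega) he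

/-- A tree inside a nonoverlapping copy which contains its tree part consists of the tree part and
of arms at the ends of the paths. -/
theorem exists_arms (h : IsDecomposition J ℓ T P φ w S) (hn : IsNonoverlapping ℓ P φ w)
    (hT : IsRigidPairing m T P) (hℓ : 2 ≤ ℓ) {X : Finset (Sym2 (Fin n))}
    (hXS : ∀ e ∈ X, e ∈ S) (hX : (SimpleGraph.fromEdgeSet (X : Set (Sym2 (Fin n)))).IsAcyclic)
    (hconn : ∀ e ∈ X, ∀ y ∈ e, ∀ v, (SimpleGraph.fromEdgeSet (X : Set (Sym2 (Fin n)))).Reachable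
      y (φ v))
    (htree : ∀ e ∈ treeEdges T φ, e ∈ X) :
    ∃ x : Sym2 (Fin k) → Bool → ℕ, (∀ a ∈ P, x a false + x a true < ℓ) ∧
      X = armEdges ℓ T P φ w x := by
  set K := SimpleGraph.fromEdgeSet (X : Set (Sym2 (Fin n))) with hK
  have hKadj : ∀ x y, x ≠ y → (K.Adj x y ↔ s(x, y) ∈ X) := by
    intro x y hxy
    rw [hK, SimpleGraph.fromEdgeSet_adj]
    simp [hxy]
  have hTK : T.map φ ≤ K := by
    intro a b hab
    obtain ⟨hne, u, v, huv, rfl, rfl⟩ := hab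
    exact (hKadj _ _ hne).2 (htree _ (mk_mem_treeEdges.2 huv))
  -- no path lies completely in the tree
  have hex : ∀ a ∈ P, ∃ t, t < ℓ ∧ s(w a t, w a (t + 1)) ∉ X := by
    intro a ha
    by_contra hcon
    push Not at hcon
    have h1 := notMem_of_leave hX hTK (A := Set.range φ) (fun _ _ => map_adj_mem_range)
      (fun x hx y hy => map_reachable hT.isTree hx hy) (y := w a) (len := ℓ)
      (strand_zero_mem h ha false) (strand_one_notMem h ha false)
      (fun i hi => (hKadj _ _ (h.ne_of_ne ha hi.le hi (by omega))).2 (hcon i hi))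
      (h.selfAvoiding a ha) (j := ℓ) (by omega) le_rfl
    obtain ⟨u, -, hu⟩ := h.exists_of_endpoint ha (Or.inr rfl)
    exact h1 ⟨u, hu.symm⟩
  have hex' : ∀ a ∈ P, ∃ t, t < ℓ ∧ s(w a (ℓ - 1 - t), w a (ℓ - 1 - t + 1)) ∉ X := by
    intro a ha
    obtain ⟨t, ht, htX⟩ := hex a ha
    refine ⟨ℓ - 1 - t, by omega, ?_⟩
    rwa [show ℓ - 1 - (ℓ - 1 - t) = t by omega]
  -- the arm ends at the first missing edge, seen from the end of the path
  let x : Sym2 (Fin k) → Bool → ℕ := fun a b =>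
    if ha : a ∈ P then (if b then Nat.find (hex' a ha) else Nat.find (hex a ha)) else 0
  have hxf : ∀ a (ha : a ∈ P), x a false = Nat.find (hex a ha) := by
    intro a ha
    simp [x, ha]
  have hxt : ∀ a (ha : a ∈ P), x a true = Nat.find (hex' a ha) := by
    intro a ha
    simp [x, ha]
  refine ⟨x, fun a ha => ?_, ?_⟩
  · have h1 := Nat.find_spec (hex a ha)
    have h2 : x a true ≤ ℓ - 1 - x a false := by
      rw [hxt a ha]
      refine Nat.find_min' (hex' a ha) ⟨by omega, ?_⟩
      rw [hxf a ha, show ℓ - 1 - (ℓ - 1 - Nat.find (hex a ha)) = Nat.find (hex a ha) by omega]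
      exact h1.2
    have h3 : x a false < ℓ := by rw [hxf a ha]; exact h1.1
    omega
  · ext e
    rw [mem_armEdges]
    constructor
    · intro he
      rcases h.mem_iff.1 (hXS e he) with h1 | ⟨a, ha, t, ht, rfl⟩
      · exact Or.inl h1
      · refine Or.inr ⟨a, ha, ?_⟩
        by_cases h1 : t < x a false
        · exact ⟨false, t, h1, rfl⟩
        by_cases h2 : ℓ - 1 - t < x a true
        · refine ⟨true, ℓ - 1 - t, h2, ?_⟩
          rw [strand_edge (by omega)]
          simp only [if_true]
          rw [show ℓ - 1 - (ℓ - 1 - t) = t by omega]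
        exfalso
        -- the edge lies in a segment of the path which is cut off on both sides
        set i := x a false with hi
        set j := ℓ - 1 - x a true with hj
        have hiX : s(w a i, w a (i + 1)) ∉ X := by
          rw [hi, hxf a ha]
          exact (Nat.find_spec (hex a ha)).2
        have hxt' : x a true < ℓ := by rw [hxt a ha]; exact (Nat.find_spec (hex' a ha)).1
        have hjX : s(w a j, w a (j + 1)) ∉ X := by
          rw [hj, hxt a ha]
          exact (Nat.find_spec (hex' a ha)).2
        have hit : i < t := by
          rcases Nat.lt_or_eq_of_le (Nat.le_of_not_lt h1) with h3 | h3
          · exact h3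
          · rw [h3] at hiX; exact absurd he hiX
        have htj : t < j := by
          rcases Nat.lt_or_eq_of_le (show t ≤ j by omega) with h3 | h3
          · exact h3
          · rw [← h3] at hjX; exact absurd he hjX
        have hclosed : ∀ y z, K.Reachable y z → (∃ r, i < r ∧ r ≤ j ∧ y = w a r) →
            ∃ r, i < r ∧ r ≤ j ∧ z = w a r := by
          rintro y z ⟨p⟩
          induction p with
          | nil => exact id
          | cons hadj p ih =>
            rename_i y y' z
            rintro ⟨r, hr1, hr2, rfl⟩
            refine ih ?_
            have hmem := (hKadj _ _ hadj.ne).1 hadj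
            rcases hn.eq_of_interior h ha (by omega) (by omega) (hXS _ hmem) with h3 | h3
            · refine ⟨r - 1, ?_, by omega, h3⟩
              by_contra hcon
              refine hiX ?_
              rw [show i = r - 1 by omega, ← h3, Nat.sub_add_cancel (by omega), Sym2.eq_swap]
              exact hmem
            · refine ⟨r + 1, by omega, ?_, h3⟩
              by_contra hcon
              refine hjX ?_
              rw [show j = r by omega, ← h3]
              exact hmem
        obtain ⟨u, -, hu⟩ := h.exists_of_endpoint ha (Or.inl rfl)
        obtain ⟨r, hr1, hr2, hr⟩ := hclosed _ _ (hconn _ he (w a t) (Sym2.mem_mk_left _ _) u)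
          ⟨t, hit, htj.le, rfl⟩
        exact hn.path_tree a ha r (by omega) (by omega) u hr.symm
    · rintro (h1 | ⟨a, ha, b, t, ht, rfl⟩)
      · exact htree e h1
      · cases b with
        | false =>
          rw [hxf a ha] at ht
          have h1 := Nat.find_min (hex a ha) ht
          push Not at h1
          exact h1 (ht.trans (Nat.find_spec (hex a ha)).1)
        | true =>
          rw [hxt a ha] at ht
          have h1 := Nat.find_min (hex' a ha) ht
          push Not at h1
          have h2 := ht.trans (Nat.find_spec (hex' a ha)).1
          rw [strand_edge h2]
          exact h1 h2

end

/-! ### Good pairs and their arms -/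

section

variable {n k ℓ m : ℕ} {J : Bool → Finset (Fin n)} {T : SimpleGraph (Fin k)}
  {P : Finset (Sym2 (Fin k))} {S S' : Bool → Multiset (Sym2 (Fin n))}

/-- Nonoverlapping decompositions of two copies, whose common edges form, for both of the copies,
the tree part together with arms of lengths `x`. -/
structure ArmSystem (J : Bool → Finset (Fin n)) (ℓ : ℕ) (T : SimpleGraph (Fin k))
    (P : Finset (Sym2 (Fin k))) (S : Bool → Multiset (Sym2 (Fin n))) where
  φ : Bool → Fin k ↪ Fin n
  w : Bool → Sym2 (Fin k) → ℕ → Fin n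
  x : Bool → Sym2 (Fin k) → Bool → ℕ
  dec : ∀ b, IsDecomposition (J b) ℓ T P (φ b) (w b) (S b)
  non : ∀ b, IsNonoverlapping ℓ P (φ b) (w b)
  arm_lt : ∀ b, ∀ a ∈ P, x b a false + x b a true < ℓ
  inter : ∀ b, (S false).toFinset ∩ (S true).toFinset = armEdges ℓ T P (φ b) (w b) (x b)
  acyclic : (SimpleGraph.fromEdgeSet
    (((S false).toFinset ∩ (S true).toFinset : Finset _) : Set (Sym2 (Fin n)))).IsAcyclic

theorem isAcyclic_of_coe_isTree {V : Type*} {G : SimpleGraph V} {B : G.Subgraph}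
    (h : B.coe.IsTree) {K : SimpleGraph V} (hK : ∀ x y, K.Adj x y → B.Adj x y) :
    K.IsAcyclic := by
  rw [SimpleGraph.isAcyclic_iff_forall_isBridge]
  intro e he
  induction e with
  | _ x y =>
    rw [SimpleGraph.isBridge_iff]
    rintro ⟨p⟩
    have hxy : B.Adj x y := hK x y he
    have key : ∀ {a b : V} (p : (K.deleteEdges {s(x, y)}).Walk a b) (ha : a ∈ B.verts)
        (hb : b ∈ B.verts), (B.coe.deleteEdges {s(⟨x, hxy.fst_mem⟩, ⟨y, hxy.snd_mem⟩)}).Reachable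
          ⟨a, ha⟩ ⟨b, hb⟩ := by
      intro a b p
      induction p with
      | nil => intro _ _; exact SimpleGraph.Reachable.refl _
      | cons hadj p ih =>
        rename_i a b c
        intro ha hc
        rw [SimpleGraph.deleteEdges_adj] at hadj
        have hab := hK _ _ hadj.1
        refine SimpleGraph.Reachable.trans (SimpleGraph.Adj.reachable ?_) (ih hab.snd_mem hc)
        rw [SimpleGraph.deleteEdges_adj]
        refine ⟨hab, fun heq => hadj.2 ?_⟩
        rw [Set.mem_singleton_iff] at heq ⊢
        have := congrArg (Sym2.map Subtype.val) heq
        simpa using this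
    exact not_reachable_deleteEdges h.isAcyclic (u := ⟨x, hxy.fst_mem⟩) (v := ⟨y, hxy.snd_mem⟩) hxy
      (key p hxy.fst_mem hxy.snd_mem)

/-- The two copies of a good pair share the edges of the two trees, which need not be equal, and arms at
the ends of the paths of either copy. -/
theorem GoodPair.nonempty_armSystem
    (h : GoodPair (J false) (J true) ℓ T P (S false) (S true)) (hT : IsRigidPairing m T P)
    (hℓ : 2 ≤ ℓ) : Nonempty (ArmSystem J ℓ T P S) := by
  obtain ⟨φ₁, w₁, φ₂, w₂, h1, hn1, h2, hn2, htree, ht1, ht2⟩ := h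
  set B := underlying (S false) ⊓ underlying (S true) with hB
  set X := (S false).toFinset ∩ (S true).toFinset with hX
  set K := SimpleGraph.fromEdgeSet (X : Set (Sym2 (Fin n))) with hK
  have hXmem : ∀ e, e ∈ X ↔ e ∈ S false ∧ e ∈ S true := by
    intro e
    rw [hX, Finset.mem_inter, Multiset.mem_toFinset, Multiset.mem_toFinset]
  have hadj : ∀ x y, K.Adj x y ↔ B.Adj x y := by
    intro x y
    rw [hK, SimpleGraph.fromEdgeSet_adj, Finset.mem_coe, hXmem]
    constructor
    · rintro ⟨⟨h1, h2⟩, hne⟩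
      exact ⟨⟨hne, h1⟩, ⟨hne, h2⟩⟩
    · rintro ⟨⟨hne, h1⟩, ⟨-, h2⟩⟩
      exact ⟨⟨h1, h2⟩, hne⟩
  have hac : K.IsAcyclic := isAcyclic_of_coe_isTree htree fun x y hxy => (hadj x y).1 hxy
  have hreach : ∀ x ∈ B.verts, ∀ y ∈ B.verts, K.Reachable x y := by
    intro x hx y hy
    let f : B.coe →g K := ⟨Subtype.val, fun {a b} hab => (hadj _ _).2 hab⟩
    exact (htree.connected.preconnected ⟨x, hx⟩ ⟨y, hy⟩).map f
  have hverts : ∀ e ∈ X, ∀ y ∈ e, y ∈ B.verts := fun e he y hy =>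
    ⟨⟨e, ((hXmem e).1 he).1, hy⟩, ⟨e, ((hXmem e).1 he).2, hy⟩⟩
  have htreeX : ∀ φ : Fin k ↪ Fin n, underlying (treeEdges T φ) ≤ B →
      ∀ e ∈ treeEdges T φ, e ∈ X := by
    intro φ hφ e he
    obtain ⟨u, v, huv, rfl⟩ := exists_of_mem_treeEdges he
    have h3 : B.Adj (φ u) (φ v) := hφ.2 ⟨φ.injective.ne huv.ne, he⟩
    exact (hXmem _).2 ⟨h3.1.2, h3.2.2⟩
  have hconn : ∀ φ : Fin k ↪ Fin n, underlying (treeEdges T φ) ≤ B →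
      ∀ e ∈ X, ∀ y ∈ e, ∀ v, K.Reachable y (φ v) := by
    intro φ hφ e he y hy v
    obtain ⟨u, hu⟩ := exists_adj_of_isTree hT.isTree hT.two_le v
    exact hreach _ (hverts e he y hy) _ (hverts _ (htreeX φ hφ _ (mk_mem_treeEdges.2 hu)) _
      (Sym2.mem_mk_left _ _))
  obtain ⟨x, hx, hxX⟩ := exists_arms h1 hn1 hT hℓ (fun e he => ((hXmem e).1 he).1) hac
    (hconn φ₁ ht1) (htreeX φ₁ ht1)
  obtain ⟨y, hy, hyX⟩ := exists_arms h2 hn2 hT hℓ (fun e he => ((hXmem e).1 he).2) hac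
    (hconn φ₂ ht2) (htreeX φ₂ ht2)
  exact ⟨{
    φ := fun b => bif b then φ₂ else φ₁
    w := fun b => bif b then w₂ else w₁
    x := fun b => bif b then y else x
    dec := Bool.rec h1 h2
    non := Bool.rec hn1 hn2
    arm_lt := Bool.rec hx hy
    inter := Bool.rec hxX hyX
    acyclic := hac }⟩

namespace ArmSystem

/-- The total length of the arms. -/
def total (A : ArmSystem J ℓ T P S) (b : Bool) : ℕ := ∑ a ∈ P, (A.x b a false + A.x b a true)

theorem card_inter (A : ArmSystem J ℓ T P S) (hT : IsRigidPairing m T P) (hℓ : 2 ≤ ℓ) (b : Bool) :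
    ((S false).toFinset ∩ (S true).toFinset).card = k - 1 + A.total b := by
  rw [A.inter b, card_armEdges (A.dec b) (A.non b) hT hℓ (A.arm_lt b), total]

/-- Both copies have the same number of tree edges, hence the same total length of the arms. -/
theorem total_eq (A : ArmSystem J ℓ T P S) (hT : IsRigidPairing m T P) (hℓ : 2 ≤ ℓ) :
    A.total true = A.total false := by
  have h1 := A.card_inter hT hℓ false
  have h2 := A.card_inter hT hℓ true
  omega

/-- The moment of a good pair, in terms of the total length of the arms. -/
theorem pairMoment_le (A : ArmSystem J ℓ T P S) (hT : IsRigidPairing m T P) (hℓ : 2 ≤ ℓ)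
    {lam ε s : ℝ} {M : ℕ} (hd : SmallDensity n lam ε s M) (hM : 1 ≤ M) :
    A.total false ≤ ℓ * m ∧ pairMoment n lam ε s (S false) (S true) ≤
      momLin n lam ε s 1 0 ^ (2 * (ℓ * m - A.total false)) * s ^ (k - 1 + A.total false) := by
  have hnd : ∀ b, (S b).Nodup := fun b => (A.non b).nodup (A.dec b) hℓ
  have hcard : ∀ b, (S b).toFinset.card = k - 1 + ℓ * m := fun b => by
    rw [Multiset.toFinset_card_of_nodup (hnd b), (A.dec b).card_eq hT]
  have h1 := A.card_inter hT hℓ false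
  have h2 : (symmDiff (S false).toFinset (S true).toFinset).card =
      2 * (ℓ * m - A.total false) := by
    rw [symmDiff_def, Finset.sup_eq_union, Finset.card_union_of_disjoint disjoint_sdiff_sdiff,
      Finset.card_sdiff, Finset.card_sdiff, hcard, hcard, Finset.inter_comm (S true).toFinset, h1]
    omega
  have h3 : A.total false ≤ ℓ * m := by
    have := Finset.card_le_card (Finset.inter_subset_left (s₁ := (S false).toFinset)
      (s₂ := (S true).toFinset))
    rw [h1, hcard] at this
    omega
  refine ⟨h3, ?_⟩
  rw [← h1, ← h2]
  refine pairMoment_le_forest hd hM (fun e he => ?_) (hnd false) (hnd true) _ A.acyclic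
    fun e he he' => ?_
  · rw [Multiset.mem_add] at he
    exact he.elim (A.dec false).not_isDiag (A.dec true).not_isDiag
  · rw [SimpleGraph.edgeSet_fromEdgeSet]
    refine ⟨?_, (A.dec false).not_isDiag he⟩
    rw [Finset.mem_coe, Finset.mem_inter, Multiset.mem_toFinset, Multiset.mem_toFinset]
    exact ⟨he, he'⟩

end ArmSystem

/-- The possible values of the free parts of the paths: the positions covered by arms of lengths
`u` and the ends of the paths are replaced by a fixed vertex `d`. -/
def freeVertices (d : Fin n) (J : Finset (Fin n)) (ℓ : ℕ) (u : P → Bool → ℕ) :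
    Finset (P → Fin (ℓ + 1) → Fin n) :=
  Fintype.piFinset fun a => Fintype.piFinset fun i =>
    if u a false < i ∧ (i : ℕ) < ℓ - u a true then
      (if (i : ℕ) = 1 ∨ (i : ℕ) = ℓ - 1 then J else Finset.univ) else {d}

/-- Every position covered by an arm saves at least the choice of a vertex of `J`. -/
theorem card_freeVertices (d : Fin n) {J : Finset (Fin n)} (hJ : 0 < J.card) (hℓ : 3 ≤ ℓ)
    (hP : P.card = m) {u : P → Bool → ℕ} (hu : ∀ a, u a false + u a true < ℓ) :
    (freeVertices d J ℓ u).card * J.card ^ (∑ a, (u a false + u a true)) ≤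
      (n ^ (ℓ - 3) * J.card ^ 2) ^ m := by
  have hJn : J.card ≤ n := by simpa using Finset.card_le_univ J
  rw [freeVertices, Fintype.card_piFinset, ← Finset.prod_pow_eq_pow_sum,
    ← Finset.prod_mul_distrib]
  refine (Finset.prod_le_pow_card _ _ (n ^ (ℓ - 3) * J.card ^ 2) fun a _ => ?_).trans_eq (by
    rw [Finset.card_univ, Fintype.card_coe, hP])
  rw [Fintype.card_piFinset]
  set g : ℕ → ℕ := fun i => (if u a false < i ∧ i < ℓ - u a true then
      (if i = 1 ∨ i = ℓ - 1 then J else Finset.univ) else {d}).card with hg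
  rw [show (∏ i : Fin (ℓ + 1), (if u a false < (i : ℕ) ∧ (i : ℕ) < ℓ - u a true then
      (if (i : ℕ) = 1 ∨ (i : ℕ) = ℓ - 1 then J else Finset.univ) else {d}).card) =
      ∏ i ∈ Finset.range (ℓ + 1), g i from (Finset.prod_range g).symm]
  have hua := hu a
  have hc : J.card ^ (u a false + u a true) = ∏ i ∈ Finset.range (ℓ + 1),
      if i ∈ Finset.Ico 1 (u a false + 1) ∪ Finset.Ico (ℓ - u a true) ℓ then J.card else 1 := by
    rw [← Finset.prod_filter, Finset.prod_const]
    congr 1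
    rw [Finset.filter_mem_eq_inter, Finset.inter_eq_right.2, Finset.card_union_of_disjoint,
      Nat.card_Ico, Nat.card_Ico]
    · omega
    · rw [Finset.disjoint_left]
      intro i hi hi'
      rw [Finset.mem_Ico] at hi hi'
      omega
    · intro i hi
      rw [Finset.mem_union, Finset.mem_Ico, Finset.mem_Ico] at hi
      rw [Finset.mem_range]
      omega
  have hB : n ^ (ℓ - 3) * J.card ^ 2 = ∏ i ∈ Finset.range (ℓ + 1),
      (if i ∈ Finset.Ico 2 (ℓ - 1) then n else 1) *
        (if i ∈ ({1, ℓ - 1} : Finset ℕ) then J.card else 1) := by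
    rw [Finset.prod_mul_distrib, ← Finset.prod_filter, ← Finset.prod_filter, Finset.prod_const,
      Finset.prod_const, Finset.filter_mem_eq_inter, Finset.filter_mem_eq_inter,
      Finset.inter_eq_right.2, Finset.inter_eq_right.2, Nat.card_Ico, Finset.card_pair]
    · congr 2
    · omega
    · intro i hi
      simp only [Finset.mem_insert, Finset.mem_singleton] at hi
      rw [Finset.mem_range]
      omega
    · intro i hi
      rw [Finset.mem_Ico] at hi
      rw [Finset.mem_range]
      omega
  rw [hc, hB, ← Finset.prod_mul_distrib]
  refine Finset.prod_le_prod' fun i hi => ?_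
  rw [Finset.mem_range] at hi
  simp only [hg, Finset.mem_union, Finset.mem_Ico, Finset.mem_insert, Finset.mem_singleton]
  by_cases h1 : u a false < i ∧ i < ℓ - u a true
  · rw [if_pos h1, if_neg (by omega : ¬ ((1 ≤ i ∧ i < u a false + 1) ∨ (ℓ - u a true ≤ i ∧ i < ℓ)))]
    by_cases h2 : i = 1 ∨ i = ℓ - 1
    · rw [if_pos h2, if_neg (by omega), if_pos h2]
      omega
    · rw [if_neg h2, if_pos (by omega), if_neg h2, Finset.card_univ, Fintype.card_fin]
  · rw [if_neg h1, Finset.card_singleton, one_mul]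
    by_cases h2 : i = 1 ∨ i = ℓ - 1
    · rw [if_neg (by omega : ¬ (2 ≤ i ∧ i < ℓ - 1)), if_pos h2, one_mul]
      split_ifs <;> omega
    · rw [if_neg h2, mul_one]
      split_ifs <;> omega

end

/-! ### Counting good pairs -/

section

variable {n k ℓ m : ℕ} {J : Bool → Finset (Fin n)} {T : SimpleGraph (Fin k)}
  {P : Finset (Sym2 (Fin k))} {S S' : Bool → Multiset (Sym2 (Fin n))}

theorem exists_indexing (X : Finset (Sym2 (Fin n))) :
    ∃ f : Sym2 (Fin n) → ℕ, Set.InjOn f X ∧ ∀ e ∈ X, f e < X.card := by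
  refine ⟨fun e => if h : e ∈ X then X.equivFin ⟨e, h⟩ else 0, fun e he e' he' heq => ?_,
    fun e he => ?_⟩
  · rw [Finset.mem_coe] at he he'
    simp only [dif_pos he, dif_pos he'] at heq
    simpa using X.equivFin.injective (Fin.ext heq)
  · simp only [dif_pos he]
    exact Fin.is_lt _

/-- A fixed numbering of the elements of a finite set. -/
def indexing (X : Finset (Sym2 (Fin n))) : Sym2 (Fin n) → ℕ := (exists_indexing X).choose

theorem indexing_injOn (X : Finset (Sym2 (Fin n))) : Set.InjOn (indexing X) X :=
  (exists_indexing X).choose_spec.1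

theorem indexing_lt {X : Finset (Sym2 (Fin n))} {e : Sym2 (Fin n)} (he : e ∈ X) :
    indexing X e < X.card :=
  (exists_indexing X).choose_spec.2 e he

theorem out_mem (a : Sym2 (Fin k)) : (Quot.out a).1 ∈ a ∧ (Quot.out a).2 ∈ a := by
  have h : s((Quot.out a).1, (Quot.out a).2) = a := Quot.out_eq a
  have h1 := Sym2.mem_mk_left (Quot.out a).1 (Quot.out a).2
  have h2 := Sym2.mem_mk_right (Quot.out a).1 (Quot.out a).2
  rw [h] at h1 h2
  exact ⟨h1, h2⟩

theorem endpoints_out {J : Finset (Fin n)} {φ : Fin k ↪ Fin n} {w : Sym2 (Fin k) → ℕ → Fin n}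
    {S : Multiset (Sym2 (Fin n))} (h : IsDecomposition J ℓ T P φ w S) {a : Sym2 (Fin k)}
    (ha : a ∈ P) : (w a 0 = φ (Quot.out a).1 ∧ w a ℓ = φ (Quot.out a).2) ∨
      (w a 0 = φ (Quot.out a).2 ∧ w a ℓ = φ (Quot.out a).1) := by
  have h1 := h.endpoints a ha
  have h2 : s((Quot.out a).1, (Quot.out a).2) = a := Quot.out_eq a
  have h3 : a.map φ = s(φ (Quot.out a).1, φ (Quot.out a).2) := by
    conv_lhs => rw [← h2]
    rfl
  rw [h3, Sym2.eq_iff] at h1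
  exact h1

namespace ArmSystem

/-- The lengths of the arms of the copy `b`, as a function on the pairing. -/
def arm (A : ArmSystem J ℓ T P S) (b : Bool) : P → Bool → ℕ := fun a c => A.x b a c

/-- The vertices of the paths at the positions which are not covered by arms of lengths `u`, and the
fixed vertex `d` elsewhere. -/
def freePart (A : ArmSystem J ℓ T P S) (d : Fin n) (b : Bool) (u : P → Bool → ℕ) :
    P → Fin (ℓ + 1) → Fin n :=
  fun a i => if u a false < i ∧ (i : ℕ) < ℓ - u a true then A.w b a i else d

theorem freePart_apply (A : ArmSystem J ℓ T P S) (d : Fin n) (b : Bool) {u : P → Bool → ℕ}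
    {a : P} {i : Fin (ℓ + 1)} (h1 : u a false < i) (h2 : (i : ℕ) < ℓ - u a true) :
    A.freePart d b u a i = A.w b a i := if_pos ⟨h1, h2⟩

/-- The orientations of the paths: whether the path of a pair starts at the first one of its two
vertices, in the order given by `Quot.out`. -/
def orientation (A : ArmSystem J ℓ T P S) (b : Bool) (a : P) : Bool :=
  decide (A.w b a 0 = A.φ b (Quot.out a.1).1)

/-- The numbers of the common edges which do not belong to the second tree. -/
def armIndices (A : ArmSystem J ℓ T P S) : Finset ℕ :=
  (((S false).toFinset ∩ (S true).toFinset).filter fun e => e ∉ treeEdges T (A.φ true)).image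
    (indexing ((S false).toFinset ∩ (S true).toFinset))

theorem total_eq_sum (A : ArmSystem J ℓ T P S) (b : Bool) :
    A.total b = ∑ a : P, (A.arm b a false + A.arm b a true) := by
  rw [total, ← Finset.sum_coe_sort P]
  rfl

theorem freePart_mem (A : ArmSystem J ℓ T P S) (d : Fin n) (b : Bool) (u : P → Bool → ℕ) :
    A.freePart d b u ∈ freeVertices d (J b) ℓ u := by
  rw [freeVertices, Fintype.mem_piFinset]
  intro a
  rw [Fintype.mem_piFinset]
  intro i
  unfold freePart
  split_ifs with h1 h2
  · rcases h2 with h2 | h2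
    · rw [h2]; exact ((A.dec b).neighbors a a.2).1
    · rw [h2]; exact ((A.dec b).neighbors a a.2).2
  · exact Finset.mem_univ _
  · exact Finset.mem_singleton_self _

theorem tree_sub (A : ArmSystem J ℓ T P S) (b : Bool) {e : Sym2 (Fin n)}
    (he : e ∈ treeEdges T (A.φ b)) : e ∈ (S false).toFinset ∩ (S true).toFinset := by
  rw [A.inter b, mem_armEdges]
  exact Or.inl he

theorem armIndices_mem (A : ArmSystem J ℓ T P S) (hT : IsRigidPairing m T P) (hℓ : 2 ≤ ℓ) :
    A.armIndices ∈ (Finset.range (k - 1 + A.total true)).powersetCard (A.total true) := by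
  rw [Finset.mem_powersetCard]
  constructor
  · intro i hi
    obtain ⟨e, he, rfl⟩ := Finset.mem_image.1 hi
    rw [Finset.mem_range, ← A.card_inter hT hℓ]
    exact indexing_lt (Finset.mem_filter.1 he).1
  · rw [armIndices, Finset.card_image_of_injOn ((indexing_injOn _).mono
      (by exact_mod_cast Finset.filter_subset _ _))]
    have h1 := Finset.card_filter_add_card_filter_not
      (s := (S false).toFinset ∩ (S true).toFinset) (fun e => e ∈ treeEdges T (A.φ true))
    have h2 : ((S false).toFinset ∩ (S true).toFinset).filter
        (fun e => e ∈ treeEdges T (A.φ true)) = (treeEdges T (A.φ true)).toFinset := by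
      ext e
      rw [Finset.mem_filter, Multiset.mem_toFinset]
      exact ⟨fun h => h.2, fun h => ⟨A.tree_sub true h, h⟩⟩
    rw [h2, Multiset.toFinset_card_of_nodup (treeEdges_nodup T _), treeEdges_card hT.isTree,
      A.card_inter hT hℓ true] at h1
    omega

/-- The ends of the paths are determined by the images of the vertices of the pairing and by the
orientations. -/
theorem ends_eq (A : ArmSystem J ℓ T P S) (A' : ArmSystem J ℓ T P S') {b : Bool}
    (ho : A.orientation b = A'.orientation b) {a : Sym2 (Fin k)} (ha : a ∈ P)
    (hφ : ∀ v ∈ a, A.φ b v = A'.φ b v) : A.w b a 0 = A'.w b a 0 ∧ A.w b a ℓ = A'.w b a ℓ := by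
  have h1 := congrFun ho ⟨a, ha⟩
  simp only [orientation, decide_eq_decide] at h1
  have e1 := hφ _ (out_mem a).1
  have e2 := hφ _ (out_mem a).2
  have hne : A.w b a 0 = A.φ b (Quot.out a).1 → A.w b a 0 = A.φ b (Quot.out a).2 → False := by
    intro h3 h4
    rcases endpoints_out (A.dec b) ha with ⟨h5, h6⟩ | ⟨h5, h6⟩
    · have := (A.dec b).selfAvoiding a ha (x₁ := 0) (x₂ := ℓ) (Set.mem_Iic.2 (Nat.zero_le _))
        (Set.mem_Iic.2 le_rfl) (by rw [h4, h6])
      have := A.arm_lt b a ha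
      omega
    · have := (A.dec b).selfAvoiding a ha (x₁ := 0) (x₂ := ℓ) (Set.mem_Iic.2 (Nat.zero_le _))
        (Set.mem_Iic.2 le_rfl) (by rw [h3, h6])
      have := A.arm_lt b a ha
      omega
  rcases endpoints_out (A.dec b) ha with ⟨h3, h4⟩ | ⟨h3, h4⟩
  · have h5 := h1.1 h3
    rcases endpoints_out (A'.dec b) ha with ⟨h6, h7⟩ | ⟨h6, h7⟩
    · exact ⟨by rw [h3, h6, e1], by rw [h4, h7, e2]⟩
    · have h8 : (Quot.out a).1 = (Quot.out a).2 := (A'.φ b).injective (h5.symm.trans h6)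
      exact ⟨by rw [h3, h5, e1], by rw [h4, h7, ← e1, h8]⟩
  · rcases endpoints_out (A'.dec b) ha with ⟨h6, h7⟩ | ⟨h6, h7⟩
    · exact absurd h3 (hne (h1.2 h6))
    · exact ⟨by rw [h3, h6, e2], by rw [h4, h7, e1]⟩

theorem eq_of_w_eq (A : ArmSystem J ℓ T P S) (A' : ArmSystem J ℓ T P S') {b : Bool}
    (htree : treeEdges T (A.φ b) = treeEdges T (A'.φ b))
    (hw : ∀ a ∈ P, ∀ t ≤ ℓ, A.w b a t = A'.w b a t) : S b = S' b := by
  rw [(A.dec b).edges, (A'.dec b).edges, htree]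
  congr 1
  refine Finset.sum_congr rfl fun a ha => ?_
  unfold pathEdges
  refine Multiset.map_congr rfl fun t ht => ?_
  rw [Multiset.mem_range] at ht
  rw [hw a ha t ht.le, hw a ha (t + 1) ht]

/-- A pair of copies is determined by the first copy, the lengths of the arms, the position of the
second tree among the common edges, and the free parts of the paths. -/
theorem eq_of_code_eq (hT : IsRigidPairing m T P) (hℓ : 2 ≤ ℓ) {d : Fin n}
    (A : ArmSystem J ℓ T P S) (A' : ArmSystem J ℓ T P S') (α α' : T ≃g T)
    (h1 : (fun v => A.φ false (α v)) = fun v => A'.φ false (α' v))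
    (h2 : A.orientation = A'.orientation)
    (h3 : A.freePart d false (fun _ _ => 0) = A'.freePart d false (fun _ _ => 0))
    (hx : A.arm false = A'.arm false) (hy : A.arm true = A'.arm true)
    (h4 : A.freePart d true (A.arm true) = A'.freePart d true (A'.arm true))
    (h5 : A.armIndices = A'.armIndices) : S = S' := by
  have hφ1 : treeEdges T (A.φ false) = treeEdges T (A'.φ false) := by
    rw [← treeEdges_iso (φ := A.φ false) α, ← treeEdges_iso (φ := A'.φ false) α']
    congr 1
    ext v
    exact congrArg Fin.val (congrFun h1 v)
  -- automorphisms fix the vertices of the pairing, so the ends of the paths are known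
  have hφ1P : ∀ a ∈ P, ∀ v ∈ a, A.φ false v = A'.φ false v := by
    intro a ha v hv
    have := congrFun h1 v
    simpa only [hT.fixed α a ha v hv, hT.fixed α' a ha v hv] using this
  have hw1 : ∀ a ∈ P, ∀ t ≤ ℓ, A.w false a t = A'.w false a t := by
    intro a ha t ht
    have hends := ends_eq A A' (congrFun h2 false) ha (hφ1P a ha)
    rcases Nat.eq_zero_or_pos t with rfl | ht0
    · exact hends.1
    rcases ht.lt_or_eq with ht1 | rfl
    · have := congrFun (congrFun h3 ⟨a, ha⟩) ⟨t, by omega⟩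
      rwa [freePart_apply, freePart_apply] at this <;> (dsimp only; omega)
    · exact hends.2
  have hS1 : S false = S' false := eq_of_w_eq A A' hφ1 hw1
  -- the first copy and its arms determine the common edges
  have hX : (S false).toFinset ∩ (S true).toFinset = (S' false).toFinset ∩ (S' true).toFinset := by
    rw [A.inter false, A'.inter false]
    ext e
    rw [mem_armEdges, mem_armEdges, hφ1]
    refine or_congr_right (exists_congr fun a => and_congr_right fun ha => exists_congr fun b => ?_)
    have hxa : A.x false a b = A'.x false a b := congrFun (congrFun hx ⟨a, ha⟩) b
    rw [hxa]
    refine exists_congr fun t => and_congr_right fun ht => ?_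
    have htl : t < ℓ := by
      have := A'.arm_lt false a ha
      cases b <;> omega
    rw [strand_edge htl, strand_edge htl, hw1 a ha _ (by cases b <;> simp <;> omega),
      hw1 a ha _ (by cases b <;> simp <;> omega)]
  have hφ2 : treeEdges T (A.φ true) = treeEdges T (A'.φ true) := by
    refine (Multiset.Nodup.ext (treeEdges_nodup T _) (treeEdges_nodup T _)).2 fun e => ?_
    by_cases he : e ∈ (S false).toFinset ∩ (S true).toFinset
    · have he' := hX ▸ he
      have key : ∀ {S : Bool → Multiset (Sym2 (Fin n))} (A : ArmSystem J ℓ T P S),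
          e ∈ (S false).toFinset ∩ (S true).toFinset →
          (indexing ((S false).toFinset ∩ (S true).toFinset) e ∈ A.armIndices ↔
            e ∉ treeEdges T (A.φ true)) := by
        intro S A he
        rw [armIndices, Finset.mem_image]
        constructor
        · rintro ⟨e', he', heq⟩
          rw [Finset.mem_filter] at he'
          have := indexing_injOn _ (Finset.mem_coe.2 he'.1) (Finset.mem_coe.2 he) heq
          exact this ▸ he'.2
        · intro h
          exact ⟨e, Finset.mem_filter.2 ⟨he, h⟩, rfl⟩
      have h6 := key A he
      have h7 := key A' he'
      rw [← hX, ← h5] at h7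
      exact not_iff_not.1 (h6.symm.trans h7)
    · have he' := hX ▸ he
      exact ⟨fun h => absurd (A.tree_sub true h) he, fun h => absurd (A'.tree_sub true h) he'⟩
  have hφ2P : ∀ a ∈ P, ∀ v ∈ a, A.φ true v = A'.φ true v := by
    obtain ⟨β, hβ⟩ := exists_iso_of_treeEdges_eq hT.isTree hT.two_le hφ2
    intro a ha v hv
    rw [hβ v, hT.fixed β a ha v hv]
  have hw2 : ∀ a ∈ P, ∀ t ≤ ℓ, A.w true a t = A'.w true a t := by
    intro a ha t ht
    have hends := ends_eq A A' (congrFun h2 true) ha (hφ2P a ha)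
    have hya : ∀ b, A.x true a b = A'.x true a b := fun b => congrFun (congrFun hy ⟨a, ha⟩) b
    have hlt := A.arm_lt true a ha
    -- the arms of the second copy run inside the first one, which determines them
    have harm : ∀ b, ∀ t ≤ A.x true a b, strand ℓ (A.w true) a b t = strand ℓ (A'.w true) a b t := by
      intro b
      have hbl : A.x true a b < ℓ := by cases b <;> omega
      refine strand_eq_strand (A.dec true) (A'.dec true) (A'.non true) hT hℓ ha b ?_ hbl.le ?_
      · cases b
        · exact hends.1
        · exact hends.2
      · intro t ht
        have : s(strand ℓ (A.w true) a b t, strand ℓ (A.w true) a b (t + 1)) ∈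
            (S false).toFinset ∩ (S true).toFinset := by
          rw [A.inter true, mem_armEdges]
          exact Or.inr ⟨a, ha, b, t, ht, rfl⟩
        rw [hX, Finset.mem_inter, Multiset.mem_toFinset, Multiset.mem_toFinset] at this
        exact this.2
    by_cases ht1 : t ≤ A.x true a false
    · exact harm false t ht1
    by_cases ht2 : ℓ - t ≤ A.x true a true
    · have := harm true (ℓ - t) ht2
      simp only [strand, if_true] at this
      rwa [show ℓ - (ℓ - t) = t by omega] at this
    · have := congrFun (congrFun h4 ⟨a, ha⟩) ⟨t, by omega⟩
      have e1 := hya false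
      have e2 := hya true
      rwa [freePart_apply, freePart_apply] at this <;> (dsimp only [arm]; omega)
  have hS2 : S true = S' true := eq_of_w_eq A A' hφ2 hw2
  funext b
  cases b
  · exact hS1
  · exact hS2

end ArmSystem

/-- The number of pairs of copies with arms of given lengths. The factor `|Aut T|` comes from recording
the first tree as an embedding, which may be composed with any automorphism. -/
theorem card_mul_card_le (hT : IsRigidPairing m T P) (hℓ : 2 ≤ ℓ) (d : Fin n)
    (x y : P → Bool → ℕ) {h : ℕ} (hh : ∑ a, (y a false + y a true) = h)
    (G : Finset (Bool → Multiset (Sym2 (Fin n))))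
    (A : ∀ S ∈ G, ArmSystem J ℓ T P S) (hx : ∀ S hS, (A S hS).arm false = x)
    (hy : ∀ S hS, (A S hS).arm true = y) :
    Nat.card (T ≃g T) * G.card ≤ n ^ k * 4 ^ m * (freeVertices (P := P) d (J false) ℓ fun _ _ => 0).card *
      (freeVertices d (J true) ℓ y).card * (k - 1 + h).choose h := by
  set C : Finset ((Fin k → Fin n) × (Bool → P → Bool) × (P → Fin (ℓ + 1) → Fin n) ×
      (P → Fin (ℓ + 1) → Fin n) × Finset ℕ) :=
    Finset.univ ×ˢ Finset.univ ×ˢ freeVertices d (J false) ℓ (fun _ _ => 0) ×ˢ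
      freeVertices d (J true) ℓ y ×ˢ (Finset.range (k - 1 + h)).powersetCard h with hC
  have hCcard : C.card = n ^ k * 4 ^ m * (freeVertices (P := P) d (J false) ℓ fun _ _ => 0).card *
      (freeVertices d (J true) ℓ y).card * (k - 1 + h).choose h := by
    have h4 : (Finset.univ : Finset (Bool → P → Bool)).card = 4 ^ m := by
      rw [Finset.card_univ, Fintype.card_fun, Fintype.card_fun, Fintype.card_bool,
        Fintype.card_coe, hT.isPairing.card_eq, ← pow_mul, mul_comm, pow_mul]
      norm_num
    rw [hC, Finset.card_product, Finset.card_product, Finset.card_product, Finset.card_product,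
      h4, Finset.card_univ, Fintype.card_fun, Fintype.card_fin, Fintype.card_fin,
      Finset.card_powersetCard, Finset.card_range]
    ring
  have hfin : Finite (T ≃g T) :=
    Finite.of_injective (fun a : T ≃g T => (a : Fin k → Fin k)) DFunLike.coe_injective
  have := Fintype.ofFinite (T ≃g T)
  rw [← hCcard, Nat.card_eq_fintype_card, ← Finset.card_univ, ← Finset.card_attach (s := G),
    ← Finset.card_product]
  refine Finset.card_le_card_of_injOn (fun p => (fun v => (A p.2.1 p.2.2).φ false (p.1 v),
    (A p.2.1 p.2.2).orientation, (A p.2.1 p.2.2).freePart d false (fun _ _ => 0),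
    (A p.2.1 p.2.2).freePart d true y, (A p.2.1 p.2.2).armIndices)) ?_ ?_
  · rintro ⟨α, S, hS⟩ -
    have h1 : (A S hS).total true = h := by
      rw [ArmSystem.total_eq_sum, hy, hh]
    simp only [hC, Finset.coe_product, Set.mem_prod, Finset.mem_coe, Finset.mem_univ, true_and]
    refine ⟨(A S hS).freePart_mem d false _, (A S hS).freePart_mem d true _, ?_⟩
    rw [← h1]
    exact (A S hS).armIndices_mem hT hℓ
  · rintro ⟨α, S, hS⟩ - ⟨α', S', hS'⟩ - heq
    simp only [Prod.mk.injEq] at heq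
    obtain ⟨e1, e2, e3, e4, e5⟩ := heq
    have hSS : S = S' := by
      refine ArmSystem.eq_of_code_eq hT hℓ (d := d) (A S hS) (A S' hS') α α' e1 e2 e3
        ((hx _ _).trans (hx _ _).symm) ((hy _ _).trans (hy _ _).symm) ?_ e5
      rw [hy, hy]
      exact e4
    subst hSS
    have : α = α' := by
      ext v
      exact congrArg Fin.val ((A S hS).φ false |>.injective (congrFun e1 v))
    rw [this]

end

/-! ### The contribution of the good pairs from above -/

/-- The entropy of the position of the second tree among the common edges. -/
theorem choose_mul_pow_le {q : ℝ} (hq0 : 0 ≤ q) (hq1 : q < 1) (a h : ℕ) :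
    ((a + h).choose h : ℝ) * q ^ h ≤ ((1 - q)⁻¹) ^ a := by
  have h1 : (q + (1 - q)) ^ (a + h) = 1 := by
    rw [add_sub_cancel, one_pow]
  rw [add_pow] at h1
  have h2 : q ^ h * (1 - q) ^ (a + h - h) * ((a + h).choose h : ℝ) ≤ 1 := by
    refine le_of_le_of_eq ?_ h1
    exact Finset.single_le_sum (a := h) (s := Finset.range (a + h + 1))
      (f := fun i => q ^ i * (1 - q) ^ (a + h - i) * ((a + h).choose i : ℝ))
      (fun i _ => mul_nonneg (mul_nonneg (pow_nonneg hq0 _) (pow_nonneg (by linarith) _))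
        (Nat.cast_nonneg _)) (Finset.mem_range.2 (by omega))
  have h3 : 0 < (1 - q) ^ a := pow_pos (by linarith) a
  rw [Nat.add_sub_cancel] at h2
  rw [inv_pow, ← one_div, le_div_iff₀ h3]
  linarith

section

variable {n k ℓ m : ℕ} {T : SimpleGraph (Fin k)} {P : Finset (Sym2 (Fin k))}

/-- A geometric series in each of the `2 * m` lengths of arms. -/
theorem sum_arms_le (hP : P.card = m) :
    ∑ x ∈ Fintype.piFinset fun _ : P => Fintype.piFinset fun _ : Bool => Finset.range ℓ,
      (1 / 4 : ℝ) ^ (∑ a, (x a false + x a true)) ≤ 2 ^ m := by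
  have hgeom : ∑ t ∈ Finset.range ℓ, (1 / 4 : ℝ) ^ t ≤ 4 / 3 := by
    have h1 := geom_sum_eq (x := (1 / 4 : ℝ)) (by norm_num) ℓ
    have h2 : (0 : ℝ) ≤ (1 / 4) ^ ℓ := by positivity
    rw [h1, div_le_iff_of_neg (by norm_num)]
    linarith
  have h1 : ∀ x : P → Bool → ℕ, (1 / 4 : ℝ) ^ (∑ a, (x a false + x a true)) =
      ∏ a, ∏ b, (1 / 4 : ℝ) ^ x a b := by
    intro x
    rw [← Finset.prod_pow_eq_pow_sum]
    refine Finset.prod_congr rfl fun a _ => ?_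
    rw [Fintype.prod_bool, pow_add, mul_comm]
  simp only [h1]
  rw [← Finset.prod_univ_sum (fun _ : P => Fintype.piFinset fun _ : Bool => Finset.range ℓ)
    (fun _ x => ∏ b, (1 / 4 : ℝ) ^ x b), Finset.prod_const, Finset.card_univ, Fintype.card_coe, hP]
  refine pow_le_pow_left₀ (Finset.sum_nonneg fun _ _ => Finset.prod_nonneg fun _ _ => by positivity)
    ?_ m
  rw [← Finset.prod_univ_sum (fun _ : Bool => Finset.range ℓ) (fun _ t => (1 / 4 : ℝ) ^ t),
    Fintype.prod_bool]
  have h3 : (0 : ℝ) ≤ ∑ t ∈ Finset.range ℓ, (1 / 4 : ℝ) ^ t :=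
    Finset.sum_nonneg fun _ _ => by positivity
  nlinarith

theorem sum_sum_eq_sum_bool {α β : Type*} [AddCommMonoid β] (C : Bool → Finset α)
    (f : α → α → β) : ∑ x ∈ C false, ∑ y ∈ C true, f x y =
      ∑ p ∈ Fintype.piFinset C, f (p false) (p true) := by
  rw [← Finset.sum_product' (f := f)]
  refine Finset.sum_nbij' (fun p b => bif b then p.2 else p.1) (fun p => (p false, p true))
    ?_ ?_ ?_ ?_ ?_
  · intro p hp
    rw [Finset.mem_product] at hp
    rw [Fintype.mem_piFinset]
    intro b
    cases b
    · exact hp.1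
    · exact hp.2
  · intro p hp
    rw [Fintype.mem_piFinset] at hp
    exact Finset.mem_product.2 ⟨hp _, hp _⟩
  · intro p _
    rfl
  · intro p _
    funext b
    cases b <;> rfl
  · intro p _
    rfl

set_option maxHeartbeats 1000000 in
/-- The contribution of the good pairs is not much larger than that of the pairs which share
exactly their tree parts: the arms cost more than they gain. -/
theorem sum_good_le {lam ε s : ℝ} (hd : SmallDensity n lam ε s (k - 1 + ℓ * m))
    (hT : IsRigidPairing m T P) (hℓ : 3 ≤ ℓ) (J₁ J₂ : Finset (Fin n)) {j : ℕ} (hj : 0 < j)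
    (hJ₁ : J₁.card = j) (hJ₂ : J₂.card = j) {q : ℝ} (hq0 : 0 ≤ q) (hq1 : q < 1)
    (hs : s ≤ q / 16 * (momLin n lam ε s 1 0 ^ 2 * j)) :
    Nat.card (T ≃g T) * ∑ S₁ ∈ copies J₁ ℓ T P, ∑ S₂ ∈ copies J₂ ℓ T P,
        pairMoment n lam ε s S₁ S₂ * (if GoodPair J₁ J₂ ℓ T P S₁ S₂ then 1 else 0) ≤
      16 ^ m * n ^ k * ((n : ℝ) ^ (ℓ - 3) * j ^ 2) ^ (2 * m) *
        (momLin n lam ε s 1 0 ^ 2) ^ (ℓ * m) * s ^ (k - 1) * ((1 - q)⁻¹) ^ (k - 1) := by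
  have hk := hT.two_le
  have hM : 1 ≤ k - 1 + ℓ * m := by omega
  let d : Fin n := ⟨0, hd.n_pos⟩
  set a := momLin n lam ε s 1 0 ^ 2 with ha
  have ha0 : 0 < a := pow_pos hd.momLin_one_zero_pos 2
  have hs0 := hd.s_pos
  have hj0 : (0 : ℝ) < j := by exact_mod_cast hj
  let J : Bool → Finset (Fin n) := fun b => bif b then J₂ else J₁
  have hJcard : ∀ b, (J b).card = j := Bool.rec hJ₁ hJ₂
  set Z : ℝ := ((n : ℝ) ^ (ℓ - 3) * j ^ 2) ^ m with hZ
  set G : Finset (Bool → Multiset (Sym2 (Fin n))) :=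
    (Fintype.piFinset fun b => copies (J b) ℓ T P).filter
      fun S => GoodPair (J false) (J true) ℓ T P (S false) (S true) with hG
  have hsumG : ∑ S₁ ∈ copies J₁ ℓ T P, ∑ S₂ ∈ copies J₂ ℓ T P,
        pairMoment n lam ε s S₁ S₂ * (if GoodPair J₁ J₂ ℓ T P S₁ S₂ then 1 else 0) =
      ∑ S ∈ G, pairMoment n lam ε s (S false) (S true) := by
    rw [hG, Finset.sum_filter]
    refine (sum_sum_eq_sum_bool (fun b => copies (J b) ℓ T P) _).trans ?_
    refine Finset.sum_congr rfl fun S _ => ?_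
    rw [mul_ite, mul_one, mul_zero]
    rfl
  have A : ∀ S ∈ G, ArmSystem J ℓ T P S := fun S hS =>
    ((Finset.mem_filter.1 hS).2.nonempty_armSystem hT (by omega)).some
  set I := Fintype.piFinset fun _ : P => Fintype.piFinset fun _ : Bool => Finset.range ℓ with hI
  let g : (Bool → Multiset (Sym2 (Fin n))) → (P → Bool → ℕ) × (P → Bool → ℕ) := fun S =>
    if hS : S ∈ G then ((A S hS).arm false, (A S hS).arm true) else 0
  have hgS : ∀ S (hS : S ∈ G), g S = ((A S hS).arm false, (A S hS).arm true) := fun S hS =>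
    dif_pos hS
  have hgI : ∀ S ∈ G, g S ∈ I ×ˢ I := by
    intro S hS
    rw [hgS S hS, Finset.mem_product]
    have key : ∀ b, (A S hS).arm b ∈ I := by
      intro b
      rw [hI, Fintype.mem_piFinset]
      intro p
      rw [Fintype.mem_piFinset]
      intro c
      have := (A S hS).arm_lt b p p.2
      rw [Finset.mem_range]
      change (A S hS).x b p c < ℓ
      cases c <;> omega
    exact ⟨key false, key true⟩
  -- fix the lengths of the arms; the factor `1 / 16` per unit of their length, which `hs` provides,
  -- is split evenly between the arms of the two copies
  have hfib : ∀ i ∈ I ×ˢ I, (Nat.card (T ≃g T) : ℝ) *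
      ∑ S ∈ G.filter (fun S => g S = i), pairMoment n lam ε s (S false) (S true) ≤
      n ^ k * 4 ^ m * Z ^ 2 * a ^ (ℓ * m) * s ^ (k - 1) * ((1 - q)⁻¹) ^ (k - 1) *
        ((1 / 4 : ℝ) ^ (∑ p, (i.1 p false + i.1 p true)) *
          (1 / 4 : ℝ) ^ (∑ p, (i.2 p false + i.2 p true))) := by
    rintro ⟨x, y⟩ -
    have hR0 : (0 : ℝ) ≤ n ^ k * 4 ^ m * Z ^ 2 * a ^ (ℓ * m) * s ^ (k - 1) *
        ((1 - q)⁻¹) ^ (k - 1) * ((1 / 4 : ℝ) ^ (∑ p, (x p false + x p true)) *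
          (1 / 4 : ℝ) ^ (∑ p, (y p false + y p true))) := by
      have : 0 ≤ (1 - q)⁻¹ := inv_nonneg.2 (by linarith)
      positivity
    rcases (G.filter (fun S => g S = (x, y))).eq_empty_or_nonempty with hemp | ⟨S₀, hS₀⟩
    · rw [hemp, Finset.sum_empty, mul_zero]
      exact hR0
    have hmem : ∀ S, S ∈ G.filter (fun S => g S = (x, y)) → S ∈ G := fun S hS =>
      (Finset.mem_filter.1 hS).1
    have hxy : ∀ S (hS : S ∈ G.filter (fun S => g S = (x, y))),
        (A S (hmem S hS)).arm false = x ∧ (A S (hmem S hS)).arm true = y := by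
      intro S hS
      have h1 := (Finset.mem_filter.1 hS).2
      rw [hgS S (hmem S hS), Prod.mk.injEq] at h1
      exact h1
    set h := ∑ p, (y p false + y p true) with hh
    have hxh : ∑ p, (x p false + x p true) = h := by
      have h1 := (A S₀ (hmem _ hS₀)).total_eq hT (by omega)
      rw [ArmSystem.total_eq_sum, ArmSystem.total_eq_sum, (hxy S₀ hS₀).1, (hxy S₀ hS₀).2] at h1
      exact h1.symm
    have htot : ∀ S (hS : S ∈ G.filter (fun S => g S = (x, y))),
        (A S (hmem S hS)).total false = h := by
      intro S hS
      rw [ArmSystem.total_eq_sum, (hxy S hS).1, hxh]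
    have hhM : h ≤ ℓ * m := by
      rw [← htot S₀ hS₀]
      exact ((A S₀ (hmem _ hS₀)).pairMoment_le hT (by omega) hd hM).1
    have hcard := card_mul_card_le hT (by omega) d x y hh.symm _
      (fun S hS => A S (hmem S hS)) (fun S hS => (hxy S hS).1) (fun S hS => (hxy S hS).2)
    have hyℓ : ∀ p, y p false + y p true < ℓ := by
      intro p
      rw [← (hxy S₀ hS₀).2]
      exact (A S₀ (hmem _ hS₀)).arm_lt true p p.2
    have hZ1 : ((freeVertices (P := P) d (J false) ℓ fun _ _ => 0).card : ℝ) ≤ Z := by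
      have h1 := card_freeVertices (P := P) d (J := J false) (by rw [hJcard]; exact hj) hℓ
        hT.isPairing.card_eq (u := fun _ _ => 0) (fun _ => by omega)
      simp only [add_zero, Finset.sum_const_zero, pow_zero, mul_one, hJcard] at h1
      rw [hZ]
      exact_mod_cast h1
    have hZ2 : ((freeVertices d (J true) ℓ y).card : ℝ) * (j : ℝ) ^ h ≤ Z := by
      have h1 := card_freeVertices (P := P) d (J := J true) (by rw [hJcard]; exact hj) hℓ
        hT.isPairing.card_eq (u := y) hyℓ
      rw [hJcard, ← hh] at h1
      rw [hZ]
      exact_mod_cast h1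
    have hchoose := choose_mul_pow_le hq0 hq1 (k - 1) h
    have hPM : ∀ S ∈ G.filter (fun S => g S = (x, y)), pairMoment n lam ε s (S false) (S true) ≤
        a ^ (ℓ * m - h) * s ^ (k - 1 + h) := by
      intro S hS
      have h1 := ((A S (hmem S hS)).pairMoment_le hT (by omega) hd hM).2
      rwa [htot S hS, pow_mul] at h1
    have hs' : a ^ (ℓ * m - h) * s ^ (k - 1 + h) ≤
        a ^ (ℓ * m) * s ^ (k - 1) * ((q / 16) ^ h * j ^ h) := by
      calc a ^ (ℓ * m - h) * s ^ (k - 1 + h) = a ^ (ℓ * m - h) * s ^ (k - 1) * s ^ h := by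
            rw [pow_add]; ring
        _ ≤ a ^ (ℓ * m - h) * s ^ (k - 1) * (q / 16 * (a * j)) ^ h := by gcongr
        _ = a ^ (ℓ * m - h + h) * s ^ (k - 1) * ((q / 16) ^ h * j ^ h) := by
            rw [mul_pow, mul_pow, pow_add]; ring
        _ = _ := by rw [Nat.sub_add_cancel hhM]
    calc (Nat.card (T ≃g T) : ℝ) *
          ∑ S ∈ G.filter (fun S => g S = (x, y)), pairMoment n lam ε s (S false) (S true)
        ≤ (Nat.card (T ≃g T) : ℝ) * ((G.filter (fun S => g S = (x, y))).card *
            (a ^ (ℓ * m) * s ^ (k - 1) * ((q / 16) ^ h * j ^ h))) := by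
          refine mul_le_mul_of_nonneg_left ?_ (Nat.cast_nonneg _)
          refine (Finset.sum_le_card_nsmul _ _ _ fun S hS => (hPM S hS).trans hs').trans_eq ?_
          rw [nsmul_eq_mul]
      _ = ((Nat.card (T ≃g T) * (G.filter (fun S => g S = (x, y))).card : ℕ) : ℝ) *
            (a ^ (ℓ * m) * s ^ (k - 1) * ((q / 16) ^ h * j ^ h)) := by
          push_cast; ring
      _ ≤ ((n ^ k * 4 ^ m * (freeVertices (P := P) d (J false) ℓ fun _ _ => 0).card *
            (freeVertices d (J true) ℓ y).card * (k - 1 + h).choose h : ℕ) : ℝ) *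
            (a ^ (ℓ * m) * s ^ (k - 1) * ((q / 16) ^ h * j ^ h)) := by
          refine mul_le_mul_of_nonneg_right (by exact_mod_cast hcard) (by positivity)
      _ = (freeVertices (P := P) d (J false) ℓ fun _ _ => 0).card *
            ((freeVertices d (J true) ℓ y).card * j ^ h) * (((k - 1 + h).choose h : ℝ) * q ^ h) *
            ((n : ℝ) ^ k * 4 ^ m * a ^ (ℓ * m) * s ^ (k - 1) * (1 / 16) ^ h) := by
          push_cast
          rw [div_eq_mul_one_div q, mul_pow]
          ring
      _ ≤ Z * Z * ((1 - q)⁻¹) ^ (k - 1) *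
            ((n : ℝ) ^ k * 4 ^ m * a ^ (ℓ * m) * s ^ (k - 1) * (1 / 16) ^ h) := by
          gcongr
      _ = n ^ k * 4 ^ m * Z ^ 2 * a ^ (ℓ * m) * s ^ (k - 1) * ((1 - q)⁻¹) ^ (k - 1) *
            ((1 / 4 : ℝ) ^ (∑ p, (x p false + x p true)) * (1 / 4 : ℝ) ^ h) := by
          rw [hxh, show (1 / 16 : ℝ) = 1 / 4 * (1 / 4) by norm_num, mul_pow]
          ring
  have hI2 := sum_arms_le (ℓ := ℓ) (m := m) (P := P) hT.isPairing.card_eq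
  rw [← hI] at hI2
  have hI0 : (0 : ℝ) ≤ ∑ x ∈ I, (1 / 4 : ℝ) ^ (∑ p, (x p false + x p true)) :=
    Finset.sum_nonneg fun _ _ => by positivity
  have hq' : 0 ≤ (1 - q)⁻¹ := inv_nonneg.2 (by linarith)
  set R : ℝ := n ^ k * 4 ^ m * Z ^ 2 * a ^ (ℓ * m) * s ^ (k - 1) * ((1 - q)⁻¹) ^ (k - 1) with hR
  have hR0 : 0 ≤ R := by positivity
  calc (Nat.card (T ≃g T) : ℝ) * ∑ S₁ ∈ copies J₁ ℓ T P, ∑ S₂ ∈ copies J₂ ℓ T P,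
        pairMoment n lam ε s S₁ S₂ * (if GoodPair J₁ J₂ ℓ T P S₁ S₂ then 1 else 0)
      = ∑ i ∈ I ×ˢ I, (Nat.card (T ≃g T) : ℝ) *
          ∑ S ∈ G.filter (fun S => g S = i), pairMoment n lam ε s (S false) (S true) := by
        rw [hsumG, ← Finset.sum_fiberwise_of_maps_to hgI, Finset.mul_sum]
    _ ≤ ∑ i ∈ I ×ˢ I, R * ((1 / 4 : ℝ) ^ (∑ p, (i.1 p false + i.1 p true)) *
          (1 / 4 : ℝ) ^ (∑ p, (i.2 p false + i.2 p true))) := Finset.sum_le_sum hfib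
    _ = R * ((∑ x ∈ I, (1 / 4 : ℝ) ^ (∑ p, (x p false + x p true))) *
          ∑ x ∈ I, (1 / 4 : ℝ) ^ (∑ p, (x p false + x p true))) := by
        rw [← Finset.mul_sum, Finset.sum_product, Finset.sum_mul_sum]
    _ ≤ R * (2 ^ m * 2 ^ m) := by
        refine mul_le_mul_of_nonneg_left ?_ hR0
        exact mul_le_mul hI2 hI2 hI0 (by positivity)
    _ = _ := by
        have e : (16 : ℝ) ^ m = 4 ^ m * (2 ^ m * 2 ^ m) := by
          rw [← mul_pow, ← mul_pow]
          norm_num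
        rw [hR, hZ, e, mul_comm 2 m, pow_mul _ m 2]
        ring

end

/-! ### Pairs of copies which share exactly the tree -/

/-- Choosing the values of an injective function one after the other. -/
theorem prod_card_sub_le_card_injective {ι α : Type*} [Fintype ι] [DecidableEq ι] [DecidableEq α]
    (d : α) (A : ι → Finset α) :
    ∏ i, ((A i).card - Fintype.card ι) ≤
      ((Fintype.piFinset A).filter fun f => Function.Injective f).card := by
  -- functions which take the value `d` outside a set and are injective on it
  let Q : Finset ι → Finset (ι → α) := fun s =>
    (Fintype.piFinset fun i => if i ∈ s then A i else {d}).filter fun f => Set.InjOn f s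
  have hQ : ∀ s f, f ∈ Q s ↔ (∀ i ∈ s, f i ∈ A i) ∧ (∀ i ∉ s, f i = d) ∧ Set.InjOn f s := by
    intro s f
    simp only [Q, Finset.mem_filter, Fintype.mem_piFinset, ← and_assoc]
    refine and_congr_left fun _ => ⟨fun h => ⟨fun i hi => ?_, fun i hi => ?_⟩, fun h i => ?_⟩
    · simpa [hi] using h i
    · simpa [hi] using h i
    · by_cases hi : i ∈ s
      · simpa [hi] using h.1 i hi
      · simpa [hi] using h.2 i hi
  have key : ∀ s : Finset ι, ∏ i ∈ s, ((A i).card - Fintype.card ι) ≤ (Q s).card := by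
    intro s
    induction s using Finset.induction_on with
    | empty =>
      rw [Finset.prod_empty, Nat.one_le_iff_ne_zero, Finset.card_ne_zero]
      exact ⟨fun _ => d, (hQ _ _).2 ⟨by simp, by simp, by simp⟩⟩
    | insert a s ha ih =>
      rw [Finset.prod_insert ha, mul_comm]
      have h1 : (Q s).card * ((A a).card - Fintype.card ι) ≤
          ((Q s).sigma fun f => A a \ s.image f).card := by
        rw [Finset.card_sigma, ← smul_eq_mul]
        refine Finset.card_nsmul_le_sum _ _ _ fun f _ => ?_
        refine le_trans ?_ (Finset.le_card_sdiff _ _)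
        exact Nat.sub_le_sub_left (Finset.card_image_le.trans (Finset.card_le_univ s)) _
      refine (Nat.mul_le_mul_right _ ih).trans (h1.trans ?_)
      refine Finset.card_le_card_of_injOn (fun p => Function.update p.1 a p.2) ?_ ?_
      · rintro ⟨f, x⟩ hp
        simp only [Finset.coe_sigma, Set.mem_sigma_iff, Finset.mem_coe, hQ, Finset.mem_sdiff,
          Finset.mem_image, not_exists, not_and] at hp
        obtain ⟨⟨h1, h2, h3⟩, h4, h5⟩ := hp
        refine (hQ _ _).2 ⟨fun i hi => ?_, fun i hi => ?_, ?_⟩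
        · by_cases hia : i = a
          · subst hia; simpa using h4
          · dsimp only
            rw [Function.update_of_ne hia]
            exact h1 i ((Finset.mem_insert.1 hi).resolve_left hia)
        · rw [Finset.mem_insert, not_or] at hi
          dsimp only
          rw [Function.update_of_ne hi.1]
          exact h2 i hi.2
        · rw [Finset.coe_insert, Set.injOn_insert (by simpa using ha)]
          refine ⟨fun i hi j hj hij => ?_, ?_⟩
          · have hia : i ≠ a := by rintro rfl; exact ha hi
            have hja : j ≠ a := by rintro rfl; exact ha hj
            dsimp only at hij
            rw [Function.update_of_ne hia, Function.update_of_ne hja] at hij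
            exact h3 hi hj hij
          · rintro ⟨i, hi, hi'⟩
            have hia : i ≠ a := by rintro rfl; exact ha hi
            simp only [Function.update_self] at hi'
            rw [Function.update_of_ne hia] at hi'
            exact h5 i hi hi'
      · rintro ⟨f, x⟩ hp ⟨f', x'⟩ hp' heq
        simp only [Finset.coe_sigma, Set.mem_sigma_iff, Finset.mem_coe, hQ] at hp hp'
        dsimp only at heq
        have hx : x = x' := by simpa using congrFun heq a
        have hf : f = f' := by
          funext i
          by_cases hia : i = a
          · subst hia; rw [hp.1.2.1 _ ha, hp'.1.2.1 _ ha]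
          · simpa [Function.update_of_ne hia] using congrFun heq i
        rw [hx, hf]
  refine (key Finset.univ).trans (Finset.card_le_card fun f hf => ?_)
  rw [hQ] at hf
  simp only [Finset.mem_filter, Fintype.mem_piFinset]
  exact ⟨fun i => hf.1 i (Finset.mem_univ i), by simpa [Set.injOn_univ] using hf.2.2⟩

theorem edgeSign_mul_edgeSign {n : ℕ} (σ : Fin n → ℤˣ) (x y z : Fin n) :
    edgeSign σ s(x, y) * edgeSign σ s(y, z) = edgeSign σ s(x, z) := by
  rw [edgeSign_mk, edgeSign_mk, edgeSign_mk, ← Int.cast_mul, ← Units.val_mul]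
  congr 2
  rw [mul_assoc, ← mul_assoc (σ y), Int.units_mul_self, one_mul]

/-- The signs along a path multiply to the sign of its two ends. -/
theorem prod_edgeSign_pathEdges {n : ℕ} (σ : Fin n → ℤˣ) (ℓ : ℕ) (p : ℕ → Fin n) :
    ((pathEdges ℓ p).map (edgeSign σ)).prod = edgeSign σ s(p 0, p ℓ) := by
  induction ℓ with
  | zero =>
    rw [edgeSign_mk, Int.units_mul_self]
    simp [pathEdges]
  | succ ℓ ih =>
    rw [← edgeSign_mul_edgeSign σ _ (p ℓ), ← ih]
    simp [pathEdges, Multiset.range_succ, mul_comm]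

theorem edgeSign_mul_self {n : ℕ} (σ : Fin n → ℤˣ) (e : Sym2 (Fin n)) :
    edgeSign σ e * edgeSign σ e = 1 := by
  induction e with
  | _ x y =>
    rw [edgeSign_mk, ← Int.cast_mul, ← Units.val_mul, Int.units_mul_self]
    simp

section

variable {n k ℓ m : ℕ} {J : Bool → Finset (Fin n)} {T : SimpleGraph (Fin k)}
  {P : Finset (Sym2 (Fin k))} {φ : Fin k ↪ Fin n} {w : Bool → Sym2 (Fin k) → ℕ → Fin n}
  {S : Bool → Multiset (Sym2 (Fin n))}

theorem IsDecomposition.eq_or_of_mem_support {J : Finset (Fin n)} {φ : Fin k ↪ Fin n}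
    {w : Sym2 (Fin k) → ℕ → Fin n} {S : Multiset (Sym2 (Fin n))}
    (h : IsDecomposition J ℓ T P φ w S) {e : Sym2 (Fin n)} {v : Fin n} (he : e ∈ S) (hv : v ∈ e) :
    v ∈ Set.range φ ∨ ∃ a ∈ P, ∃ i, 0 < i ∧ i < ℓ ∧ v = w a i := by
  rcases h.mem_iff.1 he with h1 | ⟨a, ha, t, ht, rfl⟩
  · obtain ⟨x, y, -, rfl⟩ := exists_of_mem_treeEdges h1
    rcases Sym2.mem_iff.1 hv with rfl | rfl
    · exact Or.inl ⟨_, rfl⟩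
    · exact Or.inl ⟨_, rfl⟩
  · have key : ∀ i ≤ ℓ, v = w a i → v ∈ Set.range φ ∨
        ∃ a ∈ P, ∃ i, 0 < i ∧ i < ℓ ∧ v = w a i := by
      intro i hi hvi
      by_cases hi' : i = 0 ∨ i = ℓ
      · obtain ⟨u, -, hu⟩ := h.exists_of_endpoint ha hi'
        exact Or.inl ⟨u, by rw [hvi, hu]⟩
      · exact Or.inr ⟨a, ha, i, by omega, by omega, hvi⟩
    rcases Sym2.mem_iff.1 hv with h2 | h2
    · exact key t ht.le h2
    · exact key (t + 1) ht h2

theorem mem_range_of_mem_both (h : ∀ b, IsDecomposition (J b) ℓ T P φ (w b) (S b))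
    (hx : ∀ a ∈ P, ∀ a' ∈ P, ∀ i j, 0 < i → i < ℓ → 0 < j → j < ℓ → w false a i ≠ w true a' j)
    {e e' : Sym2 (Fin n)} {v : Fin n} (he : e ∈ S false) (hv : v ∈ e) (he' : e' ∈ S true)
    (hv' : v ∈ e') : v ∈ Set.range φ := by
  rcases (h false).eq_or_of_mem_support he hv with h1 | ⟨a, ha, i, hi0, hi, h1⟩
  · exact h1
  · rcases (h true).eq_or_of_mem_support he' hv' with h2 | ⟨a', ha', j, hj0, hj, h2⟩
    · exact h2
    · exact absurd (h1.symm.trans h2) (hx a ha a' ha' i j hi0 hi hj0 hj)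

theorem mem_treeEdges_of_mem_both (h : ∀ b, IsDecomposition (J b) ℓ T P φ (w b) (S b))
    (hn : ∀ b, IsNonoverlapping ℓ P φ (w b)) (hℓ : 2 ≤ ℓ)
    (hx : ∀ a ∈ P, ∀ a' ∈ P, ∀ i j, 0 < i → i < ℓ → 0 < j → j < ℓ → w false a i ≠ w true a' j)
    {e : Sym2 (Fin n)} (he : e ∈ S false) (he' : e ∈ S true) : e ∈ treeEdges T φ := by
  rcases (h false).mem_iff.1 he with h1 | ⟨a, ha, t, ht, rfl⟩
  · exact h1
  · exfalso
    have key : ∀ i, 0 < i → i < ℓ → w false a i ∉ s(w false a t, w false a (t + 1)) := by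
      intro i hi0 hi hmem
      obtain ⟨u, hu⟩ := mem_range_of_mem_both h hx he hmem he' hmem
      exact (hn false).path_tree a ha i hi0 hi u hu.symm
    rcases Nat.eq_zero_or_pos t with rfl | ht0
    · exact key 1 (by omega) (by omega) (Sym2.mem_mk_right _ _)
    · exact key t ht0 ht (Sym2.mem_mk_left _ _)

/-- Two copies which have exactly the tree in common form a good pair. -/
theorem goodPair_of_common_tree (h : ∀ b, IsDecomposition (J b) ℓ T P φ (w b) (S b))
    (hn : ∀ b, IsNonoverlapping ℓ P φ (w b)) (hT : IsRigidPairing m T P) (hℓ : 2 ≤ ℓ)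
    (hx : ∀ a ∈ P, ∀ a' ∈ P, ∀ i j, 0 < i → i < ℓ → 0 < j → j < ℓ → w false a i ≠ w true a' j) :
    GoodPair (J false) (J true) ℓ T P (S false) (S true) := by
  have htree : ∀ b, ∀ e ∈ treeEdges T φ, e ∈ S b := fun b e he => (h b).mem_iff.2 (Or.inl he)
  have hle : underlying (treeEdges T φ) ≤ underlying (S false) ⊓ underlying (S true) := by
    refine ⟨?_, ?_⟩
    · rintro v ⟨e, he, hv⟩
      exact ⟨⟨e, htree false e he, hv⟩, ⟨e, htree true e he, hv⟩⟩
    · rintro x y ⟨hxy, he⟩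
      exact ⟨⟨hxy, htree false _ he⟩, ⟨hxy, htree true _ he⟩⟩
  refine ⟨φ, w false, φ, w true, h false, hn false, h true, hn true, ?_, hle, hle⟩
  have hmem : ∀ v, φ v ∈ (underlying (S false) ⊓ underlying (S true)).verts := fun v =>
    ⟨mem_support.1 (mem_support_of_tree (h false) hT v),
      mem_support.1 (mem_support_of_tree (h true) hT v)⟩
  have hbij : Function.Bijective
      (fun v => (⟨φ v, hmem v⟩ : (underlying (S false) ⊓ underlying (S true)).verts)) := by
    refine ⟨fun u v huv => φ.injective (congrArg Subtype.val huv), ?_⟩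
    rintro ⟨v, ⟨e, he, hv⟩, ⟨e', he', hv'⟩⟩
    obtain ⟨u, hu⟩ := mem_range_of_mem_both h hx he hv he' hv'
    exact ⟨u, Subtype.ext hu⟩
  let I : T ≃g (underlying (S false) ⊓ underlying (S true)).coe :=
    { toEquiv := Equiv.ofBijective _ hbij
      map_rel_iff' := by
        intro u v
        change (underlying (S false) ⊓ underlying (S true)).Adj (φ u) (φ v) ↔ _
        constructor
        · rintro ⟨⟨-, h1⟩, -, h2⟩
          exact mk_mem_treeEdges.1 (mem_treeEdges_of_mem_both h hn hℓ hx h1 h2)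
        · intro huv
          have h1 := mk_mem_treeEdges (φ := φ).2 huv
          have h2 : φ u ≠ φ v := φ.injective.ne huv.ne
          exact ⟨⟨h2, htree false _ h1⟩, ⟨h2, htree true _ h1⟩⟩ }
  exact I.isTree_iff.1 hT.isTree

/-- If two nonoverlapping copies share exactly the tree, then the two paths of every pair form a cycle,
whose edge signs multiply to `1`. -/
theorem le_pairMoment_of_common_tree {lam ε s : ℝ}
    (hd : SmallDensity n lam ε s (k - 1 + ℓ * m))
    (h : ∀ b, IsDecomposition (J b) ℓ T P φ (w b) (S b))
    (hn : ∀ b, IsNonoverlapping ℓ P φ (w b)) (hT : IsRigidPairing m T P) (hℓ : 2 ≤ ℓ)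
    (hx : ∀ a ∈ P, ∀ a' ∈ P, ∀ i j, 0 < i → i < ℓ → 0 < j → j < ℓ → w false a i ≠ w true a' j) :
    (momLin n lam ε s 1 0 ^ 2) ^ (ℓ * m) * (s * (1 - lam / n)) ^ (k - 1) ≤
      pairMoment n lam ε s (S false) (S true) := by
  have hnd : ∀ b, (S b).Nodup := fun b => (hn b).nodup (h b) hℓ
  let R : Bool → Multiset (Sym2 (Fin n)) := fun b => ∑ a ∈ P, pathEdges ℓ (w b a)
  have hSR : ∀ b, S b = treeEdges T φ + R b := fun b => (h b).edges
  have hndR : ∀ b, (R b).Nodup := fun b => by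
    have h1 := hnd b
    rw [hSR b] at h1
    exact (Multiset.nodup_add.1 h1).2.1
  have hdis : ∀ b, Disjoint (treeEdges T φ) (R b) := fun b => by
    have h1 := hnd b
    rw [hSR b] at h1
    exact (Multiset.nodup_add.1 h1).2.2
  have hdisR : Disjoint (R false).toFinset (R true).toFinset := by
    rw [Finset.disjoint_left]
    intro e he he'
    rw [Multiset.mem_toFinset] at he he'
    have h1 := mem_treeEdges_of_mem_both h hn hℓ hx (e := e)
      (by rw [hSR]; exact Multiset.mem_add.2 (Or.inr he))
      (by rw [hSR]; exact Multiset.mem_add.2 (Or.inr he'))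
    exact Multiset.disjoint_left.1 (hdis false) h1 he
  have hinter : (S false).toFinset ∩ (S true).toFinset = (treeEdges T φ).toFinset := by
    ext e
    simp only [Finset.mem_inter, Multiset.mem_toFinset]
    refine ⟨fun he => mem_treeEdges_of_mem_both h hn hℓ hx he.1 he.2, fun he => ?_⟩
    exact ⟨(h false).mem_iff.2 (Or.inl he), (h true).mem_iff.2 (Or.inl he)⟩
  have hsymm : symmDiff (S false).toFinset (S true).toFinset =
      (R false).toFinset ∪ (R true).toFinset := by
    have hnot : ∀ b e, e ∈ R b → e ∉ treeEdges T φ := fun b e he he' =>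
      Multiset.disjoint_left.1 (hdis b) he' he
    ext e
    have h1 : e ∈ (R false).toFinset → e ∉ (R true).toFinset := fun he =>
      Finset.disjoint_left.1 hdisR he
    have h2 := hnot false e
    have h3 := hnot true e
    simp only [Finset.mem_symmDiff, Finset.mem_union, Multiset.mem_toFinset, hSR,
      Multiset.mem_add] at h1 ⊢
    tauto
  have hcardR : ∀ b, (R b).toFinset.card = ℓ * m := fun b => by
    rw [Multiset.toFinset_card_of_nodup (hndR b), Multiset.card_sum]
    simp [pathEdges, hT.isPairing.card_eq, mul_comm]
  have hsignR : ∀ (σ : Fin n → ℤˣ) b, ∏ e ∈ (R b).toFinset, edgeSign σ e =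
      ∏ a ∈ P, edgeSign σ (a.map φ) := by
    intro σ b
    have h1 : ∏ e ∈ (R b).toFinset, edgeSign σ e = ((R b).map (edgeSign σ)).prod := by
      rw [Finset.prod, Multiset.toFinset_val, Multiset.dedup_eq_self.2 (hndR b)]
    have h2 : (R b).map (edgeSign σ) = ∑ a ∈ P, (pathEdges ℓ (w b a)).map (edgeSign σ) :=
      map_sum (Multiset.mapAddMonoidHom (edgeSign σ)) _ _
    rw [h1, h2, Multiset.prod_sum]
    refine Finset.prod_congr rfl fun a ha => ?_
    rw [prod_edgeSign_pathEdges, (h b).endpoints a ha]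
  have hk := hT.two_le
  have h1 := le_pairMoment hd (by omega) (S := S false) (S' := S true) (fun e he => by
    rcases Multiset.mem_add.1 he with he | he
    · exact (h false).not_isDiag he
    · exact (h true).not_isDiag he) (hnd false) (hnd true) (fun σ => by
    rw [hsymm, Finset.prod_union hdisR, hsignR, hsignR, ← Finset.prod_mul_distrib]
    exact Finset.prod_eq_one fun a _ => edgeSign_mul_self σ _)
  rw [hsymm, Finset.card_union_of_disjoint hdisR, hcardR, hcardR, hinter,
    Multiset.toFinset_card_of_nodup (treeEdges_nodup T φ), treeEdges_card hT.isTree,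
    ← two_mul, pow_mul] at h1
  exact h1

end

/-! ### Placements of two copies sharing the tree -/

section

variable {n k : ℕ} (ℓ : ℕ) (P : Finset (Sym2 (Fin k)))

/-- The vertices of two nonoverlapping copies of a decorated tree which share exactly the tree:
the vertices of the tree, and the interior vertices of the paths of both copies. -/
abbrev Slot {k : ℕ} (ℓ : ℕ) (P : Finset (Sym2 (Fin k))) : Type := Fin k ⊕ (Bool × P × Fin (ℓ - 1))

/-- The vertex number `t` of the path `a` of the copy `b`; the path runs between the two vertices of the
pair `a`, in the order given by `Quot.out`. -/
def slot (b : Bool) (a : P) (t : ℕ) : Slot ℓ P :=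
  if h : 0 < t ∧ t < ℓ then Sum.inr (b, a, ⟨t - 1, by omega⟩)
  else if t = 0 then Sum.inl (Quot.out a.1).1 else Sum.inl (Quot.out a.1).2

/-- The vertices of `[n]` that may be placed at a slot: the tree avoids `J false ∪ J true`, and the first
and the last interior vertex of a path of the copy `b` lie in `J b`. The interior vertex number `t` of
a path has the index `t - 1`. -/
def slotDomain (J : Bool → Finset (Fin n)) : Slot ℓ P → Finset (Fin n)
  | Sum.inl _ => Finset.univ \ (J false ∪ J true)
  | Sum.inr (b, _, i) => if (i : ℕ) = 0 ∨ (i : ℕ) + 2 = ℓ then J b else Finset.univ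

/-- The placements of two nonoverlapping copies which share exactly the tree. -/
def placements (J : Bool → Finset (Fin n)) : Finset (Slot ℓ P → Fin n) :=
  (Fintype.piFinset (slotDomain ℓ P J)).filter fun c => Function.Injective c

/-- The paths of the copy `b` of a placement. -/
def placedPath (c : Slot ℓ P → Fin n) (b : Bool) (a : Sym2 (Fin k)) (t : ℕ) : Fin n :=
  if h : a ∈ P then c (slot ℓ P b ⟨a, h⟩ t) else c (Sum.inl (Quot.out a).1)

/-- The copy `b` of a placement. -/
def placedCopy (T : SimpleGraph (Fin k)) (c : Slot ℓ P → Fin n) (b : Bool) :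
    Multiset (Sym2 (Fin n)) :=
  T.edgeFinset.val.map (Sym2.map fun v => c (Sum.inl v)) +
    ∑ a ∈ P, pathEdges ℓ (placedPath ℓ P c b a)

end

section

variable {n k ℓ m : ℕ} {P : Finset (Sym2 (Fin k))} {T : SimpleGraph (Fin k)}
  {J : Bool → Finset (Fin n)}

theorem slot_interior {b : Bool} {a : P} {t : ℕ} (h0 : 0 < t) (h : t < ℓ) :
    slot ℓ P b a t = Sum.inr (b, a, ⟨t - 1, by omega⟩) := by
  simp [slot, h0, h]

theorem slot_zero {b : Bool} {a : P} : slot ℓ P b a 0 = Sum.inl (Quot.out a.1).1 := by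
  simp [slot]

theorem slot_top {b : Bool} {a : P} (hℓ : 0 < ℓ) :
    slot ℓ P b a ℓ = Sum.inl (Quot.out a.1).2 := by
  simp [slot, hℓ.ne']

theorem placedPath_interior {c : Slot ℓ P → Fin n} {b : Bool} {a : Sym2 (Fin k)} (ha : a ∈ P)
    {t : ℕ} (h0 : 0 < t) (h : t < ℓ) :
    placedPath ℓ P c b a t = c (Sum.inr (b, ⟨a, ha⟩, ⟨t - 1, by omega⟩)) := by
  simp [placedPath, ha, slot_interior h0 h]

theorem placedPath_zero {c : Slot ℓ P → Fin n} {b : Bool} {a : Sym2 (Fin k)} :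
    placedPath ℓ P c b a 0 = c (Sum.inl (Quot.out a).1) := by
  simp [placedPath, slot_zero]

theorem placedPath_top {c : Slot ℓ P → Fin n} {b : Bool} {a : Sym2 (Fin k)} (ha : a ∈ P)
    (hℓ : 0 < ℓ) : placedPath ℓ P c b a ℓ = c (Sum.inl (Quot.out a).2) := by
  simp [placedPath, ha, slot_top hℓ]

/-- The embedding of the tree given by a placement. -/
def placedTree (c : Slot ℓ P → Fin n) (hc : Function.Injective c) : Fin k ↪ Fin n :=
  ⟨fun v => c (Sum.inl v), fun _ _ h => Sum.inl_injective (hc h)⟩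

theorem isDecomposition_of_mem_placements (hT : IsRigidPairing m T P) (hℓ : 2 ≤ ℓ)
    {c : Slot ℓ P → Fin n} (hc : c ∈ placements ℓ P J) (hinj : Function.Injective c) (b : Bool) :
    IsDecomposition (J b) ℓ T P (placedTree c hinj) (placedPath ℓ P c b)
      (placedCopy ℓ P T c b) := by
  have hdom : ∀ i, c i ∈ slotDomain ℓ P J i := by
    simp only [placements, Finset.mem_filter, Fintype.mem_piFinset] at hc
    exact hc.1
  refine ⟨fun v => ?_, fun a ha => ?_, fun a ha => ?_, fun a ha => ⟨?_, ?_⟩, rfl⟩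
  · have h1 := hdom (Sum.inl v)
    simp only [slotDomain, Finset.mem_sdiff, Finset.mem_union, not_or] at h1
    cases b
    · exact h1.2.1
    · exact h1.2.2
  · have hne : (Quot.out a).1 ≠ (Quot.out a).2 := by
      intro h
      apply hT.isPairing.not_isDiag a ha
      have h1 : a = s((Quot.out a).1, (Quot.out a).2) := (Quot.out_eq a).symm
      rw [h1]
      exact h
    intro t ht t' ht' heq
    rw [Set.mem_Iic] at ht ht'
    have cases3 : ∀ i ≤ ℓ, i = 0 ∨ i = ℓ ∨ (0 < i ∧ i < ℓ) := by omega
    rcases cases3 t ht with rfl | rfl | ⟨h1, h2⟩ <;>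
      rcases cases3 t' ht' with rfl | rfl | ⟨h3, h4⟩
    · rfl
    · rw [placedPath_zero, placedPath_top ha (by omega)] at heq
      exact absurd (Sum.inl_injective (hinj heq)) hne
    · rw [placedPath_zero, placedPath_interior ha h3 h4] at heq
      exact absurd (hinj heq) (by simp)
    · rw [placedPath_zero, placedPath_top ha (by omega)] at heq
      exact absurd (Sum.inl_injective (hinj heq)) hne.symm
    · rfl
    · rw [placedPath_top ha (by omega), placedPath_interior ha h3 h4] at heq
      exact absurd (hinj heq) (by simp)
    · rw [placedPath_zero, placedPath_interior ha h1 h2] at heq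
      exact absurd (hinj heq) (by simp)
    · rw [placedPath_top ha (by omega), placedPath_interior ha h1 h2] at heq
      exact absurd (hinj heq) (by simp)
    · rw [placedPath_interior ha h3 h4, placedPath_interior ha h1 h2] at heq
      have h5 := hinj heq
      simp only [Sum.inr.injEq, Prod.mk.injEq, Fin.mk.injEq, true_and] at h5
      omega
  · rw [placedPath_zero, placedPath_top ha (by omega)]
    conv_rhs => rw [← Quot.out_eq a]
    rfl
  · rw [placedPath_interior ha (by omega) (by omega)]
    have h1 := hdom (Sum.inr (b, ⟨a, ha⟩, ⟨1 - 1, by omega⟩))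
    simpa [slotDomain] using h1
  · rw [placedPath_interior ha (by omega) (by omega)]
    have h1 := hdom (Sum.inr (b, ⟨a, ha⟩, ⟨ℓ - 1 - 1, by omega⟩))
    have h2 : ℓ - 1 - 1 + 2 = ℓ := by omega
    simpa only [slotDomain, h2, or_true, if_true] using h1

theorem isNonoverlapping_of_injective {c : Slot ℓ P → Fin n} (hinj : Function.Injective c)
    (b : Bool) : IsNonoverlapping ℓ P (placedTree c hinj) (placedPath ℓ P c b) := by
  refine ⟨fun a ha i h0 hi v heq => ?_, fun a ha a' ha' hne i h0 hi j hj0 hj heq => ?_⟩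
  · rw [placedPath_interior ha h0 hi] at heq
    exact absurd (hinj heq) (by simp)
  · rw [placedPath_interior ha h0 hi, placedPath_interior ha' hj0 hj] at heq
    have h5 := hinj heq
    simp only [Sum.inr.injEq, Prod.mk.injEq, Subtype.mk.injEq, true_and] at h5
    exact hne h5.1

theorem placedPath_ne {c : Slot ℓ P → Fin n} (hinj : Function.Injective c) :
    ∀ a ∈ P, ∀ a' ∈ P, ∀ i j, 0 < i → i < ℓ → 0 < j → j < ℓ →
      placedPath ℓ P c false a i ≠ placedPath ℓ P c true a' j := by
  intro a ha a' ha' i j hi0 hi hj0 hj heq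
  rw [placedPath_interior ha hi0 hi, placedPath_interior ha' hj0 hj] at heq
  have h5 := hinj heq
  simp at h5

/-- At most `|Aut T|` placements give the same two copies. -/
theorem card_placements_fibre_le (hT : IsRigidPairing m T P) (hℓ : 2 ≤ ℓ)
    (p : Bool → Multiset (Sym2 (Fin n))) :
    ((placements ℓ P J).filter fun c => placedCopy ℓ P T c = p).card ≤ Nat.card (T ≃g T) := by
  have hfin : Finite (T ≃g T) :=
    Finite.of_injective (fun a : T ≃g T => (a : Fin k → Fin k)) DFunLike.coe_injective
  have := Fintype.ofFinite (T ≃g T)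
  rcases Finset.eq_empty_or_nonempty
    ((placements ℓ P J).filter fun c => placedCopy ℓ P T c = p) with h0 | ⟨c₀, hc₀⟩
  · rw [h0]; simp
  have hmem : ∀ c ∈ (placements ℓ P J).filter fun c => placedCopy ℓ P T c = p,
      c ∈ placements ℓ P J ∧ Function.Injective c ∧ placedCopy ℓ P T c = p := by
    intro c hc
    have h1 := (Finset.mem_filter.1 hc).1
    exact ⟨h1, (Finset.mem_filter.1 h1).2, (Finset.mem_filter.1 hc).2⟩
  obtain ⟨hc₁, hi₀, hp₀⟩ := hmem c₀ hc₀
  -- the tree is the common part of the two copies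
  have htree : ∀ c (hc : c ∈ placements ℓ P J) (hi : Function.Injective c)
      (hp : placedCopy ℓ P T c = p) e, e ∈ treeEdges T (placedTree c hi) ↔
        e ∈ p false ∧ e ∈ p true := by
    intro c hc hi hp e
    have h := isDecomposition_of_mem_placements (J := J) hT hℓ hc hi
    rw [hp] at h
    refine ⟨fun he => ⟨(h false).mem_iff.2 (Or.inl he), (h true).mem_iff.2 (Or.inl he)⟩,
      fun he => ?_⟩
    exact mem_treeEdges_of_mem_both h (isNonoverlapping_of_injective hi) hℓ (placedPath_ne hi)
      he.1 he.2
  -- placements with the same copies differ by an automorphism on the tree, and the tree part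
  -- determines the paths
  have haut : ∀ c : Slot ℓ P → Fin n, ∃ a : T ≃g T,
      c ∈ (placements ℓ P J).filter (fun c => placedCopy ℓ P T c = p) →
        ∀ v, c (Sum.inl v) = c₀ (Sum.inl (a v)) := by
    intro c
    by_cases hc : c ∈ (placements ℓ P J).filter fun c => placedCopy ℓ P T c = p
    · obtain ⟨h1, hi, hp⟩ := hmem c hc
      have h2 : treeEdges T (placedTree c₀ hi₀) = treeEdges T (placedTree c hi) := by
        rw [Multiset.Nodup.ext (treeEdges_nodup _ _) (treeEdges_nodup _ _)]
        intro e
        rw [htree c₀ hc₁ hi₀ hp₀, htree c h1 hi hp]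
      obtain ⟨a, ha⟩ := exists_iso_of_treeEdges_eq hT.isTree hT.two_le h2
      exact ⟨a, fun _ => ha⟩
    · exact ⟨SimpleGraph.Iso.refl, fun h => absurd h hc⟩
  choose A hA using haut
  rw [Nat.card_eq_fintype_card, ← Finset.card_univ]
  refine Finset.card_le_card_of_injOn A (fun c _ => Finset.mem_coe.2 (Finset.mem_univ _)) ?_
  intro c hc c' hc' hcc
  rw [Finset.mem_coe] at hc hc'
  obtain ⟨h1, hi, hp⟩ := hmem c hc
  obtain ⟨h1', hi', hp'⟩ := hmem c' hc'
  have hinl : ∀ v, c (Sum.inl v) = c' (Sum.inl v) := fun v => by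
    rw [hA c hc, hA c' hc', hcc]
  funext x
  rcases x with v | ⟨b, ⟨a, ha⟩, i⟩
  · exact hinl v
  · have h := isDecomposition_of_mem_placements (J := J) hT hℓ h1 hi b
    have h' := isDecomposition_of_mem_placements (J := J) hT hℓ h1' hi' b
    have h2 := strand_eq_strand h h' (isNonoverlapping_of_injective hi' b) hT hℓ ha false
      (by simp only [strand, Bool.false_eq_true, if_false, placedPath_zero, hinl]) le_rfl
      (by
        intro t ht
        simp only [strand, Bool.false_eq_true, if_false]
        rw [hp', ← hp]
        exact h.mem_iff.2 (Or.inr ⟨a, ha, t, ht, rfl⟩)) (i + 1) (by omega)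
    simp only [strand, Bool.false_eq_true, if_false] at h2
    rw [placedPath_interior ha (by omega) (by omega),
      placedPath_interior ha (by omega) (by omega)] at h2
    exact h2

/-- The number of placements: the vertices are chosen one after the other, avoiding all others. -/
theorem le_card_placements (d : Fin n) (hP : P.card = m) (hℓ : 3 ≤ ℓ) {j : ℕ}
    (hJ : ∀ b, (J b).card = j) :
    (n - 2 * j - (k + 2 * m * (ℓ - 1))) ^ k * ((j - (k + 2 * m * (ℓ - 1))) ^ 2 *
      (n - (k + 2 * m * (ℓ - 1))) ^ (ℓ - 3)) ^ (2 * m) ≤ (placements ℓ P J).card := by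
  have hcard : Fintype.card (Slot ℓ P) = k + 2 * m * (ℓ - 1) := by
    simp [hP, mul_assoc]
  have h1 := prod_card_sub_le_card_injective d (slotDomain ℓ P J)
  rw [hcard, Fintype.prod_sum_type] at h1
  refine le_trans (Nat.mul_le_mul ?_ ?_) (h1.trans (le_of_eq ?_))
  · have h2 := Finset.pow_card_le_prod (Finset.univ : Finset (Fin k))
      (fun v => (slotDomain ℓ P J (Sum.inl v)).card - (k + 2 * m * (ℓ - 1)))
      (n - 2 * j - (k + 2 * m * (ℓ - 1))) (fun v _ => ?_)
    · simpa using h2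
    · refine Nat.sub_le_sub_right ?_ _
      have h3 := Finset.le_card_sdiff (J false ∪ J true) (Finset.univ : Finset (Fin n))
      have h4 := Finset.card_union_le (J false) (J true)
      rw [hJ, hJ] at h4
      rw [Finset.card_univ, Fintype.card_fin] at h3
      simp only [slotDomain]
      omega
  · obtain ⟨L, rfl⟩ : ∃ L, ℓ = L + 3 := ⟨ℓ - 3, by omega⟩
    have h2 : ∀ (b : Bool) (a : P), (j - (k + 2 * m * (L + 3 - 1))) ^ 2 *
        (n - (k + 2 * m * (L + 3 - 1))) ^ (L + 3 - 3) = ∏ i : Fin (L + 3 - 1),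
          ((slotDomain (L + 3) P J (Sum.inr (b, a, i))).card - (k + 2 * m * (L + 3 - 1))) := by
      intro b a
      change _ = ∏ i : Fin (L + 1 + 1), _
      rw [Fin.prod_univ_succ, Fin.prod_univ_castSucc]
      have h5 : ∀ i : Fin L, (slotDomain (L + 3) P J
          (Sum.inr (b, a, (i.castSucc.succ : Fin (L + 1 + 1))))).card = n := by
        intro i
        have h6 : ¬ (((i.castSucc.succ : Fin (L + 1 + 1)) : ℕ) = 0 ∨
            ((i.castSucc.succ : Fin (L + 1 + 1)) : ℕ) + 2 = L + 3) := by
          have := i.2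
          simp only [Fin.val_succ, Fin.val_castSucc]
          omega
        simp only [slotDomain, if_neg h6, Finset.card_univ, Fintype.card_fin]
      have h7 : (slotDomain (L + 3) P J (Sum.inr (b, a, (0 : Fin (L + 1 + 1))))).card = j := by
        simp [slotDomain, hJ]
      have h8 : (slotDomain (L + 3) P J
          (Sum.inr (b, a, ((Fin.last L).succ : Fin (L + 1 + 1))))).card = j := by
        simp [slotDomain, hJ]
      simp only [h5, h7, h8, Finset.prod_const, Finset.card_univ, Fintype.card_fin]
      rw [show L + 3 - 3 = L by omega]
      ring
    rw [Fintype.prod_prod_type]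
    simp only [Fintype.prod_prod_type, ← h2, Finset.prod_const, Finset.card_univ,
      Fintype.card_coe, Fintype.card_bool, hP, ← pow_mul]
    exact le_of_eq (by ring)
  · simp only [placements]

/-- The contribution of the good pairs to the first moment, from below: place the tree outside
`J₁ ∪ J₂` and the two families of paths disjointly. -/
theorem le_sum_good {lam ε s : ℝ} (hd : SmallDensity n lam ε s (k - 1 + ℓ * m))
    (hlam : lam ≤ n) (hT : IsRigidPairing m T P) (hℓ : 3 ≤ ℓ) (J₁ J₂ : Finset (Fin n)) {j : ℕ}
    (hJ₁ : J₁.card = j) (hJ₂ : J₂.card = j) :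
    (((n - 2 * j - (k + 2 * m * (ℓ - 1))) ^ k * ((j - (k + 2 * m * (ℓ - 1))) ^ 2 *
      (n - (k + 2 * m * (ℓ - 1))) ^ (ℓ - 3)) ^ (2 * m) : ℕ) : ℝ) *
      ((momLin n lam ε s 1 0 ^ 2) ^ (ℓ * m) * (s * (1 - lam / n)) ^ (k - 1)) ≤
    Nat.card (T ≃g T) * ∑ S₁ ∈ copies J₁ ℓ T P, ∑ S₂ ∈ copies J₂ ℓ T P,
      pairMoment n lam ε s S₁ S₂ * (if GoodPair J₁ J₂ ℓ T P S₁ S₂ then 1 else 0) := by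
  set v : ℝ := (momLin n lam ε s 1 0 ^ 2) ^ (ℓ * m) * (s * (1 - lam / n)) ^ (k - 1) with hv
  have hn0 : (0 : ℝ) < n := by exact_mod_cast hd.n_pos
  have hv0 : 0 ≤ v := by
    have h1 : 0 ≤ s * (1 - lam / n) :=
      mul_nonneg hd.s_pos.le (sub_nonneg.2 ((div_le_one hn0).2 hlam))
    positivity
  let J : Bool → Finset (Fin n) := fun b => if b then J₂ else J₁
  have hJ : ∀ b, (J b).card = j := by intro b; cases b <;> simp [J, hJ₁, hJ₂]
  let C : Bool → Finset (Multiset (Sym2 (Fin n))) := fun b => copies (J b) ℓ T P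
  have hsum := sum_sum_eq_sum_bool C fun S₁ S₂ =>
    pairMoment n lam ε s S₁ S₂ * (if GoodPair J₁ J₂ ℓ T P S₁ S₂ then (1 : ℝ) else 0)
  have hsum' : ∑ S₁ ∈ copies J₁ ℓ T P, ∑ S₂ ∈ copies J₂ ℓ T P,
      pairMoment n lam ε s S₁ S₂ * (if GoodPair J₁ J₂ ℓ T P S₁ S₂ then (1 : ℝ) else 0) =
      ∑ p ∈ Fintype.piFinset C, pairMoment n lam ε s (p false) (p true) *
        (if GoodPair J₁ J₂ ℓ T P (p false) (p true) then (1 : ℝ) else 0) := hsum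
  rw [hsum']
  set I := (placements ℓ P J).image (placedCopy ℓ P T) with hI
  have hspec : ∀ p ∈ I, p ∈ Fintype.piFinset C ∧ GoodPair J₁ J₂ ℓ T P (p false) (p true) ∧
      v ≤ pairMoment n lam ε s (p false) (p true) := by
    intro p hp
    obtain ⟨c, hc, rfl⟩ := Finset.mem_image.1 hp
    have hi : Function.Injective c := (Finset.mem_filter.1 hc).2
    have h := isDecomposition_of_mem_placements (J := J) hT (by omega) hc hi
    have hn := isNonoverlapping_of_injective hi
    refine ⟨Fintype.mem_piFinset.2 fun b => ?_,
      goodPair_of_common_tree h hn hT (by omega) (placedPath_ne hi),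
      le_pairMoment_of_common_tree hd h hn hT (by omega) (placedPath_ne hi)⟩
    simp only [C, copies, Set.Finite.mem_toFinset]
    exact ⟨_, _, h b⟩
  have h1 : (I.card : ℝ) * v ≤ ∑ p ∈ Fintype.piFinset C, pairMoment n lam ε s (p false) (p true) *
        (if GoodPair J₁ J₂ ℓ T P (p false) (p true) then (1 : ℝ) else 0) := by
    refine le_trans ?_ (Finset.sum_le_sum_of_subset_of_nonneg (s := I)
      (fun p hp => (hspec p hp).1) ?_)
    · rw [← nsmul_eq_mul]
      refine Finset.card_nsmul_le_sum _ _ _ fun p hp => ?_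
      rw [if_pos (hspec p hp).2.1, mul_one]
      exact (hspec p hp).2.2
    · intro p hp _
      have hcard : ∀ b, (p b).card ≤ k - 1 + ℓ * m := by
        intro b
        have h2 := Fintype.mem_piFinset.1 hp b
        simp only [C, copies, Set.Finite.mem_toFinset] at h2
        obtain ⟨φ, w, h3⟩ := h2
        exact (h3.card_eq hT).le
      refine mul_nonneg (pairMoment_nonneg hd (hcard _) (hcard _)) ?_
      split_ifs <;> norm_num
  have h2 := le_card_placements (J := J) (k := k) (ℓ := ℓ) (P := P) ⟨0, hd.n_pos⟩
    hT.isPairing.card_eq hℓ hJ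
  have h3 : (placements ℓ P J).card ≤ Nat.card (T ≃g T) * I.card :=
    Finset.card_le_mul_card_image _ _ fun p _ => card_placements_fibre_le hT (by omega) p
  calc _ ≤ ((Nat.card (T ≃g T) * I.card : ℕ) : ℝ) * v := by
        refine mul_le_mul_of_nonneg_right ?_ hv0
        exact_mod_cast h2.trans h3
    _ = Nat.card (T ≃g T) * ((I.card : ℝ) * v) := by push_cast; ring
    _ ≤ _ := mul_le_mul_of_nonneg_left h1 (Nat.cast_nonneg _)

end

/-! ### Automorphisms of good trees -/

section

variable {V : Type*} {T : SimpleGraph V}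

theorem dist_iso (a : T ≃g T) (u v : V) (hT : T.Connected) : T.dist (a u) (a v) = T.dist u v := by
  have key : ∀ (a : T ≃g T) u v, T.dist (a u) (a v) ≤ T.dist u v := by
    intro a u v
    obtain ⟨p, hp⟩ := hT.exists_walk_length_eq_dist u v
    rw [← hp, ← SimpleGraph.Walk.length_map a.toHom p]
    exact SimpleGraph.dist_le _
  refine le_antisymm (key a u v) ?_
  simpa using key a.symm (a u) (a v)

/-- A geodesic to one side of an edge of a tree, the edge, and a geodesic to the other side form
a geodesic. -/
theorem dist_eq_of_edge (hT : T.IsTree) {x y u v : V} (hxy : T.Adj y x)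
    (hu : T.dist x u = T.dist y u + 1) (hv : T.dist y v = T.dist x v + 1) :
    T.dist u v = T.dist y u + 1 + T.dist x v := by
  obtain ⟨p, hp, hpl⟩ := hT.connected.exists_path_of_dist u y
  obtain ⟨q, hq, hql⟩ := hT.connected.exists_path_of_dist x v
  have tri : ∀ {u v w : V}, T.dist u w ≤ T.dist u v + T.dist v w := hT.connected.dist_triangle
  have comm : ∀ {u v : V}, T.dist u v = T.dist v u := T.dist_comm
  have hps : ∀ z ∈ p.support, T.dist y z < T.dist x z := by
    intro z hz
    have h1 := congrArg SimpleGraph.Walk.length (p.take_spec hz)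
    rw [SimpleGraph.Walk.length_append] at h1
    have h2 := SimpleGraph.dist_le (p.takeUntil z hz)
    have h3 := SimpleGraph.dist_le (p.dropUntil z hz)
    have h4 := tri (u := x) (v := z) (w := u)
    have h5 := comm (u := z) (v := u)
    have h6 := comm (u := z) (v := y)
    have h7 := comm (u := u) (v := y)
    omega
  have hqs : ∀ z ∈ q.support, T.dist x z < T.dist y z := by
    intro z hz
    have h1 := congrArg SimpleGraph.Walk.length (q.take_spec hz)
    rw [SimpleGraph.Walk.length_append] at h1
    have h2 := SimpleGraph.dist_le (q.takeUntil z hz)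
    have h3 := SimpleGraph.dist_le (q.dropUntil z hz)
    have h4 := tri (u := y) (v := z) (w := v)
    omega
  have hpath : (p.append (SimpleGraph.Walk.cons hxy q)).IsPath := by
    rw [SimpleGraph.Walk.isPath_def, SimpleGraph.Walk.support_append,
      SimpleGraph.Walk.support_cons, List.tail_cons, List.nodup_append]
    refine ⟨hp.support_nodup, hq.support_nodup, ?_⟩
    rintro z hz _ hz' rfl
    exact absurd (hps z hz) (hqs z hz').not_gt
  obtain ⟨r, hr, hrl⟩ := hT.connected.exists_path_of_dist u v
  have h1 := congrArg (fun z : T.Path u v => z.1.length)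
    ((hT.isAcyclic.subsingleton_path u v).elim ⟨_, hpath⟩ ⟨r, hr⟩)
  simp only [SimpleGraph.Walk.length_append, SimpleGraph.Walk.length_cons] at h1
  rw [← hrl, ← h1, hpl, hql, T.dist_comm]
  ring

theorem exists_adj_dist (hT : T.Connected) {u v : V} (hne : u ≠ v) :
    ∃ x, T.Adj u x ∧ T.dist x v + 1 = T.dist u v := by
  obtain ⟨p, hp⟩ := hT.exists_walk_length_eq_dist u v
  cases p with
  | nil => exact absurd rfl hne
  | @cons _ x _ h q =>
    refine ⟨x, h, ?_⟩
    rw [SimpleGraph.Walk.length_cons] at hp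
    have h1 := SimpleGraph.dist_le q
    have h3 := SimpleGraph.dist_eq_one_iff_adj.2 h
    have h4 := hT.dist_triangle (u := u) (v := x) (w := v)
    omega

/-- Isomorphic rooted trees are similar, with no paths attached. -/
theorem Similar.of_iso {V' : Type*} {T' : SimpleGraph V'} {ι : ℝ} (hι : 0 ≤ Real.log ι⁻¹)
    (e : T ≃g T') : Similar ι T T' := by
  refine ⟨0, 0, Fin.elim0, Fin.elim0, Fin.elim0, Fin.elim0, ?_, ?_, fun i => i.elim0,
    fun i => i.elim0, fun i => i.elim0, fun i => i.elim0, ⟨?_⟩⟩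
  · rw [Nat.cast_zero]
    exact mul_nonneg (inv_nonneg.2 hι) (Nat.cast_nonneg _)
  · rw [Nat.cast_zero]
    exact mul_nonneg (inv_nonneg.2 hι) (Nat.cast_nonneg _)
  · refine { toEquiv := Equiv.sumCongr e.toEquiv (Equiv.refl _), map_rel_iff' := ?_ }
    intro x y
    rcases x with x | ⟨i, -⟩
    · rcases y with y | ⟨i, -⟩
      · simp [attachPaths, e.map_adj_iff]
      · exact i.elim0
    · exact i.elim0

theorem dist_descendants_iso (hT : T.Connected) {r : V} (a : T ≃g T) (hr : a r = r) (u v : V) :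
    a v ∈ descendants T r (a u) ↔ v ∈ descendants T r u := by
  have h1 : ∀ v, T.dist r (a v) = T.dist r v := fun v => by
    conv_lhs => rw [← hr, dist_iso a _ _ hT]
  simp only [descendants, Set.mem_ofPred_eq, h1, dist_iso a _ _ hT]

/-- An automorphism which fixes the root restricts to an isomorphism of descendant trees. -/
def descendantIso (hT : T.Connected) {r : V} (a : T ≃g T) (hr : a r = r) (u : V) :
    descendantTree T r u ≃g descendantTree T r (a u) where
  toEquiv := a.toEquiv.subtypeEquiv fun v => (dist_descendants_iso hT a hr u v).symm
  map_rel_iff' := by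
    intro x y
    exact a.map_adj_iff

theorem descendants_subset (hT : T.Connected) {r p v : V} (h : IsChild T r p v) :
    descendants T r v ⊆ descendants T r p := by
  intro u hu
  simp only [descendants, Set.mem_ofPred_eq] at hu ⊢
  have h1 := hT.dist_triangle (u := r) (v := p) (w := u)
  have h2 := hT.dist_triangle (u := p) (v := v) (w := u)
  have h3 := SimpleGraph.dist_eq_one_iff_adj.2 h.1
  have h4 := h.2
  omega

theorem exists_isChild (hT : T.Connected) {r v : V} (hv : v ≠ r) : ∃ p, IsChild T r p v := by
  obtain ⟨p, hp, hd⟩ := exists_adj_dist hT hv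
  exact ⟨p, hp.symm, by rw [T.dist_comm, ← hd, T.dist_comm]⟩

theorem descendants_of_isLeaf (hT : T.Connected) {r v : V} (hv : v ≠ r) (hl : IsLeaf T v) :
    descendants T r v = {v} := by
  refine Set.eq_singleton_iff_unique_mem.2 ⟨by simp [descendants], fun u hu => ?_⟩
  by_contra hne
  obtain ⟨p, hp, hpd⟩ := exists_isChild hT hv
  obtain ⟨x, hx, hxd⟩ := exists_adj_dist hT (Ne.symm hne)
  obtain ⟨z, hz⟩ := Set.ncard_eq_one.1 hl
  have h1 : p = z := by
    have : p ∈ T.neighborSet v := hp.symm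
    rwa [hz] at this
  have h2 : x = z := by
    have : x ∈ T.neighborSet v := hx
    rwa [hz] at this
  subst h1 h2
  simp only [descendants, Set.mem_ofPred_eq] at hu
  have h3 := hT.dist_triangle (u := r) (v := x) (w := u)
  omega

end

section

variable {k : ℕ} {T : SimpleGraph (Fin k)} {r : Fin k}

theorem ncard_descendants_iso (hT : T.Connected) (a : T ≃g T) (hr : a r = r) (u : Fin k) :
    (descendants T r (a u)).ncard = (descendants T r u).ncard :=
  (Nat.card_congr (descendantIso hT a hr u).toEquiv).symm

/-- The root of a tree is fixed by all automorphisms if each of its branches contains less than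
half of the vertices, since it is the only vertex with the least sum of distances. -/
theorem iso_apply_root (hT : T.IsTree)
    (hbr : ∀ c, T.Adj r c → 2 * (descendants T r c).ncard < k) (a : T ≃g T) : a r = r := by
  by_contra hne
  obtain ⟨x, hx, hxd⟩ := exists_adj_dist hT.connected (Ne.symm hne)
  have hsum : ∑ v, T.dist (a r) v = ∑ v, T.dist r v := by
    rw [← Equiv.sum_comp a.toEquiv]
    exact Finset.sum_congr rfl fun v _ => dist_iso a r v hT.connected
  set d := T.dist r (a r) with hd
  have hd0 : 0 < d := hT.connected.pos_dist_of_ne (Ne.symm hne)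
  -- moving from `r` to `a r` shortens distances only within the branch of `x`, by at most `d`, and
  -- lengthens all other distances by `d`
  have hpt : ∀ v, T.dist r v + (if v ∈ descendants T r x then 0 else d) ≤
      T.dist (a r) v + (if v ∈ descendants T r x then d else 0) := by
    intro v
    split_ifs with hv
    · have h1 := hT.connected.dist_triangle (u := r) (v := a r) (w := v)
      omega
    · have h1 := SimpleGraph.dist_eq_one_iff_adj.2 hx
      have h2 := hT.dist_eq_dist_add_one_of_adj v hx
      simp only [descendants, Set.mem_ofPred_eq, h1] at hv
      rw [T.dist_comm (u := v), T.dist_comm (u := v)] at h2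
      have h3 := dist_eq_of_edge hT hx.symm (u := a r) (v := v) (by omega) (by omega)
      omega
  have h1 := Finset.sum_le_sum fun v (_ : v ∈ Finset.univ) => hpt v
  rw [Finset.sum_add_distrib, Finset.sum_add_distrib, hsum, Finset.sum_ite, Finset.sum_ite] at h1
  simp only [Finset.sum_const_zero, Finset.sum_const, smul_eq_mul, zero_add, add_zero] at h1
  have h2 := Finset.card_filter_add_card_filter_not (s := (Finset.univ : Finset (Fin k)))
    (fun v => v ∈ descendants T r x)
  have h3 : (Finset.univ.filter fun v => v ∈ descendants T r x).card =
      (descendants T r x).ncard := by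
    rw [← Set.ncard_coe_finset]
    congr 1
    ext v
    simp
  rw [Finset.card_univ, Fintype.card_fin] at h2
  have h4 := hbr x hx
  rw [h3] at h1 h2
  have h5 := Nat.le_of_mul_le_mul_right (Nat.le_of_add_le_add_left h1) hd0
  omega

/-- The pairings of a good tree are rigid. The root is the centroid, hence fixed by all automorphisms; by
induction on the distance from the root, so is every vertex with many descendants, since siblings with
non-similar descendant trees cannot be exchanged. -/
theorem isRigidPairing_of_isGoodRootedTree {ι : ℝ} {m : ℕ} {W : Finset (Sym2 (Fin k))}
    (hι : 1 < Real.log ι⁻¹) (hk : Odd k) (hg : IsGoodRootedTree ι T r) (hW : IsPairing m W)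
    (hmaj : ∀ v ∈ pairVertices W, v ∈ majorVertices ι T r ∧ v ≠ r) : IsRigidPairing m T W := by
  have hT := hg.isTree
  obtain ⟨h, rfl⟩ := hk
  have hroot : ∀ a : T ≃g T, a r = r := by
    intro a
    refine iso_apply_root hT (fun c hc => ?_) a
    obtain ⟨x, y, -, hxy, hx, hy, -⟩ := hg.root_children
    have h1 : ((2 * h + 1 : ℕ) : ℝ) - 1 = 2 * (h : ℝ) := by push_cast; ring
    have h2 : (2 * (h : ℝ)) / 2 = (h : ℝ) := by ring
    rw [h1, h2, Nat.floor_natCast] at hx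
    rw [h1, h2, Nat.ceil_natCast] at hy
    have h3 : IsChild T r r c := ⟨hc, by
      rw [SimpleGraph.dist_self, SimpleGraph.dist_eq_one_iff_adj.2 hc]⟩
    -- both branches have `h` vertices out of `2 * h + 1`
    rcases (hxy c).1 h3 with rfl | rfl <;> omega
  have hmajor : ∀ (a : T ≃g T) (d : ℕ) (v : Fin (2 * h + 1)), T.dist r v = d →
      v ∈ majorVertices ι T r → a v = v := by
    intro a d
    induction d with
    | zero =>
      intro v hv _
      rw [← hT.connected.dist_eq_zero_iff.1 hv, hroot]
    | succ d ih =>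
      intro v hv hvm
      have hvr : v ≠ r := by rintro rfl; simp at hv
      obtain ⟨p, hp⟩ := exists_isChild hT.connected hvr
      have hpm : p ∈ majorVertices ι T r := by
        simp only [majorVertices, Set.mem_ofPred_eq] at hvm ⊢
        refine hvm.trans ?_
        exact_mod_cast Set.ncard_le_ncard (descendants_subset hT.connected hp)
      have hap := ih p (by have := hp.2; omega) hpm
      by_contra hne
      have hchild : IsChild T r p (a v) := by
        refine ⟨?_, ?_⟩
        · rw [← hap]; exact a.map_adj_iff.2 hp.1
        · rw [← hp.2]
          conv_lhs => rw [← hroot a, dist_iso a _ _ hT.connected]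
      refine hg.not_similar_siblings p v (a v) hp hchild (Ne.symm hne) hvm ?_
        (Similar.of_iso (by linarith) (descendantIso hT.connected a (hroot a) v))
      simp only [majorVertices, Set.mem_ofPred_eq] at hvm ⊢
      rwa [ncard_descendants_iso hT.connected a (hroot a)]
  have hmem : ∀ e ∈ W, ∀ v ∈ e, v ∈ pairVertices W := fun e he v hv => by
    simp only [pairVertices, Finset.mem_filter, Finset.mem_univ, true_and]
    exact ⟨e, he, hv⟩
  refine ⟨hT, ?_, hW, fun e he v hv hl => ?_, fun a e he v hv => ?_⟩
  · obtain ⟨x, y, hne, -⟩ := hg.root_children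
    have h1 := x.2
    have h2 := y.2
    have h3 : (x : ℕ) ≠ y := fun h => hne (Fin.ext h)
    omega
  · obtain ⟨h1, h2⟩ := hmaj v (hmem e he v hv)
    simp only [majorVertices, Set.mem_ofPred_eq] at h1
    rw [descendants_of_isLeaf hT.connected h2 hl, Set.ncard_singleton] at h1
    push_cast at h1
    nlinarith
  · exact hmajor a _ v rfl (hmaj v (hmem e he v hv)).1

end

/-! ### Relabelling by the hidden permutation -/

section

variable {n k ℓ m : ℕ} {J : Finset (Fin n)} {T : SimpleGraph (Fin k)} {P : Finset (Sym2 (Fin k))}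
  {φ : Fin k ↪ Fin n} {w : Sym2 (Fin k) → ℕ → Fin n} {S : Multiset (Sym2 (Fin n))}

theorem treeEdges_relabel (T : SimpleGraph (Fin k)) (φ : Fin k ↪ Fin n)
    (π : Equiv.Perm (Fin n)) :
    treeEdges T (φ.trans π.toEmbedding) = (treeEdges T φ).map (Sym2.map π) := by
  simp only [treeEdges, Multiset.map_map]
  refine Multiset.map_congr rfl fun e _ => ?_
  induction e with
  | _ x y => simp

theorem IsDecomposition.relabel (h : IsDecomposition J ℓ T P φ w S) (π : Equiv.Perm (Fin n)) :
    IsDecomposition (J.map π.toEmbedding) ℓ T P (φ.trans π.toEmbedding) (fun a t => π (w a t))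
      (S.map (Sym2.map π)) := by
  refine ⟨fun v => ?_, fun a ha => ?_, fun a ha => ?_, fun a ha => ?_, ?_⟩
  · simpa using h.tree_notMem v
  · exact π.injective.comp_injOn (h.selfAvoiding a ha)
  · have h1 := congrArg (Sym2.map π) (h.endpoints a ha)
    rw [Sym2.map_mk] at h1
    rw [h1, Sym2.map_map]
    rfl
  · simpa using h.neighbors a ha
  · rw [treeEdges_relabel, h.edges, Multiset.map_add]
    congr 1
    have h1 : (∑ a ∈ P, pathEdges ℓ (w a)).map (Sym2.map π) =
        ∑ a ∈ P, (pathEdges ℓ (w a)).map (Sym2.map π) :=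
      map_sum (Multiset.mapAddMonoidHom (Sym2.map π)) _ _
    rw [h1]
    refine Finset.sum_congr rfl fun a _ => ?_
    simp only [pathEdges, Multiset.map_map]
    rfl

theorem IsNonoverlapping.relabel (h : IsNonoverlapping ℓ P φ w) (π : Equiv.Perm (Fin n)) :
    IsNonoverlapping ℓ P (φ.trans π.toEmbedding) (fun a t => π (w a t)) :=
  ⟨fun a ha i h0 hi v heq => h.path_tree a ha i h0 hi v (π.injective heq),
    fun a ha a' ha' hne i h0 hi j hj0 hj heq =>
      h.path_path a ha a' ha' hne i h0 hi j hj0 hj (π.injective heq)⟩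

theorem relabel_symm_relabel (S : Multiset (Sym2 (Fin n))) (π : Equiv.Perm (Fin n)) :
    (S.map (Sym2.map π)).map (Sym2.map π.symm) = S := by
  rw [Multiset.map_map]
  conv_rhs => rw [← Multiset.map_id S]
  refine Multiset.map_congr rfl fun e _ => ?_
  induction e with
  | _ x y => simp

theorem relabel_injective (π : Equiv.Perm (Fin n)) :
    Function.Injective fun S : Multiset (Sym2 (Fin n)) => S.map (Sym2.map π) :=
  Function.LeftInverse.injective fun S => relabel_symm_relabel S π

theorem map_symm_map (J : Finset (Fin n)) (π : Equiv.Perm (Fin n)) :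
    (J.map π.toEmbedding).map π.symm.toEmbedding = J := by
  ext x; simp

theorem mem_copies : S ∈ copies J ℓ T P ↔ ∃ φ w, IsDecomposition J ℓ T P φ w S := by
  simp [copies]

/-- Relabelling the copies amounts to relabelling the reserved set of vertices. -/
theorem copies_relabel (J : Finset (Fin n)) (ℓ : ℕ) (T : SimpleGraph (Fin k))
    (P : Finset (Sym2 (Fin k))) (π : Equiv.Perm (Fin n)) :
    copies (J.map π.toEmbedding) ℓ T P =
      (copies J ℓ T P).image fun S => S.map (Sym2.map π) := by
  ext S
  rw [Finset.mem_image, mem_copies]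
  constructor
  · rintro ⟨φ, w, h⟩
    have h1 := h.relabel π.symm
    rw [map_symm_map] at h1
    exact ⟨_, mem_copies.2 ⟨_, _, h1⟩, relabel_symm_relabel S π.symm⟩
  · rintro ⟨S', hS', rfl⟩
    obtain ⟨φ, w, h⟩ := mem_copies.1 hS'
    exact ⟨_, _, h.relabel π⟩

/-- After relabelling by the hidden permutation, the condition on it becomes a property of a pair of
copies. -/
theorem mem_goodPermutations_iff {JA JB : Finset (Fin n)}
    {H : UnlabeledTree k × Finset (Sym2 (Fin k))} {S₁ S₂ : Multiset (Sym2 (Fin n))}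
    {π : Equiv.Perm (Fin n)} :
    π ∈ goodPermutations JA JB ℓ H S₁ S₂ ↔
      GoodPair (JA.map π.toEmbedding) JB ℓ H.1.graph H.2 (S₁.map (Sym2.map π)) S₂ := by
  constructor
  · rintro ⟨φ₁, w₁, φ₂, w₂, h1, h2, h3, h4, h5, h6, h7⟩
    refine ⟨_, _, φ₂, w₂, h1.relabel π, h2.relabel π, h3, h4, h5, ?_, h7⟩
    rwa [treeEdges_relabel]
  · rintro ⟨φ₁, w₁, φ₂, w₂, h1, h2, h3, h4, h5, h6, h7⟩
    have h1' := h1.relabel π.symm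
    rw [map_symm_map, relabel_symm_relabel] at h1'
    refine ⟨_, _, φ₂, w₂, h1', h2.relabel π.symm, h3, h4, h5, ?_, h7⟩
    rw [treeEdges_relabel]
    have h8 := relabel_symm_relabel (treeEdges H.1.graph φ₁) π.symm
    rw [Equiv.symm_symm] at h8
    rwa [h8]

end

/-! ### The two parts of the first moment -/

section

variable {n k ℓ m : ℕ} {lam ε s : ℝ}

/-- The contribution of the good pairs of copies of one decorated tree. -/
def goodSum (n : ℕ) (lam ε s : ℝ) (ℓ : ℕ) {k : ℕ} (T : SimpleGraph (Fin k))
    (P : Finset (Sym2 (Fin k))) (J₁ J₂ : Finset (Fin n)) : ℝ :=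
  ∑ S₁ ∈ copies J₁ ℓ T P, ∑ S₂ ∈ copies J₂ ℓ T P,
    pairMoment n lam ε s S₁ S₂ * (if GoodPair J₁ J₂ ℓ T P S₁ S₂ then 1 else 0)

/-- The contribution of the remaining pairs of copies of one decorated tree. -/
def badSum (n : ℕ) (lam ε s : ℝ) (ℓ : ℕ) {k : ℕ} (T : SimpleGraph (Fin k))
    (P : Finset (Sym2 (Fin k))) (J₁ J₂ : Finset (Fin n)) : ℝ :=
  ∑ S₁ ∈ copies J₁ ℓ T P, ∑ S₂ ∈ copies J₂ ℓ T P,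
    pairMoment n lam ε s S₁ S₂ * (if GoodPair J₁ J₂ ℓ T P S₁ S₂ then 0 else 1)

variable {Hs : Finset (UnlabeledTree k × Finset (Sym2 (Fin k)))}

theorem expectation_goodPermutations (JA JB : Finset (Fin n)) :
    expectation lam ε s (restrictedStatistic lam ε s ℓ m JA JB Hs (goodPermutations JA JB ℓ)) =
      (Fintype.card (Equiv.Perm (Fin n)) : ℝ)⁻¹ * ∑ π : Equiv.Perm (Fin n), ∑ H ∈ Hs,
        statWeight n lam ε s ℓ m H.1.graph *
          goodSum n lam ε s ℓ H.1.graph H.2 (JA.map π.toEmbedding) JB := by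
  rw [expectation_restrictedStatistic lam ε s ℓ m JA JB Hs _ fun H _ J S hS e he => by
    obtain ⟨φ, w, h⟩ := mem_copies.1 hS
    exact h.not_isDiag he]
  congr 1
  refine Finset.sum_congr rfl fun π _ => Finset.sum_congr rfl fun H _ => ?_
  rw [goodSum, copies_relabel, Finset.sum_image fun x _ y _ h => relabel_injective π h]
  simp only [mem_goodPermutations_iff]

theorem expectation_goodPermutations_compl (JA JB : Finset (Fin n)) :
    expectation lam ε s (restrictedStatistic lam ε s ℓ m JA JB Hs
      fun H S₁ S₂ => (goodPermutations JA JB ℓ H S₁ S₂)ᶜ) =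
      (Fintype.card (Equiv.Perm (Fin n)) : ℝ)⁻¹ * ∑ π : Equiv.Perm (Fin n), ∑ H ∈ Hs,
        statWeight n lam ε s ℓ m H.1.graph *
          badSum n lam ε s ℓ H.1.graph H.2 (JA.map π.toEmbedding) JB := by
  rw [expectation_restrictedStatistic lam ε s ℓ m JA JB Hs _ fun H _ J S hS e he => by
    obtain ⟨φ, w, h⟩ := mem_copies.1 hS
    exact h.not_isDiag he]
  congr 1
  refine Finset.sum_congr rfl fun π _ => Finset.sum_congr rfl fun H _ => ?_
  rw [badSum, copies_relabel, Finset.sum_image fun x _ y _ h => relabel_injective π h]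
  simp only [Set.mem_compl_iff, mem_goodPermutations_iff, ite_not]

theorem expectation_statistic (JA JB : Finset (Fin n))
    (Good : UnlabeledTree k × Finset (Sym2 (Fin k)) →
      Multiset (Sym2 (Fin n)) → Multiset (Sym2 (Fin n)) → Set (Equiv.Perm (Fin n))) :
    expectation lam ε s (fun _ A B => statistic lam ε s ℓ m JA JB Hs A B) =
      expectation lam ε s (restrictedStatistic lam ε s ℓ m JA JB Hs Good) +
      expectation lam ε s (restrictedStatistic lam ε s ℓ m JA JB Hs
        fun H S₁ S₂ => (Good H S₁ S₂)ᶜ) := by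
  have h : ∀ π A B, statistic lam ε s ℓ m JA JB Hs A B =
      restrictedStatistic lam ε s ℓ m JA JB Hs Good π A B +
      restrictedStatistic lam ε s ℓ m JA JB Hs (fun H S₁ S₂ => (Good H S₁ S₂)ᶜ) π A B := by
    intro π A B
    simp only [statistic, restrictedStatistic]
    rw [← Finset.sum_add_distrib]
    refine Finset.sum_congr rfl fun H _ => ?_
    rw [← mul_add, ← Finset.sum_add_distrib]
    congr 1
    refine Finset.sum_congr rfl fun S₁ _ => ?_
    rw [← Finset.sum_add_distrib]
    refine Finset.sum_congr rfl fun S₂ _ => ?_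
    rw [← mul_add]
    by_cases hg : π ∈ Good H S₁ S₂ <;> simp [hg]
  simp only [expectation]
  simp only [← Finset.sum_add_distrib, ← mul_add, ← h]

theorem badSum_nonneg {T : SimpleGraph (Fin k)} {P : Finset (Sym2 (Fin k))}
    (hd : SmallDensity n lam ε s (k - 1 + ℓ * m)) (hT : IsRigidPairing m T P)
    (J₁ J₂ : Finset (Fin n)) : 0 ≤ badSum n lam ε s ℓ T P J₁ J₂ := by
  refine Finset.sum_nonneg fun S₁ h₁ => Finset.sum_nonneg fun S₂ h₂ => ?_
  obtain ⟨φ, w, h₁⟩ := mem_copies.1 h₁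
  obtain ⟨φ', w', h₂⟩ := mem_copies.1 h₂
  refine mul_nonneg (pairMoment_nonneg hd (h₁.card_eq hT).le (h₂.card_eq hT).le) ?_
  split_ifs <;> norm_num

theorem average_le {ι α : Type*} [Fintype ι] [Nonempty ι] (A : Finset α) (f : ι → α → ℝ) {c : ℝ}
    (h : ∀ i, ∀ a ∈ A, f i a ≤ c) : (Fintype.card ι : ℝ)⁻¹ * ∑ i, ∑ a ∈ A, f i a ≤ A.card * c := by
  have h1 : (0 : ℝ) < Fintype.card ι := by exact_mod_cast Fintype.card_pos
  rw [inv_mul_le_iff₀ h1]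
  have h2 : ∀ i ∈ Finset.univ, ∑ a ∈ A, f i a ≤ A.card * c := fun i _ => by
    rw [← nsmul_eq_mul]
    exact Finset.sum_le_card_nsmul _ _ _ (h i)
  have h3 := Finset.sum_le_card_nsmul _ _ _ h2
  rwa [nsmul_eq_mul, Finset.card_univ] at h3

theorem le_average {ι α : Type*} [Fintype ι] [Nonempty ι] (A : Finset α) (f : ι → α → ℝ) {c : ℝ}
    (h : ∀ i, ∀ a ∈ A, c ≤ f i a) : A.card * c ≤ (Fintype.card ι : ℝ)⁻¹ * ∑ i, ∑ a ∈ A, f i a := by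
  have h1 := average_le A (fun i a => - f i a) (c := -c) fun i a ha => neg_le_neg (h i a ha)
  simp only [Finset.sum_neg_distrib, mul_neg] at h1
  exact neg_le_neg_iff.1 h1

/-- Bounds for the two parts of the first moment follow from bounds for the contribution of every
single decorated tree which are uniform in the sets `J₁`, `J₂`. -/
theorem firstMoment_bounds {j : ℕ} {JA JB : Finset (Fin n)} (hJA : JA.card = j)
    (hJB : JB.card = j) {lo up re : ℝ}
    (hb : ∀ H ∈ Hs, ∀ J₁ J₂ : Finset (Fin n), J₁.card = j → J₂.card = j →
      lo ≤ statWeight n lam ε s ℓ m H.1.graph * goodSum n lam ε s ℓ H.1.graph H.2 J₁ J₂ ∧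
      statWeight n lam ε s ℓ m H.1.graph * goodSum n lam ε s ℓ H.1.graph H.2 J₁ J₂ ≤ up ∧
      0 ≤ statWeight n lam ε s ℓ m H.1.graph * badSum n lam ε s ℓ H.1.graph H.2 J₁ J₂ ∧
      statWeight n lam ε s ℓ m H.1.graph * badSum n lam ε s ℓ H.1.graph H.2 J₁ J₂ ≤ re) :
    let main := expectation lam ε s
      (restrictedStatistic lam ε s ℓ m JA JB Hs (goodPermutations JA JB ℓ))
    let rest := expectation lam ε s (restrictedStatistic lam ε s ℓ m JA JB Hs
        fun H S₁ S₂ => (goodPermutations JA JB ℓ H S₁ S₂)ᶜ)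
    Hs.card * lo ≤ main ∧ main ≤ Hs.card * up ∧ 0 ≤ rest ∧ rest ≤ Hs.card * re := by
  intro main rest
  have hJ : ∀ π : Equiv.Perm (Fin n), (JA.map π.toEmbedding).card = j := fun π => by
    rw [Finset.card_map, hJA]
  have h1 : main = _ := expectation_goodPermutations JA JB
  have h2 : rest = _ := expectation_goodPermutations_compl JA JB
  rw [h1, h2]
  refine ⟨le_average _ _ fun π H hH => (hb H hH _ _ (hJ π) hJB).1,
    average_le _ _ fun π H hH => (hb H hH _ _ (hJ π) hJB).2.1, ?_,
    average_le _ _ fun π H hH => (hb H hH _ _ (hJ π) hJB).2.2.2⟩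
  have h3 := le_average Hs (fun (π : Equiv.Perm (Fin n)) H => statWeight n lam ε s ℓ m H.1.graph *
      badSum n lam ε s ℓ H.1.graph H.2 (JA.map π.toEmbedding) JB)
    fun π H hH => (hb H hH _ _ (hJ π) hJB).2.2.1
  simpa using h3

end

/-! ### One decorated tree -/

/-- The inequalities between the parameters which hold for large `n` and which are used for the
estimates of the first moment. -/
structure IsLargeSize (n k ℓ m : ℕ) (lam ε s ι η : ℝ) : Prop where
  ε_pos : 0 < ε
  ε_lt : ε < 1
  s_pos : 0 < s
  s_lt : s < 1
  lam_gt : 100 / (ε ^ 4 * ι ^ 4) < lam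
  ι_pos : 0 < ι
  ι_lt : ι < 1 / 100
  m_eq : (m : ℝ) = ι * k
  three_le : 3 ≤ ℓ
  exp_one_le : Real.exp 1 ≤ ε ^ 2 * lam * s
  pow_three_le : (n : ℝ) ^ 3 ≤ (ε ^ 2 * lam * s / Real.exp 1) ^ ℓ
  entropy_le : entropyBase k m ℓ ^ (8 * m) ≤ n
  size_le : 8 * ((k : ℝ) + 2 * m * (ℓ + 1) + 1 + lam) ^ 2 ≤ ι ^ 4 * n
  bad_le : 6 * (k : ℝ) ^ k * (ε ^ 2 * lam * s) ^ (k - 1) *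
    entropyBase k m ℓ ^ (2 * k + 4 * m + 4 * m * (4 * k + 4 * m)) ≤
      η * n * (s ^ (k - 1) * (ι ^ 4) ^ (2 * m) * Real.exp (-4 * ι ^ 2 * k))
  log_two_le : Real.log 2 ≤ ι ^ 2 * k

theorem card_automorphisms_le {k : ℕ} (T : SimpleGraph (Fin k)) : Nat.card (T ≃g T) ≤ k ^ k := by
  have h := Nat.card_le_card_of_injective (fun a : T ≃g T => (a : Fin k → Fin k))
    DFunLike.coe_injective
  simpa using h

/-- The powers of `n`, `s` and `g` in the number of pairs of copies, in their moments and in the weight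
of the statistic combine to the scale of the first moment. -/
theorem weight_mul_scale {n g s ι : ℝ} (hn : 0 < n) (L k m : ℕ) :
    s ^ (k - 1) * g ^ ((L + 1) * m) / n ^ (k + (L + 1) * m) *
      (n ^ k * (ι ^ 4 * n ^ L) ^ (2 * m) * (g / n) ^ ((L + 1) * m) * s ^ (k - 1)) =
      s ^ (2 * (k - 1)) * (ι ^ 4 * g ^ (L + 1) / n) ^ (2 * m) := by
  have h1 : g ^ ((L + 1) * m) * g ^ ((L + 1) * m) = (g ^ (L + 1)) ^ (2 * m) := by
    rw [← pow_mul, ← pow_add]; congr 1; ring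
  have h2 : (n ^ L) ^ (2 * m) * n ^ (2 * m) = n ^ ((L + 1) * m) * n ^ ((L + 1) * m) := by
    rw [← pow_mul, ← pow_add, ← pow_add]; congr 1; ring
  have h3 : s ^ (2 * (k - 1)) = s ^ (k - 1) * s ^ (k - 1) := by rw [← pow_add]; congr 1; ring
  have h4 : n ^ (2 * m) ≠ 0 := by positivity
  have h5 : n ^ ((L + 1) * m) ≠ 0 := by positivity
  have h6 : n ^ k ≠ 0 := by positivity
  rw [h3, div_pow g, div_pow (ι ^ 4 * g ^ (L + 1)), mul_pow (ι ^ 4) (g ^ (L + 1)), ← h1,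
    mul_pow (ι ^ 4) (n ^ L), pow_add n k, (eq_div_iff h4).2 h2]
  field_simp

/-- The contribution of a decorated tree to `firstMomentScale`. -/
def treeScale (n : ℕ) (lam ε s ι : ℝ) (ℓ m k : ℕ) : ℝ :=
  s ^ (2 * (k - 1)) * (ι ^ 4 * (ε ^ 2 * lam * s) ^ ℓ / n) ^ (2 * m)

namespace IsLargeSize

variable {n k ℓ m : ℕ} {lam ε s ι η : ℝ} {T : SimpleGraph (Fin k)} {P : Finset (Sym2 (Fin k))}

theorem lam_pos (h : IsLargeSize n k ℓ m lam ε s ι η) : 0 < lam := by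
  have h1 := h.ε_pos
  have h2 := h.ι_pos
  exact lt_trans (by positivity) h.lam_gt

theorem g_pos (h : IsLargeSize n k ℓ m lam ε s ι η) : 0 < ε ^ 2 * lam * s := by
  have h1 := h.ε_pos
  have h2 := h.lam_pos
  have h3 := h.s_pos
  positivity

theorem n_pos (h : IsLargeSize n k ℓ m lam ε s ι η) : (0 : ℝ) < n := by
  have h1 := h.size_le
  have h2 := h.lam_pos
  have h3 : 0 < 8 * ((k : ℝ) + 2 * m * (ℓ + 1) + 1 + lam) ^ 2 := by positivity
  have h4 : 0 < ι ^ 4 := pow_pos h.ι_pos 4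
  nlinarith

/-- All polynomial error terms are bounded by this quantity. -/
theorem error_le (h : IsLargeSize n k ℓ m lam ε s ι η) {x y : ℝ} (hx : 0 ≤ x) (hy : 0 ≤ y)
    (hx' : x ≤ k + 2 * m * (ℓ + 1) + 1 + lam) (hy' : y ≤ k + 2 * m * (ℓ + 1) + 1 + lam) :
    x * y ≤ ι ^ 4 / 8 * n := by
  have h1 := h.size_le
  have h2 := mul_le_mul hx' hy' hy (hx.trans hx')
  nlinarith

theorem lam_le (h : IsLargeSize n k ℓ m lam ε s ι η) : lam ≤ ι ^ 4 / 8 * n := by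
  have h1 := h.lam_pos
  have h2 := h.error_le (x := 1) (y := lam) zero_le_one h1.le
    (by have : (0 : ℝ) ≤ k + 2 * m * (ℓ + 1) := by positivity
        linarith) (by have : (0 : ℝ) ≤ k + 2 * m * (ℓ + 1) := by positivity
                      linarith)
  linarith

theorem ι_pow_le (h : IsLargeSize n k ℓ m lam ε s ι η) : ι ^ 4 ≤ ι ^ 2 ∧ ι ^ 2 ≤ 1 / 10000 := by
  have h1 := h.ι_pos
  have h2 := h.ι_lt
  have h3 : ι ^ 2 ≤ 1 / 10000 := by nlinarith
  exact ⟨by nlinarith [sq_nonneg ι, sq_nonneg (ι ^ 2)], h3⟩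

theorem smallDensity (h : IsLargeSize n k ℓ m lam ε s ι η) :
    SmallDensity n lam ε s (k - 1 + ℓ * m) where
  n_pos := by exact_mod_cast h.n_pos
  ε_pos := h.ε_pos
  ε_lt := h.ε_lt
  s_pos := h.s_pos
  s_lt := h.s_lt
  lam_pos := h.lam_pos
  density_le := by
    rw [div_le_iff₀ h.n_pos]
    have h1 := h.lam_le
    have h2 := h.ι_pow_le
    nlinarith [h.n_pos]
  mul_le := by
    have h0 := h.lam_pos
    have h3 : ((k - 1 : ℕ) : ℝ) ≤ k := by exact_mod_cast Nat.sub_le k 1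
    have h1 : (((k - 1 + ℓ * m : ℕ)) : ℝ) ≤ k + 2 * m * (ℓ + 1) + 1 + lam := by
      push_cast
      have : (0 : ℝ) ≤ m * ℓ := by positivity
      have : (0 : ℝ) ≤ m := by positivity
      linarith
    have h2 := h.error_le (x := ((k - 1 + ℓ * m : ℕ) : ℝ)) (y := lam) (by positivity) h0.le h1
      (by have : (0 : ℝ) ≤ k + 2 * m * (ℓ + 1) := by positivity
          linarith)
    rw [mul_div_assoc', div_le_iff₀ h.n_pos, ← mul_assoc]
    have h4 := h.ι_pow_le
    have h5 : ((k - 1 + ℓ * m : ℕ) : ℝ) * lam * s ≤ ((k - 1 + ℓ * m : ℕ) : ℝ) * lam :=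
      mul_le_of_le_one_right (by positivity) h.s_lt.le
    nlinarith [h.n_pos]

theorem statWeight_mul (x : ℝ) : statWeight n lam ε s ℓ m T * x =
    s ^ (k - 1) * (ε ^ 2 * lam * s) ^ (ℓ * m) / (n : ℝ) ^ (k + ℓ * m) *
      (Nat.card (T ≃g T) * x) := by
  rw [statWeight]; ring

theorem treeScale_pos (h : IsLargeSize n k ℓ m lam ε s ι η) : 0 < treeScale n lam ε s ι ℓ m k := by
  have h1 := h.g_pos
  have h2 := h.ι_pos
  have h3 := h.s_pos
  have h4 := h.n_pos
  rw [treeScale]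
  positivity

/-- A bad pair loses a factor `n`, which pays for the entropy of the path systems. -/
theorem weight_mul_badSum_le (h : IsLargeSize n k ℓ m lam ε s ι η) (hT : IsRigidPairing m T P)
    (J₁ J₂ : Finset (Fin n)) :
    statWeight n lam ε s ℓ m T * badSum n lam ε s ℓ T P J₁ J₂ ≤
      η * (treeScale n lam ε s ι ℓ m k * Real.exp (-4 * ι ^ 2 * k)) := by
  have h1 := sum_bad_le h.smallDensity hT (by have := h.three_le; omega) J₁ J₂ h.entropy_le
    h.exp_one_le h.pow_three_le
  have hn := h.n_pos
  have hs := h.s_pos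
  have hg := h.g_pos
  have hk : k = k - 1 + 1 := by have := hT.two_le; omega
  set g := ε ^ 2 * lam * s with hgdef
  set B := entropyBase k m ℓ ^ (2 * k + 4 * m + 4 * m * (4 * k + 4 * m)) with hB
  have hB0 : 0 ≤ B := by rw [hB, entropyBase]; positivity
  have hcard : (Nat.card (T ≃g T) : ℝ) ≤ (k : ℝ) ^ k := by exact_mod_cast card_automorphisms_le T
  have hid : s ^ (k - 1) * g ^ (ℓ * m) / (n : ℝ) ^ (k + ℓ * m) * ((k : ℝ) ^ k * (6 *
      (g / n) ^ (k - 1 + ℓ * m) * ((n : ℝ) ^ (2 * (k - 1 + ℓ * m)) / n ^ (2 * m)) * B)) =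
      (6 * (k : ℝ) ^ k * g ^ (k - 1) * B) / n *
        (s ^ (k - 1) * (g ^ (ℓ * m) * g ^ (ℓ * m)) / n ^ (2 * m)) := by
    have e1 : (n : ℝ) ^ (k + ℓ * m) = n * n ^ (k - 1 + ℓ * m) := by
      rw [← pow_succ']; congr 1; omega
    have e2 : (n : ℝ) ^ (2 * (k - 1 + ℓ * m)) =
        n ^ (k - 1 + ℓ * m) * n ^ (k - 1 + ℓ * m) := by rw [← pow_add]; congr 1; ring
    rw [e1, e2, div_pow, pow_add g]
    have hz : (n : ℝ) ^ (k - 1 + ℓ * m) ≠ 0 := by positivity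
    field_simp
  rw [statWeight_mul]
  calc _ ≤ s ^ (k - 1) * g ^ (ℓ * m) / (n : ℝ) ^ (k + ℓ * m) * ((k : ℝ) ^ k * (6 *
      (g / n) ^ (k - 1 + ℓ * m) * ((n : ℝ) ^ (2 * (k - 1 + ℓ * m)) / n ^ (2 * m)) * B)) := by
        refine mul_le_mul_of_nonneg_left ?_ (by positivity)
        exact mul_le_mul hcard h1 (badSum_nonneg h.smallDensity hT J₁ J₂) (by positivity)
    _ = _ := hid
    _ ≤ (η * (s ^ (k - 1) * (ι ^ 4) ^ (2 * m) * Real.exp (-4 * ι ^ 2 * k))) *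
        (s ^ (k - 1) * (g ^ (ℓ * m) * g ^ (ℓ * m)) / n ^ (2 * m)) := by
        refine mul_le_mul_of_nonneg_right ?_ (by positivity)
        rw [div_le_iff₀ hn]
        refine h.bad_le.trans (le_of_eq ?_)
        ring
    _ = _ := by
        rw [treeScale, div_pow, mul_pow (ι ^ 4), ← hgdef,
          show (g ^ ℓ) ^ (2 * m) = g ^ (ℓ * m) * g ^ (ℓ * m) by
            rw [← pow_mul, ← pow_add]; congr 1; ring,
          show s ^ (2 * (k - 1)) = s ^ (k - 1) * s ^ (k - 1) by rw [← pow_add]; congr 1; ring]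
        ring

/-- The density of the sets `J₁`, `J₂` makes the arms of a good pair cost more than they gain. -/
theorem s_le (h : IsLargeSize n k ℓ m lam ε s ι η) :
    s ≤ (ι ^ 2 / 2) / 16 * (momLin n lam ε s 1 0 ^ 2 * (⌊ι ^ 2 * n⌋₊ : ℕ)) := by
  have hn := h.n_pos
  have hs := h.s_pos
  have hε := h.ε_pos
  have hι := h.ι_pos
  have hlam := h.lam_pos
  have hd := h.smallDensity
  have hp := hd.p_pos
  have hp1 := hd.p_le_fifth
  -- `ι ^ 2 * n` is large
  have h1 : 8 * 1 ^ 2 ≤ ι ^ 4 * n := by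
    refine le_trans ?_ h.size_le
    have : (1 : ℝ) ≤ k + 2 * m * (ℓ + 1) + 1 + lam := by
      have : (0 : ℝ) ≤ k + 2 * m * (ℓ + 1) := by positivity
      linarith
    nlinarith
  have h2 : 2 ≤ ι ^ 2 * n := by nlinarith [h.ι_pow_le]
  have h3 : ι ^ 2 * n / 2 ≤ (⌊ι ^ 2 * n⌋₊ : ℕ) := by
    have := Nat.lt_floor_add_one (ι ^ 2 * n)
    linarith
  have h4 : ε ^ 2 * (lam * s / n) ≤ momLin n lam ε s 1 0 ^ 2 := by
    rw [hd.momLin_one_zero_sq, le_div_iff₀ (by linarith)]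
    exact mul_le_of_le_one_right (by positivity) (by linarith)
  have h5 : 100 ≤ ε ^ 2 * lam * ι ^ 4 := by
    have h6 := h.lam_gt
    rw [div_lt_iff₀ (by positivity)] at h6
    have h7 : ε ^ 4 ≤ ε ^ 2 := by
      have : ε ^ 2 ≤ 1 := pow_le_one₀ hε.le h.ε_lt.le
      nlinarith [sq_nonneg ε]
    calc (100 : ℝ) ≤ lam * (ε ^ 4 * ι ^ 4) := h6.le
      _ ≤ lam * (ε ^ 2 * ι ^ 4) := by gcongr
      _ = _ := by ring
  calc s ≤ (ι ^ 2 / 2) / 16 * (ε ^ 2 * (lam * s / n) * (ι ^ 2 * n / 2)) := by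
        have h8 : (ι ^ 2 / 2) / 16 * (ε ^ 2 * (lam * s / n) * (ι ^ 2 * n / 2)) =
            s * (ε ^ 2 * lam * ι ^ 4) / 64 := by
          field_simp
          ring
        rw [h8]
        nlinarith
    _ ≤ _ := by gcongr

/-- The arms and the orientations of the paths cost only a factor which is exponential in `ι * k`. -/
theorem weight_mul_goodSum_le (h : IsLargeSize n k ℓ m lam ε s ι η) (hT : IsRigidPairing m T P)
    {J₁ J₂ : Finset (Fin n)} (hJ₁ : J₁.card = ⌊ι ^ 2 * n⌋₊) (hJ₂ : J₂.card = ⌊ι ^ 2 * n⌋₊) :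
    statWeight n lam ε s ℓ m T * goodSum n lam ε s ℓ T P J₁ J₂ ≤
      treeScale n lam ε s ι ℓ m k * (2 * Real.exp (4 * ι * k)) := by
  have hn := h.n_pos
  have hs := h.s_pos
  have hg := h.g_pos
  have hι := h.ι_pos
  have hι2 := h.ι_pow_le
  have hι1 := h.ι_lt
  have hd := h.smallDensity
  have hp := hd.p_pos
  have hp1 := hd.p_le_fifth
  have hsle := h.s_le
  set j := ⌊ι ^ 2 * n⌋₊ with hj
  have hjle : (j : ℝ) ≤ ι ^ 2 * n := Nat.floor_le (by positivity)
  have hj0 : 0 < j := by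
    rcases Nat.eq_zero_or_pos j with h0 | h0
    · rw [h0] at hsle
      simp at hsle
      linarith
    · exact h0
  have h1 := sum_good_le hd hT h.three_le J₁ J₂ hj0 hJ₁ hJ₂ (q := ι ^ 2 / 2) (by positivity)
    (by linarith) hsle
  change _ * goodSum n lam ε s ℓ T P J₁ J₂ ≤ _ at h1
  obtain ⟨L, hL⟩ : ∃ L, ℓ = L + 1 := ⟨ℓ - 1, by have := h.three_le; omega⟩
  set g := ε ^ 2 * lam * s with hgdef
  have e1 : ((n : ℝ) ^ (ℓ - 3) * (j : ℝ) ^ 2) ^ (2 * m) ≤ (ι ^ 4 * (n : ℝ) ^ L) ^ (2 * m) := by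
    refine pow_le_pow_left₀ (by positivity) ?_ _
    calc (n : ℝ) ^ (ℓ - 3) * (j : ℝ) ^ 2 ≤ (n : ℝ) ^ (ℓ - 3) * (ι ^ 2 * n) ^ 2 := by gcongr
      _ = ι ^ 4 * (n : ℝ) ^ (ℓ - 3 + 2) := by ring
      _ = _ := by rw [show ℓ - 3 + 2 = L by have := h.three_le; omega]
  have e2 : (momLin n lam ε s 1 0 ^ 2) ^ (ℓ * m) ≤ (g / n) ^ (ℓ * m) * 2 := by
    have h2 : momLin n lam ε s 1 0 ^ 2 = g / n * (1 - lam * s / n)⁻¹ := by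
      rw [hd.momLin_one_zero_sq, hgdef]; ring
    rw [h2, mul_pow]
    refine mul_le_mul_of_nonneg_left ?_ (by positivity)
    rw [inv_pow]
    refine inv_le_of_inv_le₀ (by norm_num) ?_
    have h3 := one_add_mul_le_pow (a := -(lam * s / n)) (by linarith) (ℓ * m)
    have h4 := hd.mul_le
    have h5 : ((ℓ * m : ℕ) : ℝ) * (lam * s / n) ≤ ((k - 1 + ℓ * m : ℕ) : ℝ) * (lam * s / n) := by
      gcongr
      omega
    rw [← sub_eq_add_neg] at h3
    linarith
  have e3 : (16 : ℝ) ^ m ≤ Real.exp (3 * ι * k) := by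
    have h2 : (16 : ℝ) ≤ Real.exp 3 := by
      have h3 := Real.exp_one_gt_d9
      have h4 : Real.exp 3 = Real.exp 1 ^ 3 := by rw [← Real.exp_nat_mul]; norm_num
      rw [h4]
      calc (16 : ℝ) ≤ 2.7 ^ 3 := by norm_num
        _ ≤ _ := by gcongr; linarith
    calc (16 : ℝ) ^ m ≤ Real.exp 3 ^ m := by gcongr
      _ = _ := by rw [← Real.exp_nat_mul, h.m_eq]; congr 1; ring
  have e4 : ((1 - ι ^ 2 / 2)⁻¹) ^ (k - 1) ≤ Real.exp (ι * k) := by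
    have h2 : (1 - ι ^ 2 / 2)⁻¹ ≤ Real.exp ι := by
      refine (inv_le_of_inv_le₀ (Real.exp_pos _) ?_)
      rw [← Real.exp_neg]
      have h3 : Real.exp (-ι) ≤ (1 + ι)⁻¹ := by
        rw [Real.exp_neg]
        exact inv_anti₀ (by linarith) (by linarith [Real.add_one_le_exp ι])
      refine h3.trans ?_
      rw [inv_le_iff_one_le_mul₀ (by linarith)]
      nlinarith
    have h3 : 1 ≤ Real.exp ι := Real.one_le_exp hι.le
    calc ((1 - ι ^ 2 / 2)⁻¹) ^ (k - 1) ≤ Real.exp ι ^ (k - 1) :=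
          pow_le_pow_left₀ (inv_nonneg.2 (by linarith)) h2 _
      _ ≤ Real.exp ι ^ k := pow_le_pow_right₀ h3 (Nat.sub_le k 1)
      _ = _ := by rw [← Real.exp_nat_mul, mul_comm]
  rw [statWeight_mul]
  have hq : 0 ≤ (1 - ι ^ 2 / 2)⁻¹ := inv_nonneg.2 (by linarith)
  calc _ ≤ s ^ (k - 1) * g ^ (ℓ * m) / (n : ℝ) ^ (k + ℓ * m) *
        (Real.exp (3 * ι * k) * n ^ k * (ι ^ 4 * (n : ℝ) ^ L) ^ (2 * m) *
          ((g / n) ^ (ℓ * m) * 2) * s ^ (k - 1) * Real.exp (ι * k)) := by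
        refine mul_le_mul_of_nonneg_left (h1.trans ?_) (by positivity)
        gcongr
    _ = s ^ (k - 1) * g ^ (ℓ * m) / (n : ℝ) ^ (k + ℓ * m) *
        (n ^ k * (ι ^ 4 * (n : ℝ) ^ L) ^ (2 * m) * (g / n) ^ (ℓ * m) * s ^ (k - 1)) *
          (2 * (Real.exp (3 * ι * k) * Real.exp (ι * k))) := by ring
    _ = _ := by
        rw [treeScale, ← hgdef, hL, weight_mul_scale hn, ← Real.exp_add]
        congr 3
        ring

/-- The factor `exp (-4 ι² k)` accounts for the tree having to avoid `J₁ ∪ J₂`, for distinct vertices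
having to be placed differently, and for the probability that a common edge is present. -/
theorem le_weight_mul_goodSum (h : IsLargeSize n k ℓ m lam ε s ι η) (hT : IsRigidPairing m T P)
    {J₁ J₂ : Finset (Fin n)} (hJ₁ : J₁.card = ⌊ι ^ 2 * n⌋₊) (hJ₂ : J₂.card = ⌊ι ^ 2 * n⌋₊) :
    treeScale n lam ε s ι ℓ m k * Real.exp (-4 * ι ^ 2 * k) ≤
      statWeight n lam ε s ℓ m T * goodSum n lam ε s ℓ T P J₁ J₂ := by
  have hn := h.n_pos
  have hs := h.s_pos
  have hg := h.g_pos
  have hι := h.ι_pos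
  have hι2 := h.ι_pow_le
  have hlam := h.lam_pos
  have hlamle := h.lam_le
  have hd := h.smallDensity
  have hp := hd.p_pos
  have hp1 := hd.p_le_fifth
  have hk : 2 ≤ k := hT.two_le
  set j := ⌊ι ^ 2 * n⌋₊ with hj
  have hjle : (j : ℝ) ≤ ι ^ 2 * n := Nat.floor_le (by positivity)
  have hjlt : ι ^ 2 * n < j + 1 := Nat.lt_floor_add_one _
  have h1 := le_sum_good hd (by nlinarith) hT h.three_le J₁ J₂ hJ₁ hJ₂
  change _ ≤ _ * goodSum n lam ε s ℓ T P J₁ J₂ at h1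
  obtain ⟨L, hL⟩ : ∃ L, ℓ = L + 1 := ⟨ℓ - 1, by have := h.three_le; omega⟩
  set g := ε ^ 2 * lam * s with hgdef
  set X : ℝ := k + 2 * m * (ℓ + 1) + 1 + lam with hX
  have hX0 : 0 ≤ X := by positivity
  have hXX := h.error_le hX0 hX0 le_rfl le_rfl
  -- the relative loss in every choice of a vertex
  set z : ℝ := X / (ι ^ 2 * n) with hz
  have hz0 : 0 ≤ z := by positivity
  have hXz : X = ι ^ 2 * n * z := by rw [hz]; field_simp
  have hX1 : 1 ≤ X := by
    have : (0 : ℝ) ≤ k + 2 * m * (ℓ + 1) := by positivity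
    linarith
  have hzX : X * z ≤ ι ^ 2 / 8 := by
    rw [hz, mul_div_assoc', div_le_iff₀ (by positivity)]
    linarith
  have hz1 : z ≤ ι ^ 2 / 8 := le_trans (le_mul_of_one_le_left hz0 hX1) hzX
  set Nc := k + 2 * m * (ℓ - 1) with hNc
  have hNcX : (Nc : ℝ) + 1 + lam ≤ X := by
    have h3 : ((ℓ - 1 : ℕ) : ℝ) ≤ ℓ + 1 := by
      have : ((ℓ - 1 : ℕ) : ℝ) ≤ ℓ := by exact_mod_cast Nat.sub_le ℓ 1
      linarith
    rw [hNc, hX]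
    push_cast
    have : (2 : ℝ) * m * ((ℓ - 1 : ℕ) : ℝ) ≤ 2 * m * (ℓ + 1) := by gcongr
    linarith
  have hι2n : ι ^ 2 * n * z ≤ n * z := by
    have : ι ^ 2 * (n * z) ≤ 1 * (n * z) := by gcongr; linarith
    linarith
  have c1 : ι ^ 2 * n * (1 - z) ≤ ((j - Nc : ℕ) : ℝ) := by
    have h3 : (j : ℝ) ≤ ((j - Nc : ℕ) : ℝ) + Nc := by exact_mod_cast le_tsub_add
    linarith
  have c2 : (n : ℝ) * (1 - z) ≤ ((n - Nc : ℕ) : ℝ) := by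
    have h3 : (n : ℝ) ≤ ((n - Nc : ℕ) : ℝ) + Nc := by exact_mod_cast le_tsub_add
    linarith
  have c3 : (n : ℝ) * Real.exp (-3 * ι ^ 2) ≤ ((n - 2 * j - Nc : ℕ) : ℝ) := by
    have h3 : (n : ℝ) ≤ ((n - 2 * j - Nc : ℕ) : ℝ) + Nc + 2 * j := by
      have : n ≤ (n - 2 * j - Nc) + Nc + 2 * j := by omega
      exact_mod_cast this
    have h4 : Real.exp (-3 * ι ^ 2) ≤ 1 - 5 / 2 * ι ^ 2 := by
      have h5 := Real.add_one_le_exp (3 * ι ^ 2)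
      rw [neg_mul, Real.exp_neg]
      refine (inv_anti₀ (by positivity) h5).trans ?_
      rw [inv_le_iff_one_le_mul₀ (by positivity)]
      have h6 : ι ^ 2 * ι ^ 2 ≤ ι ^ 2 * (1 / 10000) := by gcongr; exact hι2.2
      linarith [sq_nonneg ι]
    have h6 : ι ^ 2 * n * z ≤ ι ^ 2 * n * (1 / 2) := by gcongr; linarith
    have h7 : (n : ℝ) * Real.exp (-3 * ι ^ 2) ≤ n * (1 - 5 / 2 * ι ^ 2) := by gcongr
    linarith
  have c4 : (n : ℝ)⁻¹ * lam ≤ z := by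
    rw [inv_mul_le_iff₀ hn]
    linarith [hXz]
  have hz2 : 0 ≤ 1 - z := by linarith
  have e1 : ((n : ℝ) * Real.exp (-3 * ι ^ 2)) ^ k * ((ι ^ 2 * n * (1 - z)) ^ 2 *
      (n * (1 - z)) ^ (ℓ - 3)) ^ (2 * m) ≤ (((n - 2 * j - Nc) ^ k * ((j - Nc) ^ 2 *
      (n - Nc) ^ (ℓ - 3)) ^ (2 * m) : ℕ) : ℝ) := by
    push_cast
    gcongr
  have e2 : (g / n) ^ (ℓ * m) ≤ (momLin n lam ε s 1 0 ^ 2) ^ (ℓ * m) := by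
    refine pow_le_pow_left₀ (by positivity) ?_ _
    rw [hd.momLin_one_zero_sq, hgdef, le_div_iff₀ (by linarith)]
    calc _ ≤ ε ^ 2 * lam * s / n * 1 := by gcongr; linarith
      _ = _ := by ring
  have e3 : (s * (1 - z)) ^ (k - 1) ≤ (s * (1 - lam / n)) ^ (k - 1) := by
    refine pow_le_pow_left₀ (by positivity) ?_ _
    gcongr
    rw [div_eq_inv_mul]
    exact c4
  have e4 : Real.exp (-ι ^ 2 * k) ≤ (1 - z) ^ (L * (2 * m) + (k - 1)) := by
    have h3 := one_add_mul_le_pow (a := -z) (by linarith) (L * (2 * m) + (k - 1))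
    have h4 : ((L * (2 * m) + (k - 1) : ℕ) : ℝ) ≤ X := by
      refine le_trans ?_ hNcX
      have h5 : L * (2 * m) + (k - 1) ≤ Nc := by
        rw [hNc, hL, Nat.add_sub_cancel, mul_comm L]
        omega
      have h6 : ((L * (2 * m) + (k - 1) : ℕ) : ℝ) ≤ Nc := by exact_mod_cast h5
      linarith
    have h5 : Real.exp (-ι ^ 2 * k) ≤ 1 / 2 := by
      rw [neg_mul, Real.exp_neg, one_div]
      refine inv_anti₀ (by norm_num) ?_
      calc (2 : ℝ) = Real.exp (Real.log 2) := (Real.exp_log (by norm_num)).symm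
        _ ≤ _ := Real.exp_le_exp.2 h.log_two_le
    have h6 : ((L * (2 * m) + (k - 1) : ℕ) : ℝ) * z ≤ X * z := by gcongr
    rw [← sub_eq_add_neg] at h3
    linarith
  rw [statWeight_mul]
  calc treeScale n lam ε s ι ℓ m k * Real.exp (-4 * ι ^ 2 * k)
      = s ^ (k - 1) * g ^ (ℓ * m) / (n : ℝ) ^ (k + ℓ * m) *
        (n ^ k * (ι ^ 4 * (n : ℝ) ^ L) ^ (2 * m) * (g / n) ^ (ℓ * m) * s ^ (k - 1)) *
          (Real.exp (-3 * ι ^ 2) ^ k * Real.exp (-ι ^ 2 * k)) := by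
        rw [hL, weight_mul_scale hn, treeScale, ← hgdef, ← Real.exp_nat_mul, ← Real.exp_add]
        congr 2
        ring
    _ ≤ s ^ (k - 1) * g ^ (ℓ * m) / (n : ℝ) ^ (k + ℓ * m) *
        (n ^ k * (ι ^ 4 * (n : ℝ) ^ L) ^ (2 * m) * (g / n) ^ (ℓ * m) * s ^ (k - 1)) *
          (Real.exp (-3 * ι ^ 2) ^ k * (1 - z) ^ (L * (2 * m) + (k - 1))) := by gcongr
    _ = s ^ (k - 1) * g ^ (ℓ * m) / (n : ℝ) ^ (k + ℓ * m) *
        ((((n : ℝ) * Real.exp (-3 * ι ^ 2)) ^ k * ((ι ^ 2 * n * (1 - z)) ^ 2 *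
          (n * (1 - z)) ^ (ℓ - 3)) ^ (2 * m)) * ((g / n) ^ (ℓ * m) * (s * (1 - z)) ^ (k - 1))) := by
        have h3 : (ι ^ 2 * n * (1 - z)) ^ 2 * (n * (1 - z)) ^ (ℓ - 3) =
            ι ^ 4 * (n : ℝ) ^ L * (1 - z) ^ L := by
          rw [show L = ℓ - 3 + 2 by have := h.three_le; omega, mul_pow (n : ℝ) (1 - z) (ℓ - 3)]
          ring
        rw [h3, mul_pow _ ((1 - z) ^ L), ← pow_mul, pow_add, mul_pow s, mul_pow (n : ℝ)]
        ring
    _ ≤ _ := by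
        refine mul_le_mul_of_nonneg_left (le_trans ?_ h1) (by positivity)
        gcongr

end IsLargeSize

/-! ### Large `n` -/

/-- In terms of `u = log (log n)`, all quantities are at most exponential in a quadratic polynomial
of `u`, while `n` is a double exponential. -/
theorem isLargeSize_of_loglog {n k ℓ m : ℕ} {lam ε s ι η u : ℝ} (hε : 0 < ε) (hε' : ε < 1)
    (hs : 0 < s) (hs' : s < 1) (hlam : 100 / (ε ^ 4 * ι ^ 4) < lam) (hι : 0 < ι)
    (hι' : ι < 1 / 100) (hη : 0 < η) (hm : (m : ℝ) = ι * k) (hℓ3 : 3 ≤ ℓ)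
    (hg : Real.exp 1 ≤ ε ^ 2 * lam * s)
    (hpow : (n : ℝ) ^ 3 ≤ (ε ^ 2 * lam * s / Real.exp 1) ^ ℓ)
    (hlog : Real.log 2 ≤ ι ^ 2 * k) (hu : 1 ≤ u) (hn : (n : ℝ) = Real.exp (Real.exp u))
    (hk : (k : ℝ) ≤ Real.log u) (hℓ : (ℓ : ℝ) ≤ Real.exp u)
    (h1 : 1 + lam ≤ Real.exp u) (h2 : 8 ≤ Real.exp u)
    (h3 : Real.log (8 / ι ^ 4) + 6 * u ≤ Real.exp u) (h4 : 56 * u ^ 2 ≤ Real.exp u)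
    (h5 : Real.log (6 / η) + u * (2 + Real.log (ε ^ 2 * lam * s) + Real.log s⁻¹ +
      8 * Real.log ι⁻¹ + 4 * ι ^ 2) + 490 * u ^ 2 ≤ Real.exp u) :
    IsLargeSize n k ℓ m lam ε s ι η := by
  set g := ε ^ 2 * lam * s with hgdef
  have hg0 : 0 < g := (Real.exp_pos 1).trans_le hg
  have hu0 : 0 < u := by linarith
  have hek : Real.exp k ≤ u := by
    calc Real.exp k ≤ Real.exp (Real.log u) := Real.exp_le_exp.2 hk
      _ = u := Real.exp_log hu0
  have hk0 : (0 : ℝ) ≤ k := Nat.cast_nonneg k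
  have hku : (k : ℝ) ≤ u := by linarith [Real.add_one_le_exp (k : ℝ)]
  have hk2 : (k : ℝ) ^ 2 ≤ 2 * u := by linarith [Real.quadratic_le_exp_of_nonneg hk0]
  have hueu : u ≤ Real.exp u := by linarith [Real.add_one_le_exp u]
  have hmk : (m : ℝ) ≤ k := by rw [hm]; nlinarith
  have hm0 : (0 : ℝ) ≤ m := Nat.cast_nonneg m
  have hℓ0 : (0 : ℝ) ≤ ℓ := Nat.cast_nonneg ℓ
  have hlam0 : 0 < lam := lt_trans (by positivity) hlam
  set y := Real.exp u with hy
  have hy3 : y ^ 3 = Real.exp (3 * u) := by rw [hy, ← Real.exp_nat_mul]; norm_num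
  have hQ : (k : ℝ) + 2 * m * (ℓ + 1) + 1 + lam ≤ y ^ 3 := by
    have e1 : (2 : ℝ) * m * (ℓ + 1) ≤ 2 * y * (y + y) := by gcongr <;> linarith
    have e2 : y * 8 ≤ y * y := by gcongr
    have e3 : y * y * 8 ≤ y * y * y := by gcongr
    linarith [show y * y * y = y ^ 3 by ring]
  have hQ0 : 0 ≤ (k : ℝ) + 2 * m * (ℓ + 1) + 1 + lam := by positivity
  have hB : entropyBase k m ℓ ≤ Real.exp (7 * u) := by
    have e1 : (((2 * k + 2 * m * (ℓ + 1) : ℕ)) : ℝ) ≤ 2 * y ^ 3 := by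
      push_cast
      have : (0 : ℝ) ≤ 2 * m * (ℓ + 1) := by positivity
      linarith
    have e2 : Real.exp (7 * u) = y ^ 7 := by rw [hy, ← Real.exp_nat_mul]; norm_num
    rw [entropyBase, e2]
    calc 2 * (((2 * k + 2 * m * (ℓ + 1) : ℕ)) : ℝ) ^ 2 ≤ 2 * (2 * y ^ 3) ^ 2 := by gcongr
      _ = 8 * y ^ 6 := by ring
      _ ≤ y * y ^ 6 := by gcongr
      _ = _ := by ring
  have hB0 : 0 ≤ entropyBase k m ℓ := by rw [entropyBase]; positivity
  have hBpow : ∀ E : ℕ, entropyBase k m ℓ ^ E ≤ Real.exp (7 * u * E) := fun E => by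
    rw [mul_comm, Real.exp_nat_mul]
    exact pow_le_pow_left₀ hB0 hB E
  refine ⟨hε, hε', hs, hs', hlam, hι, hι', hm, hℓ3, hg, hpow, ?_, ?_, ?_, hlog⟩
  · refine (hBpow _).trans ?_
    rw [hn, Real.exp_le_exp]
    refine le_trans ?_ h4
    have e1 : ((8 * m : ℕ) : ℝ) ≤ 8 * u := by push_cast; linarith
    calc 7 * u * ((8 * m : ℕ) : ℝ) ≤ 7 * u * (8 * u) := by gcongr
      _ = _ := by ring
  · have e1 : 8 * ((k : ℝ) + 2 * m * (ℓ + 1) + 1 + lam) ^ 2 ≤ 8 * Real.exp (6 * u) := by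
      have : Real.exp (6 * u) = (y ^ 3) ^ 2 := by rw [hy, ← pow_mul, ← Real.exp_nat_mul]; norm_num
      rw [this]
      gcongr
    refine e1.trans ?_
    have e2 : 8 / ι ^ 4 * Real.exp (6 * u) ≤ n := by
      rw [hn]
      calc 8 / ι ^ 4 * Real.exp (6 * u) = Real.exp (Real.log (8 / ι ^ 4) + 6 * u) := by
            rw [Real.exp_add, Real.exp_log (by positivity)]
        _ ≤ _ := Real.exp_le_exp.2 h3
    rw [div_mul_eq_mul_div, div_le_iff₀ (by positivity)] at e2
    linarith
  · set E := 2 * k + 4 * m + 4 * m * (4 * k + 4 * m) with hE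
    have e1 : (E : ℝ) ≤ 70 * u := by
      rw [hE]
      push_cast
      have e2 : 4 * (m : ℝ) * (4 * k + 4 * m) ≤ 4 * k * (4 * k + 4 * k) := by gcongr
      linarith [show 4 * (k : ℝ) * (4 * k + 4 * k) = 32 * k ^ 2 by ring]
    have e3 : entropyBase k m ℓ ^ E ≤ Real.exp (490 * u ^ 2) := by
      refine (hBpow _).trans (Real.exp_le_exp.2 ?_)
      calc 7 * u * (E : ℝ) ≤ 7 * u * (70 * u) := by gcongr
        _ = _ := by ring
    have e4 : (k : ℝ) ^ k ≤ Real.exp (2 * u) := by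
      calc (k : ℝ) ^ k ≤ Real.exp k ^ k := by
            gcongr
            linarith [Real.add_one_le_exp (k : ℝ)]
        _ = Real.exp ((k : ℝ) ^ 2) := by rw [← Real.exp_nat_mul]; congr 1; ring
        _ ≤ _ := Real.exp_le_exp.2 hk2
    have hlogg : 0 ≤ Real.log g := Real.log_nonneg (by linarith [Real.add_one_le_exp (1 : ℝ)])
    have hkk : ((k - 1 : ℕ) : ℝ) ≤ u := le_trans (by exact_mod_cast Nat.sub_le k 1) hku
    have e5 : g ^ (k - 1) ≤ Real.exp (u * Real.log g) := by
      calc g ^ (k - 1) = Real.exp (((k - 1 : ℕ) : ℝ) * Real.log g) := by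
            rw [Real.exp_nat_mul, Real.exp_log hg0]
        _ ≤ _ := Real.exp_le_exp.2 (by gcongr)
    have e6 : Real.exp (-(u * Real.log s⁻¹)) ≤ s ^ (k - 1) := by
      have hl : 0 ≤ Real.log s⁻¹ := Real.log_nonneg (by rw [one_le_inv₀ hs]; exact hs'.le)
      calc Real.exp (-(u * Real.log s⁻¹)) ≤ Real.exp (-(((k - 1 : ℕ) : ℝ) * Real.log s⁻¹)) :=
            Real.exp_le_exp.2 (neg_le_neg (by gcongr))
        _ = _ := by rw [Real.log_inv, mul_neg, neg_neg, Real.exp_nat_mul, Real.exp_log hs]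
    have e7 : Real.exp (-(u * (8 * Real.log ι⁻¹))) ≤ (ι ^ 4) ^ (2 * m) := by
      have hl : 0 ≤ Real.log ι⁻¹ := Real.log_nonneg (by rw [one_le_inv₀ hι]; linarith)
      calc Real.exp (-(u * (8 * Real.log ι⁻¹))) ≤ Real.exp (-(m * (8 * Real.log ι⁻¹))) :=
            Real.exp_le_exp.2 (neg_le_neg (by gcongr; linarith))
        _ = Real.exp (((8 * m : ℕ) : ℝ) * Real.log ι) := by
            rw [Real.log_inv]; congr 1; push_cast; ring
        _ = ι ^ (8 * m) := by rw [Real.exp_nat_mul, Real.exp_log hι]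
        _ = _ := by rw [← pow_mul]; congr 1; ring
    have e8 : Real.exp (-(u * (4 * ι ^ 2))) ≤ Real.exp (-4 * ι ^ 2 * k) := by
      refine Real.exp_le_exp.2 ?_
      have : ι ^ 2 * k ≤ ι ^ 2 * u := by gcongr
      linarith
    have hη6 : 6 = η * Real.exp (Real.log (6 / η)) := by
      rw [Real.exp_log (by positivity)]; field_simp
    calc 6 * (k : ℝ) ^ k * g ^ (k - 1) * entropyBase k m ℓ ^ E
        ≤ 6 * Real.exp (2 * u) * Real.exp (u * Real.log g) * Real.exp (490 * u ^ 2) := by gcongr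
      _ = η * Real.exp (Real.log (6 / η) + 2 * u + u * Real.log g + 490 * u ^ 2) := by
          conv_lhs => rw [hη6]
          rw [Real.exp_add, Real.exp_add, Real.exp_add]
          ring
      _ ≤ η * Real.exp (y + -(u * Real.log s⁻¹) + -(u * (8 * Real.log ι⁻¹)) +
          -(u * (4 * ι ^ 2))) := by
          refine mul_le_mul_of_nonneg_left (Real.exp_le_exp.2 ?_) hη.le
          linarith
      _ = η * n * (Real.exp (-(u * Real.log s⁻¹)) * Real.exp (-(u * (8 * Real.log ι⁻¹))) *
          Real.exp (-(u * (4 * ι ^ 2)))) := by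
          rw [Real.exp_add, Real.exp_add, Real.exp_add, hn]
          ring
      _ ≤ _ := by gcongr

theorem eventually_quadratic_le_exp (a b c : ℝ) :
    ∀ᶠ u : ℝ in Filter.atTop, a + u * b + c * u ^ 2 ≤ Real.exp u := by
  have hpos : (0 : ℝ) < |a| + |b| + |c| + 1 := by positivity
  have h1 := (Real.isLittleO_pow_exp_atTop (n := 2)).bound (inv_pos.2 hpos)
  filter_upwards [h1, Filter.eventually_ge_atTop 1] with u hu hu1
  rw [Real.norm_of_nonneg (by positivity), Real.norm_of_nonneg (Real.exp_pos u).le,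
    le_inv_mul_iff₀ hpos] at hu
  refine le_trans ?_ hu
  have h2 : a ≤ |a| * u ^ 2 := by
    have : 1 ≤ u ^ 2 := one_le_pow₀ hu1
    nlinarith [le_abs_self a, abs_nonneg a]
  have h3 : u * b ≤ |b| * u ^ 2 := by
    calc u * b ≤ u * |b| := by gcongr; exact le_abs_self b
      _ ≤ _ := by nlinarith [mul_nonneg (abs_nonneg b) (by linarith : 0 ≤ u)]
  have h4 : c * u ^ 2 ≤ |c| * u ^ 2 := by gcongr; exact le_abs_self c
  nlinarith [sq_nonneg u]

/-- With `n` large, `k` is smaller than the third iterated logarithm of `n`, so that even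
`exp (O((log log n)²))` is small compared with `n`. -/
theorem eventually_isLargeSize {lam ε s ι η : ℝ} {ℓ N m : ℕ → ℕ} (hε : 0 < ε) (hε' : ε < 1)
    (hs : 0 < s) (hs' : s < 1) (hlam : 100 / (ε ^ 4 * ι ^ 4) < lam) (hι : 0 < ι)
    (hι' : ι < 1 / 100) (hη : 0 < η)
    (hℓ : ∀ᶠ n : ℕ in Filter.atTop, (ℓ n : ℝ) ≤ Real.log n)
    (hℓ' : ∀ᶠ n : ℕ in Filter.atTop, (n : ℝ) ^ 4 < (ε ^ 2 * lam * s) ^ ℓ n)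
    (hN : Filter.Tendsto N Filter.atTop Filter.atTop)
    (hN' : (fun n : ℕ => (N n : ℝ)) =o[Filter.atTop]
      fun n : ℕ => Real.log (Real.log (Real.log n)))
    (hm : ∀ᶠ n : ℕ in Filter.atTop, (m n : ℝ) = ι * N n) :
    ∀ᶠ n : ℕ in Filter.atTop, IsLargeSize n (N n) (ℓ n) (m n) lam ε s ι η := by
  have t0 : Filter.Tendsto (fun n : ℕ => (n : ℝ)) Filter.atTop Filter.atTop :=
    tendsto_natCast_atTop_atTop
  have t1 := Real.tendsto_log_atTop.comp t0
  have t2 := Real.tendsto_log_atTop.comp t1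
  have t3 := Real.tendsto_log_atTop.comp t2
  have hlam0 : 0 < lam := lt_trans (by positivity) hlam
  set g := ε ^ 2 * lam * s with hgdef
  have hg0 : 0 < g := by positivity
  have q1 := t2.eventually (eventually_quadratic_le_exp (1 + lam) 0 0)
  have q2 := t2.eventually (eventually_quadratic_le_exp 8 0 0)
  have q3 := t2.eventually (eventually_quadratic_le_exp (Real.log (8 / ι ^ 4)) 6 0)
  have q4 := t2.eventually (eventually_quadratic_le_exp 0 0 56)
  have q5 := t2.eventually (eventually_quadratic_le_exp (Real.log (6 / η))
    (2 + Real.log g + Real.log s⁻¹ + 8 * Real.log ι⁻¹ + 4 * ι ^ 2) 490)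
  have hN1 := hN'.bound one_pos
  have hN2 : ∀ᶠ n : ℕ in Filter.atTop, Real.log 2 / ι ^ 2 ≤ (N n : ℝ) :=
    (t0.comp hN).eventually_ge_atTop _
  filter_upwards [hℓ, hℓ', hm, q1, q2, q3, q4, q5, hN1, hN2, t0.eventually_gt_atTop (g ^ 2),
    t0.eventually_gt_atTop 1, t1.eventually_gt_atTop 0, t2.eventually_ge_atTop 1,
    t3.eventually_gt_atTop 0] with n hℓ hℓ' hm q1 q2 q3 q4 q5 hN1 hN2 hng hn1 hy hu hv
  simp only [Function.comp_apply] at q1 q2 q3 q4 q5 hN1 hy hu hv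
  have hn0 : (0 : ℝ) < n := by linarith
  have hyexp : Real.exp (Real.log n) = n := Real.exp_log hn0
  have huexp : Real.exp (Real.log (Real.log n)) = Real.log n := Real.exp_log hy
  have hn4 : (n : ℝ) ^ 4 = Real.exp (4 * Real.log n) := by
    rw [← Real.log_rpow hn0, Real.exp_log (by positivity)]
    norm_cast
  -- the growth conditions on the length of the paths force `g > exp 4`
  have hg4 : Real.exp 4 < g := by
    by_contra hcon
    rw [not_lt] at hcon
    have e1 : g ^ ℓ n ≤ (n : ℝ) ^ 4 := by
      calc g ^ ℓ n ≤ Real.exp 4 ^ ℓ n := by gcongr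
        _ = Real.exp (ℓ n * 4) := by rw [Real.exp_nat_mul]
        _ ≤ Real.exp (4 * Real.log n) := Real.exp_le_exp.2 (by linarith)
        _ = _ := hn4.symm
    linarith
  have hg1 : 1 < g := lt_trans (Real.one_lt_exp_iff.2 (by norm_num)) hg4
  have hℓ3 : 3 ≤ ℓ n := by
    by_contra hcon
    have e1 : g ^ ℓ n ≤ g ^ 2 := pow_le_pow_right₀ hg1.le (by omega)
    have e2 : (n : ℝ) ≤ n ^ 4 := by
      calc (n : ℝ) = n ^ 1 := (pow_one _).symm
        _ ≤ _ := pow_le_pow_right₀ hn1.le (by norm_num)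
    linarith
  refine isLargeSize_of_loglog hε hε' hs hs' hlam hι hι' hη hm hℓ3
    ((Real.exp_le_exp.2 (by norm_num)).trans hg4.le) ?_ ?_ hu ?_ ?_ ?_ ?_ ?_ ?_ ?_ ?_
  · rw [div_pow, le_div_iff₀ (by positivity)]
    have e1 : Real.exp 1 ^ ℓ n ≤ n := by
      calc Real.exp 1 ^ ℓ n = Real.exp (ℓ n) := by rw [← Real.exp_nat_mul, mul_one]
        _ ≤ Real.exp (Real.log n) := Real.exp_le_exp.2 hℓ
        _ = n := hyexp
    calc (n : ℝ) ^ 3 * Real.exp 1 ^ ℓ n ≤ (n : ℝ) ^ 3 * n := by gcongr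
      _ = (n : ℝ) ^ 4 := by ring
      _ ≤ _ := hℓ'.le
  · rw [div_le_iff₀ (by positivity)] at hN2
    linarith
  · rw [huexp, hyexp]
  · rw [Real.norm_of_nonneg (Nat.cast_nonneg _), Real.norm_of_nonneg hv.le, one_mul] at hN1
    exact hN1
  · rw [huexp]; exact hℓ
  · linarith
  · linarith
  · linarith
  · linarith
  · linarith

/-! ### Conclusion of the estimate -/

theorem iota_bounds {ι M : ℝ} (hι : 0 < ι) (hM : 100 ≤ M)
    (h : Real.exp (Real.exp (Real.exp (Real.exp M))) < ι⁻¹) :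
    ι < 1 / 100 ∧ 1 < Real.log ι⁻¹ ∧ 2 ≤ Real.log (Real.log ι⁻¹) := by
  have hi : 0 < ι⁻¹ := inv_pos.2 hι
  have e1 := Real.add_one_le_exp M
  have e2 := Real.add_one_le_exp (Real.exp M)
  have e3 := Real.add_one_le_exp (Real.exp (Real.exp M))
  have e4 := Real.add_one_le_exp (Real.exp (Real.exp (Real.exp M)))
  have h1 : Real.exp (Real.exp (Real.exp M)) < Real.log ι⁻¹ := (Real.lt_log_iff_exp_lt hi).2 h
  have h2 : Real.exp (Real.exp M) < Real.log (Real.log ι⁻¹) :=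
    (Real.lt_log_iff_exp_lt (by linarith)).2 h1
  refine ⟨?_, by linarith, by linarith⟩
  rw [lt_div_iff₀ (by norm_num), mul_comm, ← lt_div_iff₀ hι, one_div]
  linarith

theorem isRigidPairing_of_mem_decoratedTrees {ι : ℝ} {k m : ℕ} (hι : 1 < Real.log ι⁻¹)
    (hk : Odd k) {F : UnlabeledTree k → Finset (Finset (Sym2 (Fin k)))}
    (hF : IsAdmissibleChoice ι m F) {H : UnlabeledTree k × Finset (Sym2 (Fin k))}
    (hH : H ∈ decoratedTrees ι F) : IsRigidPairing m H.1.graph H.2 := by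
  obtain ⟨h1, h2⟩ := (Finset.mem_filter.1 hH).2
  obtain ⟨r, hr, hFr⟩ := hF H.1 h1
  exact isRigidPairing_of_isGoodRootedTree hι hk hr (hFr.isPairing _ h2) (hFr.subset_major _ h2)

theorem firstMomentScale_eq (n : ℕ) (lam ε s ι : ℝ) (ℓ m k c : ℕ) :
    firstMomentScale n lam ε s ι ℓ m k c = c * treeScale n lam ε s ι ℓ m k := by
  rw [firstMomentScale, treeScale]
  ring

end CorrelatedSBM

end

theorem mainTheorem3
    (ε ι δ Δ lam s : ℝ) (hε_pos : 0 < ε) (hε_lt : ε < 1) (hι_pos : 0 < ι)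
    (hι : Real.exp (Real.exp (Real.exp (Real.exp
      (max 100 (max (1 / ε) (1 / Real.log ε⁻¹)))))) < ι⁻¹)
    (hδ_pos : 0 < δ) (hδ_lt : δ < √CorrelatedSBM.otterConstant)
    (hδ : 1 < CorrelatedSBM.otterConstant⁻¹ *
      (√CorrelatedSBM.otterConstant - δ) ^ 2 * Real.exp ι)
    (hΔ : 100 / (ε ^ 4 * ι ^ 4) < Δ) (hlam : Δ < lam)
    (hs : √CorrelatedSBM.otterConstant - δ < s) (hs_lt : s < 1)
    (ℓ N m : ℕ → ℕ)
    (hℓ : ∀ᶠ n : ℕ in Filter.atTop, (ℓ n : ℝ) ≤ Real.log n)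
    (hℓ' : ∀ᶠ n : ℕ in Filter.atTop, (n : ℝ) ^ 4 < (ε ^ 2 * lam * s) ^ ℓ n)
    (hN : Filter.Tendsto N Filter.atTop Filter.atTop)
    (hN' : (fun n : ℕ => (N n : ℝ)) =o[Filter.atTop]
      fun n : ℕ => Real.log (Real.log (Real.log n)))
    (hN_odd : ∀ᶠ n : ℕ in Filter.atTop, Odd (N n))
    (hm : ∀ᶠ n : ℕ in Filter.atTop, (m n : ℝ) = ι * N n)
    (η : ℝ) (hη : 0 < η) :
    ∀ᶠ n : ℕ in Filter.atTop,
      ∀ JA JB : Finset (Fin n), JA.card = ⌊ι ^ 2 * n⌋₊ → JB.card = ⌊ι ^ 2 * n⌋₊ →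
      ∀ F : CorrelatedSBM.UnlabeledTree (N n) → Finset (Finset (Sym2 (Fin (N n)))),
        CorrelatedSBM.IsAdmissibleChoice ι (m n) F →
        let Hs := CorrelatedSBM.decoratedTrees ι F
        let scale := CorrelatedSBM.firstMomentScale n lam ε s ι (ℓ n) (m n) (N n) Hs.card
        let lower := scale * Real.exp (-4 * ι ^ 2 * N n)
        let upper := scale * Real.exp (5 * ι * Real.log (Real.log ι⁻¹) * N n)
        let good := CorrelatedSBM.goodPermutations JA JB (ℓ n)
        let total := CorrelatedSBM.expectation lam ε s fun _ A B =>
          CorrelatedSBM.statistic lam ε s (ℓ n) (m n) JA JB Hs A B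
        let main := CorrelatedSBM.expectation lam ε s
          (CorrelatedSBM.restrictedStatistic lam ε s (ℓ n) (m n) JA JB Hs good)
        let rest := CorrelatedSBM.expectation lam ε s
          (CorrelatedSBM.restrictedStatistic lam ε s (ℓ n) (m n) JA JB Hs
            fun H S₁ S₂ => (good H S₁ S₂)ᶜ)
        (lower ≤ total ∧ total ≤ upper) ∧
        (lower ≤ main ∧ main ≤ upper) ∧
        (0 ≤ rest ∧ rest ≤ η * lower ∧ rest ≤ η * main) := by
  have hs_pos : 0 < s := lt_trans (sub_pos.2 hδ_lt) hs
  obtain ⟨hι1, hι2, hι3⟩ := CorrelatedSBM.iota_bounds hι_pos (le_max_left _ _) hι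
  -- with `min η 1` in place of `η`, the remainder is at most the lower bound
  have hη' : 0 < min η 1 := lt_min hη one_pos
  filter_upwards [CorrelatedSBM.eventually_isLargeSize hε_pos hε_lt hs_pos hs_lt (hΔ.trans hlam)
    hι_pos hι1 hη' hℓ hℓ' hN hN' hm, hN_odd] with n hn hodd
  intro JA JB hJA hJB F hF Hs scale lower upper good total main rest
  have hHs : ∀ H ∈ Hs, CorrelatedSBM.IsRigidPairing (m n) H.1.graph H.2 := fun H hH =>
    CorrelatedSBM.isRigidPairing_of_mem_decoratedTrees hι2 hodd hF hH
  set t := CorrelatedSBM.treeScale n lam ε s ι (ℓ n) (m n) (N n) with ht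
  have ht0 : 0 < t := hn.treeScale_pos
  have hscale : scale = Hs.card * t := CorrelatedSBM.firstMomentScale_eq ..
  obtain ⟨b1, b2, b3, b4⟩ := CorrelatedSBM.firstMoment_bounds (ℓ := ℓ n) (m := m n) (lam := lam)
    (ε := ε) (s := s) (Hs := Hs) hJA hJB fun H hH J₁ J₂ h₁ h₂ =>
      ⟨hn.le_weight_mul_goodSum (hHs H hH) h₁ h₂, hn.weight_mul_goodSum_le (hHs H hH) h₁ h₂,
        mul_nonneg (by rw [CorrelatedSBM.statWeight]; have := hn.g_pos; positivity)
          (CorrelatedSBM.badSum_nonneg hn.smallDensity (hHs H hH) J₁ J₂),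
        hn.weight_mul_badSum_le (hHs H hH) J₁ J₂⟩
  have htotal : total = main + rest := CorrelatedSBM.expectation_statistic JA JB good
  have hlower : (Hs.card : ℝ) * (t * Real.exp (-4 * ι ^ 2 * N n)) = lower := by
    simp only [lower, hscale]
    ring
  have hc : (0 : ℝ) ≤ Hs.card := Nat.cast_nonneg _
  have hlower0 : 0 ≤ lower := by rw [← hlower]; positivity
  change _ ≤ main at b1
  change main ≤ _ at b2
  change 0 ≤ rest at b3
  change rest ≤ _ at b4
  rw [hlower] at b1
  rw [show (Hs.card : ℝ) * (min η 1 * (t * Real.exp (-4 * ι ^ 2 * N n))) = min η 1 * lower by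
    rw [← hlower]; ring] at b4
  -- both parts together are still below the upper bound
  have hexp : 2 * Real.exp (4 * ι * N n) + Real.exp (-4 * ι ^ 2 * N n) ≤
      Real.exp (5 * ι * Real.log (Real.log ι⁻¹) * N n) := by
    have hN0 : (0 : ℝ) ≤ N n := Nat.cast_nonneg _
    have e1 : Real.exp (-4 * ι ^ 2 * N n) ≤ Real.exp (4 * ι * N n) := by
      refine Real.exp_le_exp.2 ?_
      have h1 : 0 ≤ ι ^ 2 * N n := by positivity
      have h2 : 0 ≤ ι * N n := by positivity
      linarith
    have e2 : Real.log 2 ≤ ι * N n := by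
      refine hn.log_two_le.trans ?_
      gcongr
      nlinarith
    calc 2 * Real.exp (4 * ι * N n) + Real.exp (-4 * ι ^ 2 * N n)
        ≤ 2 * 2 * Real.exp (4 * ι * N n) := by linarith [Real.exp_pos (4 * ι * N n)]
      _ = Real.exp (Real.log 2 + Real.log 2 + 4 * ι * N n) := by
          rw [Real.exp_add, Real.exp_add, Real.exp_log two_pos]
      _ ≤ _ := by
          refine Real.exp_le_exp.2 ?_
          have h2 : 0 ≤ ι * N n := by positivity
          have h3 : ι * N n * 2 ≤ ι * N n * Real.log (Real.log ι⁻¹) := by gcongr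
          linarith
  have hupper : (Hs.card : ℝ) * (t * (2 * Real.exp (4 * ι * N n))) + lower ≤ upper := by
    have h1 : (Hs.card : ℝ) * t * (2 * Real.exp (4 * ι * N n) + Real.exp (-4 * ι ^ 2 * N n)) ≤
        Hs.card * t * Real.exp (5 * ι * Real.log (Real.log ι⁻¹) * N n) := by gcongr
    rw [← hlower]
    simp only [upper, hscale]
    linarith
  have hrest1 : rest ≤ lower := b4.trans (mul_le_of_le_one_left hlower0 (min_le_right _ _))
  have hrest : rest ≤ η * lower := b4.trans (by gcongr; exact min_le_left _ _)
  refine ⟨⟨by linarith, by linarith⟩, ⟨b1, by linarith⟩, b3, hrest, hrest.trans (by gcongr)⟩
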